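/- Let $p\ge 11$ be a prime, let $\mathbb F_q$ be a finite field of characteristic $p$, let $F=\mathbb F_q((t))$ and $\mathcal O_F=\mathbb F_q[[t]]$, and let $F^{\mathrm{sep}}$ be a separable closure of $F$. For a smooth plane quartic $C$ over $F$ let $\gamma(C)\in \mathrm{Br}(F)[2]\simeq H^2(F,\mu_2)$ be the value at $C$ of the generator $\gamma$ of the factor $\mathbb Z/2\mathbb Z$ of the Brauer group of the moduli stack of smooth genus three curves, that is, the second Galois–Stiefel–Whitney class of the étale $F$-algebra of degree $28$ given by the Galois action on the bitangents of $C_{F^{\mathrm{sep}}}$. For a smooth cubic surface $X\subset\mathbb P^3_F$ let $\alpha_2(E_X)$ be the second Galois–Stiefel–Whitney class of the étale $F$-algebra $E_X$ of degree $27$ given by the Galois action on the lines of $X_{F^{\mathrm{sep}}}$. There exists a smooth quartic curve $C\subset\mathbb P^2_F$ such that $\gamma(C)\in\mathrm{Br}(F)[2]$ is nonzero and $C$ has stable reduction over $\mathcal O_F$; more precisely, $C$ is the generic fibre of a stable curve over $\mathcal O_F$ that is a closed subscheme of $\mathbb P^2_{\mathcal O_F}$ defined by a quartic form. Explicitly,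 let $u\in\mathbb F_q^\times$ be a non-square and choose $\sqrt t,\sqrt u\in F^{\mathrm{sep}}$. Put $$(u_1,\dots,u_6)=\begin{cases}(1+\sqrt t,\,1-\sqrt t,\,1+\sqrt u,\,1-\sqrt u,\,2+t,\,t)&\text{if }(q-1)/2\text{ is even},\\(1+\sqrt t,\,1-\sqrt t,\,1+\sqrt u,\,1-\sqrt u,\,1+t+2\sqrt u,\,1+t-2\sqrt u)&\text{if }(q-1)/2\text{ is odd},\end{cases}$$ $c_1=-\sum_i u_i$, let $\varepsilon_m$ be the $m$-th elementary symmetric function of the $27$ elements $c_1/3-u_i$, $-2c_1/3-u_i$, $c_1/3+u_i+u_j$ $(i<j)$, and put $$p_2=\tfrac{\varepsilon_2}{12},\quad p_1=\tfrac{\varepsilon_5}{48},\quad q_2=\tfrac{\varepsilon_6-168p_2^3}{96},\quad p_0=\tfrac{\varepsilon_8-294p_2^4-528p_2q_2}{480},\quad q_1=\tfrac{\varepsilon_9-1008p_1p_2^2}{1344},$$ $$q_0=\tfrac{\varepsilon_{12}-608p_1^2p_2-4768p_0p_2^2-252p_2^6-1200p_2^3q_2+1248q_2^2}{17280}.$$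 Then $p_0,p_1,p_2,q_0,q_1,q_2$ lie in $\mathcal O_F$. Put $$f_0=p_2X-2Y+q_2W,\qquad f_1=p_1XW+q_1W^2,\qquad f_2=X^3+p_0XW^2+q_0W^3-Y^2W,\qquad g=f_1^2-4f_0f_2 .$$ The cubic surface $X\subset\mathbb P^3_F$ defined by $f_0Z^2+f_1Z+f_2=0$ is smooth; the point $[X:Y:Z:W]=[0:0:1:0]$ lies on it, and on none of the lines of $X_{F^{\mathrm{sep}}}$. The quartic curve $C\subset\mathbb P^2_F$ defined by $g=0$ is smooth; the closed subscheme of $\mathbb P^2_{\mathcal O_F}$ defined by $g=0$ is a stable curve over $\mathcal O_F$; and $\gamma(C)=\alpha_2(E_X)\neq 0$. -/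

import Mathlib

open MvPolynomial

noncomputable section PinLifts

variable {S : Type*} [Fintype S]

/-- The standard quadratic form `v ↦ ∑ s, v s ^ 2` on `ℝ^S`. -/
abbrev stdForm (S : Type*) [Fintype S] : QuadraticForm ℝ (S → ℝ) :=
  QuadraticMap.weightedSumSquares ℝ (fun _ : S => (1 : ℝ))

/-- `x` is a lift of the permutation matrix of `σ` to the Pin group of the standard positive definite
form: it has spinor norm `1` and its twisted conjugation `v ↦ involute x * v * x⁻¹` on `ℝ^S` is the
permutation `v ↦ v ∘ σ⁻¹`. Unit vectors square to `+1` here, so that a transposition of `s` and `t`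
lifts to the involution `(e_s - e_t) / √2`; with this convention the obstruction to lifting is `w₂`
(and not `w₂ + w₁²`). -/
structure IsPinLift (σ : Equiv.Perm S) (x : CliffordAlgebra (stdForm S)) : Prop where
  reverse_mul : CliffordAlgebra.reverse x * x = 1
  mul_reverse : x * CliffordAlgebra.reverse x = 1
  twisted_conj : ∀ v : S → ℝ, CliffordAlgebra.involute x * CliffordAlgebra.ι (stdForm S) v =
    CliffordAlgebra.ι (stdForm S) (v ∘ σ.symm) * x

theorem IsPinLift.one : IsPinLift (1 : Equiv.Perm S) 1 := by
  refine ⟨by simp, by simp, fun v => ?_⟩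
  have : v ∘ (1 : Equiv.Perm S).symm = v := rfl
  simp [this]

theorem IsPinLift.mul {σ τ : Equiv.Perm S} {x y : CliffordAlgebra (stdForm S)}
    (hx : IsPinLift σ x) (hy : IsPinLift τ y) : IsPinLift (σ * τ) (x * y) := by
  refine ⟨?_, ?_, fun v => ?_⟩
  · rw [CliffordAlgebra.reverse.map_mul, mul_assoc, ← mul_assoc _ x, hx.reverse_mul, one_mul,
      hy.reverse_mul]
  · rw [CliffordAlgebra.reverse.map_mul, mul_assoc, ← mul_assoc y, hy.mul_reverse, one_mul,
      hx.mul_reverse]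
  · rw [map_mul, mul_assoc, hy.twisted_conj, ← mul_assoc, hx.twisted_conj, mul_assoc]
    rfl

theorem isPinLift_swap [DecidableEq S] {a b : S} (hab : a ≠ b) :
    ∃ x, IsPinLift (Equiv.swap a b) x := by
  set w : S → ℝ := (√2)⁻¹ • (Pi.single a 1 - Pi.single b 1) with hw
  have h2 : (√2 : ℝ)⁻¹ * (√2)⁻¹ = 1 / 2 := by
    rw [← mul_inv, Real.mul_self_sqrt (by norm_num)]; norm_num
  have hwv : ∀ v : S → ℝ, ∑ s, w s * v s = (√2)⁻¹ * (v a - v b) := by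
    intro v
    simp [hw, mul_assoc, ← Finset.mul_sum, sub_mul, Finset.sum_sub_distrib, Pi.single_apply]
  have hQ : stdForm S w = 1 := by
    rw [QuadraticMap.weightedSumSquares_apply]
    simp only [one_smul]
    rw [hwv w]
    simp only [hw, Pi.smul_apply, Pi.sub_apply, Pi.single_eq_same, Pi.single_eq_of_ne hab,
      Pi.single_eq_of_ne hab.symm, smul_eq_mul]
    linear_combination 2 * h2
  have hP : ∀ v, QuadraticMap.polar (stdForm S) w v = 2 * ((√2)⁻¹ * (v a - v b)) := by
    intro v
    rw [← hwv v, QuadraticMap.polar]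
    simp only [QuadraticMap.weightedSumSquares_apply, one_smul, ← Finset.sum_sub_distrib,
      Finset.mul_sum, Pi.add_apply]
    exact Finset.sum_congr rfl fun i _ => by ring
  refine ⟨CliffordAlgebra.ι _ w, ?_, ?_, fun v => ?_⟩
  · rw [CliffordAlgebra.reverse_ι, CliffordAlgebra.ι_sq_scalar, hQ, map_one]
  · rw [CliffordAlgebra.reverse_ι, CliffordAlgebra.ι_sq_scalar, hQ, map_one]
  · have hs : v ∘ (Equiv.swap a b).symm = v - (QuadraticMap.polar (stdForm S) w v) • w := by
      rw [hP]
      funext i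
      simp only [Function.comp, Equiv.symm_swap, Pi.sub_apply, Pi.smul_apply, hw, smul_eq_mul]
      rcases eq_or_ne i a with rfl | hia
      · rw [Equiv.swap_apply_left, Pi.single_eq_same, Pi.single_eq_of_ne hab]
        linear_combination (2 * (v i - v b)) * h2
      · rcases eq_or_ne i b with rfl | hib
        · rw [Equiv.swap_apply_right, Pi.single_eq_same, Pi.single_eq_of_ne hia]
          linear_combination (-2 * (v a - v i)) * h2
        · rw [Equiv.swap_apply_of_ne_of_ne hia hib, Pi.single_eq_of_ne hia,
            Pi.single_eq_of_ne hib]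
          ring
    clear_value w
    rw [hs, map_sub, map_smul, sub_mul, CliffordAlgebra.involute_ι, smul_mul_assoc,
      CliffordAlgebra.ι_sq_scalar, hQ, map_one, Algebra.smul_def, mul_one,
      ← CliffordAlgebra.ι_mul_ι_add_swap]
    noncomm_ring

theorem exists_isPinLift (σ : Equiv.Perm S) : ∃ x, IsPinLift σ x := by
  classical
  induction σ using Equiv.Perm.swap_induction_on with
  | one => exact ⟨1, IsPinLift.one⟩
  | swap_mul f x y hxy hf =>
    obtain ⟨z, hz⟩ := hf
    obtain ⟨s, hs⟩ := isPinLift_swap hxy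
    exact ⟨s * z, hs.mul hz⟩

theorem ι_mul_sub_involute_mul_ι (v : S → ℝ) (x : CliffordAlgebra (stdForm S)) :
    CliffordAlgebra.ι (stdForm S) v * x - CliffordAlgebra.involute x * CliffordAlgebra.ι _ v =
      CliffordAlgebra.contractLeft ((stdForm S).polarBilin v) x := by
  induction x using CliffordAlgebra.left_induction with
  | algebraMap r =>
    rw [CliffordAlgebra.contractLeft_algebraMap, AlgHom.commutes, Algebra.commutes, sub_self]
  | add x y hx hy => rw [map_add, map_add, ← hx, ← hy]; noncomm_ring
  | ι_mul y a hy =>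
    rw [CliffordAlgebra.contractLeft_ι_mul, ← hy, map_mul, CliffordAlgebra.involute_ι,
      QuadraticMap.polarBilin_apply_apply, Algebra.smul_def, ← CliffordAlgebra.ι_mul_ι_add_swap]
    noncomm_ring

theorem sub_ι_mul_contractLeft {M : Type*} [AddCommGroup M] [Module ℝ M]
    (d : Module.Dual ℝ M) (e : M) (x : ExteriorAlgebra ℝ M) :
    x - ExteriorAlgebra.ι ℝ e * CliffordAlgebra.contractLeft d x =
      ExteriorAlgebra.map (LinearMap.id - d.smulRight e) x := by
  induction x using CliffordAlgebra.left_induction with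
  | algebraMap r =>
    rw [CliffordAlgebra.contractLeft_algebraMap, mul_zero, sub_zero]
    exact (AlgHom.commutes _ r).symm
  | add x y hx hy => rw [map_add, map_add, ← hx, ← hy]; noncomm_ring
  | ι_mul y a hy =>
    have h1 : ExteriorAlgebra.map (LinearMap.id - d.smulRight e) (CliffordAlgebra.ι 0 a * y) =
      ExteriorAlgebra.ι ℝ (a - d a • e) *
        ExteriorAlgebra.map (LinearMap.id - d.smulRight e) y := by
      rw [map_mul]
      congr 1
      exact ExteriorAlgebra.map_apply_ι _ _
    have h2 : ExteriorAlgebra.ι ℝ e * ExteriorAlgebra.ι ℝ e = 0 := ExteriorAlgebra.ι_sq_zero e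
    have h3 : ExteriorAlgebra.ι ℝ e * ExteriorAlgebra.ι ℝ a =
      - (ExteriorAlgebra.ι ℝ a * ExteriorAlgebra.ι ℝ e) :=
      eq_neg_of_add_eq_zero_left (ExteriorAlgebra.ι_add_mul_swap e a)
    rw [h1, ← hy, CliffordAlgebra.contractLeft_ι_mul]
    change ExteriorAlgebra.ι ℝ a * y - ExteriorAlgebra.ι ℝ e * (d a • y -
      ExteriorAlgebra.ι ℝ a * CliffordAlgebra.contractLeft d y) = _
    rw [map_sub, map_smul, mul_sub, ← mul_assoc, h3, sub_mul, mul_sub (ExteriorAlgebra.ι ℝ a),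
      smul_mul_assoc, mul_sub, ← mul_assoc (ExteriorAlgebra.ι ℝ e), h2, mul_smul_comm]
    simp only [zero_mul, sub_zero, neg_mul, mul_assoc]
    abel

theorem exists_algebraMap_of_contractLeft {x : ExteriorAlgebra ℝ (S → ℝ)}
    (hx : ∀ d : Module.Dual ℝ (S → ℝ), CliffordAlgebra.contractLeft d x = 0) :
    ∃ r : ℝ, x = algebraMap ℝ _ r := by
  classical
  have hfix : ∀ (d : Module.Dual ℝ (S → ℝ)) (e : S → ℝ), ExteriorAlgebra.map (LinearMap.id - d.smulRight e) x = x := fun d e => by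
    rw [← sub_ι_mul_contractLeft, hx, mul_zero, sub_zero]
  have key : ∀ T : Finset S, ∃ f : (S → ℝ) →ₗ[ℝ] (S → ℝ),
      ExteriorAlgebra.map f x = x ∧ ∀ v, ∀ i ∈ T, f v i = 0 := by
    intro T
    induction T using Finset.induction_on with
    | empty => exact ⟨LinearMap.id, by simp, by simp⟩
    | insert j T hj ih =>
      obtain ⟨f, hf, hfT⟩ := ih
      refine ⟨(LinearMap.id - (LinearMap.proj j).smulRight (Pi.single j 1)) ∘ₗ f, ?_, ?_⟩
      · rw [← ExteriorAlgebra.map_comp_map, AlgHom.comp_apply, hf, hfix]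
      · intro v i hi
        rcases eq_or_ne i j with rfl | hij
        · simp
        · have := hfT v i (Finset.mem_of_mem_insert_of_ne hi hij)
          simp [this, hij]
  obtain ⟨f, hf, hf0⟩ := key Finset.univ
  have h0 : f = 0 := LinearMap.ext fun v => funext fun i => hf0 v i (Finset.mem_univ i)
  subst h0
  have : ∀ y : ExteriorAlgebra ℝ (S → ℝ), ∃ r : ℝ,
      ExteriorAlgebra.map (0 : (S → ℝ) →ₗ[ℝ] (S → ℝ)) y = algebraMap ℝ _ r := by
    intro y
    induction y using CliffordAlgebra.left_induction with
    | algebraMap r => exact ⟨r, AlgHom.commutes _ r⟩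
    | add y z hy hz =>
      obtain ⟨r, hr⟩ := hy
      obtain ⟨s, hs⟩ := hz
      exact ⟨r + s, by rw [map_add, hr, hs, map_add]⟩
    | ι_mul y a hy =>
      refine ⟨0, ?_⟩
      rw [map_mul, map_zero]
      have : ExteriorAlgebra.map (0 : (S → ℝ) →ₗ[ℝ] (S → ℝ)) (CliffordAlgebra.ι 0 a) = 0 :=
        (ExteriorAlgebra.map_apply_ι _ _).trans (by simp)
      rw [this, zero_mul]
  rw [← hf]
  exact this x

theorem IsPinLift.eq_or_eq_neg_of_one {x : CliffordAlgebra (stdForm S)}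
    (hx : IsPinLift (1 : Equiv.Perm S) x) : x = 1 ∨ x = -1 := by
  classical
  have hv : ∀ v, CliffordAlgebra.contractLeft ((stdForm S).polarBilin v) x = 0 := fun v => by
    rw [← ι_mul_sub_involute_mul_ι, hx.twisted_conj]
    exact sub_self _
  have hd : ∀ d : Module.Dual ℝ (S → ℝ), CliffordAlgebra.contractLeft d x = 0 := by
    intro d
    have : d = (stdForm S).polarBilin (fun i => d (Pi.single i 1) / 2) := by
      refine LinearMap.pi_ext' fun i => LinearMap.ext_ring ?_
      simp only [LinearMap.comp_apply, LinearMap.single_apply,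
        QuadraticMap.polarBilin_apply_apply, QuadraticMap.polar,
        QuadraticMap.weightedSumSquares_apply, one_smul, ← Finset.sum_sub_distrib]
      rw [Finset.sum_eq_single i]
      · simp; ring
      · intro b _ hb
        simp [Pi.single_eq_of_ne hb]
      · simp
    rw [this, hv]
  let e := CliffordAlgebra.equivExterior (stdForm S)
  obtain ⟨r, hr⟩ := exists_algebraMap_of_contractLeft (x := e x) fun d => by
    have := CliffordAlgebra.changeForm_contractLeft
      (CliffordAlgebra.changeForm.associated_neg_proof (Q := stdForm S)) d x
    rw [hd, map_zero] at this
    exact this.symm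
  have hxr : x = algebraMap ℝ _ r := by
    apply e.injective
    rw [hr]
    exact (CliffordAlgebra.changeForm_algebraMap
      (CliffordAlgebra.changeForm.associated_neg_proof (Q := stdForm S)) r).symm
  have h1 := hx.reverse_mul
  rw [hxr, CliffordAlgebra.reverse.commutes, ← map_mul, ← map_one (algebraMap ℝ _)] at h1
  have h2 : r * r = 1 := (algebraMap ℝ (CliffordAlgebra (stdForm S))).injective h1
  rcases mul_self_eq_one_iff.mp h2 with h | h
  · left; rw [hxr, h, map_one]
  · right; rw [hxr, h, map_neg, map_one]

theorem IsPinLift.eq_or_eq_neg {σ : Equiv.Perm S} {x y : CliffordAlgebra (stdForm S)}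
    (hx : IsPinLift σ x) (hy : IsPinLift σ y) : x = y ∨ x = -y := by
  have hinv : IsPinLift (1 : Equiv.Perm S) (CliffordAlgebra.reverse y * x) := by
    refine ⟨?_, ?_, fun v => ?_⟩
    · rw [CliffordAlgebra.reverse.map_mul, CliffordAlgebra.reverse_reverse, mul_assoc,
        ← mul_assoc y, hy.mul_reverse, one_mul, hx.reverse_mul]
    · rw [CliffordAlgebra.reverse.map_mul, CliffordAlgebra.reverse_reverse, mul_assoc,
        ← mul_assoc x, hx.mul_reverse, one_mul, hy.reverse_mul]
    · have h1 : CliffordAlgebra.involute (CliffordAlgebra.reverse y) * CliffordAlgebra.involute y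
          = 1 := by rw [← map_mul, hy.reverse_mul, map_one]
      have h2 := hy.twisted_conj v
      have h3 : CliffordAlgebra.involute (CliffordAlgebra.reverse y) *
          CliffordAlgebra.ι (stdForm S) (v ∘ σ.symm) =
          CliffordAlgebra.ι (stdForm S) v * CliffordAlgebra.reverse y := by
        calc _ = CliffordAlgebra.involute (CliffordAlgebra.reverse y) *
              (CliffordAlgebra.ι (stdForm S) (v ∘ σ.symm) * y) * CliffordAlgebra.reverse y := by
              rw [mul_assoc, mul_assoc, hy.mul_reverse, mul_one]
          _ = _ := by rw [← h2, ← mul_assoc, h1, one_mul]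
      rw [map_mul, mul_assoc, hx.twisted_conj, ← mul_assoc, h3, mul_assoc]
      rfl
  have hyx : x = y * (CliffordAlgebra.reverse y * x) := by
    rw [← mul_assoc, hy.mul_reverse, one_mul]
  rcases hinv.eq_or_eq_neg_of_one with h | h
  · left; rw [hyx, h, mul_one]
  · right; rw [hyx, h, mul_neg, mul_one]

/-- A chosen lift of `σ` to the Pin group. -/
def pinLift (σ : Equiv.Perm S) : CliffordAlgebra (stdForm S) := (exists_isPinLift σ).choose

theorem isPinLift_pinLift (σ : Equiv.Perm S) : IsPinLift σ (pinLift σ) :=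
  (exists_isPinLift σ).choose_spec

open scoped Classical in
/-- The sign `±1` with `pinLift σ * pinLift τ = ± pinLift (σ * τ)`. It is a 2-cocycle on `Perm S` with
values in `{1, -1}` and represents the second Stiefel-Whitney class `w₂` of the permutation
representation `ℝ^S`. -/
def pinSign (σ τ : Equiv.Perm S) : ℤˣ :=
  if pinLift σ * pinLift τ = pinLift (σ * τ) then 1 else -1

theorem pinLift_mul (σ τ : Equiv.Perm S) :
    pinLift σ * pinLift τ = ((pinSign σ τ : ℤ) : CliffordAlgebra (stdForm S)) *
      pinLift (σ * τ) := by
  unfold pinSign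
  split_ifs with h
  · simpa using h
  · have := ((isPinLift_pinLift σ).mul (isPinLift_pinLift τ)).eq_or_eq_neg
      (isPinLift_pinLift (σ * τ))
    simpa using this.resolve_left h

theorem pinSign_cocycle (σ τ υ : Equiv.Perm S) :
    pinSign σ (τ * υ) * pinSign τ υ = pinSign (σ * τ) υ * pinSign σ τ := by
  have h : pinLift σ * pinLift τ * pinLift υ = pinLift σ * (pinLift τ * pinLift υ) :=
    mul_assoc _ _ _
  rw [pinLift_mul, pinLift_mul, mul_assoc, pinLift_mul, ← mul_assoc (pinLift σ),
    ← (Int.cast_commute _ _).eq, mul_assoc (_ : CliffordAlgebra (stdForm S)) (pinLift σ),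
    pinLift_mul, ← mul_assoc, ← mul_assoc, mul_assoc σ τ υ] at h
  have hu : IsUnit (pinLift (σ * (τ * υ))) :=
    ⟨⟨_, _, (isPinLift_pinLift _).mul_reverse, (isPinLift_pinLift _).reverse_mul⟩, rfl⟩
  have h' := hu.mul_right_cancel h
  have hinj : Function.Injective (fun n : ℤ => (n : CliffordAlgebra (stdForm S))) := by
    intro a b hab
    have : (algebraMap ℝ (CliffordAlgebra (stdForm S))) a = algebraMap ℝ _ b := by
      simpa using hab
    exact_mod_cast (algebraMap ℝ (CliffordAlgebra (stdForm S))).injective this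
  apply Units.ext
  apply hinj
  push_cast
  rw [← (Int.cast_commute (pinSign τ υ : ℤ) _).eq, ← h', (Int.cast_commute _ _).eq]

end PinLifts

noncomputable section BrauerGroup

variable (F : Type*) [Field F]

/-- Continuous 2-cocycles of the absolute Galois group of `F` with values in the units of a separable
closure of `F`. -/
def brauerCocycles : Subgroup
    (Gal(SeparableClosure F/F) × Gal(SeparableClosure F/F) → (SeparableClosure F)ˣ) where
  carrier := {c | IsLocallyConstant c ∧ ∀ g h j,
    c (g, h * j) * Units.map (g : SeparableClosure F →* SeparableClosure F) (c (h, j)) =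
      c (g * h, j) * c (g, h)}
  mul_mem' := by
    rintro a b ⟨ha, ha'⟩ ⟨hb, hb'⟩
    refine ⟨ha.mul hb, fun g h j => ?_⟩
    simp only [Pi.mul_apply, map_mul]
    rw [mul_mul_mul_comm, ha', hb', mul_mul_mul_comm]
  one_mem' := ⟨IsLocallyConstant.const 1, fun g h j => by simp⟩
  inv_mem' := by
    rintro a ⟨ha, ha'⟩
    refine ⟨ha.inv, fun g h j => ?_⟩
    simp only [Pi.inv_apply, map_inv]
    rw [← mul_inv, ha', mul_inv]

/-- Coboundaries of continuous 1-cochains. -/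
def brauerCoboundaries : Subgroup
    (Gal(SeparableClosure F/F) × Gal(SeparableClosure F/F) → (SeparableClosure F)ˣ) where
  carrier := {c | ∃ b : Gal(SeparableClosure F/F) → (SeparableClosure F)ˣ, IsLocallyConstant b ∧
    ∀ g h, c (g, h) =
      Units.map (g : SeparableClosure F →* SeparableClosure F) (b h) * (b (g * h))⁻¹ * b g}
  mul_mem' := by
    rintro a b ⟨a', ha, ha'⟩ ⟨b', hb, hb'⟩
    refine ⟨a' * b', ha.mul hb, fun g h => ?_⟩
    rw [Pi.mul_apply, ha', hb', Pi.mul_apply, Pi.mul_apply, Pi.mul_apply, map_mul, mul_inv,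
      mul_mul_mul_comm, mul_mul_mul_comm (Units.map _ (a' h))]
  one_mem' := ⟨1, IsLocallyConstant.const 1, fun g h => by simp⟩
  inv_mem' := by
    rintro a ⟨a', ha, ha'⟩
    refine ⟨a'⁻¹, ha.inv, fun g h => ?_⟩
    rw [Pi.inv_apply, ha', Pi.inv_apply, Pi.inv_apply, Pi.inv_apply, map_inv, mul_inv, mul_inv]

/-- The (cohomological) Brauer group `Br(F) = H²(Spec F, 𝔾ₘ) = H²(Gal(Fˢᵉᵖ/F), (Fˢᵉᵖ)ˣ)`, written
additively. -/
def Br : Type _ :=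
  Additive (brauerCocycles F ⧸ (brauerCoboundaries F).subgroupOf (brauerCocycles F))

instance : AddCommGroup (Br F) :=
  inferInstanceAs (AddCommGroup
    (Additive (brauerCocycles F ⧸ (brauerCoboundaries F).subgroupOf (brauerCocycles F))))

variable {F}

/-- The second Galois-Stiefel-Whitney class of the étale `F`-algebra corresponding to a finite set `S`
with a continuous action `ρ` of the absolute Galois group: the pullback along `ρ` of the class `w₂` of
the permutation representation of `Perm S`. It lives in `H²(F, μ₂) = Br(F)[2]`; here it is regarded as
an element of `Br(F)` through `{1, -1} ⊆ (Fˢᵉᵖ)ˣ`. -/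
def galoisSW₂ {S : Type*} [Fintype S] (ρ : Gal(SeparableClosure F/F) →* Equiv.Perm S)
    (hρ : IsLocallyConstant ρ) : Br F :=
  Additive.ofMul (QuotientGroup.mk ⟨fun x =>
    Units.map (Int.castRingHom (SeparableClosure F) : ℤ →* SeparableClosure F)
      (pinSign (ρ x.1) (ρ x.2)),
    (hρ.comp_continuous continuous_fst).comp₂ (hρ.comp_continuous continuous_snd)
      fun σ τ => Units.map (Int.castRingHom (SeparableClosure F) : ℤ →* SeparableClosure F)
        (pinSign σ τ),
    fun g h j => by
      have hfix : ∀ z : ℤˣ, Units.map (g : SeparableClosure F →* SeparableClosure F)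
          (Units.map (Int.castRingHom (SeparableClosure F) : ℤ →* SeparableClosure F) z) =
          Units.map (Int.castRingHom (SeparableClosure F) : ℤ →* SeparableClosure F) z := by
        intro z
        ext
        simp
      simp only [hfix]
      rw [← map_mul, ← map_mul, map_mul ρ, map_mul ρ, pinSign_cocycle]⟩)

/-- The image `σ(U)` of a linear subspace `U` under a Galois automorphism `σ`. -/
def galSubspace {n : ℕ} (σ : Gal(SeparableClosure F/F))
    (U : Submodule (SeparableClosure F) (Fin n → SeparableClosure F)) :
    Submodule (SeparableClosure F) (Fin n → SeparableClosure F) where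
  carrier := {v | (fun i => σ.symm (v i)) ∈ U}
  add_mem' := by
    intro a b ha hb
    simpa [Pi.add_def] using U.add_mem ha hb
  zero_mem' := by
    simp only [Set.mem_ofPred_eq, Pi.zero_apply, map_zero]
    exact U.zero_mem
  smul_mem' := by
    intro c a ha
    simpa [Pi.smul_def] using U.smul_mem (σ.symm c) ha

theorem mem_galSubspace {n : ℕ} {σ : Gal(SeparableClosure F/F)}
    {U : Submodule (SeparableClosure F) (Fin n → SeparableClosure F)}
    {v : Fin n → SeparableClosure F} :
    v ∈ galSubspace σ U ↔ (fun i => σ.symm (v i)) ∈ U := Iff.rfl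

/-- The Galois action on a Galois-stable set of linear subspaces. -/
def galPerm {n : ℕ} (T : Set (Submodule (SeparableClosure F) (Fin n → SeparableClosure F)))
    (hT : ∀ σ : Gal(SeparableClosure F/F), ∀ U ∈ T, galSubspace σ U ∈ T) :
    Gal(SeparableClosure F/F) →* Equiv.Perm T where
  toFun σ :=
    { toFun := fun U => ⟨galSubspace σ U, hT σ U U.2⟩
      invFun := fun U => ⟨galSubspace σ.symm U, hT σ.symm U U.2⟩
      left_inv := fun U => Subtype.ext <| Submodule.ext fun v => by simp [mem_galSubspace]
      right_inv := fun U => Subtype.ext <| Submodule.ext fun v => by simp [mem_galSubspace] }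
  map_one' := Equiv.ext fun U => Subtype.ext <| Submodule.ext fun v => Iff.rfl
  map_mul' σ τ := Equiv.ext fun U => Subtype.ext <| Submodule.ext fun v => Iff.rfl

theorem galPerm_locallyConstant {n : ℕ}
    (T : Set (Submodule (SeparableClosure F) (Fin n → SeparableClosure F)))
    (hT : ∀ σ : Gal(SeparableClosure F/F), ∀ U ∈ T, galSubspace σ U ∈ T) (hfin : T.Finite) :
    IsLocallyConstant (galPerm T hT) := by
  have hstab : ∀ U : T, ∃ V : Subgroup Gal(SeparableClosure F/F),
      IsOpen (V : Set Gal(SeparableClosure F/F)) ∧ ∀ σ ∈ V, galPerm T hT σ U = U := by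
    rintro ⟨U, hU⟩
    obtain ⟨B, hB⟩ := (IsNoetherian.noetherian U : U.FG)
    let E : IntermediateField F (SeparableClosure F) :=
      IntermediateField.adjoin F (⋃ v ∈ B, Set.range v)
    have hfinE : (⋃ v ∈ B, Set.range v : Set (SeparableClosure F)).Finite :=
      B.finite_toSet.biUnion fun v _ => Set.finite_range v
    have : Finite (⋃ v ∈ B, Set.range v : Set (SeparableClosure F)) := hfinE
    have : FiniteDimensional F E :=
      IntermediateField.finiteDimensional_adjoin fun x _ => Algebra.IsIntegral.isIntegral x
    have hle : ∀ σ ∈ E.fixingSubgroup, U ≤ galSubspace σ U := by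
      intro σ hσ
      rw [← hB, Submodule.span_le]
      intro v hv
      have : (fun i => σ.symm (v i)) = v := by
        funext i
        rw [AlgEquiv.symm_apply_eq]
        exact ((IntermediateField.mem_fixingSubgroup_iff _ _).1 hσ (v i)
          (IntermediateField.subset_adjoin _ _ (Set.mem_biUnion hv ⟨i, rfl⟩))).symm
      rw [SetLike.mem_coe, mem_galSubspace, this]
      exact Submodule.subset_span hv
    refine ⟨E.fixingSubgroup, E.fixingSubgroup_isOpen, fun σ hσ => Subtype.ext ?_⟩
    refine le_antisymm (fun v hv => ?_) (hle σ hσ)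
    have h1 := hle σ⁻¹ (inv_mem hσ) (mem_galSubspace.1 hv)
    have h2 : (fun i => (σ⁻¹).symm (σ.symm (v i))) = v := by
      funext i
      exact σ.apply_symm_apply (v i)
    rw [mem_galSubspace, h2] at h1
    exact h1
  choose V hVo hV using hstab
  have : Finite T := hfin
  have hopen : IsOpen ((galPerm T hT).ker : Set Gal(SeparableClosure F/F)) := by
    have : (⨅ U, V U) ≤ (galPerm T hT).ker := by
      intro σ hσ
      rw [MonoidHom.mem_ker]
      exact Equiv.ext fun U => hV U σ ((Subgroup.mem_iInf.1 hσ) U)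
    refine Subgroup.isOpen_mono this ?_
    rw [Subgroup.coe_iInf]
    exact isOpen_iInter_of_finite hVo
  rw [IsLocallyConstant.iff_exists_open]
  intro σ
  refine ⟨(fun τ => σ⁻¹ * τ) ⁻¹' ((galPerm T hT).ker : Set Gal(SeparableClosure F/F)),
    hopen.preimage (continuous_const_mul σ⁻¹), by simp, fun τ hτ => ?_⟩
  have h1 : galPerm T hT (σ⁻¹ * τ) = 1 := hτ
  rw [map_mul, map_inv, inv_mul_eq_one] at h1
  exact h1.symm

/-- The second Galois-Stiefel-Whitney class of the étale algebra attached to a finite Galois-stable set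
of linear subspaces (junk value `0` if the set is infinite). -/
def subspacesSW₂ {n : ℕ} (T : Set (Submodule (SeparableClosure F) (Fin n → SeparableClosure F)))
    (hT : ∀ σ : Gal(SeparableClosure F/F), ∀ U ∈ T, galSubspace σ U ∈ T) : Br F :=
  open scoped Classical in
  if hfin : T.Finite then
    letI : Fintype T := hfin.fintype
    galoisSW₂ (galPerm T hT) (galPerm_locallyConstant T hT hfin)
  else 0

theorem finrank_galSubspace {n : ℕ} (σ : Gal(SeparableClosure F/F))
    (U : Submodule (SeparableClosure F) (Fin n → SeparableClosure F)) :
    Module.finrank (SeparableClosure F) (galSubspace σ U) =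
      Module.finrank (SeparableClosure F) U := by
  have hmem : ∀ v : U, (fun i => σ ((v : Fin n → SeparableClosure F) i)) ∈ galSubspace σ U := by
    intro v
    rw [mem_galSubspace]
    simp
  let e : U →ₛₗ[(σ : SeparableClosure F →+* SeparableClosure F)] galSubspace σ U :=
    { toFun := fun v => ⟨_, hmem v⟩
      map_add' := fun v w => Subtype.ext (funext fun i => map_add σ _ _)
      map_smul' := fun c v => Subtype.ext (funext fun i => map_mul σ _ _) }
  have hbij : Function.Bijective e := by
    refine ⟨fun v w h => ?_, fun w => ?_⟩
    · refine Subtype.ext (funext fun i => ?_)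
      exact σ.injective (congrFun (congrArg Subtype.val h) i)
    · refine ⟨⟨_, mem_galSubspace.1 w.2⟩, Subtype.ext (funext fun i => ?_)⟩
      exact σ.apply_symm_apply _
  have := rank_eq_of_equiv_equiv (σ : SeparableClosure F → SeparableClosure F)
    (AddEquiv.ofBijective e.toAddMonoidHom hbij) σ.bijective fun c v => map_smulₛₗ e c v
  rw [Module.finrank, Module.finrank, this]

theorem aeval_galois {n : ℕ} (σ : Gal(SeparableClosure F/F)) (f : MvPolynomial (Fin n) F)
    (v : Fin n → SeparableClosure F) :
    aeval v f = σ (aeval (fun i => σ.symm (v i)) f) := by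
  have := comp_aeval_apply (fun i => σ.symm (v i)) (σ : SeparableClosure F →ₐ[F] SeparableClosure F) f
  simpa using this.symm

/-- The lines over the separable closure (as 2-dimensional linear subspaces) that are contained in the
projective hypersurface `f = 0`. -/
def linesOn {n : ℕ} (f : MvPolynomial (Fin n) F) :
    Set (Submodule (SeparableClosure F) (Fin n → SeparableClosure F)) :=
  {U | Module.finrank (SeparableClosure F) U = 2 ∧ ∀ v ∈ U, aeval v f = 0}

theorem galSubspace_mem_linesOn {n : ℕ} (f : MvPolynomial (Fin n) F)
    (σ : Gal(SeparableClosure F/F)) : ∀ U ∈ linesOn f, galSubspace σ U ∈ linesOn f := by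
  rintro U ⟨h1, h2⟩
  refine ⟨(finrank_galSubspace σ U).trans h1, fun v hv => ?_⟩
  rw [aeval_galois σ, h2 _ (mem_galSubspace.1 hv), map_zero]

/-- `α₂(E_X)` for the smooth cubic surface `X : f = 0` in `ℙ³`, where `E_X` is the étale algebra of
degree 27 given by the Galois action on the lines of `X`. -/
def linesSW₂ (f : MvPolynomial (Fin 4) F) : Br F :=
  subspacesSW₂ (linesOn f) (fun σ => galSubspace_mem_linesOn f σ)

/-- The bitangents over the separable closure of the plane quartic `f = 0`: the lines to which `f`
restricts as the square of a quadratic form (i.e. every intersection multiplicity is even;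
hyperflexes are included). -/
def bitangents (f : MvPolynomial (Fin 3) F) :
    Set (Submodule (SeparableClosure F) (Fin 3 → SeparableClosure F)) :=
  {U | Module.finrank (SeparableClosure F) U = 2 ∧
    ∃ h : MvPolynomial (Fin 3) (SeparableClosure F), h.IsHomogeneous 2 ∧
      ∀ v ∈ U, aeval v f = eval v h ^ 2}

theorem galSubspace_mem_bitangents (f : MvPolynomial (Fin 3) F)
    (σ : Gal(SeparableClosure F/F)) : ∀ U ∈ bitangents f, galSubspace σ U ∈ bitangents f := by
  rintro U ⟨h1, h, hh, h2⟩
  refine ⟨(finrank_galSubspace σ U).trans h1,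
    map (σ : SeparableClosure F →+* SeparableClosure F) h, hh.map _, fun v hv => ?_⟩
  rw [aeval_galois σ, h2 _ (mem_galSubspace.1 hv), map_pow, eval_map]
  congr 1
  have := eval₂_comp_left (σ : SeparableClosure F →+* SeparableClosure F) (RingHom.id _)
    (fun i => σ.symm (v i)) h
  rw [← eval₂_id]
  refine this.trans ?_
  congr 1
  funext i
  exact σ.apply_symm_apply _

/-- The class `γ(C) ∈ Br(F)` of the smooth plane quartic `C : f = 0` over a field of characteristic
different from two. The generator `γ` of the summand `ℤ/2ℤ` of the Brauer group of the stack of smooth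
curves of genus three is the second Galois-Stiefel-Whitney class of the étale algebra of degree 28 of
odd theta characteristics, and the odd theta characteristics of a smooth plane quartic are its
bitangents. -/
def gammaClass (f : MvPolynomial (Fin 3) F) : Br F :=
  subspacesSW₂ (bitangents f) (fun σ => galSubspace_mem_bitangents f σ)

end BrauerGroup

section Curves

/-- `f` is a form of degree `d` over the field `F` which defines a smooth hypersurface in projective
space: the Jacobian criterion at all geometric points. -/
def IsSmoothForm {F : Type*} [Field F] {n : ℕ} (d : ℕ) (f : MvPolynomial (Fin n) F) : Prop :=
  f.IsHomogeneous d ∧ ∀ v : Fin n → AlgebraicClosure F, v ≠ 0 → aeval v f = 0 →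
    ∃ i, aeval v (pderiv i f) ≠ 0

/-- The closed subscheme `g = 0` of `ℙ²` over an algebraically closed field of characteristic different
from two is a stable curve of arithmetic genus three. (A plane curve is always connected, and a plane
quartic has arithmetic genus three.)
* `reduced`: the curve is reduced;
* `nodal`: all singular points are ordinary double points. The Hessian matrix at a singular point `v`
  kills `v`, and the quadratic form that it induces on the tangent plane of `ℙ²` has to be
  nondegenerate;
* `components`: every smooth rational irreducible component `A = 0` (that is, every component which is
  a line or a conic, as a smooth plane curve of degree `d` has genus `(d - 1)(d - 2)/2`) meets the
  rest `B = 0` of the curve in at least three points. -/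
structure IsStablePlaneQuartic {Ω : Type*} [Field Ω] (g : MvPolynomial (Fin 3) Ω) : Prop where
  homogeneous : g.IsHomogeneous 4
  ne_zero : g ≠ 0
  reduced : Squarefree g
  nodal : ∀ v : Fin 3 → Ω, v ≠ 0 → eval v g = 0 → (∀ i, eval v (pderiv i g) = 0) →
    (Matrix.of fun i j => eval v (pderiv i (pderiv j g))).rank = 2
  components : ∀ A B : MvPolynomial (Fin 3) Ω, g = A * B → Irreducible A → A.totalDegree ≤ 2 →
    3 ≤ {P : Projectivization Ω (Fin 3 → Ω) | eval P.rep A = 0 ∧ eval P.rep B = 0}.encard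

/-- The closed subscheme `g = 0` of `ℙ²` over the base ring `R` is a stable curve over `R` (of genus
three): it is flat over `R` (and of course proper), and all its geometric fibres are stable curves.
Flatness is stated for the homogeneous coordinate ring. -/
structure IsStablePlaneQuarticOver.{v} {R : Type v} [CommRing R] (g : MvPolynomial (Fin 3) R) :
    Prop where
  homogeneous : g.IsHomogeneous 4
  flat : Module.Flat R (MvPolynomial (Fin 3) R ⧸ Ideal.span {g})
  fibres : ∀ (Ω : Type v) [Field Ω] [IsAlgClosed Ω] (φ : R →+* Ω), IsStablePlaneQuartic (map φ g)

end Curves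

noncomputable section Shioda

/-- The coefficients of Shioda's normal form of a cubic surface. -/
structure ShiodaCoeffs (R : Type*) where
  (p₀ p₁ p₂ q₀ q₁ q₂ : R)

namespace ShiodaCoeffs

variable {R : Type*} [CommRing R]

/-- Change of coefficient ring. -/
def map {R' : Type*} [CommRing R'] (φ : R →+* R') (c : ShiodaCoeffs R) : ShiodaCoeffs R' :=
  ⟨φ c.p₀, φ c.p₁, φ c.p₂, φ c.q₀, φ c.q₁, φ c.q₂⟩

/-- `f₀(X, Y, W) = p₂ X - 2 Y + q₂ W`; the variables `X, Y, W` have the indices `0, 1, 2`. -/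
def f₀ (c : ShiodaCoeffs R) : MvPolynomial (Fin 3) R := C c.p₂ * X 0 - 2 * X 1 + C c.q₂ * X 2

/-- `f₁(X, Y, W) = p₁ X W + q₁ W²`. -/
def f₁ (c : ShiodaCoeffs R) : MvPolynomial (Fin 3) R := C c.p₁ * X 0 * X 2 + C c.q₁ * X 2 ^ 2

/-- `f₂(X, Y, W) = X³ + p₀ X W² + q₀ W³ - Y² W`. -/
def f₂ (c : ShiodaCoeffs R) : MvPolynomial (Fin 3) R :=
  X 0 ^ 3 + C c.p₀ * X 0 * X 2 ^ 2 + C c.q₀ * X 2 ^ 3 - X 1 ^ 2 * X 2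

/-- The quartic form `g = f₁² - 4 f₀ f₂`. -/
def quartic (c : ShiodaCoeffs R) : MvPolynomial (Fin 3) R := c.f₁ ^ 2 - 4 * c.f₀ * c.f₂

/-- The cubic form `f₀(X, Y, W) Z² + f₁(X, Y, W) Z + f₂(X, Y, W)`; the variables `X, Y, Z, W` have the
indices `0, 1, 2, 3`. -/
def cubic (c : ShiodaCoeffs R) : MvPolynomial (Fin 4) R :=
  rename ![0, 1, 3] c.f₀ * X 2 ^ 2 + rename ![0, 1, 3] c.f₁ * X 2 + rename ![0, 1, 3] c.f₂

/-- The 27 elements `c₁/3 - uᵢ`, `-2c₁/3 - uᵢ`, `c₁/3 + uᵢ + uⱼ` for `i < j`, with `c₁ = -∑ uᵢ`. -/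
def roots {L : Type*} [Field L] (u : Fin 6 → L) : Multiset L :=
  let c₁ : L := -∑ i, u i
  (Finset.univ.val.map fun i : Fin 6 => c₁ / 3 - u i) +
  (Finset.univ.val.map fun i : Fin 6 => -2 * c₁ / 3 - u i) +
  ((Finset.univ.filter fun x : Fin 6 × Fin 6 => x.1 < x.2).val.map fun x =>
    c₁ / 3 + u x.1 + u x.2)

/-- Shioda's coefficients of the cubic surface attached to the six points `[uᵢ⁻² : uᵢ⁻³ : 1]`, where
`ε m` is the `m`-th elementary symmetric function of the 27 elements above. -/
def ofPoints {L : Type*} [Field L] (u : Fin 6 → L) : ShiodaCoeffs L :=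
  let ε : ℕ → L := (roots u).esymm
  let p₂ := ε 2 / 12
  let p₁ := ε 5 / 48
  let q₂ := (ε 6 - 168 * p₂ ^ 3) / 96
  let p₀ := (ε 8 - 294 * p₂ ^ 4 - 528 * p₂ * q₂) / 480
  let q₁ := (ε 9 - 1008 * p₁ * p₂ ^ 2) / 1344
  let q₀ := (ε 12 - 608 * p₁ ^ 2 * p₂ - 4768 * p₀ * p₂ ^ 2 - 252 * p₂ ^ 6
    - 1200 * p₂ ^ 3 * q₂ + 1248 * q₂ ^ 2) / 17280
  ⟨p₀, p₁, p₂, q₀, q₁, q₂⟩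

end ShiodaCoeffs

/-- The six parameters over the finite field with `q` elements, where `s = √t` and `r = √u`: the first
choice if `(q - 1)/2` is even, and the second one if it is odd. -/
def sixParameters {L : Type*} [Field L] (q : ℕ) (t s r : L) : Fin 6 → L :=
  if Even ((q - 1) / 2) then ![1 + s, 1 - s, 1 + r, 1 - r, 2 + t, t]
  else ![1 + s, 1 - s, 1 + r, 1 - r, 1 + t + 2 * r, 1 + t - 2 * r]

/-- The inclusion of `k⟦t⟧` into the separable closure of `k⸨t⸩`. -/
def toSep (k : Type*) [Field k] : PowerSeries k →+* SeparableClosure (LaurentSeries k) :=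
  (algebraMap (LaurentSeries k) (SeparableClosure (LaurentSeries k))).comp
    (algebraMap (PowerSeries k) (LaurentSeries k))

/-- The plane quartic `f = 0` over `k⸨t⸩` has stable reduction over `k⟦t⟧`, by a plane model: it is the
generic fibre of a stable curve `g = 0` in `ℙ²` over `k⟦t⟧`. -/
def HasStableReduction {k : Type*} [Field k] (f : MvPolynomial (Fin 3) (LaurentSeries k)) : Prop :=
  ∃ g : MvPolynomial (Fin 3) (PowerSeries k), IsStablePlaneQuarticOver g ∧
    map (algebraMap (PowerSeries k) (LaurentSeries k)) g = f

end Shioda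

/-! Slopes of lines. If the line x = a z + b w, y = d z + e w lies on the cubic surface, then d and
e can be eliminated, which leaves a quadratic and a cubic equation for b. Their resultant is -512
times a monic polynomial of degree 27 in the slope a, with coefficients polynomial in the pᵢ and qᵢ
(`resultant_lineQuad_lineCub`). So once lines with the 27 prescribed slopes are known, with
multiplicities, comparison of coefficients gives the formulas for pᵢ, qᵢ in terms of the εₘ
(`ofPoints_eq`).

The lines are explicit. In both cases the parameters are 1 ± s, 1 ± r, 1 + t ± m with s² = t, r² = u
and m = 1 or m = 2r. The lines c₁₂, c₃₄, c₅₆ lie in one plane, and each remaining line is obtained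
from the one of these three that it meets. The coefficients depend only on t, r² and m², hence are
power series. The only coincidence of slopes is between c₁₂ and c₃₄, and it is a double root
(`genPos`, `linePoly_eq_prod`); in particular there are no further lines.

Smoothness. A line through a singular point of the surface has a first order deformation that
changes its slope, so its slope is a multiple root. The slopes of the lines through such a point are
the roots of a sextic with root sum zero, so they cannot all equal the single nonzero multiple root.
The quartic is the branch curve of the projection from [0:0:1:0], and its singular points lift to
singular points of the surface.

Stable reduction. A homomorphism from k⟦t⟧ to a field is injective or kills t. In the first case the
argument above shows that the fibre is smooth. For t = 0 the form f₁ vanishes and the quartic is the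
union of a line and a nodal cubic meeting in three distinct points; the nondegeneracy conditions
hold because u is not a square.

The classes. The bitangents are the rational line f₀ = 0 and the projections of the 27 lines, so
both Galois sets carry the same action up to one fixed point. It factors through the quadratic
characters of t and u, acting by two commuting products of transpositions. Their lifts to the Pin
group square to -1 and commute up to a sign ε. Hence the class is (t,-1) + (u,-1), plus (u,t) if ε =
-1. Here (u,-1) = 0, because -1 is a norm from k(√u). If -1 is a square, then ε = -1 and the class
is (u,t); otherwise ε = 1 and -1 is u times a square, so the class is again (u,t). It is nonzero
since x² - u y² - t z² is anisotropic over k((t)) (`signBit_ne_coboundary`). -/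

namespace ShiodaCoeffs

/-! ### Elimination theory: the polynomial of degree 27 for the slopes -/

section LinePolynomial

variable {R : Type*} [CommRing R]

/-- The line `x = a z + b w`, `y = d z + e w` lies on the cubic surface with coefficients `c`. -/
structure IsLine (c : ShiodaCoeffs R) (a b d e : R) : Prop where
  eq₃ : 2 * d = a ^ 3 + c.p₂ * a
  eq₂ : 2 * e + d ^ 2 = 3 * a ^ 2 * b + c.p₂ * b + c.p₁ * a + c.q₂
  eq₁ : 2 * d * e = 3 * a * b ^ 2 + c.p₀ * a + c.p₁ * b + c.q₁
  eq₀ : e ^ 2 = b ^ 3 + c.p₀ * b + c.q₀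

/-- Twice the coefficient `d` of a line. -/
def dTwo (c : ShiodaCoeffs R) (a : R) : R := a * (a ^ 2 + c.p₂)

/-- The quantity `8 e - 4 (3 a² + p₂) b` of a line. -/
def eRest (c : ShiodaCoeffs R) (a : R) : R := 4 * (c.p₁ * a + c.q₂) - c.dTwo a ^ 2

/-- The linear coefficient in `b` of `lineQuad`. -/
def quad₁ (c : ShiodaCoeffs R) (a : R) : R := 8 * c.p₁ - 4 * (3 * a ^ 2 + c.p₂) * c.dTwo a

/-- The constant coefficient in `b` of `lineQuad`. -/
def quad₀ (c : ShiodaCoeffs R) (a : R) : R := 8 * (c.p₀ * a + c.q₁) - c.dTwo a * c.eRest a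

/-- The quadratic coefficient in `b` of `lineCub`. -/
def cub₂ (c : ShiodaCoeffs R) (a : R) : R := -16 * (3 * a ^ 2 + c.p₂) ^ 2

/-- The linear coefficient in `b` of `lineCub`. -/
def cub₁ (c : ShiodaCoeffs R) (a : R) : R := 64 * c.p₀ - 8 * (3 * a ^ 2 + c.p₂) * c.eRest a

/-- The constant coefficient in `b` of `lineCub`. -/
def cub₀ (c : ShiodaCoeffs R) (a : R) : R := 64 * c.q₀ - c.eRest a ^ 2

/-- The first equation for the pair `(a, b)` of a line, after elimination of `d` and `e`. -/
def lineQuad (c : ShiodaCoeffs R) (a b : R) : R := 24 * a * b ^ 2 + c.quad₁ a * b + c.quad₀ a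

/-- The second equation for the pair `(a, b)` of a line, after elimination of `d` and `e`. -/
def lineCub (c : ShiodaCoeffs R) (a b : R) : R :=
  64 * b ^ 3 + c.cub₂ a * b ^ 2 + c.cub₁ a * b + c.cub₀ a

theorem IsLine.dTwo_eq {c : ShiodaCoeffs R} {a b d e : R} (h : c.IsLine a b d e) :
    c.dTwo a = 2 * d := by
  rw [dTwo]; linear_combination -h.eq₃

theorem IsLine.eRest_eq {c : ShiodaCoeffs R} {a b d e : R} (h : c.IsLine a b d e) :
    c.eRest a = 8 * e - 4 * (3 * a ^ 2 + c.p₂) * b := by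
  rw [eRest, h.dTwo_eq]; linear_combination -4 * h.eq₂

theorem IsLine.lineQuad_eq {c : ShiodaCoeffs R} {a b d e : R} (h : c.IsLine a b d e) :
    c.lineQuad a b = 0 := by
  rw [lineQuad, quad₁, quad₀, h.eRest_eq, h.dTwo_eq]
  linear_combination -8 * h.eq₁

theorem IsLine.lineCub_eq {c : ShiodaCoeffs R} {a b d e : R} (h : c.IsLine a b d e) :
    c.lineCub a b = 0 := by
  rw [lineCub, cub₂, cub₁, cub₀, h.eRest_eq]
  linear_combination -64 * h.eq₀

/-- The resultant of `α x² + β x + γ` and `δ x³ + ε x² + ζ x + η`. -/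
def resultant₂₃ (α β γ δ ε ζ η : R) : R :=
  α ^ 3 * η ^ 2 - α ^ 2 * β * ζ * η - 2 * α ^ 2 * γ * ε * η + α ^ 2 * γ * ζ ^ 2 +
    α * β ^ 2 * ε * η + 3 * α * β * γ * δ * η - α * β * γ * ε * ζ - 2 * α * γ ^ 2 * δ * ζ +
    α * γ ^ 2 * ε ^ 2 - β ^ 3 * δ * η + β ^ 2 * γ * δ * ζ - β * γ ^ 2 * δ * ε + γ ^ 3 * δ ^ 2

theorem resultant₂₃_eq_zero {α β γ δ ε ζ η x : R} (h₂ : α * x ^ 2 + β * x + γ = 0)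
    (h₃ : δ * x ^ 3 + ε * x ^ 2 + ζ * x + η = 0) : resultant₂₃ α β γ δ ε ζ η = 0 := by
  rw [resultant₂₃]
  -- The resultant lies in the ideal generated by the two polynomials; these are its cofactors, of
  -- degree 2 and 1 in `x`.
  linear_combination (x ^ 2 * (α ^ 2 * δ * ζ - α * β * δ * ε - α * γ * δ ^ 2 + β ^ 2 * δ ^ 2) +
      x * (-α ^ 2 * δ * η + α ^ 2 * ε * ζ - α * β * ε ^ 2 + β ^ 2 * δ * ε - β * γ * δ ^ 2) +
      (-α ^ 2 * ε * η + α ^ 2 * ζ ^ 2 + α * β * δ * η - α * β * ε * ζ - 2 * α * γ * δ * ζ +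
        α * γ * ε ^ 2 + β ^ 2 * δ * ζ - β * γ * δ * ε + γ ^ 2 * δ ^ 2)) * h₂ +
    (x * (-α ^ 3 * ζ + α ^ 2 * β * ε + α ^ 2 * γ * δ - α * β ^ 2 * δ) +
      (α ^ 3 * η - α ^ 2 * β * ζ - α ^ 2 * γ * ε + α * β ^ 2 * ε + 2 * α * β * γ * δ -
        β ^ 3 * δ)) * h₃

/-- The resultant in terms of the pseudo-remainder of the cubic by the quadratic. -/
theorem sq_mul_resultant₂₃ (α β γ δ ε ζ η : R) :
    α ^ 2 * resultant₂₃ α β γ δ ε ζ η =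
      α * (α ^ 2 * η - (α * ε - δ * β) * γ) ^ 2 -
      β * (α ^ 2 * η - (α * ε - δ * β) * γ) * (α ^ 2 * ζ - α * δ * γ - (α * ε - δ * β) * β) +
      γ * (α ^ 2 * ζ - α * δ * γ - (α * ε - δ * β) * β) ^ 2 := by
  rw [resultant₂₃]; ring

set_option maxHeartbeats 2000000 in
/-- The coefficients of the monic polynomial of degree 27 whose roots are the slopes `a` of the 27
lines. -/
def lineCoeff (c : ShiodaCoeffs R) : ℕ → R
  | 27 => 1
  | 25 => 12 * c.p₂
  | 23 => 60 * c.p₂ ^ 2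
  | 22 => -48 * c.p₁
  | 21 => 168 * c.p₂ ^ 3 + 96 * c.q₂
  | 20 => -336 * c.p₂ * c.p₁
  | 19 => 294 * c.p₂ ^ 4 + 528 * c.p₂ * c.q₂ + 480 * c.p₀
  | 18 => -1008 * c.p₂ ^ 2 * c.p₁ - 1344 * c.q₁
  | 17 => 336 * c.p₂ ^ 5 + 1152 * c.p₂ ^ 2 * c.q₂ + 2304 * c.p₂ * c.p₀ + 144 * c.p₁ ^ 2
  | 16 => -1680 * c.p₂ ^ 3 * c.p₁ - 5568 * c.p₂ * c.q₁ - 768 * c.p₁ * c.q₂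
  | 15 => 252 * c.p₂ ^ 6 + 1200 * c.p₂ ^ 3 * c.q₂ + 4768 * c.p₂ ^ 2 * c.p₀ + 608 * c.p₂ * c.p₁ ^ 2
      - 1248 * c.q₂ ^ 2 + 17280 * c.q₀
  | 14 => -1680 * c.p₂ ^ 4 * c.p₁ - 8832 * c.p₂ ^ 2 * c.q₁ - 2688 * c.p₂ * c.p₁ * c.q₂ + 2304 *
      c.p₁ * c.p₀
  | 13 => 120 * c.p₂ ^ 7 + 480 * c.p₂ ^ 4 * c.q₂ + 5696 * c.p₂ ^ 3 * c.p₀ + 976 * c.p₂ ^ 2 * c.p₁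
      ^ 2 - 4800 * c.p₂ * c.q₂ ^ 2 + 43776 * c.p₂ * c.q₀ + 3264 * c.p₁ * c.q₁ + 12288 * c.q₂ *
      c.p₀
  | 12 => -1008 * c.p₂ ^ 5 * c.p₁ - 6528 * c.p₂ ^ 3 * c.q₁ - 3072 * c.p₂ ^ 2 * c.p₁ * c.q₂ + 5888
      * c.p₂ * c.p₁ * c.p₀ + 832 * c.p₁ ^ 3 + 10752 * c.q₂ * c.q₁
  | 11 => 33 * c.p₂ ^ 8 - 144 * c.p₂ ^ 5 * c.q₂ + 4384 * c.p₂ ^ 4 * c.p₀ + 704 * c.p₂ ^ 3 * c.p₁ ^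
      2 - 6720 * c.p₂ ^ 2 * c.q₂ ^ 2 + 41472 * c.p₂ ^ 2 * c.q₀ + 2688 * c.p₂ * c.p₁ * c.q₁ + 34560
      * c.p₂ * c.q₂ * c.p₀ + 4224 * c.p₁ ^ 2 * c.q₂ - 34560 * c.p₀ ^ 2
  | 10 => -336 * c.p₂ ^ 6 * c.p₁ - 2112 * c.p₂ ^ 4 * c.q₁ - 768 * c.p₂ ^ 3 * c.p₁ * c.q₂ + 3584 *
      c.p₂ ^ 2 * c.p₁ * c.p₀ + 2560 * c.p₂ * c.p₁ ^ 3 + 23040 * c.p₂ * c.q₂ * c.q₁ + 8448 * c.p₁ *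
      c.q₂ ^ 2 + 64512 * c.p₁ * c.q₀ - 70656 * c.p₀ * c.q₁
  | 9 => 4 * c.p₂ ^ 9 - 192 * c.p₂ ^ 6 * c.q₂ + 2176 * c.p₂ ^ 5 * c.p₀ + 176 * c.p₂ ^ 4 * c.p₁ ^ 2
      - 3840 * c.p₂ ^ 3 * c.q₂ ^ 2 + 22528 * c.p₂ ^ 3 * c.q₀ - 5504 * c.p₂ ^ 2 * c.p₁ * c.q₁ +
      32768 * c.p₂ ^ 2 * c.q₂ * c.p₀ + 8960 * c.p₂ * c.p₁ ^ 2 * c.q₂ - 39936 * c.p₂ * c.p₀ ^ 2 -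
      18944 * c.p₁ ^ 2 * c.p₀ + 5120 * c.q₂ ^ 3 + 110592 * c.q₂ * c.q₀ - 40704 * c.q₁ ^ 2
  | 8 => -48 * c.p₂ ^ 7 * c.p₁ - 192 * c.p₂ ^ 5 * c.q₁ + 768 * c.p₂ ^ 4 * c.p₁ * c.q₂ - 1536 *
      c.p₂ ^ 3 * c.p₁ * c.p₀ + 2688 * c.p₂ ^ 2 * c.p₁ ^ 3 + 13824 * c.p₂ ^ 2 * c.q₂ * c.q₁ + 16128
      * c.p₂ * c.p₁ * c.q₂ ^ 2 + 82944 * c.p₂ * c.p₁ * c.q₀ - 64512 * c.p₂ * c.p₀ * c.q₁ + 4608 *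
      c.p₁ ^ 2 * c.q₁ - 73728 * c.p₁ * c.q₂ * c.p₀
  | 7 => -48 * c.p₂ ^ 7 * c.q₂ + 608 * c.p₂ ^ 6 * c.p₀ - 32 * c.p₂ ^ 5 * c.p₁ ^ 2 - 480 * c.p₂ ^ 4
      * c.q₂ ^ 2 + 9600 * c.p₂ ^ 4 * c.q₀ - 6144 * c.p₂ ^ 3 * c.p₁ * c.q₁ + 10752 * c.p₂ ^ 3 *
      c.q₂ * c.p₀ + 5376 * c.p₂ ^ 2 * c.p₁ ^ 2 * c.q₂ - 20992 * c.p₂ ^ 2 * c.p₀ ^ 2 - 16384 * c.p₂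
      * c.p₁ ^ 2 * c.p₀ + 9984 * c.p₂ * c.q₂ ^ 3 + 156672 * c.p₂ * c.q₂ * c.q₀ - 38400 * c.p₂ *
      c.q₁ ^ 2 - 2560 * c.p₁ ^ 4 - 15360 * c.p₁ * c.q₂ * c.q₁ - 56832 * c.q₂ ^ 2 * c.p₀ - 165888 *
      c.p₀ * c.q₀
  | 6 => 384 * c.p₂ ^ 5 * c.p₁ * c.q₂ - 1792 * c.p₂ ^ 4 * c.p₁ * c.p₀ + 1024 * c.p₂ ^ 3 * c.p₁ ^ 3
      + 1536 * c.p₂ ^ 3 * c.q₂ * c.q₁ + 6912 * c.p₂ ^ 2 * c.p₁ * c.q₂ ^ 2 + 21504 * c.p₂ ^ 2 *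
      c.p₁ * c.q₀ - 19456 * c.p₂ ^ 2 * c.p₀ * c.q₁ + 10240 * c.p₂ * c.p₁ ^ 2 * c.q₁ - 57344 * c.p₂
      * c.p₁ * c.q₂ * c.p₀ - 10240 * c.p₁ ^ 3 * c.q₂ + 49152 * c.p₁ * c.p₀ ^ 2 - 21504 * c.q₂ ^ 2
      * c.q₁ - 110592 * c.q₁ * c.q₀
  | 5 => 64 * c.p₂ ^ 7 * c.p₀ - 16 * c.p₂ ^ 6 * c.p₁ ^ 2 + 192 * c.p₂ ^ 5 * c.q₂ ^ 2 + 2304 * c.p₂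
      ^ 5 * c.q₀ - 1344 * c.p₂ ^ 4 * c.p₁ * c.q₁ + 768 * c.p₂ ^ 3 * c.p₁ ^ 2 * c.q₂ - 3072 * c.p₂
      ^ 3 * c.p₀ ^ 2 - 4608 * c.p₂ ^ 2 * c.p₁ ^ 2 * c.p₀ + 4608 * c.p₂ ^ 2 * c.q₂ ^ 3 + 55296 *
      c.p₂ ^ 2 * c.q₂ * c.q₀ - 12288 * c.p₂ ^ 2 * c.q₁ ^ 2 - 1536 * c.p₂ * c.p₁ ^ 4 + 10752 * c.p₂
      * c.p₁ * c.q₂ * c.q₁ - 46080 * c.p₂ * c.q₂ ^ 2 * c.p₀ - 110592 * c.p₂ * c.p₀ * c.q₀ - 19200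
      * c.p₁ ^ 2 * c.q₂ ^ 2 + 27648 * c.p₁ ^ 2 * c.q₀ - 9216 * c.p₁ * c.p₀ * c.q₁ + 73728 * c.q₂ *
      c.p₀ ^ 2
  | 4 => -256 * c.p₂ ^ 5 * c.p₁ * c.p₀ + 64 * c.p₂ ^ 4 * c.p₁ ^ 3 - 768 * c.p₂ ^ 3 * c.p₁ * c.q₂ ^
      2 + 3072 * c.p₂ ^ 3 * c.p₁ * c.q₀ - 1024 * c.p₂ ^ 3 * c.p₀ * c.q₁ - 512 * c.p₂ ^ 2 * c.p₁ ^
      2 * c.q₁ - 8192 * c.p₂ ^ 2 * c.p₁ * c.q₂ * c.p₀ - 4096 * c.p₂ * c.p₁ ^ 3 * c.q₂ + 16384 *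
      c.p₂ * c.p₁ * c.p₀ ^ 2 - 3072 * c.p₂ * c.q₂ ^ 2 * c.q₁ - 36864 * c.p₂ * c.q₁ * c.q₀ + 8192 *
      c.p₁ ^ 3 * c.p₀ - 18432 * c.p₁ * c.q₂ ^ 3 + 73728 * c.p₁ * c.q₂ * c.q₀ - 39936 * c.p₁ * c.q₁
      ^ 2 + 24576 * c.q₂ * c.p₀ * c.q₁
  | 3 => 256 * c.p₂ ^ 6 * c.q₀ - 128 * c.p₂ ^ 5 * c.p₁ * c.q₁ - 256 * c.p₂ ^ 5 * c.q₂ * c.p₀ + 128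
      * c.p₂ ^ 4 * c.p₁ ^ 2 * c.q₂ + 256 * c.p₂ ^ 4 * c.p₀ ^ 2 - 1024 * c.p₂ ^ 3 * c.p₁ ^ 2 * c.p₀
      - 256 * c.p₂ ^ 3 * c.q₂ ^ 3 + 9216 * c.p₂ ^ 3 * c.q₂ * c.q₀ - 2560 * c.p₂ ^ 3 * c.q₁ ^ 2 +
      256 * c.p₂ ^ 2 * c.p₁ ^ 4 + 2048 * c.p₂ ^ 2 * c.p₁ * c.q₂ * c.q₁ - 7680 * c.p₂ ^ 2 * c.q₂ ^
      2 * c.p₀ - 18432 * c.p₂ ^ 2 * c.p₀ * c.q₀ - 2560 * c.p₂ * c.p₁ ^ 2 * c.q₂ ^ 2 - 6144 * c.p₂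
      * c.p₁ ^ 2 * c.q₀ - 14336 * c.p₂ * c.p₁ * c.p₀ * c.q₁ + 24576 * c.p₂ * c.q₂ * c.p₀ ^ 2 +
      15360 * c.p₁ ^ 3 * c.q₁ + 8192 * c.p₁ ^ 2 * c.q₂ * c.p₀ - 6912 * c.q₂ ^ 4 + 55296 * c.q₂ ^ 2
      * c.q₀ - 30720 * c.q₂ * c.q₁ ^ 2 - 16384 * c.p₀ ^ 3 - 110592 * c.q₀ ^ 2
  | 2 => 4096 * c.p₂ * c.p₁ ^ 3 * c.p₀ - 12288 * c.p₂ * c.p₁ * c.q₁ ^ 2 - 1024 * c.p₁ ^ 5 + 24576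
      * c.p₁ ^ 2 * c.q₂ * c.q₁
  | 1 => -256 * c.p₂ ^ 4 * c.q₁ ^ 2 + 512 * c.p₂ ^ 3 * c.p₁ * c.q₂ * c.q₁ - 256 * c.p₂ ^ 2 * c.p₁
      ^ 2 * c.q₂ ^ 2 - 3072 * c.p₂ ^ 2 * c.p₁ ^ 2 * c.q₀ - 1024 * c.p₂ ^ 2 * c.p₁ * c.p₀ * c.q₁ +
      2048 * c.p₂ * c.p₁ ^ 3 * c.q₁ + 4096 * c.p₂ * c.p₁ ^ 2 * c.q₂ * c.p₀ - 6144 * c.p₂ * c.q₂ *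
      c.q₁ ^ 2 - 2048 * c.p₁ ^ 4 * c.q₂ - 4096 * c.p₁ ^ 2 * c.p₀ ^ 2 + 9216 * c.p₁ * c.q₂ ^ 2 *
      c.q₁ - 36864 * c.p₁ * c.q₁ * c.q₀ + 12288 * c.p₀ * c.q₁ ^ 2
  | 0 => -1024 * c.p₂ ^ 2 * c.p₁ * c.q₁ ^ 2 + 2048 * c.p₂ * c.p₁ ^ 2 * c.q₂ * c.q₁ - 1024 * c.p₁ ^
      3 * c.q₂ ^ 2 + 4096 * c.p₁ ^ 3 * c.q₀ - 4096 * c.p₁ ^ 2 * c.p₀ * c.q₁ - 4096 * c.q₁ ^ 3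
  | _ => 0

/-- The value at `a` of the monic polynomial of degree 27 whose roots are the slopes of the 27 lines. -/
def lineValue (c : ShiodaCoeffs R) (a : R) : R := ∑ n ∈ Finset.range 28, c.lineCoeff n * a ^ n

set_option maxHeartbeats 2000000 in
set_option maxRecDepth 4000 in
-- This is the origin of the list `lineCoeff`: the resultant in `b` has leading coefficient -512 =
-- -2⁹ in `a`, a unit as soon as 2 is one.
theorem resultant_lineQuad_lineCub (c : ShiodaCoeffs R) (a : R) :
    resultant₂₃ (24 * a) (c.quad₁ a) (c.quad₀ a) 64 (c.cub₂ a) (c.cub₁ a) (c.cub₀ a) =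
      -512 * c.lineValue a := by
  rw [resultant₂₃, quad₁, quad₀, cub₂, cub₁, cub₀, eRest, dTwo, lineValue]
  simp only [Finset.sum_range_succ, Finset.sum_range_zero, lineCoeff]
  ring

theorem IsLine.lineValue_eq {c : ShiodaCoeffs R} {a b d e : R} (h : c.IsLine a b d e)
    (h2 : IsUnit (2 : R)) : c.lineValue a = 0 := by
  have h1 := resultant_lineQuad_lineCub c a
  rw [resultant₂₃_eq_zero h.lineQuad_eq h.lineCub_eq] at h1
  have h3 : IsUnit (-512 : R) := by
    have : (-512 : R) = -(2 ^ 9) := by norm_num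
    rw [this]
    exact (h2.pow 9).neg
  exact (h3.mul_right_eq_zero).1 h1.symm

/-- The monic polynomial of degree 27 whose roots are the slopes of the 27 lines. -/
noncomputable def linePoly (c : ShiodaCoeffs R) : Polynomial R :=
  ∑ n ∈ Finset.range 28, Polynomial.C (c.lineCoeff n) * Polynomial.X ^ n

set_option maxHeartbeats 2000000 in
theorem lineCoeff_map {R' : Type*} [CommRing R'] (φ : R →+* R') (c : ShiodaCoeffs R) (n : ℕ) :
    (c.map φ).lineCoeff n = φ (c.lineCoeff n) := by
  unfold lineCoeff
  split <;>
  simp only [map, map_add, map_sub, map_mul, map_pow, map_neg, map_ofNat, map_zero, map_one]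

theorem linePoly_map {R' : Type*} [CommRing R'] (φ : R →+* R') (c : ShiodaCoeffs R) :
    (c.map φ).linePoly = c.linePoly.map φ := by
  simp only [linePoly, lineCoeff_map, Polynomial.map_sum, Polynomial.map_mul, Polynomial.map_C,
    Polynomial.map_pow, Polynomial.map_X]

theorem linePoly_eval (c : ShiodaCoeffs R) (a : R) : c.linePoly.eval a = c.lineValue a := by
  simp [linePoly, lineValue, Polynomial.eval_finsetSum]

theorem linePoly_coeff (c : ShiodaCoeffs R) {n : ℕ} (hn : n < 28) :
    c.linePoly.coeff n = c.lineCoeff n := by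
  simp only [linePoly, Polynomial.finsetSum_coeff, Polynomial.coeff_C_mul_X_pow]
  rw [Finset.sum_ite_eq, if_pos (Finset.mem_range.2 hn)]

theorem linePoly_natDegree_le (c : ShiodaCoeffs R) : c.linePoly.natDegree ≤ 27 :=
  Polynomial.natDegree_sum_le_of_forall_le _ _ fun n hn =>
    (Polynomial.natDegree_C_mul_X_pow_le _ n).trans
      (Nat.lt_succ_iff.1 (Finset.mem_range.1 hn))

theorem linePoly_monic (c : ShiodaCoeffs R) : c.linePoly.Monic :=
  Polynomial.monic_of_natDegree_le_of_coeff_eq_one 27 c.linePoly_natDegree_le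
    (c.linePoly_coeff (n := 27) (by norm_num))

end LinePolynomial

end ShiodaCoeffs

/-! ### A tritangent plane and the explicit lines that meet it -/

namespace ShiodaCoeffs

section Pairs

variable {R : Type*} [CommRing R]

/-- The plane `Y = α X + β Z + γ W` meets the cubic surface with coefficients `c` in the three lines
with slopes `aᵢ` and offsets `bᵢ`. -/
structure IsPlane (c : ShiodaCoeffs R) (a₁ a₂ a₃ b₁ b₂ b₃ α β γ : R) : Prop where
  sum_slope : a₁ + a₂ + a₃ = 0
  sum_offset : α ^ 2 = b₁ + b₂ + b₃
  prod_slope : 2 * β = a₁ * a₂ * a₃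
  p₂ : c.p₂ = 2 * α + (a₁ * a₂ + a₁ * a₃ + a₂ * a₃)
  p₁ : c.p₁ = 2 * α * β + (a₁ * (b₂ + b₃) + a₂ * (b₁ + b₃) + a₃ * (b₁ + b₂))
  p₀ : c.p₀ = 2 * α * γ + (b₁ * b₂ + b₁ * b₃ + b₂ * b₃)
  q₂ : c.q₂ = β ^ 2 + 2 * γ - (a₁ * a₂ * b₃ + a₁ * a₃ * b₂ + a₂ * a₃ * b₁)
  q₁ : c.q₁ = 2 * β * γ - (a₁ * b₂ * b₃ + a₂ * b₁ * b₃ + a₃ * b₁ * b₂)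
  q₀ : c.q₀ = γ ^ 2 - b₁ * b₂ * b₃

namespace IsPlane

variable {c : ShiodaCoeffs R} {a₁ a₂ a₃ b₁ b₂ b₃ α β γ : R}

theorem swap₂₃ (h : c.IsPlane a₁ a₂ a₃ b₁ b₂ b₃ α β γ) : c.IsPlane a₁ a₃ a₂ b₁ b₃ b₂ α β γ where
  sum_slope := by linear_combination h.sum_slope
  sum_offset := by linear_combination h.sum_offset
  prod_slope := by linear_combination h.prod_slope
  p₂ := by linear_combination h.p₂
  p₁ := by linear_combination h.p₁
  p₀ := by linear_combination h.p₀
  q₂ := by linear_combination h.q₂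
  q₁ := by linear_combination h.q₁
  q₀ := by linear_combination h.q₀

theorem swap₁₃ (h : c.IsPlane a₁ a₂ a₃ b₁ b₂ b₃ α β γ) : c.IsPlane a₃ a₂ a₁ b₃ b₂ b₁ α β γ where
  sum_slope := by linear_combination h.sum_slope
  sum_offset := by linear_combination h.sum_offset
  prod_slope := by linear_combination h.prod_slope
  p₂ := by linear_combination h.p₂
  p₁ := by linear_combination h.p₁
  p₀ := by linear_combination h.p₀
  q₂ := by linear_combination h.q₂
  q₁ := by linear_combination h.q₁
  q₀ := by linear_combination h.q₀

/-- Put ℓ = αX + βZ + γW and Lᵢ = X - aᵢZ - bᵢW. The relations in `IsPlane` are the comparison of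
coefficients in F = L₁L₂L₃ - (Y - ℓ)(2Z² + W(Y + ℓ)) for the cubic form F, so F vanishes where L₃ =
Y - ℓ = 0. -/
theorem isLine₃ (h : c.IsPlane a₁ a₂ a₃ b₁ b₂ b₃ α β γ) :
    c.IsLine a₃ b₃ (α * a₃ + β) (α * b₃ + γ) where
  eq₃ := by rw [h.p₂]; linear_combination h.prod_slope - a₃ ^ 2 * h.sum_slope
  eq₂ := by
    rw [h.p₂, h.p₁, h.q₂]
    linear_combination a₃ ^ 2 * h.sum_offset - 2 * a₃ * b₃ * h.sum_slope
  eq₁ := by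
    rw [h.p₁, h.p₀, h.q₁]
    linear_combination 2 * a₃ * b₃ * h.sum_offset - b₃ ^ 2 * h.sum_slope
  eq₀ := by rw [h.p₀, h.q₀]; linear_combination b₃ ^ 2 * h.sum_offset

/-- A line that meets the third line of the plane. -/
theorem isLine (h : c.IsPlane a₁ a₂ a₃ b₁ b₂ b₃ α β γ) {a b : R} (κ : R)
    (h₀ : 2 * κ = (a - a₁) * (a - a₂))
    (h₁ : κ * (2 * α * a + 2 * β + κ * (a - a₃)) = (a - a₁) * (b - b₂) + (a - a₂) * (b - b₁))
    (h₂ : κ * (2 * α * b + 2 * γ + κ * (b - b₃)) = (b - b₁) * (b - b₂)) :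
    c.IsLine a b (α * a + β + κ * (a - a₃)) (α * b + γ + κ * (b - b₃)) where
  -- On the new line Y - ℓ = κL₃, so a factor L₃ splits off from F. The rest, L₁L₂ = κ(2Z² + W(Y +
  -- ℓ)), has the coefficients `h₀`, `h₁`, `h₂` at Z², ZW, W².
  eq₃ := by
    rw [h.p₂]
    linear_combination h.prod_slope - a ^ 2 * h.sum_slope + (a - a₃) * h₀
  eq₂ := by
    rw [h.p₂, h.p₁, h.q₂]
    linear_combination a ^ 2 * h.sum_offset - 2 * a * b * h.sum_slope + (a - a₃) * h₁ +
      (b - b₃) * h₀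
  eq₁ := by
    rw [h.p₁, h.p₀, h.q₁]
    linear_combination 2 * a * b * h.sum_offset - b ^ 2 * h.sum_slope + (a - a₃) * h₂ +
      (b - b₃) * h₁
  eq₀ := by
    rw [h.p₀, h.q₀]
    linear_combination b ^ 2 * h.sum_offset + (b - b₃) * h₂

end IsPlane

/-- The scaled coefficient `6² α`. -/
def planeX (θ B D : R) : R :=
  -81 - 9 * D - 9 * B - 189 * θ + 81 * θ ^ 2

/-- The scaled coefficient `6⁶ γ`. -/
def planeC (θ B D : R) : R :=
  177147 - 19683 * D - 2187 * D ^ 2 + 243 * D ^ 3 - 19683 * B + 39366 * B * D - 243 * B * D ^ 2 -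
    2187 * B ^ 2 - 243 * B ^ 2 * D + 243 * B ^ 3 + 1003833 * θ + 39366 * θ * D - 5103 * θ * D ^ 2
    + 39366 * θ * B + 91854 * θ * B * D - 5103 * θ * B ^ 2 + 1810836 * θ ^ 2 + 142155 * θ ^ 2 * D
    - 9477 * θ ^ 2 * D ^ 2 - 94041 * θ ^ 2 * B + 16038 * θ ^ 2 * B * D - 9477 * θ ^ 2 * B ^ 2 +
    164025 * θ ^ 3 + 21870 * θ ^ 3 * D - 371790 * θ ^ 3 * B - 1522152 * θ ^ 4 + 111537 * θ ^ 4 * D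
    - 124659 * θ ^ 4 * B + 216513 * θ ^ 5 + 333153 * θ ^ 6

/-- The scaled offset `6⁴ b` of the line `c₁₂`. -/
def off₁₂ (θ B D : R) : R :=
  2187 - 486 * D + 27 * D ^ 2 - 486 * B + 270 * B * D + 27 * B ^ 2 + 16038 * θ - 1134 * θ * D -
    1134 * θ * B + 22113 * θ ^ 2 - 1134 * θ ^ 2 * D - 1134 * θ ^ 2 * B + 2430 * θ ^ 3 - 2349 * θ ^
    4

/-- The scaled offset `6⁴ b` of the line `c₃₄`. -/
def off₃₄ (θ B D : R) : R :=
  2187 - 486 * D + 27 * D ^ 2 + 2430 * B - 54 * B * D + 27 * B ^ 2 + 7290 * θ - 162 * θ * D + 4698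
    * θ * B + 4617 * θ ^ 2 - 1134 * θ ^ 2 * D + 1782 * θ ^ 2 * B - 6318 * θ ^ 3 - 2349 * θ ^ 4

/-- The scaled offset `6⁴ b` of the line `c₅₆`. -/
def off₅₆ (θ B D : R) : R :=
  2187 + 2430 * D + 27 * D ^ 2 - 486 * B - 54 * B * D + 27 * B ^ 2 + 7290 * θ + 4698 * θ * D - 162
    * θ * B - 4131 * θ ^ 2 + 810 * θ ^ 2 * D - 2106 * θ ^ 2 * B - 26730 * θ ^ 3 + 11259 * θ ^ 4

/-- The scaled offset `6⁴ b` of the lines of the same type as `a₁`. -/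
def offA₁ (σ r m : R) : R :=
  2187 - 486 * m ^ 2 + 27 * m ^ 4 - 486 * r ^ 2 - 54 * r ^ 2 * m ^ 2 + 27 * r ^ 4 + 26244 * σ -
    2916 * σ * m ^ 2 - 2916 * σ * r ^ 2 + 48114 * σ ^ 2 - 6318 * σ ^ 2 * m ^ 2 + 2430 * σ ^ 2 * r
    ^ 2 + 157464 * σ ^ 3 - 2916 * σ ^ 3 * m ^ 2 - 11664 * σ ^ 3 * r ^ 2 + 94041 * σ ^ 4 - 10206 *
    σ ^ 4 * m ^ 2 + 16038 * σ ^ 4 * r ^ 2 + 131220 * σ ^ 5 - 118098 * σ ^ 6 - 183708 * σ ^ 7 -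
    190269 * σ ^ 8

/-- The scaled offset `6⁴ b` of the lines of the same type as `a₃`. -/
def offA₃ (θ r m : R) : R :=
  2187 - 486 * m ^ 2 + 27 * m ^ 4 + 8748 * r - 972 * r * m ^ 2 + 5346 * r ^ 2 - 54 * r ^ 2 * m ^ 2
    + 972 * r ^ 3 + 27 * r ^ 4 - 1458 * θ - 2106 * θ * m ^ 2 + 11664 * θ * r - 324 * θ * r * m ^ 2
    + 6642 * θ * r ^ 2 + 648 * θ * r ^ 3 - 7047 * θ ^ 2 - 1134 * θ ^ 2 * m ^ 2 - 972 * θ ^ 2 * r +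
    1782 * θ ^ 2 * r ^ 2 - 4374 * θ ^ 3 - 2268 * θ ^ 3 * r - 2349 * θ ^ 4

/-- The scaled offset `6⁴ b` of the lines of the same type as `a₅`. -/
def offA₅ (θ r m : R) : R :=
  2187 + 8748 * m + 5346 * m ^ 2 + 972 * m ^ 3 + 27 * m ^ 4 - 486 * r ^ 2 - 972 * r ^ 2 * m - 54 *
    r ^ 2 * m ^ 2 + 27 * r ^ 4 + 24786 * θ + 46656 * θ * m + 18306 * θ * m ^ 2 + 1620 * θ * m ^ 3
    - 2106 * θ * r ^ 2 - 1296 * θ * r ^ 2 * m + 80433 * θ ^ 2 + 86508 * θ ^ 2 * m + 15390 * θ ^ 2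
    * m ^ 2 - 2106 * θ ^ 2 * r ^ 2 + 97686 * θ ^ 3 + 50220 * θ ^ 3 * m + 43335 * θ ^ 4

/-- The scaled offset `6⁴ b` of the lines of the same type as `b₁`. -/
def offB₁ (σ r m : R) : R :=
  2187 - 486 * m ^ 2 + 27 * m ^ 4 - 486 * r ^ 2 - 54 * r ^ 2 * m ^ 2 + 27 * r ^ 4 - 26244 * σ +
    2916 * σ * m ^ 2 + 2916 * σ * r ^ 2 + 100602 * σ ^ 2 - 486 * σ ^ 2 * m ^ 2 - 9234 * σ ^ 2 * r
    ^ 2 - 367416 * σ ^ 3 + 14580 * σ ^ 3 * m ^ 2 + 5832 * σ ^ 3 * r ^ 2 + 776385 * σ ^ 4 + 7290 *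
    σ ^ 4 * m ^ 2 - 18954 * σ ^ 4 * r ^ 2 - 1443420 * σ ^ 5 + 1823958 * σ ^ 6 - 1600884 * σ ^ 7 +
    911979 * σ ^ 8

/-- The scaled offset `6⁴ b` of the lines of the same type as `b₃`. -/
def offB₃ (θ r m : R) : R :=
  2187 - 486 * m ^ 2 + 27 * m ^ 4 - 8748 * r + 972 * r * m ^ 2 + 5346 * r ^ 2 - 54 * r ^ 2 * m ^ 2
    - 972 * r ^ 3 + 27 * r ^ 4 + 16038 * θ - 162 * θ * m ^ 2 - 34992 * θ * r + 1620 * θ * r * m ^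
    2 + 14418 * θ * r ^ 2 - 1296 * θ * r ^ 3 + 33777 * θ ^ 2 + 810 * θ ^ 2 * m ^ 2 - 47628 * θ ^ 2
    * r + 9558 * θ ^ 2 * r ^ 2 + 32562 * θ ^ 3 - 19764 * θ ^ 3 * r + 11259 * θ ^ 4

/-- The scaled offset `6⁴ b` of the lines of the same type as `b₅`. -/
def offB₅ (θ r m : R) : R :=
  2187 - 8748 * m + 5346 * m ^ 2 - 972 * m ^ 3 + 27 * m ^ 4 - 486 * r ^ 2 + 972 * r ^ 2 * m - 54 *
    r ^ 2 * m ^ 2 + 27 * r ^ 4 - 10206 * θ + 2754 * θ * m ^ 2 - 324 * θ * m ^ 3 - 162 * θ * r ^ 2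
    + 648 * θ * r ^ 2 * m - 18711 * θ ^ 2 + 4860 * θ ^ 2 * m - 162 * θ ^ 2 * m ^ 2 - 162 * θ ^ 2 *
    r ^ 2 - 5346 * θ ^ 3 - 2268 * θ ^ 3 * m + 4455 * θ ^ 4

/-- The scaled offset `6⁴ b` of the lines of the same type as `c₁₃`. -/
def off₁₃ (σ r m : R) : R :=
  2187 - 486 * m ^ 2 + 27 * m ^ 4 - 486 * r ^ 2 - 54 * r ^ 2 * m ^ 2 + 27 * r ^ 4 - 8748 * σ * r -
    972 * σ * r * m ^ 2 + 972 * σ * r ^ 3 + 21870 * σ ^ 2 - 3402 * σ ^ 2 * m ^ 2 + 8748 * σ ^ 2 *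
    r + 972 * σ ^ 2 * r * m ^ 2 + 2430 * σ ^ 2 * r ^ 2 - 1944 * σ ^ 2 * r ^ 3 + 26244 * σ ^ 3 +
    2916 * σ ^ 3 * m ^ 2 - 43740 * σ ^ 3 * r - 23328 * σ ^ 3 * r ^ 2 + 41553 * σ ^ 4 - 10206 * σ ^
    4 * m ^ 2 - 17496 * σ ^ 4 * r + 16038 * σ ^ 4 * r ^ 2 + 104976 * σ ^ 5 + 78732 * σ ^ 5 * r +
    65610 * σ ^ 6 + 61236 * σ ^ 6 * r + 183708 * σ ^ 7 - 190269 * σ ^ 8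

/-- The scaled offset `6⁴ b` of the lines of the same type as `c₁₅`. -/
def off₁₅ (σ r m : R) : R :=
  2187 - 486 * m ^ 2 + 27 * m ^ 4 - 486 * r ^ 2 - 54 * r ^ 2 * m ^ 2 + 27 * r ^ 4 - 8748 * σ * m +
    972 * σ * m ^ 3 - 972 * σ * r ^ 2 * m + 21870 * σ ^ 2 + 8748 * σ ^ 2 * m + 2430 * σ ^ 2 * m ^
    2 + 972 * σ ^ 2 * m ^ 3 - 3402 * σ ^ 2 * r ^ 2 - 1944 * σ ^ 2 * r ^ 2 * m - 52488 * σ ^ 3 -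
    43740 * σ ^ 3 * m + 11664 * σ ^ 3 * m ^ 2 + 2916 * σ ^ 3 * r ^ 2 + 120285 * σ ^ 4 + 87480 * σ
    ^ 4 * m - 1458 * σ ^ 4 * m ^ 2 - 1458 * σ ^ 4 * r ^ 2 - 288684 * σ ^ 5 - 78732 * σ ^ 5 * m +
    380538 * σ ^ 6 + 61236 * σ ^ 6 * m - 524880 * σ ^ 7 + 360855 * σ ^ 8

/-- The scaled offset `6⁴ b` of the lines of the same type as `c₃₅`. -/
def off₃₅ (θ r m : R) : R :=
  2187 - 486 * m ^ 2 + 27 * m ^ 4 - 2916 * r * m + 324 * r * m ^ 3 - 486 * r ^ 2 + 594 * r ^ 2 * m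
    ^ 2 + 324 * r ^ 3 * m + 27 * r ^ 4 + 7290 * θ + 2916 * θ * m - 1134 * θ * m ^ 2 + 324 * θ * m
    ^ 3 - 5832 * θ * r - 6804 * θ * r * m + 1296 * θ * r * m ^ 2 - 1134 * θ * r ^ 2 + 1296 * θ * r
    ^ 2 * m + 324 * θ * r ^ 3 + 13365 * θ ^ 2 + 3888 * θ ^ 2 * m - 162 * θ ^ 2 * m ^ 2 - 10692 * θ
    ^ 2 * r - 2916 * θ ^ 2 * r * m - 162 * θ ^ 2 * r ^ 2 + 14094 * θ ^ 3 + 2268 * θ ^ 3 * m - 6480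
    * θ ^ 3 * r + 4455 * θ ^ 4

/-- The coefficients of a cubic surface that meets the plane `Y = α X + β Z + γ W` in the three given
lines. -/
def ofPlane (a₁ a₂ a₃ b₁ b₂ b₃ α β γ : R) : ShiodaCoeffs R where
  p₂ := 2 * α + (a₁ * a₂ + a₁ * a₃ + a₂ * a₃)
  p₁ := 2 * α * β + (a₁ * (b₂ + b₃) + a₂ * (b₁ + b₃) + a₃ * (b₁ + b₂))
  p₀ := 2 * α * γ + (b₁ * b₂ + b₁ * b₃ + b₂ * b₃)
  q₂ := β ^ 2 + 2 * γ - (a₁ * a₂ * b₃ + a₁ * a₃ * b₂ + a₂ * a₃ * b₁)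
  q₁ := 2 * β * γ - (a₁ * b₂ * b₃ + a₂ * b₁ * b₃ + a₃ * b₁ * b₂)
  q₀ := γ ^ 2 - b₁ * b₂ * b₃

/-- Shioda's coefficients of the points `1 ± s`, `1 ± r`, `1 + t ± m` for `s² = t = 3 θ`, `r² = B`,
`m² = D`, where the coefficient of weight `w` is multiplied by `6 ^ w`. -/
def intCoeffs (θ B D : R) : ShiodaCoeffs R :=
  ofPlane (6 * (-2 * θ)) (6 * (-2 * θ)) (6 * (4 * θ)) (off₁₂ θ B D) (off₃₄ θ B D) (off₅₆ θ B D)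
    (planeX θ B D) (1728 * θ ^ 3) (planeC θ B D)

/-- Six of the relations hold by the definition of `ofPlane`. Only the three that do not involve the
coefficients of the surface constrain the data of the plane. -/
theorem isPlane_intCoeffs (θ B D : R) :
    (intCoeffs θ B D).IsPlane (6 * (-2 * θ)) (6 * (-2 * θ)) (6 * (4 * θ)) (off₁₂ θ B D)
      (off₃₄ θ B D) (off₅₆ θ B D) (planeX θ B D) (1728 * θ ^ 3) (planeC θ B D) where
  sum_slope := by ring
  sum_offset := by rw [planeX, off₁₂, off₃₄, off₅₆]; ring
  prod_slope := by ring
  p₂ := rfl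
  p₁ := rfl
  p₀ := rfl
  q₂ := rfl
  q₁ := rfl
  q₀ := rfl

set_option maxHeartbeats 1000000 in
-- In the classical notation for the 27 lines, aᵢ and bᵢ meet cᵢⱼ. So types 1, 3, 5 are constructed
-- from c₁₂, c₃₄, c₅₆, and the swap of the plane moves that line to the third place.
theorem exists_isLine_a1 (σ r m : R) :
    ∃ d e, (intCoeffs (3 * σ ^ 2) (r ^ 2) (m ^ 2)).IsLine (6 * (-3 - 2 * (3 * σ ^ 2) - 3 * σ)) (offA₁ σ r m) d e := by
  have hP := isPlane_intCoeffs (3 * σ ^ 2) (r ^ 2) (m ^ 2)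
  -- The factor κ is forced: it is half the product of the differences between the slope and the
  -- slopes of the two other lines in the plane. The same holds for the other types.
  refine ⟨_, _, hP.swap₁₃.isLine (18 * (-3 - 3 * σ) * (-3 - 3 * σ - 18 * σ ^ 2)) ?_ ?_ ?_⟩
  · ring
  · simp only [offA₁, off₅₆, off₃₄, planeX]
    ring
  · simp only [offA₁, off₁₂, off₃₄, off₅₆, planeX, planeC]
    ring

set_option maxHeartbeats 1000000 in
theorem exists_isLine_a3 (θ r m : R) :
    ∃ d e, (intCoeffs θ (r ^ 2) (m ^ 2)).IsLine (6 * (-3 - 2 * θ - r)) (offA₃ θ r m) d e := by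
  have hP := isPlane_intCoeffs θ (r ^ 2) (m ^ 2)
  refine ⟨_, _, hP.swap₂₃.isLine (18 * (-3 - r) * (-3 - r - 6 * θ)) ?_ ?_ ?_⟩
  · ring
  · simp only [offA₃, off₁₂, off₅₆, planeX]
    ring
  · simp only [offA₃, off₁₂, off₃₄, off₅₆, planeX, planeC]
    ring

set_option maxHeartbeats 1000000 in
theorem exists_isLine_a5 (θ r m : R) :
    ∃ d e, (intCoeffs θ (r ^ 2) (m ^ 2)).IsLine (6 * (-3 - 5 * θ - m)) (offA₅ θ r m) d e := by
  have hP := isPlane_intCoeffs θ (r ^ 2) (m ^ 2)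
  refine ⟨_, _, hP.isLine (18 * (-3 - m - 3 * θ) * (-3 - m - 3 * θ)) ?_ ?_ ?_⟩
  · ring
  · simp only [offA₅, off₁₂, off₃₄, planeX]
    ring
  · simp only [offA₅, off₁₂, off₃₄, off₅₆, planeX, planeC]
    ring

set_option maxHeartbeats 1000000 in
theorem exists_isLine_b1 (σ r m : R) :
    ∃ d e, (intCoeffs (3 * σ ^ 2) (r ^ 2) (m ^ 2)).IsLine (6 * (3 + 4 * (3 * σ ^ 2) - 3 * σ)) (offB₁ σ r m) d e := by
  have hP := isPlane_intCoeffs (3 * σ ^ 2) (r ^ 2) (m ^ 2)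
  refine ⟨_, _, hP.swap₁₃.isLine (18 * (3 - 3 * σ + 18 * σ ^ 2) * (3 - 3 * σ)) ?_ ?_ ?_⟩
  · ring
  · simp only [offB₁, off₅₆, off₃₄, planeX]
    ring
  · simp only [offB₁, off₁₂, off₃₄, off₅₆, planeX, planeC]
    ring

set_option maxHeartbeats 1000000 in
theorem exists_isLine_b3 (θ r m : R) :
    ∃ d e, (intCoeffs θ (r ^ 2) (m ^ 2)).IsLine (6 * (3 + 4 * θ - r)) (offB₃ θ r m) d e := by
  have hP := isPlane_intCoeffs θ (r ^ 2) (m ^ 2)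
  refine ⟨_, _, hP.swap₂₃.isLine (18 * (3 - r + 6 * θ) * (3 - r)) ?_ ?_ ?_⟩
  · ring
  · simp only [offB₃, off₁₂, off₅₆, planeX]
    ring
  · simp only [offB₃, off₁₂, off₃₄, off₅₆, planeX, planeC]
    ring

set_option maxHeartbeats 1000000 in
theorem exists_isLine_b5 (θ r m : R) :
    ∃ d e, (intCoeffs θ (r ^ 2) (m ^ 2)).IsLine (6 * (3 + θ - m)) (offB₅ θ r m) d e := by
  have hP := isPlane_intCoeffs θ (r ^ 2) (m ^ 2)
  refine ⟨_, _, hP.isLine (18 * (3 - m + 3 * θ) * (3 - m + 3 * θ)) ?_ ?_ ?_⟩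
  · ring
  · simp only [offB₅, off₁₂, off₃₄, planeX]
    ring
  · simp only [offB₅, off₁₂, off₃₄, off₅₆, planeX, planeC]
    ring

set_option maxHeartbeats 1000000 in
-- Lines cᵢⱼ and cₖₗ meet when the index pairs are disjoint: c₁₃ meets c₅₆, c₁₅ meets c₃₄ and c₃₅
-- meets c₁₂.
theorem exists_isLine_c13 (σ r m : R) :
    ∃ d e, (intCoeffs (3 * σ ^ 2) (r ^ 2) (m ^ 2)).IsLine (6 * (-2 * (3 * σ ^ 2) + 3 * σ + r)) (off₁₃ σ r m) d e := by
  have hP := isPlane_intCoeffs (3 * σ ^ 2) (r ^ 2) (m ^ 2)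
  refine ⟨_, _, hP.isLine (18 * (r + 3 * σ) * (r + 3 * σ)) ?_ ?_ ?_⟩
  · ring
  · simp only [off₁₃, off₁₂, off₃₄, planeX]
    ring
  · simp only [off₁₃, off₁₂, off₃₄, off₅₆, planeX, planeC]
    ring

set_option maxHeartbeats 1000000 in
theorem exists_isLine_c15 (σ r m : R) :
    ∃ d e, (intCoeffs (3 * σ ^ 2) (r ^ 2) (m ^ 2)).IsLine (6 * ((3 * σ ^ 2) + 3 * σ + m)) (off₁₅ σ r m) d e := by
  have hP := isPlane_intCoeffs (3 * σ ^ 2) (r ^ 2) (m ^ 2)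
  refine ⟨_, _, hP.swap₂₃.isLine (18 * (m + 3 * σ + 9 * σ ^ 2) * (m + 3 * σ - 9 * σ ^ 2)) ?_ ?_ ?_⟩
  · ring
  · simp only [off₁₅, off₁₂, off₅₆, planeX]
    ring
  · simp only [off₁₅, off₁₂, off₃₄, off₅₆, planeX, planeC]
    ring

set_option maxHeartbeats 1000000 in
theorem exists_isLine_c35 (θ r m : R) :
    ∃ d e, (intCoeffs θ (r ^ 2) (m ^ 2)).IsLine (6 * (θ + r + m)) (off₃₅ θ r m) d e := by
  have hP := isPlane_intCoeffs θ (r ^ 2) (m ^ 2)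
  refine ⟨_, _, hP.swap₁₃.isLine (18 * (m + r + 3 * θ) * (m + r - 3 * θ)) ?_ ?_ ?_⟩
  · ring
  · simp only [off₃₅, off₅₆, off₃₄, planeX]
    ring
  · simp only [off₃₅, off₁₂, off₃₄, off₅₆, planeX, planeC]
    ring

end Pairs

end ShiodaCoeffs

/-! ### The table of the 27 lines -/

namespace ShiodaCoeffs

section Table

variable {R : Type*} [CommRing R]

/-- The constant term in the slopes of the 27 lines. -/
def slopeOne : Fin 27 → ℤ :=
  ![-3, -3, -3, -3, -3, -3, 3, 3, 3, 3, 3, 3, 0, 0, 0, 0, 0, 0, 0, 0, 0, 0, 0, 0, 0, 0, 0]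

/-- The coefficient of `θ` in the slopes of the 27 lines. -/
def slopeθ : Fin 27 → ℤ :=
  ![-2, -2, -2, -2, -5, -5, 4, 4, 4, 4, 1, 1, -2, -2, -2, 1, 1, -2, -2, 1, 1, -2, 1, 1, 1, 1, 4]

/-- The coefficient of `s = 3 σ` in the slopes of the 27 lines. -/
def slopeS : Fin 27 → ℤ :=
  ![-1, 1, 0, 0, 0, 0, -1, 1, 0, 0, 0, 0, 0, 1, 1, 1, 1, -1, -1, -1, -1, 0, 0, 0, 0, 0, 0]

/-- The coefficient of `r` in the slopes of the 27 lines. -/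
def slopeR : Fin 27 → ℤ :=
  ![0, 0, -1, 1, 0, 0, 0, 0, -1, 1, 0, 0, 0, 1, -1, 0, 0, 1, -1, 0, 0, 0, 1, 1, -1, -1, 0]

/-- The coefficient of `m` in the slopes of the 27 lines. -/
def slopeM : Fin 27 → ℤ :=
  ![0, 0, 0, 0, -1, 1, 0, 0, 0, 0, -1, 1, 0, 0, 0, 1, -1, 0, 0, 1, -1, 0, 1, -1, 1, -1, 0]

/-- The slopes of the 27 lines, in the order of `ShiodaCoeffs.roots`. -/
def lineSlope (σ r m : R) (i : Fin 27) : R :=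
  slopeOne i + slopeθ i * (3 * σ ^ 2) + slopeS i * (3 * σ) + slopeR i * r + slopeM i * m

/-- The offsets of the 27 lines, scaled by `6 ^ 4`. -/
def lineOffset (σ r m : R) : Fin 27 → R :=
  ![offA₁ σ r m, offA₁ (-σ) r m, offA₃ (3 * σ ^ 2) r m, offA₃ (3 * σ ^ 2) (-r) m, offA₅ (3 * σ ^
    2) r m, offA₅ (3 * σ ^ 2) r (-m), offB₁ σ r m, offB₁ (-σ) r m, offB₃ (3 * σ ^ 2) r m, offB₃ (3
    * σ ^ 2) (-r) m, offB₅ (3 * σ ^ 2) r m, offB₅ (3 * σ ^ 2) r (-m), off₁₂ (3 * σ ^ 2) (r ^ 2) (m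
    ^ 2), off₁₃ σ r m, off₁₃ σ (-r) m, off₁₅ σ r m, off₁₅ σ r (-m), off₁₃ (-σ) r m, off₁₃ (-σ)
    (-r) m, off₁₅ (-σ) r m, off₁₅ (-σ) r (-m), off₃₄ (3 * σ ^ 2) (r ^ 2) (m ^ 2), off₃₅ (3 * σ ^
    2) r m, off₃₅ (3 * σ ^ 2) r (-m), off₃₅ (3 * σ ^ 2) (-r) m, off₃₅ (3 * σ ^ 2) (-r) (-m), off₅₆
    (3 * σ ^ 2) (r ^ 2) (m ^ 2)]

theorem isLine_of_eq {c c' : ShiodaCoeffs R} {a a' b : R} (h : ∃ d e, c.IsLine a b d e)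
    (hc : c' = c) (ha : a' = a) : ∃ d e, c'.IsLine a' b d e := by
  rwa [hc, ha]

/-- Sign changes of `σ`, `r`, `m` leave the surface unchanged and exchange the parameters within the
pairs, so one line of each type yields the others; c₁₂, c₃₄, c₅₆ come from the plane itself. -/
theorem exists_isLine_lineSlope (σ r m : R) (i : Fin 27) : ∃ d e,
    (intCoeffs (3 * σ ^ 2) (r ^ 2) (m ^ 2)).IsLine (6 * lineSlope σ r m i) (lineOffset σ r m i) d e := by
  fin_cases i
  · exact isLine_of_eq (exists_isLine_a1 (σ) r m)
      (by ring_nf) (by simp [lineSlope, slopeOne, slopeθ, slopeS, slopeR, slopeM]; try ring)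
  · exact isLine_of_eq (exists_isLine_a1 (-σ) r m)
      (by ring_nf) (by simp [lineSlope, slopeOne, slopeθ, slopeS, slopeR, slopeM]; try ring)
  · exact isLine_of_eq (exists_isLine_a3 (3 * σ ^ 2) (r) m)
      (by ring_nf) (by simp [lineSlope, slopeOne, slopeθ, slopeS, slopeR, slopeM]; try ring)
  · exact isLine_of_eq (exists_isLine_a3 (3 * σ ^ 2) (-r) m)
      (by ring_nf) (by simp [lineSlope, slopeOne, slopeθ, slopeS, slopeR, slopeM]; try ring)
  · exact isLine_of_eq (exists_isLine_a5 (3 * σ ^ 2) r (m))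
      (by ring_nf) (by simp [lineSlope, slopeOne, slopeθ, slopeS, slopeR, slopeM]; try ring)
  · exact isLine_of_eq (exists_isLine_a5 (3 * σ ^ 2) r (-m))
      (by ring_nf) (by simp [lineSlope, slopeOne, slopeθ, slopeS, slopeR, slopeM]; try ring)
  · exact isLine_of_eq (exists_isLine_b1 (σ) r m)
      (by ring_nf) (by simp [lineSlope, slopeOne, slopeθ, slopeS, slopeR, slopeM]; try ring)
  · exact isLine_of_eq (exists_isLine_b1 (-σ) r m)
      (by ring_nf) (by simp [lineSlope, slopeOne, slopeθ, slopeS, slopeR, slopeM]; try ring)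
  · exact isLine_of_eq (exists_isLine_b3 (3 * σ ^ 2) (r) m)
      (by ring_nf) (by simp [lineSlope, slopeOne, slopeθ, slopeS, slopeR, slopeM]; try ring)
  · exact isLine_of_eq (exists_isLine_b3 (3 * σ ^ 2) (-r) m)
      (by ring_nf) (by simp [lineSlope, slopeOne, slopeθ, slopeS, slopeR, slopeM]; try ring)
  · exact isLine_of_eq (exists_isLine_b5 (3 * σ ^ 2) r (m))
      (by ring_nf) (by simp [lineSlope, slopeOne, slopeθ, slopeS, slopeR, slopeM]; try ring)
  · exact isLine_of_eq (exists_isLine_b5 (3 * σ ^ 2) r (-m))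
      (by ring_nf) (by simp [lineSlope, slopeOne, slopeθ, slopeS, slopeR, slopeM]; try ring)
  · exact isLine_of_eq (⟨_, _, (isPlane_intCoeffs _ _ _).swap₁₃.isLine₃⟩)
      (by ring_nf) (by simp [lineSlope, slopeOne, slopeθ, slopeS, slopeR, slopeM]; try ring)
  · exact isLine_of_eq (exists_isLine_c13 σ r m)
      (by ring_nf) (by simp [lineSlope, slopeOne, slopeθ, slopeS, slopeR, slopeM]; try ring)
  · exact isLine_of_eq (exists_isLine_c13 σ (-r) m)
      (by ring_nf) (by simp [lineSlope, slopeOne, slopeθ, slopeS, slopeR, slopeM]; try ring)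
  · exact isLine_of_eq (exists_isLine_c15 σ r m)
      (by ring_nf) (by simp [lineSlope, slopeOne, slopeθ, slopeS, slopeR, slopeM]; try ring)
  · exact isLine_of_eq (exists_isLine_c15 σ r (-m))
      (by ring_nf) (by simp [lineSlope, slopeOne, slopeθ, slopeS, slopeR, slopeM]; try ring)
  · exact isLine_of_eq (exists_isLine_c13 (-σ) r m)
      (by ring_nf) (by simp [lineSlope, slopeOne, slopeθ, slopeS, slopeR, slopeM]; try ring)
  · exact isLine_of_eq (exists_isLine_c13 (-σ) (-r) m)
      (by ring_nf) (by simp [lineSlope, slopeOne, slopeθ, slopeS, slopeR, slopeM]; try ring)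
  · exact isLine_of_eq (exists_isLine_c15 (-σ) r m)
      (by ring_nf) (by simp [lineSlope, slopeOne, slopeθ, slopeS, slopeR, slopeM]; try ring)
  · exact isLine_of_eq (exists_isLine_c15 (-σ) r (-m))
      (by ring_nf) (by simp [lineSlope, slopeOne, slopeθ, slopeS, slopeR, slopeM]; try ring)
  · exact isLine_of_eq (⟨_, _, (isPlane_intCoeffs _ _ _).swap₂₃.isLine₃⟩)
      (by ring_nf) (by simp [lineSlope, slopeOne, slopeθ, slopeS, slopeR, slopeM]; try ring)
  · exact isLine_of_eq (exists_isLine_c35 (3 * σ ^ 2) r m)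
      (by ring_nf) (by simp [lineSlope, slopeOne, slopeθ, slopeS, slopeR, slopeM]; try ring)
  · exact isLine_of_eq (exists_isLine_c35 (3 * σ ^ 2) r (-m))
      (by ring_nf) (by simp [lineSlope, slopeOne, slopeθ, slopeS, slopeR, slopeM]; try ring)
  · exact isLine_of_eq (exists_isLine_c35 (3 * σ ^ 2) (-r) m)
      (by ring_nf) (by simp [lineSlope, slopeOne, slopeθ, slopeS, slopeR, slopeM]; try ring)
  · exact isLine_of_eq (exists_isLine_c35 (3 * σ ^ 2) (-r) (-m))
      (by ring_nf) (by simp [lineSlope, slopeOne, slopeθ, slopeS, slopeR, slopeM]; try ring)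
  · exact isLine_of_eq (⟨_, _, (isPlane_intCoeffs _ _ _).isLine₃⟩)
      (by ring_nf) (by simp [lineSlope, slopeOne, slopeθ, slopeS, slopeR, slopeM]; try ring)

end Table

end ShiodaCoeffs

/-! ### Weights and pseudo-remainders -/

namespace ShiodaCoeffs

section Scaling

variable {R : Type*} [CommRing R]

/-- Multiplication of the coefficients of weight `w` by `h ^ w`. -/
def scale (h : R) (c : ShiodaCoeffs R) : ShiodaCoeffs R :=
  ⟨h ^ 8 * c.p₀, h ^ 5 * c.p₁, h ^ 2 * c.p₂, h ^ 12 * c.q₀, h ^ 9 * c.q₁, h ^ 6 * c.q₂⟩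

/-- With weights 1, 4, 3, 6 for a, b, d, e, the four equations are homogeneous of weights 3, 6, 9,
12. -/
theorem IsLine.scale {c : ShiodaCoeffs R} {a b d e : R} (H : c.IsLine a b d e) (h : R) :
    (c.scale h).IsLine (h * a) (h ^ 4 * b) (h ^ 3 * d) (h ^ 6 * e) where
  eq₃ := by simp only [ShiodaCoeffs.scale]; linear_combination h ^ 3 * H.eq₃
  eq₂ := by simp only [ShiodaCoeffs.scale]; linear_combination h ^ 6 * H.eq₂
  eq₁ := by simp only [ShiodaCoeffs.scale]; linear_combination h ^ 9 * H.eq₁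
  eq₀ := by simp only [ShiodaCoeffs.scale]; linear_combination h ^ 12 * H.eq₀

/-- Shioda's coefficients of the points `1 ± s`, `1 ± r`, `1 + t ± m` for `s² = t = 3 θ`, `r² = B`,
`m² = D` and `h = 1 / 6`. -/
def pairCoeffs (h θ B D : R) : ShiodaCoeffs R := (intCoeffs θ B D).scale h

theorem pairCoeffs_map {R' : Type*} [CommRing R'] (φ : R →+* R') (h θ B D : R) :
    (pairCoeffs h θ B D).map φ = pairCoeffs (φ h) (φ θ) (φ B) (φ D) := by
  simp only [pairCoeffs, ShiodaCoeffs.scale, map, intCoeffs, ofPlane, planeX, planeC, off₁₂, off₃₄,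
    off₅₆, map_add, map_sub, map_mul, map_pow, map_neg, map_ofNat]

/-- The linear coefficient of the pseudo-remainder of `lineCub` by `lineQuad`. -/
def rem₁ (c : ShiodaCoeffs R) (a : R) : R :=
  (24 * a) ^ 2 * c.cub₁ a - 24 * a * 64 * c.quad₀ a - (24 * a * c.cub₂ a - 64 * c.quad₁ a) * c.quad₁ a

/-- The constant coefficient of the pseudo-remainder of `lineCub` by `lineQuad`. -/
def rem₀ (c : ShiodaCoeffs R) (a : R) : R :=
  (24 * a) ^ 2 * c.cub₀ a - (24 * a * c.cub₂ a - 64 * c.quad₁ a) * c.quad₀ a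

/-- A common root `b` of the cubic and the quadratic is a root of the linear pseudo-remainder. -/
theorem IsLine.rem_eq {c : ShiodaCoeffs R} {a b d e : R} (H : c.IsLine a b d e) :
    c.rem₁ a * b + c.rem₀ a = 0 := by
  have h₂ := H.lineQuad_eq
  have h₃ := H.lineCub_eq
  rw [lineQuad] at h₂
  rw [lineCub] at h₃
  rw [rem₁, rem₀]
  linear_combination (24 * a) ^ 2 * h₃ -
    (24 * a * 64 * b + (24 * a * c.cub₂ a - 64 * c.quad₁ a)) * h₂

/-- The right-hand side is quadratic in the two coefficients of the pseudo-remainder, so a common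
zero of these coefficients is a double zero of the left-hand side. -/
theorem lineValue_eq_rem (c : ShiodaCoeffs R) (a : R) :
    (24 * a) ^ 2 * (-512 * c.lineValue a) = 24 * a * c.rem₀ a ^ 2 -
      c.quad₁ a * c.rem₀ a * c.rem₁ a + c.quad₀ a * c.rem₁ a ^ 2 := by
  rw [← resultant_lineQuad_lineCub, sq_mul_resultant₂₃, rem₁, rem₀]

theorem rem_map {R' : Type*} [CommRing R'] (φ : R →+* R') (c : ShiodaCoeffs R) (a : R) :
    (c.map φ).rem₁ (φ a) = φ (c.rem₁ a) ∧ (c.map φ).rem₀ (φ a) = φ (c.rem₀ a) := by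
  constructor <;>
  simp only [rem₁, rem₀, quad₁, quad₀, cub₂, cub₁, cub₀, eRest, dTwo, map, map_add, map_sub, map_mul,
    map_pow, map_neg, map_ofNat]

theorem lineValue_map_C (c : ShiodaCoeffs R) :
    (c.map Polynomial.C).lineValue Polynomial.X = c.linePoly := by
  simp only [lineValue, lineCoeff_map, linePoly]

end Scaling

/-! ### Multiple roots of the slope polynomial -/

section DoubleRoots

variable {K : Type*} [Field K]

theorem derivative_eval_eq_zero_of_sq_dvd {f : Polynomial K} {a : K}
    (h : (Polynomial.X - Polynomial.C a) ^ 2 ∣ f) : f.derivative.eval a = 0 := by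
  obtain ⟨g, rfl⟩ := h
  simp [Polynomial.derivative_mul, Polynomial.derivative_pow]

/-- If the first equation for the offset divides the second one, then the slope is a double root. -/
theorem sq_dvd_linePoly {c : ShiodaCoeffs K} {a : K} (h2 : (2 : K) ≠ 0) (h3 : (3 : K) ≠ 0)
    (ha : a ≠ 0) (h₁ : c.rem₁ a = 0) (h₀ : c.rem₀ a = 0) :
    (Polynomial.X - Polynomial.C a) ^ 2 ∣ c.linePoly := by
  -- The identity is used with the indeterminate as slope, so that divisibility by (X - a)² can be
  -- read off.
  have key := lineValue_eq_rem (c.map Polynomial.C) Polynomial.X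
  rw [lineValue_map_C] at key
  have hr := rem_map (Polynomial.evalRingHom a) (c.map Polynomial.C) Polynomial.X
  have hc : (c.map Polynomial.C).map (Polynomial.evalRingHom a) = c := by simp [map]
  rw [hc] at hr
  simp only [Polynomial.coe_evalRingHom, Polynomial.eval_X, h₁, h₀] at hr
  obtain ⟨g₁, hg₁⟩ := Polynomial.dvd_iff_isRoot.2 hr.1.symm
  obtain ⟨g₀, hg₀⟩ := Polynomial.dvd_iff_isRoot.2 hr.2.symm
  have hdvd : (Polynomial.X - Polynomial.C a) ^ 2 ∣
      Polynomial.C (24 ^ 2 * -512) * (Polynomial.X ^ 2 * c.linePoly) := by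
    refine ⟨24 * Polynomial.X * g₀ ^ 2 - (c.map Polynomial.C).quad₁ Polynomial.X * g₀ * g₁ +
      (c.map Polynomial.C).quad₀ Polynomial.X * g₁ ^ 2, ?_⟩
    have : Polynomial.C (24 ^ 2 * -512 : K) = 24 ^ 2 * -512 := by
      simp only [map_mul, map_pow, map_neg, map_ofNat]
    rw [this]
    rw [hg₁, hg₀] at key
    linear_combination key
  have hne : (24 ^ 2 * -512 : K) ≠ 0 := by
    have : (24 ^ 2 * -512 : K) = -(2 ^ 15 * 3 ^ 2) := by norm_num
    rw [this]
    exact neg_ne_zero.2 (mul_ne_zero (pow_ne_zero _ h2) (pow_ne_zero _ h3))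
  rw [(Polynomial.isUnit_C.2 hne.isUnit).dvd_mul_left] at hdvd
  -- The factor X² from the pseudo-division is prime to X - a because `a` is nonzero.
  refine IsCoprime.dvd_of_dvd_mul_left (IsCoprime.pow ?_) hdvd
  have := Polynomial.isCoprime_X_sub_C_of_isUnit_sub (R := K) (a := a) (b := 0) (by simpa using ha)
  simpa using this

/-- A first order deformation of a line that changes the slope shows that the slope is a double
root. -/
theorem derivative_linePoly_eval_eq_zero {c : ShiodaCoeffs K} {a a' : K} {b d e : DualNumber K}
    (h2 : (2 : K) ≠ 0) (ha' : a' ≠ 0)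
    (H : (c.map (algebraMap K (DualNumber K))).IsLine
      (algebraMap K _ a + algebraMap K _ a' * DualNumber.eps) b d e) :
    c.linePoly.derivative.eval a = 0 := by
  have hu : IsUnit (2 : DualNumber K) := by
    have := (h2.isUnit).map (algebraMap K (DualNumber K))
    rwa [map_ofNat] at this
  have h := H.lineValue_eq hu
  -- Over the dual numbers P(a + a'ε) = P(a) + P'(a)a'ε; the coefficient of ε gives P'(a) = 0.
  rw [← linePoly_eval, linePoly_map, Polynomial.eval_map, ← Polynomial.aeval_def,
    Polynomial.aeval_add_of_sq_eq_zero] at h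
  · have h' := congrArg TrivSqZeroExt.snd h
    rw [Polynomial.aeval_algebraMap_apply, Polynomial.aeval_algebraMap_apply, ← mul_assoc,
      ← map_mul] at h'
    simpa [TrivSqZeroExt.algebraMap_eq_inl, ha'] using h'
  · rw [mul_pow, pow_two DualNumber.eps, DualNumber.eps_mul_eps, mul_zero]

end DoubleRoots

end ShiodaCoeffs

/-! ### General position: there are exactly 27 lines -/

namespace ShiodaCoeffs

section GeneralPosition

variable {K : Type*} [Field K]

/-- The coefficients over a field with the parameters `σ = s / 3`, `r`, `m`. -/
def fieldCoeffs (σ r m : K) : ShiodaCoeffs K := pairCoeffs 6⁻¹ (3 * σ ^ 2) (r ^ 2) (m ^ 2)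

/-- The offsets of the 27 lines. -/
def fieldOffset (σ r m : K) (i : Fin 27) : K := 6⁻¹ ^ 4 * lineOffset σ r m i

/-- The parameters are in general position: the only coincidence between the slopes of the 27 lines
is the one of `c₁₂` and `c₃₄` (the indices 12 and 21), and these two lines are distinct. -/
structure GenPos (σ r m : K) : Prop where
  two_ne : (2 : K) ≠ 0
  three_ne : (3 : K) ≠ 0
  slope_inj : ∀ i j, lineSlope σ r m i = lineSlope σ r m j →
    i = j ∨ (i = 12 ∧ j = 21) ∨ (i = 21 ∧ j = 12)
  slope_ne : ∀ i, lineSlope σ r m i ≠ 0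
  offset_ne : fieldOffset σ r m 12 ≠ fieldOffset σ r m 21

theorem lineSlope_twelve (σ r m : K) : lineSlope σ r m 12 = -2 * (3 * σ ^ 2) := by
  simp [lineSlope, slopeOne, slopeθ, slopeS, slopeR, slopeM]

theorem lineSlope_twentyOne (σ r m : K) : lineSlope σ r m 21 = -2 * (3 * σ ^ 2) := by
  simp [lineSlope, slopeOne, slopeθ, slopeS, slopeR, slopeM]

namespace GenPos

variable {σ r m : K}

theorem six_ne (H : GenPos σ r m) : (6 : K) ≠ 0 := by
  have : (6 : K) = 2 * 3 := by norm_num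
  rw [this]
  exact mul_ne_zero H.two_ne H.three_ne

theorem exists_isLine (H : GenPos σ r m) (i : Fin 27) : ∃ d e,
    (fieldCoeffs σ r m).IsLine (lineSlope σ r m i) (fieldOffset σ r m i) d e := by
  obtain ⟨d, e, h⟩ := exists_isLine_lineSlope σ r m i
  have h' := h.scale (6⁻¹ : K)
  rw [inv_mul_cancel_left₀ H.six_ne] at h'
  exact ⟨_, _, h'⟩

/-- A linear polynomial in `b` with two distinct roots is zero. -/
theorem rem_eq_zero {a b b' d e d' e' : K} (h : (fieldCoeffs σ r m).IsLine a b d e)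
    (h' : (fieldCoeffs σ r m).IsLine a b' d' e') (hb : b ≠ b') :
    (fieldCoeffs σ r m).rem₁ a = 0 ∧ (fieldCoeffs σ r m).rem₀ a = 0 := by
  have h₁ := h.rem_eq
  have h₂ := h'.rem_eq
  have h₃ : (fieldCoeffs σ r m).rem₁ a = 0 := by
    have : (fieldCoeffs σ r m).rem₁ a * (b - b') = 0 := by linear_combination h₁ - h₂
    exact (mul_eq_zero.1 this).resolve_right (sub_ne_zero.2 hb)
  refine ⟨h₃, ?_⟩
  rwa [h₃, zero_mul, zero_add] at h₁

/-- Both sides are monic and the degrees are at most 2 + 25, so divisibility suffices. The factors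
are pairwise coprime; the square divides since c₁₂ and c₃₄ have the same slope and different
offsets. -/
theorem linePoly_eq_sq_mul (H : GenPos σ r m) : (fieldCoeffs σ r m).linePoly =
    (Polynomial.X - Polynomial.C (lineSlope σ r m 12)) ^ 2 *
      ∏ i ∈ (Finset.univ.erase 12).erase 21, (Polynomial.X - Polynomial.C (lineSlope σ r m i)) := by
  have hmon : ((Polynomial.X - Polynomial.C (lineSlope σ r m 12)) ^ 2 *
      ∏ i ∈ (Finset.univ.erase 12).erase 21,
        (Polynomial.X - Polynomial.C (lineSlope σ r m i))).Monic :=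
    ((Polynomial.monic_X_sub_C _).pow 2).mul
      (Polynomial.monic_prod_of_monic _ _ fun i _ => Polynomial.monic_X_sub_C _)
  refine Polynomial.eq_of_monic_of_dvd_of_natDegree_le hmon (linePoly_monic _) ?_ ?_
  · have hcop : ∀ i j, i ≠ j → ¬(i = 12 ∧ j = 21) → ¬(i = 21 ∧ j = 12) →
        IsCoprime (Polynomial.X - Polynomial.C (lineSlope σ r m i))
          (Polynomial.X - Polynomial.C (lineSlope σ r m j)) := by
      intro i j h1 h2 h3
      refine Polynomial.isCoprime_X_sub_C_of_isUnit_sub (sub_ne_zero.2 fun h => ?_).isUnit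
      rcases H.slope_inj i j h with h | h | h
      exacts [h1 h, h2 h, h3 h]
    refine IsCoprime.mul_dvd (IsCoprime.pow_left (IsCoprime.prod_right fun i hi => ?_)) ?_
      (Finset.prod_dvd_of_coprime (fun i hi j hj hij => ?_) fun i _ => ?_)
    · simp only [Finset.mem_erase, Finset.mem_univ, and_true] at hi
      exact hcop _ _ (Ne.symm hi.2) (fun h => hi.1 h.2) (by simp)
    · obtain ⟨d, e, h⟩ := H.exists_isLine 12
      obtain ⟨d', e', h'⟩ := H.exists_isLine 21
      rw [lineSlope_twentyOne, ← lineSlope_twelve σ r m] at h'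
      obtain ⟨h₁, h₀⟩ := rem_eq_zero h h' H.offset_ne
      exact sq_dvd_linePoly H.two_ne H.three_ne (H.slope_ne 12) h₁ h₀
    · simp only [Finset.coe_erase, Finset.coe_univ, Set.mem_sdiff, Set.mem_univ,
        Set.mem_singleton_iff, true_and] at hi hj
      exact hcop _ _ hij (fun h => hi.1 h.1) (fun h => hi.2 h.1)
    · rw [Polynomial.dvd_iff_isRoot, Polynomial.IsRoot, linePoly_eval]
      obtain ⟨d, e, h⟩ := H.exists_isLine i
      exact h.lineValue_eq H.two_ne.isUnit
  · refine (linePoly_natDegree_le _).trans ?_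
    rw [((Polynomial.monic_X_sub_C _).pow 2).natDegree_mul
      (Polynomial.monic_prod_of_monic _ _ fun i _ => Polynomial.monic_X_sub_C _),
      (Polynomial.monic_X_sub_C _).natDegree_pow,
      Polynomial.natDegree_prod_of_monic _ _ fun i _ => Polynomial.monic_X_sub_C _]
    simp

theorem linePoly_eq_prod (H : GenPos σ r m) : (fieldCoeffs σ r m).linePoly =
    ∏ i, (Polynomial.X - Polynomial.C (lineSlope σ r m i)) := by
  rw [H.linePoly_eq_sq_mul, ← Finset.mul_prod_erase Finset.univ _ (Finset.mem_univ 12),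
    ← Finset.mul_prod_erase (Finset.univ.erase 12) _ (a := 21) (by simp), ← mul_assoc, pow_two,
    lineSlope_twentyOne, lineSlope_twelve]

theorem exists_slope_eq (H : GenPos σ r m) {a b d e : K} (h : (fieldCoeffs σ r m).IsLine a b d e) :
    ∃ i, a = lineSlope σ r m i := by
  have h1 := h.lineValue_eq H.two_ne.isUnit
  rw [← linePoly_eval, H.linePoly_eq_prod, Polynomial.eval_prod, Finset.prod_eq_zero_iff] at h1
  obtain ⟨i, -, hi⟩ := h1
  exact ⟨i, by simpa [sub_eq_zero] using hi⟩

/-- The only multiple root of `linePoly` is the common slope of `c₁₂` and `c₃₄`. -/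
theorem eq_of_derivative_eval_eq_zero (H : GenPos σ r m) {i : Fin 27}
    (h : (fieldCoeffs σ r m).linePoly.derivative.eval (lineSlope σ r m i) = 0) :
    i = 12 ∨ i = 21 := by
  by_contra! hi
  rw [H.linePoly_eq_prod, ← Finset.mul_prod_erase Finset.univ _ (Finset.mem_univ i)] at h
  simp only [Polynomial.derivative_mul, Polynomial.derivative_sub, Polynomial.derivative_X,
    Polynomial.derivative_C, sub_zero, one_mul, Polynomial.eval_add, Polynomial.eval_mul,
    Polynomial.eval_sub, Polynomial.eval_X, Polynomial.eval_C, sub_self, zero_mul, add_zero,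
    Polynomial.eval_prod, Finset.prod_eq_zero_iff, Finset.mem_erase, Finset.mem_univ, and_true] at h
  obtain ⟨j, hj, hij⟩ := h
  rcases H.slope_inj i j (sub_eq_zero.1 hij) with h | h | h
  exacts [hj h.symm, hi.1 h.1, hi.2 h.1]

/-- The slope and the offset of any line are the ones of a line in the list. -/
theorem exists_eq (H : GenPos σ r m) {a b d e : K} (h : (fieldCoeffs σ r m).IsLine a b d e) :
    ∃ i, a = lineSlope σ r m i ∧ b = fieldOffset σ r m i := by
  obtain ⟨i, rfl⟩ := H.exists_slope_eq h
  obtain ⟨d', e', h'⟩ := H.exists_isLine i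
  by_cases hb : b = fieldOffset σ r m i
  · exact ⟨i, rfl, hb⟩
  -- Two offsets over one slope force a double root, so the slope is the one of c₁₂ and c₃₄.
  obtain ⟨h₁, h₀⟩ := rem_eq_zero h h' hb
  have hsq := sq_dvd_linePoly H.two_ne H.three_ne (H.slope_ne i) h₁ h₀
  have hi := H.eq_of_derivative_eval_eq_zero (derivative_eval_eq_zero_of_sq_dvd hsq)
  have hs : lineSlope σ r m i = lineSlope σ r m 12 := by
    rcases hi with rfl | rfl
    · rfl
    · rw [lineSlope_twelve, lineSlope_twentyOne]
  have hs' : lineSlope σ r m i = lineSlope σ r m 21 := by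
    rw [hs, lineSlope_twelve, lineSlope_twentyOne]
  obtain ⟨_, _, l₁⟩ := H.exists_isLine 12
  obtain ⟨_, _, l₂⟩ := H.exists_isLine 21
  rw [← hs] at l₁
  rw [← hs'] at l₂
  have e₀ := h.lineQuad_eq
  have e₁ := l₁.lineQuad_eq
  have e₂ := l₂.lineQuad_eq
  rw [lineQuad] at e₀ e₁ e₂
  -- Otherwise the quadratic equation for the offset, with leading coefficient 24a ≠ 0, would have
  -- three distinct roots.
  by_contra! hc
  have n₁ := sub_ne_zero.2 (hc 12 hs)
  have n₂ := sub_ne_zero.2 (hc 21 hs')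
  have n₃ := sub_ne_zero.2 H.offset_ne
  have f₁ : 24 * lineSlope σ r m i * (b + fieldOffset σ r m 12) +
      (fieldCoeffs σ r m).quad₁ (lineSlope σ r m i) = 0 :=
    (mul_eq_zero.1 (by linear_combination e₀ - e₁ :
      (b - fieldOffset σ r m 12) * (24 * lineSlope σ r m i * (b + fieldOffset σ r m 12) +
      (fieldCoeffs σ r m).quad₁ (lineSlope σ r m i)) = 0)).resolve_left n₁
  have f₂ : 24 * lineSlope σ r m i * (b + fieldOffset σ r m 21) +
      (fieldCoeffs σ r m).quad₁ (lineSlope σ r m i) = 0 :=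
    (mul_eq_zero.1 (by linear_combination e₀ - e₂ :
      (b - fieldOffset σ r m 21) * (24 * lineSlope σ r m i * (b + fieldOffset σ r m 21) +
      (fieldCoeffs σ r m).quad₁ (lineSlope σ r m i)) = 0)).resolve_left n₂
  have h24 : (24 : K) ≠ 0 := by
    have : (24 : K) = 2 ^ 3 * 3 := by norm_num
    rw [this]
    exact mul_ne_zero (pow_ne_zero _ H.two_ne) H.three_ne
  exact mul_ne_zero (mul_ne_zero h24 (H.slope_ne i)) n₃ (by linear_combination f₁ - f₂)

end GenPos

/-- The elementary symmetric functions of the slopes. -/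
theorem ofPoints_eq {σ r m : K} (H : GenPos σ r m) (h5 : (5 : K) ≠ 0) (h7 : (7 : K) ≠ 0)
    {u : Fin 6 → K} (hu : roots u = Finset.univ.val.map (lineSlope σ r m)) :
    ofPoints u = fieldCoeffs σ r m := by
  have hcard : Multiset.card (roots u) = 27 := by rw [hu]; simp
  have hprod : (fieldCoeffs σ r m).linePoly =
      ((roots u).map fun a => Polynomial.X - Polynomial.C a).prod := by
    rw [H.linePoly_eq_prod, hu, Multiset.map_map]; rfl
  -- Vieta: the coefficient of X^(27 - n) is (-1)ⁿ times the `n`-th elementary symmetric function.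
  have hesymm : ∀ n ≤ 27, (roots u).esymm n = (-1) ^ n * (fieldCoeffs σ r m).lineCoeff (27 - n) := by
    intro n hn
    have h1 := Multiset.prod_X_sub_C_coeff (roots u) (k := 27 - n) (by omega)
    rw [← hprod, linePoly_coeff _ (by omega), hcard, show 27 - (27 - n) = n by omega] at h1
    rw [h1, ← mul_assoc, ← mul_pow]
    simp
  set c := fieldCoeffs σ r m with hc
  have e2 : (roots u).esymm 2 = 12 * c.p₂ := by rw [hesymm 2 (by norm_num)]; simp [lineCoeff]
  have e5 : (roots u).esymm 5 = 48 * c.p₁ := by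
    rw [hesymm 5 (by norm_num)]; simp [lineCoeff]; ring
  have e6 : (roots u).esymm 6 = 168 * c.p₂ ^ 3 + 96 * c.q₂ := by
    rw [hesymm 6 (by norm_num)]; simp [lineCoeff]; ring
  have e8 : (roots u).esymm 8 = 294 * c.p₂ ^ 4 + 528 * c.p₂ * c.q₂ + 480 * c.p₀ := by
    rw [hesymm 8 (by norm_num)]; simp [lineCoeff]; ring
  have e9 : (roots u).esymm 9 = 1008 * c.p₁ * c.p₂ ^ 2 + 1344 * c.q₁ := by
    rw [hesymm 9 (by norm_num)]; simp [lineCoeff]; ring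
  have e12 : (roots u).esymm 12 = 252 * c.p₂ ^ 6 + 1200 * c.p₂ ^ 3 * c.q₂ +
      4768 * c.p₂ ^ 2 * c.p₀ + 608 * c.p₂ * c.p₁ ^ 2 - 1248 * c.q₂ ^ 2 + 17280 * c.q₀ := by
    rw [hesymm 12 (by norm_num)]; simp [lineCoeff]; ring
  have n12 : (12 : K) ≠ 0 := by
    rw [show (12 : K) = 2 ^ 2 * 3 by norm_num]
    exact mul_ne_zero (pow_ne_zero _ H.two_ne) H.three_ne
  have n48 : (48 : K) ≠ 0 := by
    rw [show (48 : K) = 2 ^ 4 * 3 by norm_num]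
    exact mul_ne_zero (pow_ne_zero _ H.two_ne) H.three_ne
  have n96 : (96 : K) ≠ 0 := by
    rw [show (96 : K) = 2 ^ 5 * 3 by norm_num]
    exact mul_ne_zero (pow_ne_zero _ H.two_ne) H.three_ne
  have n480 : (480 : K) ≠ 0 := by
    rw [show (480 : K) = 2 ^ 5 * 3 * 5 by norm_num]
    exact mul_ne_zero (mul_ne_zero (pow_ne_zero _ H.two_ne) H.three_ne) h5
  have n1344 : (1344 : K) ≠ 0 := by
    rw [show (1344 : K) = 2 ^ 6 * 3 * 7 by norm_num]
    exact mul_ne_zero (mul_ne_zero (pow_ne_zero _ H.two_ne) H.three_ne) h7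
  have n17280 : (17280 : K) ≠ 0 := by
    rw [show (17280 : K) = 2 ^ 7 * 3 ^ 3 * 5 by norm_num]
    exact mul_ne_zero (mul_ne_zero (pow_ne_zero _ H.two_ne) (pow_ne_zero _ H.three_ne)) h5
  have p2 : (roots u).esymm 2 / 12 = c.p₂ := by rw [e2, mul_div_cancel_left₀ _ n12]
  have p1 : (roots u).esymm 5 / 48 = c.p₁ := by rw [e5, mul_div_cancel_left₀ _ n48]
  have q2 : ((roots u).esymm 6 - 168 * c.p₂ ^ 3) / 96 = c.q₂ := by
    rw [e6, div_eq_iff n96]; ring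
  have p0 : ((roots u).esymm 8 - 294 * c.p₂ ^ 4 - 528 * c.p₂ * c.q₂) / 480 = c.p₀ := by
    rw [e8, div_eq_iff n480]; ring
  have q1 : ((roots u).esymm 9 - 1008 * c.p₁ * c.p₂ ^ 2) / 1344 = c.q₁ := by
    rw [e9, div_eq_iff n1344]; ring
  have q0 : ((roots u).esymm 12 - 608 * c.p₁ ^ 2 * c.p₂ - 4768 * c.p₀ * c.p₂ ^ 2 - 252 * c.p₂ ^ 6
      - 1200 * c.p₂ ^ 3 * c.q₂ + 1248 * c.q₂ ^ 2) / 17280 = c.q₀ := by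
    rw [e12, div_eq_iff n17280]; ring
  simp only [ofPoints, p2, p1, q2, p0, q1, q0]

/-- Here c₁/3 = -2 - 2t/3. The parametrization s = 3σ turns t/3 into 3σ², which makes all entries of
the slope table integral. -/
theorem roots_eq {s r m t : K} (h3 : (3 : K) ≠ 0) (ht : s ^ 2 = t) :
    roots ![1 + s, 1 - s, 1 + r, 1 - r, 1 + t + m, 1 + t - m] =
      Finset.univ.val.map (lineSlope (s / 3) r m) := by
  obtain ⟨σ, rfl⟩ : ∃ σ, s = 3 * σ := ⟨s / 3, by field_simp⟩
  rw [mul_div_cancel_left₀ _ h3]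
  subst ht
  set u : Fin 6 → K := ![1 + 3 * σ, 1 - 3 * σ, 1 + r, 1 - r, 1 + (3 * σ) ^ 2 + m,
    1 + (3 * σ) ^ 2 - m] with hu
  have hc : -∑ i, u i = 3 * (-2 - 6 * σ ^ 2) := by
    simp [hu, Fin.sum_univ_succ]
    ring
  have hc₁ : (-∑ i, u i) / 3 = -2 - 6 * σ ^ 2 := by rw [hc, mul_div_cancel_left₀ _ h3]
  have hc₂ : -2 * (-∑ i, u i) / 3 = 4 + 12 * σ ^ 2 := by rw [hc, div_eq_iff h3]; ring
  have h1 : (Finset.univ.filter fun x : Fin 6 × Fin 6 => x.1 < x.2).val =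
      {(0, 1), (0, 2), (0, 3), (0, 4), (0, 5), (1, 2), (1, 3), (1, 4), (1, 5), (2, 3), (2, 4),
        (2, 5), (3, 4), (3, 5), (4, 5)} := by decide
  have h6 : (Finset.univ : Finset (Fin 6)).val = {0, 1, 2, 3, 4, 5} := by decide
  have h27 : (Finset.univ : Finset (Fin 27)).val = {0, 1, 2, 3, 4, 5, 6, 7, 8, 9, 10, 11, 12, 13,
    14, 15, 16, 17, 18, 19, 20, 21, 22, 23, 24, 25, 26} := by decide
  simp only [roots, hc₁, hc₂, h1, h6, h27, Multiset.insert_eq_cons, Multiset.map_cons,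
    Multiset.map_singleton, Multiset.cons_add, Multiset.singleton_add]
  simp only [← Multiset.cons_zero]
  have hcons : ∀ {a b : K} {M N : Multiset K}, a = b → M = N → a ::ₘ M = b ::ₘ N := by
    rintro a _ M _ rfl rfl
    rfl
  -- The table follows the order of `roots`, so the two multisets agree entry by entry.
  iterate 27
    refine hcons
      (by simp [hu, lineSlope, slopeOne, slopeθ, slopeS, slopeR, slopeM]; try ring) ?_
  rfl

end GeneralPosition

end ShiodaCoeffs

/-! ### The Jacobian criterion over the algebraic closure -/

section NonsingularForms

/-- The hypersurface `f = 0` in projective space has no singular rational point. -/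
def IsNonsingular {K : Type*} [Field K] {n : ℕ} (f : MvPolynomial (Fin n) K) : Prop :=
  ∀ v : Fin n → K, v ≠ 0 → eval v f = 0 → ∃ i, eval v (pderiv i f) ≠ 0

theorem isSmoothForm_of_isNonsingular {F : Type*} [Field F] {n d : ℕ} {f : MvPolynomial (Fin n) F}
    (hf : f.IsHomogeneous d)
    (h : IsNonsingular (map (algebraMap F (AlgebraicClosure F)) f)) : IsSmoothForm d f := by
  refine ⟨hf, fun v hv h0 => ?_⟩
  obtain ⟨i, hi⟩ := h v hv (by rwa [eval_map, ← aeval_def])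
  refine ⟨i, ?_⟩
  rwa [pderiv_map, eval_map, ← aeval_def] at hi

end NonsingularForms

/-! ### The forms of the construction and their derivatives -/

namespace ShiodaCoeffs

section Forms

variable {R : Type*} [CommRing R] (c : ShiodaCoeffs R)

theorem map_f₀ {R' : Type*} [CommRing R'] (φ : R →+* R') : (c.map φ).f₀ = MvPolynomial.map φ c.f₀ := by
  simp [f₀, map]

theorem map_f₁ {R' : Type*} [CommRing R'] (φ : R →+* R') : (c.map φ).f₁ = MvPolynomial.map φ c.f₁ := by
  simp [f₁, map]

theorem map_f₂ {R' : Type*} [CommRing R'] (φ : R →+* R') : (c.map φ).f₂ = MvPolynomial.map φ c.f₂ := by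
  simp [f₂, map]

theorem map_quartic {R' : Type*} [CommRing R'] (φ : R →+* R') :
    (c.map φ).quartic = MvPolynomial.map φ c.quartic := by
  simp [quartic, map_f₀, map_f₁, map_f₂]

theorem map_cubic {R' : Type*} [CommRing R'] (φ : R →+* R') :
    (c.map φ).cubic = MvPolynomial.map φ c.cubic := by
  simp [cubic, map_f₀, map_f₁, map_f₂, map_rename]

theorem cubic_eq : c.cubic = (C c.p₂ * X 0 - 2 * X 1 + C c.q₂ * X 3) * X 2 ^ 2 +
    (C c.p₁ * X 0 * X 3 + C c.q₁ * X 3 ^ 2) * X 2 +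
    (X 0 ^ 3 + C c.p₀ * X 0 * X 3 ^ 2 + C c.q₀ * X 3 ^ 3 - X 1 ^ 2 * X 3) := by
  have h2 : rename ![0, 1, 3] (2 : MvPolynomial (Fin 3) R) = (2 : MvPolynomial (Fin 4) R) :=
    map_ofNat _ 2
  simp [cubic, f₀, f₁, f₂, h2]

theorem isHomogeneous_f₀ : c.f₀.IsHomogeneous 1 := by
  have h2 : (2 : MvPolynomial (Fin 3) R) = C 2 := (map_ofNat C 2).symm
  rw [f₀, h2]
  exact (((isHomogeneous_C_mul_X _ _).sub (isHomogeneous_C_mul_X _ _)).add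
    (isHomogeneous_C_mul_X _ _))

theorem isHomogeneous_f₁ : c.f₁.IsHomogeneous 2 :=
  ((isHomogeneous_C_mul_X _ _).mul (isHomogeneous_X _ _)).add
    (isHomogeneous_C_mul_X_pow _ _ _)

theorem isHomogeneous_f₂ : c.f₂.IsHomogeneous 3 :=
  (((isHomogeneous_X_pow _ _).add
    ((isHomogeneous_C_mul_X _ _).mul (isHomogeneous_X_pow _ _))).add
    (isHomogeneous_C_mul_X_pow _ _ _)).sub ((isHomogeneous_X_pow _ _).mul (isHomogeneous_X _ _))

theorem isHomogeneous_quartic : c.quartic.IsHomogeneous 4 := by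
  have h4 : (4 : MvPolynomial (Fin 3) R) = C 4 := (map_ofNat C 4).symm
  rw [quartic, h4]
  exact ((c.isHomogeneous_f₁.pow 2).sub
    (((isHomogeneous_C _ _).mul c.isHomogeneous_f₀).mul c.isHomogeneous_f₂))

theorem isHomogeneous_cubic : c.cubic.IsHomogeneous 3 :=
  ((c.isHomogeneous_f₀.rename_isHomogeneous.mul (isHomogeneous_X_pow _ _)).add
    (c.isHomogeneous_f₁.rename_isHomogeneous.mul (isHomogeneous_X _ _))).add
    c.isHomogeneous_f₂.rename_isHomogeneous

theorem eval_f₀ (v : Fin 3 → R) : eval v c.f₀ = c.p₂ * v 0 - 2 * v 1 + c.q₂ * v 2 := by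
  simp [f₀]

theorem eval_f₁ (v : Fin 3 → R) : eval v c.f₁ = c.p₁ * v 0 * v 2 + c.q₁ * v 2 ^ 2 := by
  simp [f₁]

theorem eval_f₂ (v : Fin 3 → R) :
    eval v c.f₂ = v 0 ^ 3 + c.p₀ * v 0 * v 2 ^ 2 + c.q₀ * v 2 ^ 3 - v 1 ^ 2 * v 2 := by
  simp [f₂]

theorem eval_quartic (v : Fin 3 → R) :
    eval v c.quartic = eval v c.f₁ ^ 2 - 4 * eval v c.f₀ * eval v c.f₂ := by
  simp [quartic]

theorem eval_cubic (v : Fin 4 → R) : eval v c.cubic =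
    eval ![v 0, v 1, v 3] c.f₀ * v 2 ^ 2 + eval ![v 0, v 1, v 3] c.f₁ * v 2 +
      eval ![v 0, v 1, v 3] c.f₂ := by
  simp [cubic_eq, eval_f₀, eval_f₁, eval_f₂]

theorem eval_pderiv_quartic (v : Fin 3 → R) (i : Fin 3) : eval v (pderiv i c.quartic) =
    2 * eval v c.f₁ * eval v (pderiv i c.f₁) - 4 * (eval v (pderiv i c.f₀) * eval v c.f₂ +
      eval v c.f₀ * eval v (pderiv i c.f₂)) := by
  have h4 : (4 : MvPolynomial (Fin 3) R) = C 4 := (map_ofNat C 4).symm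
  simp only [quartic, h4, map_sub, Derivation.leibniz, Derivation.leibniz_pow, smul_eq_mul, map_add,
    map_mul, eval_C, pderiv_C, nsmul_eq_mul]
  simp
  ring

theorem eval_pderiv_f₀ (v : Fin 3 → R) :
    eval v (pderiv 0 c.f₀) = c.p₂ ∧ eval v (pderiv 1 c.f₀) = -2 ∧ eval v (pderiv 2 c.f₀) = c.q₂ := by
  have h2 : (2 : MvPolynomial (Fin 3) R) = C 2 := (map_ofNat C 2).symm
  refine ⟨?_, ?_, ?_⟩ <;> rw [f₀, h2] <;> simp [pderiv_X]

theorem eval_pderiv_f₁ (v : Fin 3 → R) :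
    eval v (pderiv 0 c.f₁) = c.p₁ * v 2 ∧ eval v (pderiv 1 c.f₁) = 0 ∧
      eval v (pderiv 2 c.f₁) = c.p₁ * v 0 + 2 * c.q₁ * v 2 := by
  refine ⟨?_, ?_, ?_⟩ <;> rw [f₁] <;>
    simp [pderiv_X, Derivation.leibniz, Derivation.leibniz_pow] <;> ring

theorem eval_pderiv_f₂ (v : Fin 3 → R) :
    eval v (pderiv 0 c.f₂) = 3 * v 0 ^ 2 + c.p₀ * v 2 ^ 2 ∧
      eval v (pderiv 1 c.f₂) = -2 * v 1 * v 2 ∧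
      eval v (pderiv 2 c.f₂) = 2 * c.p₀ * v 0 * v 2 + 3 * c.q₀ * v 2 ^ 2 - v 1 ^ 2 := by
  refine ⟨?_, ?_, ?_⟩ <;> rw [f₂] <;>
    simp [pderiv_X, Derivation.leibniz, Derivation.leibniz_pow] <;> ring

theorem eval_pderiv_cubic (v : Fin 4 → R) :
    eval v (pderiv 0 c.cubic) = c.p₂ * v 2 ^ 2 + c.p₁ * v 3 * v 2 + 3 * v 0 ^ 2 + c.p₀ * v 3 ^ 2 ∧
    eval v (pderiv 1 c.cubic) = -2 * v 2 ^ 2 - 2 * v 1 * v 3 ∧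
    eval v (pderiv 2 c.cubic) = 2 * (c.p₂ * v 0 - 2 * v 1 + c.q₂ * v 3) * v 2 +
      (c.p₁ * v 0 * v 3 + c.q₁ * v 3 ^ 2) ∧
    eval v (pderiv 3 c.cubic) = c.q₂ * v 2 ^ 2 + (c.p₁ * v 0 + 2 * c.q₁ * v 3) * v 2 +
      2 * c.p₀ * v 0 * v 3 + 3 * c.q₀ * v 3 ^ 2 - v 1 ^ 2 := by
  have h2 : (2 : MvPolynomial (Fin 4) R) = C 2 := (map_ofNat C 2).symm
  refine ⟨?_, ?_, ?_, ?_⟩ <;> rw [cubic_eq, h2] <;>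
    simp [pderiv_X, Derivation.leibniz, Derivation.leibniz_pow] <;> ring

end Forms

/-! ### Lines through a singular point deform to first order -/

section SingularPoints

variable {K : Type*} [Field K]

/-- A line through a singular point is a multiple root of `linePoly`. -/
theorem isLine_of_singular {c : ShiodaCoeffs K} (h2 : (2 : K) ≠ 0) {x t a δ : K}
    (hx : 3 * x ^ 2 + c.p₀ + c.p₁ * t + c.p₂ * t ^ 2 = 0)
    (ht : 2 * (c.p₂ * x + c.q₂) * t + 4 * t ^ 3 + c.p₁ * x + c.q₁ = 0)
    (h : x ^ 3 + (c.p₀ + c.p₁ * t + c.p₂ * t ^ 2) * x + c.q₀ + c.q₁ * t + c.q₂ * t ^ 2 + t ^ 4 = 0)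
    (hδ : 2 * δ = a ^ 3 + c.p₂ * a + 4 * t)
    (ha : δ ^ 2 = 3 * x * a ^ 2 + (c.p₁ + 2 * c.p₂ * t) * a + c.p₂ * x + c.q₂ + 6 * t ^ 2) :
    c.IsLine a (x - a * t) (δ - 2 * t) (t ^ 2 - δ * t) ∧
      c.linePoly.derivative.eval a = 0 := by
  -- This is the line of slope `a` through the singular point [x : -t² : t : 1]; `hx`, `ht` and `h`
  -- say that the point is singular.
  have H : c.IsLine a (x - a * t) (δ - 2 * t) (t ^ 2 - δ * t) := by
    constructor
    · linear_combination hδ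
    · linear_combination ha - 3 * t * hδ
    · linear_combination -2 * t * ha + 3 * t ^ 2 * hδ - a * hx - ht
    · linear_combination t ^ 2 * ha - t ^ 3 * hδ + t * ht - h + t * a * hx
  refine ⟨H, ?_⟩
  -- Linearizing the four equations gives cubic forms on the line that vanish at the singular point,
  -- so the linearization has a kernel. The vector below is in it, normalized to a' = 2.
  refine derivative_linePoly_eval_eq_zero (a' := 2)
    (b := TrivSqZeroExt.inl (x - a * t) + TrivSqZeroExt.inr (2 * (δ - t)))
    (d := TrivSqZeroExt.inl (δ - 2 * t) + TrivSqZeroExt.inr (3 * a ^ 2 + c.p₂))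
    (e := TrivSqZeroExt.inl (t ^ 2 - δ * t) + TrivSqZeroExt.inr
      (6 * x * a + c.p₁ + 2 * c.p₂ * t - (3 * a ^ 2 + c.p₂) * t)) h2 h2 ?_
  have h2' : (2 : DualNumber K) = TrivSqZeroExt.inl 2 := rfl
  have h3' : (3 : DualNumber K) = TrivSqZeroExt.inl 3 := rfl
  have heps : (algebraMap K (DualNumber K)) 2 * DualNumber.eps = TrivSqZeroExt.inr 2 := by
    ext <;> simp [TrivSqZeroExt.algebraMap_eq_inl]
  rw [heps]
  constructor
  · ext
    · simp [map, h2', TrivSqZeroExt.algebraMap_eq_inl, pow_succ]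
      linear_combination H.eq₃
    · simp [map, h2', TrivSqZeroExt.algebraMap_eq_inl, pow_succ]
      ring
  · ext
    · simp [map, h2', h3', TrivSqZeroExt.algebraMap_eq_inl, pow_succ]
      linear_combination H.eq₂
    · simp [map, h2', h3', TrivSqZeroExt.algebraMap_eq_inl, pow_succ]
      ring
  · ext
    · simp [map, h2', h3', TrivSqZeroExt.algebraMap_eq_inl, pow_succ]
      linear_combination H.eq₁
    · simp [map, h2', h3', TrivSqZeroExt.algebraMap_eq_inl, pow_succ]
      linear_combination -2 * hx
  · ext
    · simp [map, TrivSqZeroExt.algebraMap_eq_inl, pow_succ]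
      linear_combination H.eq₀
    · simp [map, TrivSqZeroExt.algebraMap_eq_inl, pow_succ]
      linear_combination -2 * (δ - t) * hx

end SingularPoints

end ShiodaCoeffs

/-! ### Smoothness of the cubic surface and of the quartic -/

namespace ShiodaCoeffs

section Smoothness

variable {K : Type*} [Field K]

/-- The flex point `[0 : 0 : 1 : 0]` does not lie on a line of the surface. -/
theorem GenPos.flex_not_mem {σ r m : K} (H : GenPos σ r m) {v : Fin 3 → K}
    (h₀ : eval v (fieldCoeffs σ r m).f₀ = 0) (h₁ : eval v (fieldCoeffs σ r m).f₁ = 0)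
    (h₂ : eval v (fieldCoeffs σ r m).f₂ = 0) : v = 0 := by
  set c := fieldCoeffs σ r m
  rw [eval_f₀] at h₀
  rw [eval_f₁] at h₁
  rw [eval_f₂] at h₂
  by_cases hw : v 2 = 0
  · have hx : v 0 = 0 := by
      rw [hw] at h₂
      exact pow_eq_zero_iff (n := 3) (by norm_num) |>.1 (by linear_combination h₂)
    have hy : v 1 = 0 := by
      rw [hw, hx] at h₀
      exact (mul_eq_zero.1 (by linear_combination -h₀ : 2 * v 1 = 0)).resolve_left H.two_ne
    funext i
    fin_cases i <;> assumption
  · exfalso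
    obtain ⟨b, hb⟩ : ∃ b, v 0 = b * v 2 := ⟨v 0 / v 2, by field_simp⟩
    obtain ⟨e, he⟩ : ∃ e, v 1 = e * v 2 := ⟨v 1 / v 2, by field_simp⟩
    rw [hb, he] at h₀ h₂
    rw [hb] at h₁
    -- The join of the common zero with [0:0:1:0] is a line on the surface of slope 0, and no slope
    -- is 0.
    have hl : c.IsLine 0 b 0 e := by
      constructor
      · ring
      · exact mul_left_cancel₀ hw (by linear_combination -h₀)
      · exact mul_left_cancel₀ (pow_ne_zero 2 hw) (by linear_combination -h₁)
      · exact mul_left_cancel₀ (pow_ne_zero 3 hw) (by linear_combination -h₂)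
    obtain ⟨i, hi⟩ := H.exists_slope_eq hl
    exact H.slope_ne i hi.symm

/-- The sextic whose roots are the slopes of the lines through a singular point `(x, -t², t)`. -/
theorem exists_root_ne [IsAlgClosed K] (h6 : (6 : K) ≠ 0) {a₀ : K} (ha₀ : a₀ ≠ 0)
    (p t u v w : K) : ∃ a, a ≠ a₀ ∧ (a ^ 3 + p * a + t) ^ 2 = u * a ^ 2 + v * a + w := by
  by_contra! hno
  let P : Polynomial K := (Polynomial.X ^ 3 + (Polynomial.C p * Polynomial.X + Polynomial.C t)) ^ 2 -
    (Polynomial.C u * Polynomial.X ^ 2 + Polynomial.C v * Polynomial.X + Polynomial.C w)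
  have hP : P = Polynomial.X ^ 6 + (Polynomial.C (2 * p) * Polynomial.X ^ 4 +
      Polynomial.C (2 * t) * Polynomial.X ^ 3 + Polynomial.C (p ^ 2 - u) * Polynomial.X ^ 2 +
      Polynomial.C (2 * p * t - v) * Polynomial.X + Polynomial.C (t ^ 2 - w)) := by
    simp only [P, map_mul, map_sub, map_pow, map_ofNat]
    ring
  have hlow : (Polynomial.C (2 * p) * Polynomial.X ^ 4 +
      Polynomial.C (2 * t) * Polynomial.X ^ 3 + Polynomial.C (p ^ 2 - u) * Polynomial.X ^ 2 +
      Polynomial.C (2 * p * t - v) * Polynomial.X + Polynomial.C (t ^ 2 - w)).degree ≤ ((4 : ℕ) : WithBot ℕ) := by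
    compute_degree
    norm_num
  have hlt := lt_of_le_of_lt hlow (show ((4 : ℕ) : WithBot ℕ) < (6 : ℕ) by norm_num)
  have hmon : P.Monic := by rw [hP]; exact Polynomial.monic_X_pow_add hlt
  have hdeg : P.natDegree = 6 := by
    rw [hP]
    refine Polynomial.natDegree_eq_of_degree_eq_some ?_
    rw [Polynomial.degree_add_eq_left_of_degree_lt (by rwa [Polynomial.degree_X_pow]),
      Polynomial.degree_X_pow]
  -- The roots of the monic sextic sum to zero, whereas six copies of `a₀` sum to 6a₀ ≠ 0.
  have hcoeff : P.coeff 5 = 0 := by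
    rw [hP, Polynomial.coeff_add, Polynomial.coeff_X_pow]
    rw [if_neg (by norm_num), zero_add]
    exact Polynomial.coeff_eq_zero_of_degree_lt
      (lt_of_le_of_lt hlow (show ((4 : ℕ) : WithBot ℕ) < (5 : ℕ) by norm_num))
  have hroots : P.roots = Multiset.replicate 6 a₀ := by
    refine Multiset.eq_replicate.2 ⟨?_, fun b hb => ?_⟩
    · rw [← hdeg]
      exact (Polynomial.splits_iff_card_roots.1 (IsAlgClosed.splits P))
    · by_contra hne
      refine hno b hne ?_
      have := (Polynomial.mem_roots'.1 hb).2
      simp only [P, Polynomial.IsRoot, Polynomial.eval_sub, Polynomial.eval_pow,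
        Polynomial.eval_add, Polynomial.eval_mul, Polynomial.eval_C, Polynomial.eval_X] at this
      linear_combination this
  have hs := (IsAlgClosed.splits P).nextCoeff_eq_neg_sum_roots_of_monic hmon
  rw [hroots, Polynomial.nextCoeff_of_natDegree_pos (by omega), hdeg, hcoeff] at hs
  simp at hs
  exact (mul_ne_zero h6 ha₀) (by linear_combination hs)

/-- A singular point would carry a line whose slope is not that of c₁₂, by `exists_root_ne`. But
this slope is a multiple root of the slope polynomial, and the only multiple root is the slope of
c₁₂. -/
theorem GenPos.isNonsingular_cubic [IsAlgClosed K] {σ r m : K} (H : GenPos σ r m) :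
    IsNonsingular (fieldCoeffs σ r m).cubic := by
  intro v hv h
  by_contra! hs
  obtain ⟨e₀, e₁, e₂, e₃⟩ := eval_pderiv_cubic (fieldCoeffs σ r m) v
  rw [hs] at e₀ e₁ e₂ e₃
  rw [eval_cubic, eval_f₀, eval_f₁, eval_f₂] at h
  simp only [Matrix.cons_val_zero, Matrix.cons_val_one, Matrix.cons_val] at h
  set c := fieldCoeffs σ r m
  by_cases hw : v 3 = 0
  · rw [hw] at e₀ e₁ e₃
    have hz : v 2 = 0 := pow_eq_zero_iff (n := 2) (by norm_num) |>.1
      ((mul_eq_zero.1 (by linear_combination e₁ : 2 * v 2 ^ 2 = 0)).resolve_left H.two_ne)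
    rw [hz] at e₀ e₃
    have hx : v 0 = 0 := pow_eq_zero_iff (n := 2) (by norm_num) |>.1
      ((mul_eq_zero.1 (by linear_combination -e₀ : 3 * v 0 ^ 2 = 0)).resolve_left H.three_ne)
    have hy : v 1 = 0 := pow_eq_zero_iff (n := 2) (by norm_num) |>.1 (by linear_combination e₃)
    exact hv (by funext i; fin_cases i <;> assumption)
  · obtain ⟨x, hx⟩ : ∃ x, v 0 = x * v 3 := ⟨v 0 / v 3, by field_simp⟩
    obtain ⟨y, hy⟩ : ∃ y, v 1 = y * v 3 := ⟨v 1 / v 3, by field_simp⟩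
    obtain ⟨t, ht⟩ : ∃ t, v 2 = t * v 3 := ⟨v 2 / v 3, by field_simp⟩
    rw [hx, hy, ht] at h e₂
    rw [hy, ht] at e₁
    rw [hx, ht] at e₀
    have hw2 := pow_ne_zero 2 hw
    have hw3 := pow_ne_zero 3 hw
    -- The derivative with respect to Y places the singular point at [x : -t² : t : 1].
    have hyt : y = -t ^ 2 := by
      have : 2 * v 3 ^ 2 * (y + t ^ 2) = 0 := by linear_combination e₁
      have := (mul_eq_zero.1 this).resolve_left (mul_ne_zero H.two_ne hw2)
      linear_combination this
    subst hyt
    have E₀ : 3 * x ^ 2 + c.p₀ + c.p₁ * t + c.p₂ * t ^ 2 = 0 :=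
      (mul_eq_zero.1 (by linear_combination -e₀ : v 3 ^ 2 *
        (3 * x ^ 2 + c.p₀ + c.p₁ * t + c.p₂ * t ^ 2) = 0)).resolve_left hw2
    have E₂ : 2 * (c.p₂ * x + c.q₂) * t + 4 * t ^ 3 + c.p₁ * x + c.q₁ = 0 :=
      (mul_eq_zero.1 (by linear_combination -e₂ : v 3 ^ 2 *
        (2 * (c.p₂ * x + c.q₂) * t + 4 * t ^ 3 + c.p₁ * x + c.q₁) = 0)).resolve_left hw2
    have E : x ^ 3 + (c.p₀ + c.p₁ * t + c.p₂ * t ^ 2) * x + c.q₀ + c.q₁ * t + c.q₂ * t ^ 2 +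
        t ^ 4 = 0 :=
      (mul_eq_zero.1 (by linear_combination h : v 3 ^ 3 *
        (x ^ 3 + (c.p₀ + c.p₁ * t + c.p₂ * t ^ 2) * x + c.q₀ + c.q₁ * t + c.q₂ * t ^ 2 +
        t ^ 4) = 0)).resolve_left hw3
    obtain ⟨a, hne, ha⟩ := exists_root_ne H.six_ne (H.slope_ne 12) c.p₂ (4 * t)
      (4 * (3 * x)) (4 * (c.p₁ + 2 * c.p₂ * t)) (4 * (c.p₂ * x + c.q₂ + 6 * t ^ 2))
    obtain ⟨δ, hδ⟩ : ∃ δ, a ^ 3 + c.p₂ * a + 4 * t = 2 * δ :=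
      ⟨(a ^ 3 + c.p₂ * a + 4 * t) / 2, by have := H.two_ne; field_simp⟩
    rw [hδ] at ha
    have ha' : δ ^ 2 = 3 * x * a ^ 2 + (c.p₁ + 2 * c.p₂ * t) * a + c.p₂ * x + c.q₂ + 6 * t ^ 2 :=
      mul_left_cancel₀ (pow_ne_zero 2 H.two_ne) (by linear_combination ha)
    obtain ⟨hl, hd⟩ := isLine_of_singular H.two_ne E₀ E₂ E hδ.symm ha'
    obtain ⟨i, rfl⟩ := H.exists_slope_eq hl
    rcases H.eq_of_derivative_eval_eq_zero hd with rfl | rfl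
    · exact hne rfl
    · exact hne (by rw [lineSlope_twelve, lineSlope_twentyOne])

/-- The quartic is the discriminant of f₀Z² + f₁Z + f₂. Where f₀ ≠ 0, the double root over a
singular point is a singular point of the surface; where f₀ = 0, also f₁ = f₂ = 0, which
`flex_not_mem` excludes. -/
theorem GenPos.isNonsingular_quartic [IsAlgClosed K] {σ r m : K} (H : GenPos σ r m) :
    IsNonsingular (fieldCoeffs σ r m).quartic := by
  intro v hv h
  by_contra! hs
  have e₀ := eval_pderiv_quartic (fieldCoeffs σ r m) v 0
  have e₁ := eval_pderiv_quartic (fieldCoeffs σ r m) v 1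
  have e₂ := eval_pderiv_quartic (fieldCoeffs σ r m) v 2
  rw [hs] at e₀ e₁ e₂
  rw [eval_quartic] at h
  set c := fieldCoeffs σ r m with hc
  have h4 : (4 : K) ≠ 0 := by
    rw [show (4 : K) = 2 ^ 2 by norm_num]; exact pow_ne_zero _ H.two_ne
  by_cases h0 : eval v c.f₀ = 0
  · rw [h0, mul_zero, zero_mul, sub_zero] at h
    have h1 : eval v c.f₁ = 0 := pow_eq_zero_iff (n := 2) (by norm_num) |>.1 h
    rw [h0, h1, (eval_pderiv_f₀ c v).2.1] at e₁
    have h2 : eval v c.f₂ = 0 := by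
      have : 4 * 2 * eval v c.f₂ = 0 := by linear_combination -e₁
      exact (mul_eq_zero.1 this).resolve_left (mul_ne_zero h4 H.two_ne)
    exact hv (H.flex_not_mem h0 h1 h2)
  -- The double root z = -f₁/(2f₀). The gradient of the discriminant at `v` is -4f₀ times the
  -- gradient of the cubic form at (v, z), in the coordinates X, Y, W.
  · obtain ⟨z, hz⟩ : ∃ z, eval v c.f₁ = -2 * eval v c.f₀ * z :=
      ⟨-eval v c.f₁ / (2 * eval v c.f₀), by have := H.two_ne; field_simp⟩
    have h2 : eval v c.f₂ = eval v c.f₀ * z ^ 2 := by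
      have : 4 * eval v c.f₀ * (eval v c.f₂ - eval v c.f₀ * z ^ 2) = 0 := by
        rw [hz] at h; linear_combination -h
      linear_combination (mul_eq_zero.1 this).resolve_left (mul_ne_zero h4 h0)
    have key : ∀ i, 2 * eval v c.f₁ * eval v (pderiv i c.f₁) -
        4 * (eval v (pderiv i c.f₀) * eval v c.f₂ + eval v c.f₀ * eval v (pderiv i c.f₂)) = 0 →
        eval v (pderiv i c.f₀) * z ^ 2 + eval v (pderiv i c.f₁) * z + eval v (pderiv i c.f₂) = 0 := by
      intro i hi
      have : 4 * eval v c.f₀ * (eval v (pderiv i c.f₀) * z ^ 2 + eval v (pderiv i c.f₁) * z +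
          eval v (pderiv i c.f₂)) = 0 := by
        rw [hz, h2] at hi; linear_combination -hi
      exact (mul_eq_zero.1 this).resolve_left (mul_ne_zero h4 h0)
    have k₀ := key 0 e₀.symm
    have k₁ := key 1 e₁.symm
    have k₂ := key 2 e₂.symm
    obtain ⟨a₀, a₁, a₂⟩ := eval_pderiv_f₀ c v
    obtain ⟨b₀, b₁, b₂⟩ := eval_pderiv_f₁ c v
    obtain ⟨d₀, d₁, d₂⟩ := eval_pderiv_f₂ c v
    rw [a₀, b₀, d₀] at k₀
    rw [a₁, b₁, d₁] at k₁
    rw [a₂, b₂, d₂] at k₂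
    have hne : ![v 0, v 1, z, v 2] ≠ 0 := by
      intro h
      apply hv
      funext i
      fin_cases i
      exacts [congrFun h 0, congrFun h 1, congrFun h 3]
    have hv' : ![v 0, v 1, v 2] = v := by funext i; fin_cases i <;> rfl
    obtain ⟨i, hi⟩ := H.isNonsingular_cubic ![v 0, v 1, z, v 2] hne (by
      rw [eval_cubic]
      simp only [Matrix.cons_val_zero, Matrix.cons_val_one, Matrix.cons_val]
      rw [hv', ← hc, h2, hz]
      ring)
    obtain ⟨s₀, s₁, s₂, s₃⟩ := eval_pderiv_cubic c ![v 0, v 1, z, v 2]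
    simp only [Matrix.cons_val_zero, Matrix.cons_val_one, Matrix.cons_val] at s₀ s₁ s₂ s₃
    rw [eval_f₀, eval_f₁] at hz
    apply hi
    fin_cases i
    · exact s₀.trans (by linear_combination k₀)
    · exact s₁.trans (by linear_combination k₁)
    · exact s₂.trans (by linear_combination hz)
    · exact s₃.trans (by linear_combination k₂)

end Smoothness

end ShiodaCoeffs

/-! ### Anisotropy of x² - u y² - t z² over k⟦t⟧ by infinite descent -/

section Descent

variable {k : Type*} [Field k]

/-- If `u` is not a square, then the ternary quadratic form `x² - u y² - t z²` is anisotropic over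
`k⟦t⟧`. -/
theorem PowerSeries.eq_zero_of_sq_eq {u : k} (hu : ¬ IsSquare u) {a b c : PowerSeries k}
    (h : a ^ 2 = C u * b ^ 2 + X * c ^ 2) : a = 0 ∧ b = 0 ∧ c = 0 := by
  -- Modulo t the equation is a² = u b², so t divides `a` and `b` as `u` is not a square; then t²
  -- divides t c², so t divides `c`.
  have step : ∀ {a b c : PowerSeries k}, a ^ 2 = C u * b ^ 2 + X * c ^ 2 →
      ∃ a' b' c', a = X * a' ∧ b = X * b' ∧ c = X * c' ∧ a' ^ 2 = C u * b' ^ 2 + X * c' ^ 2 := by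
    intro a b c h
    have h₀ := congrArg (constantCoeff (R := k)) h
    simp only [map_pow, map_add, map_mul, constantCoeff_C, constantCoeff_X, zero_mul,
      add_zero] at h₀
    have hb : constantCoeff b = 0 := by
      by_contra hb
      refine hu ⟨constantCoeff a / constantCoeff b, ?_⟩
      field_simp
      linear_combination -h₀
    have ha : constantCoeff a = 0 := by
      rw [hb] at h₀
      exact pow_eq_zero_iff (n := 2) (by norm_num) |>.1 (by linear_combination h₀)
    obtain ⟨a', rfl⟩ := X_dvd_iff.2 ha
    obtain ⟨b', rfl⟩ := X_dvd_iff.2 hb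
    have h₁ : X * a' ^ 2 = C u * (X * b' ^ 2) + c ^ 2 :=
      mul_left_cancel₀ X_ne_zero (by linear_combination h)
    have h₂ := congrArg (constantCoeff (R := k)) h₁
    simp only [map_pow, map_add, map_mul, constantCoeff_C, constantCoeff_X, zero_mul,
      mul_zero, zero_add] at h₂
    obtain ⟨c', rfl⟩ := X_dvd_iff.2 (pow_eq_zero_iff (n := 2) (by norm_num) |>.1 h₂.symm)
    exact ⟨a', b', c', rfl, rfl, rfl, mul_left_cancel₀ X_ne_zero (by linear_combination h₁)⟩
  have dvd : ∀ n : ℕ, ∀ {a b c : PowerSeries k}, a ^ 2 = C u * b ^ 2 + X * c ^ 2 →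
      X ^ n ∣ a ∧ X ^ n ∣ b ∧ X ^ n ∣ c := by
    intro n
    induction n with
    | zero => simp
    | succ n ih =>
      intro a b c h
      obtain ⟨a', b', c', rfl, rfl, rfl, h'⟩ := step h
      obtain ⟨h₁, h₂, h₃⟩ := ih h'
      rw [pow_succ']
      exact ⟨mul_dvd_mul_left _ h₁, mul_dvd_mul_left _ h₂, mul_dvd_mul_left _ h₃⟩
  have zero : ∀ a : PowerSeries k, (∀ n : ℕ, X ^ n ∣ a) → a = 0 := by
    intro a ha
    ext n
    exact X_pow_dvd_iff.1 (ha (n + 1)) n (Nat.lt_succ_self n)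
  exact ⟨zero _ fun n => (dvd n h).1, zero _ fun n => (dvd n h).2.1, zero _ fun n => (dvd n h).2.2⟩

variable {K : Type*} [Field K] {φ : PowerSeries k →+* K} {u : k} {s r : K}

/-- The elements `1`, `r = √u` and `s = √t` are linearly independent (with power series as coefficients
of `1` and constants as coefficients of `r` and `s`). -/
theorem PowerSeries.eq_zero_of_add_sqrt (h2 : (2 : k) ≠ 0) (hu : ¬ IsSquare u)
    (hφ : Function.Injective φ) (hs : s ^ 2 = φ PowerSeries.X) (hr : r ^ 2 = φ (PowerSeries.C u))
    {a : PowerSeries k} {b c : k}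
    (h : φ a + φ (PowerSeries.C b) * r + φ (PowerSeries.C c) * s = 0) : a = 0 ∧ b = 0 ∧ c = 0 := by
  have hu₀ : u ≠ 0 := fun h => hu (h ▸ IsSquare.zero)
  -- Squaring c s = -(a + b r) gives Q = P r, hence Q² = u P², and descent yields P = Q = 0.
  set P : PowerSeries k := 2 * a * C b
  set Q : PowerSeries k := X * C c ^ 2 - a ^ 2 - C u * C b ^ 2 with hQ
  have h₁ : φ Q = φ P * r := by
    simp only [P, Q, map_sub, map_mul, map_pow, map_ofNat, ← hs, ← hr]
    linear_combination (φ (C c) * s - φ a - φ (C b) * r) * h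
  have h₂ : Q ^ 2 = C u * P ^ 2 + X * 0 ^ 2 := hφ (by
    simp only [map_add, map_mul, map_pow, h₁, map_zero, ← hr]; ring)
  obtain ⟨hQ₀, hP₀, -⟩ := eq_zero_of_sq_eq hu h₂
  have h2' : (2 : PowerSeries k) ≠ 0 := fun h => h2 (by
    simpa using (map_ofNat constantCoeff 2).symm.trans (congrArg constantCoeff h))
  have hC : Function.Injective (C (R := k)) := C_injective
  rcases mul_eq_zero.1 hP₀ with h | h
  · have ha : a = 0 := (mul_eq_zero.1 h).resolve_left h2'
    have h₃ : u * b ^ 2 = 0 := by simpa [hQ₀, ha] using congrArg constantCoeff hQ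
    have hb : b = 0 := by simpa [hu₀] using h₃
    rw [hQ₀, ha, hb] at hQ
    refine ⟨ha, hb, ?_⟩
    have : X * C c ^ 2 = 0 := by simpa using hQ.symm
    exact hC (by simpa [X_ne_zero] using this)
  · have hb : b = 0 := hC (by simpa using h)
    obtain ⟨ha, -, hc⟩ := eq_zero_of_sq_eq hu (a := a) (b := 0) (c := C c) (by
      rw [hQ₀, hb, map_zero] at hQ; linear_combination hQ)
    exact ⟨ha, hb, hC (by simpa using hc)⟩

end Descent

/-! ### The parameters of both cases are in general position -/

namespace ShiodaCoeffs

section PowerSeries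

variable {k : Type*} [Field k] {K : Type*} [Field K] {φ : PowerSeries k →+* K} {u : k} {s r m : K}

theorem intCast_eq_zero_of_abs_lt {p : ℕ} [CharP k p] {n : ℤ} (hn : |n| < p) (h : (n : k) = 0) :
    n = 0 :=
  Int.eq_zero_of_abs_lt_dvd ((CharP.intCast_eq_zero_iff k p n).1 h) hn

/-- Integers of absolute value at most 10 are determined by their residue modulo p ≥ 11. After
multiplication by 3 the relation has the form a + b r + c s = 0 with a = 3n₀ + n₁t, so all four
residues vanish. -/
theorem code_eq_zero {p : ℕ} [CharP k p] (hp : 11 ≤ p) (hu : ¬ IsSquare u)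
    (hφ : Function.Injective φ) (hs : s ^ 2 = φ PowerSeries.X) (hr : r ^ 2 = φ (PowerSeries.C u))
    {n₀ n₁ n₂ n₃ : ℤ} (h₀ : |n₀| ≤ 10) (h₁ : |n₁| ≤ 10) (h₂ : |n₂| ≤ 10) (h₃ : |n₃| ≤ 10)
    (h : n₀ + n₁ * (3 * (s / 3) ^ 2) + n₂ * (3 * (s / 3)) + n₃ * r = (0 : K)) :
    n₀ = 0 ∧ n₁ = 0 ∧ n₂ = 0 ∧ n₃ = 0 := by
  have hlt : ∀ {n : ℤ}, |n| ≤ 10 → |n| < p := fun h => by omega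
  have hk : ∀ n : ℤ, 0 < n → n ≤ 10 → (n : k) ≠ 0 := fun n hn hn' h => by
    have := intCast_eq_zero_of_abs_lt (p := p) (hlt (by rw [abs_of_pos hn]; exact hn')) h
    omega
  have h2 : (2 : k) ≠ 0 := by simpa using hk 2 (by norm_num) (by norm_num)
  have h3 : (3 : k) ≠ 0 := by simpa using hk 3 (by norm_num) (by norm_num)
  have h3' : (3 : K) ≠ 0 := fun h => h3 <| by
    have : φ 3 = φ 0 := by rw [map_ofNat, map_zero, h]
    exact (map_ofNat PowerSeries.constantCoeff 3).symm.trans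
      ((congrArg PowerSeries.constantCoeff (hφ this)).trans (map_zero _))
  have key := PowerSeries.eq_zero_of_add_sqrt h2 hu hφ hs hr
    (a := 3 * (n₀ : PowerSeries k) + (n₁ : PowerSeries k) * PowerSeries.X) (b := 3 * n₃) (c := 3 * n₂) (by
      simp only [map_add, map_mul, map_ofNat, map_intCast, ← hs]
      field_simp at h
      linear_combination h)
  obtain ⟨ha, hb, hc⟩ := key
  have e3 : (3 : PowerSeries k) = PowerSeries.C 3 := (map_ofNat PowerSeries.C 3).symm
  have en : ∀ n : ℤ, (n : PowerSeries k) = PowerSeries.C (n : k) := fun n => (map_intCast _ n).symm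
  rw [e3, en, en] at ha
  have ha₀ := congrArg PowerSeries.constantCoeff ha
  have ha₁ := congrArg (PowerSeries.coeff 1) ha
  simp [h3] at ha₀
  rw [ha₀] at ha₁
  simp at ha₁
  simp [h3] at hb hc
  exact ⟨intCast_eq_zero_of_abs_lt (hlt h₀) ha₀, intCast_eq_zero_of_abs_lt (hlt h₁) ha₁,
    intCast_eq_zero_of_abs_lt (hlt h₂) hc, intCast_eq_zero_of_abs_lt (hlt h₃) hb⟩

/-- This factorization shows that c₁₂ and c₃₄ are distinct although their slopes coincide: u ≠ t and
m ≠ ±(3 + t). -/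
theorem off₁₂_sub_off₃₄ (θ B D : K) :
    off₁₂ θ B D - off₃₄ θ B D = 324 * ((B - 3 * θ) * (D - 9 * (1 + θ) ^ 2)) := by
  simp only [off₁₂, off₃₄]
  ring

/-- The parameters of the two cases of the construction are in general position. -/
theorem genPos {p : ℕ} [CharP k p] (hp : 11 ≤ p) (hu : ¬ IsSquare u)
    (hφ : Function.Injective φ) (hs : s ^ 2 = φ PowerSeries.X) (hr : r ^ 2 = φ (PowerSeries.C u))
    (hm : m = 1 ∨ m = 2 * r) : GenPos (s / 3) r m := by
  have hK : ∀ n : ℤ, |n| ≤ 10 → (n : K) = 0 → n = 0 := fun n hn h =>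
    (code_eq_zero (n₁ := 0) (n₂ := 0) (n₃ := 0) hp hu hφ hs hr hn (by simp) (by simp) (by simp)
      (by simpa using h)).1
  have h2 : (2 : K) ≠ 0 := fun h => by simpa using hK 2 (by norm_num) (by simpa using h)
  have h3 : (3 : K) ≠ 0 := fun h => by simpa using hK 3 (by norm_num) (by simpa using h)
  have hr₁ : r ^ 2 - s ^ 2 ≠ 0 := by
    rw [hs, hr, ← map_sub, Ne, map_eq_zero_iff φ hφ]
    intro h
    simpa using congrArg (PowerSeries.coeff 1) h
  have hslope : ∃ c : ℤ × ℤ, (m = c.1 + c.2 * r) ∧ (c = (1, 0) ∨ c = (0, 2)) := by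
    rcases hm with rfl | rfl
    · exact ⟨(1, 0), by simp, Or.inl rfl⟩
    · exact ⟨(0, 2), by simp, Or.inr rfl⟩
  obtain ⟨c, rfl, hc⟩ := hslope
  refine ⟨h2, h3, fun i j h => ?_, fun i h => ?_, ?_⟩
  · have key := code_eq_zero hp hu hφ hs hr
      (n₀ := slopeOne i + slopeM i * c.1 - (slopeOne j + slopeM j * c.1))
      (n₁ := slopeθ i - slopeθ j) (n₂ := slopeS i - slopeS j)
      (n₃ := slopeR i + slopeM i * c.2 - (slopeR j + slopeM j * c.2))
    -- With m = c.1 + c.2 r, a slope is an integral vector in 1, t/3, s, r. The bounds and the list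
    -- of coincidences are finite checks.
    have hb : ∀ c : ℤ × ℤ, (c = (1, 0) ∨ c = (0, 2)) → ∀ i j,
        |slopeOne i + slopeM i * c.1 - (slopeOne j + slopeM j * c.1)| ≤ 10 ∧
        |slopeθ i - slopeθ j| ≤ 10 ∧ |slopeS i - slopeS j| ≤ 10 ∧
        |slopeR i + slopeM i * c.2 - (slopeR j + slopeM j * c.2)| ≤ 10 := by
      rintro _ (rfl | rfl) <;> decide
    have hi : ∀ c : ℤ × ℤ, (c = (1, 0) ∨ c = (0, 2)) → ∀ i j,
        slopeOne i + slopeM i * c.1 - (slopeOne j + slopeM j * c.1) = 0 ∧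
        slopeθ i - slopeθ j = 0 ∧ slopeS i - slopeS j = 0 ∧
        slopeR i + slopeM i * c.2 - (slopeR j + slopeM j * c.2) = 0 →
        i = j ∨ (i = 12 ∧ j = 21) ∨ (i = 21 ∧ j = 12) := by
      rintro _ (rfl | rfl) <;> decide
    obtain ⟨b₀, b₁, b₂, b₃⟩ := hb c hc i j
    refine hi c hc i j (key b₀ b₁ b₂ b₃ ?_)
    simp only [lineSlope] at h
    push_cast
    linear_combination h
  · have key := code_eq_zero hp hu hφ hs hr
      (n₀ := slopeOne i + slopeM i * c.1) (n₁ := slopeθ i) (n₂ := slopeS i)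
      (n₃ := slopeR i + slopeM i * c.2)
    have hb : ∀ c : ℤ × ℤ, (c = (1, 0) ∨ c = (0, 2)) → ∀ i,
        |slopeOne i + slopeM i * c.1| ≤ 10 ∧ |slopeθ i| ≤ 10 ∧ |slopeS i| ≤ 10 ∧
        |slopeR i + slopeM i * c.2| ≤ 10 := by
      rintro _ (rfl | rfl) <;> decide
    have hi : ∀ c : ℤ × ℤ, (c = (1, 0) ∨ c = (0, 2)) → ∀ i,
        ¬ (slopeOne i + slopeM i * c.1 = 0 ∧ slopeθ i = 0 ∧ slopeS i = 0 ∧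
          slopeR i + slopeM i * c.2 = 0) := by
      rintro _ (rfl | rfl) <;> decide
    obtain ⟨b₀, b₁, b₂, b₃⟩ := hb c hc i
    refine hi c hc i (key b₀ b₁ b₂ b₃ ?_)
    simp only [lineSlope] at h
    push_cast
    linear_combination h
  · have h6 : (6 : K) ≠ 0 := by
      rw [show (6 : K) = 2 * 3 by norm_num]; exact mul_ne_zero h2 h3
    have h324 : (324 : K) ≠ 0 := by
      rw [show (324 : K) = 2 ^ 2 * 3 ^ 4 by norm_num]
      exact mul_ne_zero (pow_ne_zero _ h2) (pow_ne_zero _ h3)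
    simp only [fieldOffset, lineOffset, Matrix.cons_val]
    rw [← sub_ne_zero, ← mul_sub, off₁₂_sub_off₃₄]
    refine mul_ne_zero (pow_ne_zero _ (inv_ne_zero h6)) (mul_ne_zero h324 (mul_ne_zero ?_ ?_))
    · have : r ^ 2 - 3 * (3 * (s / 3) ^ 2) = r ^ 2 - s ^ 2 := by field_simp
      rwa [this]
    · intro h
      -- The second factor vanishes only for m = ±(3 + t). The coefficient of t already contradicts
      -- this; each of the four cases is read off from the constant term.
      have h' : (c.1 + c.2 * r) ^ 2 = (3 + s ^ 2) ^ 2 := by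
        field_simp at h
        exact mul_left_cancel₀ (pow_ne_zero 2 h3) (by linear_combination h)
      have hk : ((c.1 + c.2 * r - 3 - s ^ 2) * (c.1 + c.2 * r + 3 + s ^ 2)) = 0 := by
        linear_combination h'
      have hss : s ^ 2 = 3 * (3 * (s / 3) ^ 2) := by field_simp
      rcases hc with rfl | rfl <;> rcases mul_eq_zero.1 hk with h | h
      · have := (code_eq_zero hp hu hφ hs hr (n₀ := -2) (n₁ := -3) (n₂ := 0) (n₃ := 0)
          (by simp) (by simp) (by simp) (by simp) (by
            push_cast; rw [hss] at h; push_cast at h; linear_combination h)).1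
        omega
      · have := (code_eq_zero hp hu hφ hs hr (n₀ := 4) (n₁ := 3) (n₂ := 0) (n₃ := 0)
          (by simp) (by simp) (by simp) (by simp) (by
            push_cast; rw [hss] at h; push_cast at h; linear_combination h)).1
        omega
      · have := (code_eq_zero hp hu hφ hs hr (n₀ := -3) (n₁ := -3) (n₂ := 0) (n₃ := 2)
          (by simp) (by simp) (by simp) (by simp) (by
            push_cast; rw [hss] at h; push_cast at h; linear_combination h)).1
        omega
      · have := (code_eq_zero hp hu hφ hs hr (n₀ := 3) (n₁ := 3) (n₂ := 0) (n₃ := 2)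
          (by simp) (by simp) (by simp) (by simp) (by
            push_cast; rw [hss] at h; push_cast at h; linear_combination h)).1
        omega

end PowerSeries

end ShiodaCoeffs

/-! ### Factors of homogeneous polynomials -/

section Homogeneous

variable {σ K : Type*} [Field K]

/-- The homogenisation of a polynomial with respect to a new variable in degree zero, as a polynomial
whose coefficients are the homogeneous components. -/
noncomputable def MvPolynomial.gradedPolynomial :
    MvPolynomial σ K →ₐ[K] Polynomial (MvPolynomial σ K) :=
  aeval fun i => Polynomial.C (X i) * Polynomial.X

theorem MvPolynomial.gradedPolynomial_monomial (d : σ →₀ ℕ) (a : K) :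
    gradedPolynomial (monomial d a) = Polynomial.monomial d.degree (monomial d a) := by
  rw [gradedPolynomial, aeval_monomial, ← Polynomial.C_mul_X_pow_eq_monomial, monomial_eq,
    Finsupp.degree]
  simp only [Finsupp.prod, mul_pow, Finset.prod_mul_distrib, map_mul, map_prod, map_pow,
    Finset.prod_pow_eq_pow_sum]
  rw [mul_assoc]
  rfl

theorem MvPolynomial.coeff_gradedPolynomial (f : MvPolynomial σ K) (n : ℕ) :
    (gradedPolynomial f).coeff n = homogeneousComponent n f := by
  induction f using MvPolynomial.induction_on' with
  | monomial d a =>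
    rw [gradedPolynomial_monomial, Polynomial.coeff_monomial]
    split_ifs with h
    · exact ((homogeneousComponent_of_mem (isHomogeneous_monomial a rfl)).trans (if_pos h.symm)).symm
    · exact ((homogeneousComponent_of_mem (isHomogeneous_monomial a rfl)).trans
        (if_neg fun h' => h h'.symm)).symm
  | add p q hp hq => rw [map_add, Polynomial.coeff_add, hp, hq, map_add]

theorem MvPolynomial.gradedPolynomial_ne_zero {f : MvPolynomial σ K} (hf : f ≠ 0) :
    gradedPolynomial f ≠ 0 := by
  intro h
  apply hf
  rw [← sum_homogeneousComponent f]
  exact Finset.sum_eq_zero fun i _ => by rw [← coeff_gradedPolynomial, h, Polynomial.coeff_zero]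

/-- The factors of a homogeneous polynomial are homogeneous. -/
theorem MvPolynomial.IsHomogeneous.exists_of_mul {f g : MvPolynomial σ K} {n : ℕ}
    (h : (f * g).IsHomogeneous n) (h₀ : f * g ≠ 0) :
    ∃ a b, a + b = n ∧ f.IsHomogeneous a ∧ g.IsHomogeneous b := by
  have hf := gradedPolynomial_ne_zero (left_ne_zero_of_mul h₀)
  have hg := gradedPolynomial_ne_zero (right_ne_zero_of_mul h₀)
  -- The product is a monomial. Lowest and highest degrees are additive over a domain, so they
  -- coincide for each factor.
  have key : gradedPolynomial f * gradedPolynomial g = Polynomial.monomial n (f * g) := by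
    rw [← map_mul]
    ext1 m
    rw [coeff_gradedPolynomial, Polynomial.coeff_monomial]
    exact (homogeneousComponent_of_mem h).trans (by simp only [eq_comm])
  have h₁ := congrArg Polynomial.natDegree key
  have h₂ := congrArg Polynomial.natTrailingDegree key
  rw [Polynomial.natDegree_mul hf hg, Polynomial.natDegree_monomial_eq _ h₀] at h₁
  rw [Polynomial.natTrailingDegree_mul hf hg, Polynomial.natTrailingDegree_monomial h₀] at h₂
  have h₃ := Polynomial.natTrailingDegree_le_natDegree (gradedPolynomial f)
  have h₄ := Polynomial.natTrailingDegree_le_natDegree (gradedPolynomial g)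
  have aux : ∀ p : MvPolynomial σ K, (gradedPolynomial p).natTrailingDegree =
      (gradedPolynomial p).natDegree → p.IsHomogeneous (gradedPolynomial p).natDegree := by
    intro p hp
    have : p = homogeneousComponent (gradedPolynomial p).natDegree p := by
      conv_lhs => rw [← sum_homogeneousComponent p]
      by_cases hm : (gradedPolynomial p).natDegree ∈ Finset.range (p.totalDegree + 1)
      · refine Finset.sum_eq_single_of_mem _ hm fun m _ hne => ?_
        rw [← coeff_gradedPolynomial]
        rcases lt_or_gt_of_ne hne with hlt | hlt
        · exact Polynomial.coeff_eq_zero_of_lt_natTrailingDegree (hp ▸ hlt)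
        · exact Polynomial.coeff_eq_zero_of_natDegree_lt hlt
      · rw [homogeneousComponent_eq_zero _ _ (by simpa using hm)]
        refine Finset.sum_eq_zero fun m hm' => ?_
        rw [← coeff_gradedPolynomial]
        refine Polynomial.coeff_eq_zero_of_lt_natTrailingDegree ?_
        simp only [Finset.mem_range] at hm hm'
        omega
    have hc := homogeneousComponent_isHomogeneous (gradedPolynomial p).natDegree p
    rwa [← this] at hc
  exact ⟨_, _, h₁, aux f (by omega), aux g (by omega)⟩

theorem MvPolynomial.IsHomogeneous.isUnit_of_zero {f : MvPolynomial σ K} (h : f.IsHomogeneous 0)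
    (h₀ : f ≠ 0) : IsUnit f := by
  rw [totalDegree_eq_zero_iff_eq_C.1 ((totalDegree_zero_iff_isHomogeneous σ).2 h)] at h₀ ⊢
  exact (isUnit_iff_ne_zero.2 fun h => h₀ (by rw [h, map_zero])).map C

theorem MvPolynomial.IsHomogeneous.eval_zero_eq_zero {f : MvPolynomial σ K} {n : ℕ}
    (h : f.IsHomogeneous n) (hn : n ≠ 0) : eval 0 f = 0 := by
  have : eval 0 f = constantCoeff f := by rw [MvPolynomial.eval_zero]
  rw [this, constantCoeff_eq]
  exact h.coeff_eq_zero (by simpa using hn.symm)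

theorem MvPolynomial.IsHomogeneous.not_isUnit {f : MvPolynomial σ K} {n : ℕ}
    (h : f.IsHomogeneous n) (hn : n ≠ 0) : ¬ IsUnit f := fun hf =>
  (hf.map (eval (0 : σ → K))).ne_zero (h.eval_zero_eq_zero hn)

/-- A homogeneous polynomial is irreducible if it has no homogeneous factors of lower degree. -/
theorem MvPolynomial.IsHomogeneous.irreducible {f : MvPolynomial σ K} {n : ℕ}
    (h : f.IsHomogeneous n) (hn : n ≠ 0) (h₀ : f ≠ 0)
    (H : ∀ g g' a b, a + b = n → a ≠ 0 → b ≠ 0 → g.IsHomogeneous a → g'.IsHomogeneous b →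
      f ≠ g * g') : Irreducible f := by
  refine ⟨h.not_isUnit hn, fun g g' hg => ?_⟩
  rw [hg] at h h₀
  obtain ⟨a, b, hab, ha, hb⟩ := h.exists_of_mul h₀
  rcases eq_or_ne a 0 with rfl | ha₀
  · exact Or.inl (ha.isUnit_of_zero (left_ne_zero_of_mul h₀))
  rcases eq_or_ne b 0 with rfl | hb₀
  · exact Or.inr (hb.isUnit_of_zero (right_ne_zero_of_mul h₀))
  exact absurd hg (H g g' a b hab ha₀ hb₀ ha hb)

end Homogeneous

/-! ### Two surfaces through the origin of affine 3-space -/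

section CommonZero

variable {Ω : Type*} [Field Ω]

/-- The kernels of the substitutions that set the first n variables to 0 form a strict chain of
primes of length 3 below the ideal of the origin. -/
theorem MvPolynomial.three_le_height_vanishingIdeal :
    3 ≤ (vanishingIdeal Ω {(0 : Fin 3 → Ω)}).height := by
  let φ : ℕ → MvPolynomial (Fin 3) Ω →ₐ[Ω] MvPolynomial (Fin 3) Ω := fun n =>
    aeval fun j => if j.1 < n then 0 else X j
  have hφ : ∀ n j, φ n (X j) = if j.1 < n then 0 else X j := fun n j => aeval_X _ _
  have hle : ∀ m n, m ≤ n → RingHom.ker (φ m) ≤ RingHom.ker (φ n) := by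
    intro m n hmn f hf
    have : (φ n).comp (φ m) = φ n := by
      ext1 j
      rw [AlgHom.comp_apply, hφ, hφ]
      by_cases h : j.1 < m
      · rw [if_pos h, if_pos (h.trans_le hmn), map_zero]
      · rw [if_neg h, hφ]
    rw [RingHom.mem_ker] at hf ⊢
    rw [← this, AlgHom.comp_apply, hf, map_zero]
  have hlt : ∀ n (hn : n < 3), RingHom.ker (φ n) < RingHom.ker (φ (n + 1)) := by
    intro n hn
    refine lt_of_le_of_ne (hle _ _ (Nat.le_succ n)) fun h => ?_
    have h₁ : (X ⟨n, hn⟩ : MvPolynomial (Fin 3) Ω) ∈ RingHom.ker (φ (n + 1)) := by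
      rw [RingHom.mem_ker, hφ]; simp
    rw [← h, RingHom.mem_ker, hφ, if_neg (lt_irrefl n)] at h₁
    exact X_ne_zero _ h₁
  have hp : ∀ n, (RingHom.ker (φ n)).IsPrime := fun n => RingHom.ker_isPrime _
  have h₁ := Ideal.height_add_one_le_of_lt_of_isPrime (hlt 0 (by norm_num))
  have h₂ := Ideal.height_add_one_le_of_lt_of_isPrime (hlt 1 (by norm_num))
  have h₃ := Ideal.height_add_one_le_of_lt_of_isPrime (hlt 2 (by norm_num))
  have h₄ : RingHom.ker (φ 3) ≤ vanishingIdeal Ω {(0 : Fin 3 → Ω)} := by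
    intro f hf
    rw [mem_vanishingIdeal_singleton_iff]
    have : (aeval (0 : Fin 3 → Ω)).comp (φ 3) = aeval (0 : Fin 3 → Ω) := by
      ext1 j
      rw [AlgHom.comp_apply, hφ, if_pos j.2, map_zero, aeval_X]
      rfl
    rw [← this, AlgHom.comp_apply, hf, map_zero]
  refine le_trans ?_ (Ideal.height_mono h₄)
  calc (3 : ℕ∞) = 0 + 1 + 1 + 1 := by norm_num
    _ ≤ (RingHom.ker (φ 0)).height + 1 + 1 + 1 := by gcongr; exact bot_le
    _ ≤ (RingHom.ker (φ 1)).height + 1 + 1 := by gcongr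
    _ ≤ (RingHom.ker (φ 2)).height + 1 := by gcongr
    _ ≤ _ := h₃

/-- Two surfaces in affine 3-space that meet in the origin also meet in another point. -/
theorem MvPolynomial.exists_common_zero [IsAlgClosed Ω] {f g : MvPolynomial (Fin 3) Ω}
    (hf : eval 0 f = 0) (hg : eval 0 g = 0) : ∃ v, v ≠ 0 ∧ eval v f = 0 ∧ eval v g = 0 := by
  classical
  by_contra! hno
  set p := vanishingIdeal Ω {(0 : Fin 3 → Ω)} with hp
  set s : Finset (MvPolynomial (Fin 3) Ω) := {f, g} with hs
  have hz : zeroLocus Ω (Ideal.span (s : Set (MvPolynomial (Fin 3) Ω))) = {0} := by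
    rw [zeroLocus_span]
    ext v
    simp only [hs, Finset.coe_insert, Finset.coe_singleton, Set.mem_insert_iff,
      Set.mem_singleton_iff, forall_eq_or_imp, forall_eq, Set.mem_ofPred_eq]
    constructor
    · rintro ⟨h₁, h₂⟩
      by_contra hv
      exact hno v hv h₁ h₂
    · rintro rfl
      exact ⟨hf, hg⟩
  -- By the Nullstellensatz the ideal of the origin would be the radical of (f, g), hence minimal
  -- over two elements. Krull's height theorem then bounds its height by 2.
  have hrad : (Ideal.span (s : Set (MvPolynomial (Fin 3) Ω))).radical = p := by
    rw [← vanishingIdeal_zeroLocus_eq_radical (K := Ω), hz]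
  have hpp : p.IsPrime := by rw [hp]; infer_instance
  have hmin : p ∈ (Ideal.span (s : Set (MvPolynomial (Fin 3) Ω))).minimalPrimes := by
    rw [← Ideal.radical_minimalPrimes, hrad, Ideal.minimalPrimes_eq_subsingleton_self]
    rfl
  have h₁ := Ideal.height_le_card_of_mem_minimalPrimes_span_finset hmin
  have h₂ : s.card ≤ 2 := Finset.card_le_two
  have h₃ := (three_le_height_vanishingIdeal (Ω := Ω)).trans h₁
  have h₄ : (3 : ℕ∞) ≤ (2 : ℕ) := h₃.trans (by exact_mod_cast h₂)
  exact absurd h₄ (by norm_num)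

end CommonZero

/-! ### Smooth quartics are stable -/

section StableQuartic

variable {Ω : Type*} [Field Ω] [IsAlgClosed Ω]

/-- Smooth plane quartics are stable. -/
theorem IsNonsingular.isStablePlaneQuartic {g : MvPolynomial (Fin 3) Ω} (h : IsNonsingular g)
    (hg : g.IsHomogeneous 4) : IsStablePlaneQuartic g := by
  have hne : g ≠ 0 := by
    rintro rfl
    obtain ⟨i, hi⟩ := h 1 one_ne_zero (map_zero _)
    simp at hi
  -- A common zero of two factors away from the origin is a singular point of the product, by the
  -- product rule. So a smooth form has no two factors that both vanish at the origin.
  have key : ∀ A B, g = A * B → ¬ (eval 0 A = 0 ∧ eval 0 B = 0) := by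
    rintro A B rfl ⟨hA, hB⟩
    obtain ⟨v, hv, hA, hB⟩ := exists_common_zero hA hB
    obtain ⟨i, hi⟩ := h v hv (by rw [map_mul, hA, zero_mul])
    rw [Derivation.leibniz, map_add] at hi
    simp [hA, hB] at hi
  refine ⟨hg, hne, fun A hA => ?_, fun v hv h₀ h₁ => ?_, fun A B hAB hA hd => ?_⟩
  · obtain ⟨B, hB⟩ := hA
    rw [mul_assoc] at hB
    have hg' := hg
    rw [hB] at hg'
    obtain ⟨a, b, hab, ha, hb⟩ := hg'.exists_of_mul (hB ▸ hne)
    rcases eq_or_ne a 0 with rfl | ha₀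
    · exact ha.isUnit_of_zero (left_ne_zero_of_mul (hB ▸ hne))
    · have := ha.eval_zero_eq_zero ha₀
      exact absurd ⟨this, by rw [map_mul, this, zero_mul]⟩ (key _ _ hB)
  · obtain ⟨i, hi⟩ := h v hv h₀
    exact absurd (h₁ i) hi
  · have hg' := hg
    rw [hAB] at hg'
    obtain ⟨a, b, hab, ha, hb⟩ := hg'.exists_of_mul (hAB ▸ hne)
    rw [ha.totalDegree hA.ne_zero] at hd
    rcases eq_or_ne a 0 with rfl | ha₀
    · exact absurd (ha.isUnit_of_zero hA.ne_zero) hA.not_isUnit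
    · exact absurd ⟨ha.eval_zero_eq_zero ha₀, hb.eval_zero_eq_zero (by omega)⟩ (key _ _ hAB)

end StableQuartic

/-! ### Matrices of rank two -/

section Rank

variable {K : Type*} [Field K]

/-- The factorization through dimension 2 bounds the rank from above, the nonzero minor from below.
-/
theorem Matrix.rank_eq_two_of_mul {M : Matrix (Fin 3) (Fin 3) K} (P : Matrix (Fin 3) (Fin 2) K)
    (Q : Matrix (Fin 2) (Fin 3) K) (hM : M = P * Q) (f : Fin 2 → Fin 3)
    (hdet : (M.submatrix f f).det ≠ 0) : M.rank = 2 := by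
  refine le_antisymm ?_ ?_
  · rw [hM]
    exact (rank_mul_le_left P Q).trans (P.rank_le_width)
  · have h₁ : (M.submatrix f f).rank = 2 := by
      rw [rank_of_det_ne_zero hdet, Fintype.card_fin]
    exact h₁ ▸ rank_submatrix_le M f f

end Rank

/-! ### The degenerate fibre: a line and a nodal cubic -/

namespace ShiodaCoeffs

section SpecialFibre

variable {K : Type*} [Field K] {c : ShiodaCoeffs K}

theorem f₁_eq_zero (h₁ : c.p₁ = 0) (h₂ : c.q₁ = 0) : c.f₁ = 0 := by
  simp [f₁, h₁, h₂]

theorem quartic_eq_of_f₁_eq_zero (h : c.f₁ = 0) : c.quartic = C (-4) * (c.f₀ * c.f₂) := by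
  rw [quartic, h, map_neg, map_ofNat]
  ring

theorem f₀_ne_zero (h2 : (2 : K) ≠ 0) : c.f₀ ≠ 0 := by
  intro h
  have := (eval_pderiv_f₀ c 0).2.1
  rw [h] at this
  simp [h2] at this

theorem f₂_ne_zero : c.f₂ ≠ 0 := by
  intro h
  have := eval_f₂ c ![1, 0, 0]
  rw [h] at this
  simp at this

theorem quartic_ne_zero (h2 : (2 : K) ≠ 0) : c.quartic ≠ 0 := by
  intro h
  have e₀ := eval_quartic c ![1, 0, 0]
  have e₁ := eval_quartic c ![1, 1, 0]
  rw [h, eval_f₀, eval_f₁, eval_f₂] at e₀ e₁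
  simp only [map_zero, Matrix.cons_val_zero, Matrix.cons_val_one, Matrix.cons_val] at e₀ e₁
  exact pow_ne_zero 3 h2 (by linear_combination e₀ - e₁)

theorem irreducible_f₀ (h2 : (2 : K) ≠ 0) : Irreducible c.f₀ :=
  (isHomogeneous_f₀ c).irreducible one_ne_zero (f₀_ne_zero h2)
    fun g g' a b hab ha hb => by omega

theorem exists_eq_sum_of_isHomogeneous_one {g : MvPolynomial (Fin 3) K} (h : g.IsHomogeneous 1) :
    ∃ a : Fin 3 → K, ∀ v, eval v g = ∑ i, a i * v i := by
  have h' : g ∈ homogeneousSubmodule (Fin 3) K 1 := h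
  rw [homogeneousSubmodule_one_eq_span_X, Submodule.mem_span_range_iff_exists_fun] at h'
  obtain ⟨a, rfl⟩ := h'
  exact ⟨a, fun v => by simp [smul_eval]⟩

/-- Every line contains a point where f₂ is nonzero: one with W = 0, except for the lines X =
constant, on which f₂ still depends on Y. -/
theorem not_dvd_f₂ {g : MvPolynomial (Fin 3) K} (h : g.IsHomogeneous 1) : ¬ g ∣ c.f₂ := by
  rintro ⟨g', hg'⟩
  obtain ⟨a, ha⟩ := exists_eq_sum_of_isHomogeneous_one h
  have key : ∀ v, ∑ i, a i * v i = 0 → eval v c.f₂ = 0 := fun v hv => by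
    rw [hg', map_mul, ha, hv, zero_mul]
  simp only [Fin.sum_univ_three, eval_f₂] at key
  have h₁ : a 1 = 0 := by
    by_contra h₁
    have := key ![1, -a 0 / a 1, 0] (by simp; field_simp; ring)
    simp at this
  have h₀ : a 0 ≠ 0 := by
    intro h₀
    have := key ![1, 0, 0] (by simp [h₀])
    simp at this
  have e₀ := key ![-a 2 / a 0, 0, 1] (by simp; field_simp; ring)
  have e₁ := key ![-a 2 / a 0, 1, 1] (by simp [h₁]; field_simp; ring)
  simp only [Matrix.cons_val_zero, Matrix.cons_val_one, Matrix.cons_val] at e₀ e₁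
  exact one_ne_zero (α := K) (by linear_combination e₀ - e₁)

theorem irreducible_f₂ : Irreducible c.f₂ := by
  refine (isHomogeneous_f₂ c).irreducible (by norm_num) f₂_ne_zero
    fun g g' a b hab ha hb hg hg' h => ?_
  rcases (by omega : a = 1 ∨ b = 1) with rfl | rfl
  · exact not_dvd_f₂ hg (Dvd.intro _ h.symm)
  · exact not_dvd_f₂ hg' (Dvd.intro_left _ h.symm)

theorem eval_pderiv_pderiv_quartic (h : c.f₁ = 0) (v : Fin 3 → K) (i j : Fin 3) :
    eval v (pderiv i (pderiv j c.quartic)) = -4 * (eval v c.f₀ * eval v (pderiv i (pderiv j c.f₂)) +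
      eval v (pderiv i c.f₀) * eval v (pderiv j c.f₂) +
      eval v (pderiv j c.f₀) * eval v (pderiv i c.f₂)) := by
  have h0 : pderiv i (pderiv j c.f₀) = 0 := by
    have h2 : (2 : MvPolynomial (Fin 3) K) = C 2 := (map_ofNat C 2).symm
    rw [f₀, h2]
    simp [pderiv_X, Pi.single_apply]
    split_ifs <;> simp
  rw [quartic_eq_of_f₁_eq_zero h]
  simp only [Derivation.leibniz, smul_eq_mul, map_add, map_mul, eval_C, pderiv_C, h0, mul_zero,
    zero_add, add_zero]
  ring

theorem eval_hessian_f₂ (v : Fin 3 → K) :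
    (Matrix.of fun i j => eval v (pderiv i (pderiv j c.f₂))) =
      !![6 * v 0, 0, 2 * c.p₀ * v 2; 0, -2 * v 2, -2 * v 1;
        2 * c.p₀ * v 2, -2 * v 1, 2 * c.p₀ * v 0 + 6 * c.q₀ * v 2] := by
  have h2 : ∀ i : Fin 3, pderiv i (2 : MvPolynomial (Fin 3) K) = 0 := fun i => by
    rw [← map_ofNat C 2, pderiv_C]
  have h3 : ∀ i : Fin 3, pderiv i (3 : MvPolynomial (Fin 3) K) = 0 := fun i => by
    rw [← map_ofNat C 3, pderiv_C]
  ext i j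
  fin_cases i <;> fin_cases j <;>
    simp [f₂, pderiv_X, Derivation.leibniz, Derivation.leibniz_pow, h2, h3] <;> ring

/-- A cubic polynomial with three distinct roots. -/
theorem cubic_eq_of_roots {x₁ x₂ x₃ a b d : K} (h₁₂ : x₁ ≠ x₂) (h₁₃ : x₁ ≠ x₃) (h₂₃ : x₂ ≠ x₃)
    (h₁ : x₁ ^ 3 + a * x₁ ^ 2 + b * x₁ + d = 0) (h₂ : x₂ ^ 3 + a * x₂ ^ 2 + b * x₂ + d = 0)
    (h₃ : x₃ ^ 3 + a * x₃ ^ 2 + b * x₃ + d = 0) :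
    a = -(x₁ + x₂ + x₃) ∧ b = x₁ * x₂ + x₁ * x₃ + x₂ * x₃ ∧ d = -(x₁ * x₂ * x₃) := by
  have n₁₂ := sub_ne_zero.2 h₁₂
  have n₁₃ := sub_ne_zero.2 h₁₃
  have n₂₃ := sub_ne_zero.2 h₂₃
  have e₁₂ : x₁ ^ 2 + x₁ * x₂ + x₂ ^ 2 + a * (x₁ + x₂) + b = 0 :=
    mul_left_cancel₀ n₁₂ (by linear_combination h₁ - h₂)
  have e₁₃ : x₁ ^ 2 + x₁ * x₃ + x₃ ^ 2 + a * (x₁ + x₃) + b = 0 :=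
    mul_left_cancel₀ n₁₃ (by linear_combination h₁ - h₃)
  have ha : a = -(x₁ + x₂ + x₃) := mul_left_cancel₀ n₂₃ (by linear_combination e₁₂ - e₁₃)
  subst ha
  have hb : b = x₁ * x₂ + x₁ * x₃ + x₂ * x₃ := by linear_combination e₁₂
  subst hb
  exact ⟨rfl, rfl, by linear_combination h₁⟩

/-- The data of the degenerate fibre: the cubic `f₂` has a node in `(x₀, 0)`, and the line `f₀` meets
it in three distinct points. -/
structure IsNodal (c : ShiodaCoeffs K) (x₀ : K) (b e : Fin 3 → K) : Prop where
  two_ne : (2 : K) ≠ 0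
  three_ne : (3 : K) ≠ 0
  f₁ : c.f₁ = 0
  p₀ : c.p₀ = -3 * x₀ ^ 2
  q₀ : c.q₀ = 2 * x₀ ^ 3
  node_ne : x₀ ≠ 0
  inj : Function.Injective b
  line : ∀ i, 2 * e i = c.p₂ * b i + c.q₂
  curve : ∀ i, e i ^ 2 = b i ^ 3 + c.p₀ * b i + c.q₀

namespace IsNodal

variable {x₀ : K} {b e : Fin 3 → K}

/-- The offsets `b i` are the three roots of 4(x³ + p₀x + q₀) - (p₂x + q₂)², the restriction of the
cubic to the line. -/
theorem vieta (H : c.IsNodal x₀ b e) : -(c.p₂ ^ 2) = -4 * (b 0 + b 1 + b 2) ∧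
    4 * c.p₀ - 2 * c.p₂ * c.q₂ = 4 * (b 0 * b 1 + b 0 * b 2 + b 1 * b 2) ∧
    4 * c.q₀ - c.q₂ ^ 2 = -4 * (b 0 * b 1 * b 2) := by
  have h2 := H.two_ne
  have h4 : (4 : K) ≠ 0 := by
    rw [show (4 : K) = 2 ^ 2 by norm_num]; exact pow_ne_zero _ h2
  have key : ∀ i, b i ^ 3 + -(c.p₂ ^ 2) / 4 * b i ^ 2 + (4 * c.p₀ - 2 * c.p₂ * c.q₂) / 4 * b i +
      (4 * c.q₀ - c.q₂ ^ 2) / 4 = 0 := by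
    intro i
    field_simp
    linear_combination -4 * H.curve i + (2 * e i + c.p₂ * b i + c.q₂) * H.line i
  obtain ⟨h₁, h₂, h₃⟩ := cubic_eq_of_roots (H.inj.ne (by decide)) (H.inj.ne (by decide))
    (H.inj.ne (by decide)) (key 0) (key 1) (key 2)
  rw [div_eq_iff h4] at h₁ h₂ h₃
  exact ⟨by linear_combination h₁, by linear_combination h₂, by linear_combination h₃⟩

theorem exists_eq (H : c.IsNodal x₀ b e) {x y : K} (h₀ : 2 * y = c.p₂ * x + c.q₂)
    (h₂ : y ^ 2 = x ^ 3 + c.p₀ * x + c.q₀) : ∃ i, x = b i ∧ y = e i := by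
  obtain ⟨v₁, v₂, v₃⟩ := H.vieta
  have h4 : (4 : K) ≠ 0 := by
    rw [show (4 : K) = 2 ^ 2 by norm_num]; exact pow_ne_zero _ H.two_ne
  have h : 4 * ((x - b 0) * (x - b 1) * (x - b 2)) = 0 := by
    linear_combination -4 * h₂ + (2 * y + c.p₂ * x + c.q₂) * h₀ - x ^ 2 * v₁ - x * v₂ - v₃
  have : ∃ i, x = b i := by
    rcases mul_eq_zero.1 ((mul_eq_zero.1 h).resolve_left h4) with h | h
    · rcases mul_eq_zero.1 h with h | h
      exacts [⟨0, sub_eq_zero.1 h⟩, ⟨1, sub_eq_zero.1 h⟩]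
    · exact ⟨2, sub_eq_zero.1 h⟩
  obtain ⟨i, rfl⟩ := this
  exact ⟨i, rfl, mul_left_cancel₀ H.two_ne (by rw [h₀, H.line])⟩

/-- Transversality of the line and the cubic: up to a factor 4 this is the derivative of that
polynomial at a root, the product of the differences to the other two. -/
theorem slope_ne (H : c.IsNodal x₀ b e) (i : Fin 3) :
    3 * b i ^ 2 + c.p₀ - c.p₂ * e i ≠ 0 := by
  obtain ⟨v₁, v₂, v₃⟩ := H.vieta
  have h4 : (4 : K) ≠ 0 := by
    rw [show (4 : K) = 2 ^ 2 by norm_num]; exact pow_ne_zero _ H.two_ne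
  have n₁ : b 0 - b 1 ≠ 0 := sub_ne_zero.2 (H.inj.ne (by decide))
  have n₂ : b 0 - b 2 ≠ 0 := sub_ne_zero.2 (H.inj.ne (by decide))
  have n₃ : b 1 - b 2 ≠ 0 := sub_ne_zero.2 (H.inj.ne (by decide))
  intro h
  have h' := H.line i
  fin_cases i
  · exact mul_ne_zero h4 (mul_ne_zero n₁ n₂) (by
      simp only [Fin.zero_eta] at h h'
      linear_combination 4 * h + 2 * c.p₂ * h' - 2 * b 0 * v₁ - v₂)
  · exact mul_ne_zero h4 (mul_ne_zero n₁ n₃) (by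
      simp only [Fin.mk_one] at h h'
      linear_combination -4 * h - 2 * c.p₂ * h' + 2 * b 1 * v₁ + v₂)
  · exact mul_ne_zero h4 (mul_ne_zero n₂ n₃) (by
      simp only [Fin.reduceFinMk] at h h'
      linear_combination 4 * h + 2 * c.p₂ * h' - 2 * b 2 * v₁ - v₂)

/-- The points of the line `f₀` on the cubic `f₂`. -/
theorem exists_smul_eq (H : c.IsNodal x₀ b e) {v : Fin 3 → K} (hv : v ≠ 0)
    (h₀ : eval v c.f₀ = 0) (h₂ : eval v c.f₂ = 0) :
    ∃ i w, w ≠ 0 ∧ v = ![b i * w, e i * w, w] := by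
  rw [eval_f₀] at h₀
  rw [eval_f₂] at h₂
  have hw : v 2 ≠ 0 := by
    intro hw
    rw [hw] at h₀ h₂
    have hx : v 0 = 0 := pow_eq_zero_iff (n := 3) (by norm_num) |>.1 (by linear_combination h₂)
    have hy : v 1 = 0 := by
      rw [hx] at h₀
      exact (mul_eq_zero.1 (by linear_combination -h₀ : 2 * v 1 = 0)).resolve_left H.two_ne
    exact hv (by funext i; fin_cases i <;> assumption)
  obtain ⟨x, hx⟩ : ∃ x, v 0 = x * v 2 := ⟨v 0 / v 2, by field_simp⟩
  obtain ⟨y, hy⟩ : ∃ y, v 1 = y * v 2 := ⟨v 1 / v 2, by field_simp⟩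
  rw [hx, hy] at h₀ h₂
  obtain ⟨i, rfl, rfl⟩ := H.exists_eq (x := x) (y := y)
    (mul_left_cancel₀ hw (by linear_combination -h₀))
    (mul_left_cancel₀ (pow_ne_zero 3 hw) (by linear_combination -h₂))
  exact ⟨i, v 2, hw, by funext j; fin_cases j <;> simp [hx, hy]⟩

/-- A singular point lies either on both components, where the Hessian is the symmetric product of
the two gradients up to a scalar, or off the line and at the node of the cubic, where it is a
multiple of the Hessian of f₂. -/
theorem rank_hessian (H : c.IsNodal x₀ b e) {v : Fin 3 → K} (hv : v ≠ 0)
    (h : eval v c.quartic = 0) (hd : ∀ i, eval v (pderiv i c.quartic) = 0) :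
    (Matrix.of fun i j => eval v (pderiv i (pderiv j c.quartic))).rank = 2 := by
  have h2 := H.two_ne
  have h4 : (4 : K) ≠ 0 := by
    rw [show (4 : K) = 2 ^ 2 by norm_num]; exact pow_ne_zero _ h2
  have hM : (Matrix.of fun i j => eval v (pderiv i (pderiv j c.quartic))) =
      Matrix.of fun i j => -4 * (eval v c.f₀ *
        (Matrix.of fun i j => eval v (pderiv i (pderiv j c.f₂))) i j +
      eval v (pderiv i c.f₀) * eval v (pderiv j c.f₂) +
      eval v (pderiv j c.f₀) * eval v (pderiv i c.f₂)) := by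
    ext i j
    exact eval_pderiv_pderiv_quartic H.f₁ v i j
  rw [hM, eval_hessian_f₂]
  have hd' : ∀ i, eval v (pderiv i c.f₀) * eval v c.f₂ + eval v c.f₀ * eval v (pderiv i c.f₂) = 0 := by
    intro i
    have := hd i
    rw [eval_pderiv_quartic, H.f₁] at this
    exact (mul_eq_zero.1 (by simp only [map_zero] at this; linear_combination -this :
      4 * (eval v (pderiv i c.f₀) * eval v c.f₂ + eval v c.f₀ * eval v (pderiv i c.f₂)) = 0)).resolve_left h4
  have h' : eval v c.f₀ * eval v c.f₂ = 0 := by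
    rw [eval_quartic, H.f₁] at h
    exact (mul_eq_zero.1 (by simp only [map_zero] at h; linear_combination -h :
      4 * (eval v c.f₀ * eval v c.f₂) = 0)).resolve_left h4
  obtain ⟨a₀, a₁, a₂⟩ := eval_pderiv_f₀ c v
  obtain ⟨d₀, d₁, d₂⟩ := eval_pderiv_f₂ c v
  by_cases hf₀ : eval v c.f₀ = 0
  · have hf₂ : eval v c.f₂ = 0 := by
      have := hd' 1
      rw [a₁, hf₀, zero_mul, add_zero] at this
      exact (mul_eq_zero.1 this).resolve_left (neg_ne_zero.2 h2)
    obtain ⟨i, w, hw, rfl⟩ := H.exists_smul_eq hv hf₀ hf₂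
    have hs := H.slope_ne i
    rw [hf₀]
    generalize eval ![b i * w, e i * w, w] c.f₂ = f at *
    refine Matrix.rank_eq_two_of_mul
      (Matrix.of fun j l => -4 * ![eval ![b i * w, e i * w, w] (pderiv j c.f₀),
        eval ![b i * w, e i * w, w] (pderiv j c.f₂)] l)
      (Matrix.of fun l j => ![eval ![b i * w, e i * w, w] (pderiv j c.f₂),
        eval ![b i * w, e i * w, w] (pderiv j c.f₀)] l) ?_ ![0, 1] ?_
    · ext j l
      simp [Matrix.mul_apply, Fin.sum_univ_two]
      ring
    · rw [Matrix.det_fin_two]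
      simp only [Matrix.submatrix_apply, Matrix.of_apply, Matrix.cons_val_zero, Matrix.cons_val_one,
        a₀, a₁, d₀, d₁, Matrix.cons_val]
      -- The upper left minor is minus this square; the last factor is nonzero by transversality.
      have : (-4 * 2 * w ^ 2 * (3 * b i ^ 2 + c.p₀ - c.p₂ * e i)) ^ 2 ≠ 0 :=
        pow_ne_zero _ (mul_ne_zero (mul_ne_zero (mul_ne_zero (neg_ne_zero.2 h4) h2)
          (pow_ne_zero _ hw)) hs)
      intro h
      exact this (by linear_combination -h)
  · have hf₂ : eval v c.f₂ = 0 := (mul_eq_zero.1 h').resolve_left hf₀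
    have hz : ∀ i, eval v (pderiv i c.f₂) = 0 := fun i =>
      (mul_eq_zero.1 (by simpa [hf₂] using hd' i)).resolve_left hf₀
    rw [hz] at d₀ d₁ d₂
    have hw : v 2 ≠ 0 := by
      intro hw
      rw [hw] at d₀ d₂
      have hx : v 0 = 0 := pow_eq_zero_iff (n := 2) (by norm_num) |>.1
        ((mul_eq_zero.1 (by linear_combination -d₀ : 3 * v 0 ^ 2 = 0)).resolve_left H.three_ne)
      have hy : v 1 = 0 := pow_eq_zero_iff (n := 2) (by norm_num) |>.1 (by linear_combination d₂)
      exact hv (by funext i; fin_cases i <;> assumption)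
    have hy : v 1 = 0 := (mul_eq_zero.1 ((mul_eq_zero.1 (by linear_combination d₁ :
      2 * (v 1 * v 2) = 0)).resolve_left h2)).resolve_right hw
    rw [eval_f₂] at hf₂
    obtain ⟨x, hx⟩ : ∃ x, v 0 = x * v 2 := ⟨v 0 / v 2, by field_simp⟩
    rw [hx, hy, H.p₀, H.q₀] at hf₂
    rw [hx, H.p₀] at d₀
    have E₀ : x ^ 2 - x₀ ^ 2 = 0 := (mul_eq_zero.1 (by linear_combination -d₀ :
      3 * v 2 ^ 2 * (x ^ 2 - x₀ ^ 2) = 0)).resolve_left (mul_ne_zero H.three_ne (pow_ne_zero 2 hw))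
    have E₂ : (x - x₀) ^ 2 * (x + 2 * x₀) = 0 := (mul_eq_zero.1 (by linear_combination hf₂ :
      v 2 ^ 3 * ((x - x₀) ^ 2 * (x + 2 * x₀)) = 0)).resolve_left (pow_ne_zero 3 hw)
    -- The curve allows x = x₀ and x = -2x₀, and the derivative x = ±x₀. The second value would
    -- require 3x₀² = 0.
    have hxx : x = x₀ := by
      rcases mul_eq_zero.1 E₂ with h | h
      · exact sub_eq_zero.1 (pow_eq_zero_iff (n := 2) (by norm_num) |>.1 h)
      · exfalso
        have : x = -2 * x₀ := by linear_combination h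
        rw [this] at E₀
        exact mul_ne_zero H.three_ne (pow_ne_zero 2 H.node_ne) (by linear_combination E₀)
    subst hxx
    set k := -4 * eval v c.f₀ * v 2 with hk
    have hk₀ : k ≠ 0 := mul_ne_zero (mul_ne_zero (neg_ne_zero.2 h4) hf₀) hw
    -- At the node [x : 0 : 1] the Hessian kills the vector (x, 0, 1), which produces this
    -- factorization.
    refine Matrix.rank_eq_two_of_mul (k • !![6 * x, 0; 0, -2; -6 * x ^ 2, 0])
      !![1, 0, -x; 0, 1, 0] ?_ ![0, 1] ?_
    · ext i j
      simp only [hz, mul_zero, add_zero]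
      fin_cases i <;> fin_cases j <;>
        simp [Matrix.mul_apply, Fin.sum_univ_two, hx, hy, H.p₀, H.q₀, hk] <;> ring
    · rw [Matrix.det_fin_two]
      simp only [hz, mul_zero, add_zero]
      simp [hx, H.node_ne, hw, h2, hf₀, h4]
      rw [show (6 : K) = 2 * 3 by norm_num]
      exact mul_ne_zero h2 H.three_ne

theorem totalDegree_f₂ : c.f₂.totalDegree = 3 := (isHomogeneous_f₂ c).totalDegree f₂_ne_zero

/-- The quartic is -4f₀f₂ with f₀ and f₂ irreducible and not associated. The only component of
degree at most 2 is the line, which meets the cubic in three points; the nodal cubic has arithmetic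
genus one. -/
theorem isStablePlaneQuartic (H : c.IsNodal x₀ b e) : IsStablePlaneQuartic c.quartic := by
  have h4 : (-4 : K) ≠ 0 := by
    rw [show (-4 : K) = -2 ^ 2 by norm_num]; exact neg_ne_zero.2 (pow_ne_zero _ H.two_ne)
  have hu : IsUnit (C (-4) : MvPolynomial (Fin 3) K) := (isUnit_iff_ne_zero.2 h4).map C
  have hq := quartic_eq_of_f₁_eq_zero H.f₁
  refine ⟨isHomogeneous_quartic c, quartic_ne_zero H.two_ne, ?_, fun v => H.rank_hessian,
    fun A B hAB hA hd => ?_⟩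
  · rw [hq, squarefree_mul_iff, squarefree_mul_iff]
    exact ⟨hu.isRelPrime_left, hu.squarefree,
      (irreducible_f₀ H.two_ne).isRelPrime_iff_not_dvd.2 fun h => not_dvd_f₂ (isHomogeneous_f₀ c) h,
      (irreducible_f₀ H.two_ne).squarefree, irreducible_f₂.squarefree⟩
  · have hdvd : A ∣ c.f₀ := by
      have h₁ : A ∣ C (-4) * (c.f₀ * c.f₂) := hq ▸ Dvd.intro _ hAB.symm
      rcases hA.prime.dvd_or_dvd ((hu.dvd_mul_left).1 h₁) with h | h
      · exact h
      · exfalso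
        have h₂ := totalDegree_le_of_dvd_of_isDomain (hA.associated_of_dvd irreducible_f₂ h).symm.dvd
          hA.ne_zero
        rw [totalDegree_f₂] at h₂
        omega
    obtain ⟨D, hD⟩ := hdvd
    have hDu : IsUnit D := ((irreducible_f₀ H.two_ne).isUnit_or_isUnit hD).resolve_left hA.not_isUnit
    have hB : B = C (-4) * (D * c.f₂) := by
      refine mul_left_cancel₀ hA.ne_zero ?_
      rw [← hAB, hq, hD]
      ring
    have hne : ∀ i, ![b i, e i, 1] ≠ 0 := fun i h => one_ne_zero (α := K) (congrFun h 2)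
    let P : Fin 3 → Projectivization K (Fin 3 → K) := fun i => Projectivization.mk K _ (hne i)
    have hP : Function.Injective P := by
      intro i j h
      obtain ⟨a, ha⟩ := (Projectivization.mk_eq_mk_iff' K _ _ (hne i) (hne j)).1 h
      have h₁ : a = 1 := by simpa using congrFun ha 2
      exact H.inj (by simpa [h₁] using (congrFun ha 0).symm)
    have hsub : Set.range P ⊆
        {P : Projectivization K (Fin 3 → K) | eval P.rep A = 0 ∧ eval P.rep B = 0} := by
      rintro _ ⟨i, rfl⟩
      obtain ⟨a, ha⟩ := Projectivization.exists_smul_eq_mk_rep K _ (hne i)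
      change eval (Projectivization.mk K _ (hne i)).rep A = 0 ∧
        eval (Projectivization.mk K _ (hne i)).rep B = 0
      rw [← ha]
      have h₀ : eval (a • ![b i, e i, 1]) c.f₀ = 0 := by
        rw [eval_f₀]
        simp only [Pi.smul_apply, Units.smul_def, smul_eq_mul, Matrix.cons_val_zero,
          Matrix.cons_val_one, Matrix.cons_val]
        linear_combination -(a : K) * H.line i
      have h₂ : eval (a • ![b i, e i, 1]) c.f₂ = 0 := by
        rw [eval_f₂]
        simp only [Pi.smul_apply, Units.smul_def, smul_eq_mul, Matrix.cons_val_zero,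
          Matrix.cons_val_one, Matrix.cons_val]
        linear_combination -(a : K) ^ 3 * H.curve i
      refine ⟨?_, by rw [hB, map_mul, map_mul, h₂, mul_zero, mul_zero]⟩
      rw [hD, map_mul] at h₀
      exact (mul_eq_zero.1 h₀).resolve_right (hDu.map (eval _)).ne_zero
    exact (by simp : (3 : ℕ∞) ≤ ENat.card (Fin 3)).trans
      (hP.encard_range.trans (Set.encard_le_encard hsub))

end IsNodal

end SpecialFibre

end ShiodaCoeffs

/-! ### The coefficients of the degenerate fibre -/

namespace ShiodaCoeffs

section SpecialFibre

variable {K : Type*} [Field K]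

/-- With p₀ = -3x₀² and q₀ = 2x₀³ the cubic x³ + p₀x + q₀ is (x - x₀)²(x + 2x₀), which exhibits the
node. -/
theorem intCoeffs_zero (B D : K) :
    (intCoeffs 0 B D).p₁ = 0 ∧ (intCoeffs 0 B D).q₁ = 0 ∧
    (intCoeffs 0 B D).p₀ = -3 * (27 * (81 - 18 * B - 18 * D + (B - D) ^ 2)) ^ 2 ∧
    (intCoeffs 0 B D).q₀ = 2 * (27 * (81 - 18 * B - 18 * D + (B - D) ^ 2)) ^ 3 := by
  refine ⟨?_, ?_, ?_, ?_⟩ <;>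
    simp only [intCoeffs, ofPlane, off₁₂, off₃₄, off₅₆, planeX, planeC] <;> ring

/-- The fibre `θ = 0` is the union of a nodal cubic and a line. -/
theorem exists_isNodal_pairCoeffs {h B D : K} (h2 : (2 : K) ≠ 0) (h3 : (3 : K) ≠ 0) (hh : h ≠ 0)
    (hB : B ≠ 0) (hD : D ≠ 0) (hBD : B ≠ D) (hB9 : B ≠ 9) (hD9 : D ≠ 9)
    (hn : 81 - 18 * B - 18 * D + (B - D) ^ 2 ≠ 0) :
    ∃ x₀ b e, (pairCoeffs h 0 B D).IsNodal x₀ b e := by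
  obtain ⟨i₁, i₂, i₃, i₄⟩ := intCoeffs_zero B D
  have hpl := isPlane_intCoeffs (0 : K) B D
  -- For θ = 0 the three lines in the plane have slope 0, so they pass through [0:0:1:0] and project
  -- to the points where the line f₀ meets the cubic f₂.
  obtain ⟨d₁, e₁, l₁⟩ : ∃ d e, (intCoeffs 0 B D).IsLine 0 (off₁₂ 0 B D) d e := by
    have := hpl.swap₁₃.isLine₃
    rw [mul_zero, mul_zero] at this
    exact ⟨_, _, this⟩
  obtain ⟨d₂, e₂, l₂⟩ : ∃ d e, (intCoeffs 0 B D).IsLine 0 (off₃₄ 0 B D) d e := by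
    have := hpl.swap₂₃.isLine₃
    rw [mul_zero, mul_zero] at this
    exact ⟨_, _, this⟩
  obtain ⟨d₃, e₃, l₃⟩ : ∃ d e, (intCoeffs 0 B D).IsLine 0 (off₅₆ 0 B D) d e := by
    have := hpl.isLine₃
    rw [mul_zero, mul_zero] at this
    exact ⟨_, _, this⟩
  have l : ∀ i, ∃ d, (pairCoeffs h 0 B D).IsLine 0
      (![h ^ 4 * off₁₂ 0 B D, h ^ 4 * off₃₄ 0 B D, h ^ 4 * off₅₆ 0 B D] i) d
      (![h ^ 6 * e₁, h ^ 6 * e₂, h ^ 6 * e₃] i) := by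
    have s₁ := l₁.scale h
    have s₂ := l₂.scale h
    have s₃ := l₃.scale h
    rw [mul_zero] at s₁ s₂ s₃
    intro i
    fin_cases i
    exacts [⟨_, s₁⟩, ⟨_, s₂⟩, ⟨_, s₃⟩]
  have h27 : (27 : K) ≠ 0 := by
    rw [show (27 : K) = 3 ^ 3 by norm_num]; exact pow_ne_zero _ h3
  have h324 : (324 : K) ≠ 0 := by
    rw [show (324 : K) = 2 ^ 2 * 3 ^ 4 by norm_num]
    exact mul_ne_zero (pow_ne_zero _ h2) (pow_ne_zero _ h3)
  have hh4 := pow_ne_zero 4 hh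
  -- The hypotheses on `B` and `D`, apart from the one for the node, are the nonvanishing of the
  -- factors of these three differences.
  have o₁ : h ^ 4 * off₁₂ 0 B D - h ^ 4 * off₃₄ 0 B D = h ^ 4 * (324 * (B * (D - 9))) := by
    simp only [off₁₂, off₃₄]; ring
  have o₂ : h ^ 4 * off₁₂ 0 B D - h ^ 4 * off₅₆ 0 B D = h ^ 4 * (324 * (D * (B - 9))) := by
    simp only [off₁₂, off₅₆]; ring
  have o₃ : h ^ 4 * off₃₄ 0 B D - h ^ 4 * off₅₆ 0 B D =
      h ^ 4 * (324 * (3 ^ 2 * (B - D))) := by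
    simp only [off₃₄, off₅₆]; ring
  have n₁ : h ^ 4 * off₁₂ 0 B D ≠ h ^ 4 * off₃₄ 0 B D := by
    rw [← sub_ne_zero, o₁]
    exact mul_ne_zero hh4 (mul_ne_zero h324 (mul_ne_zero hB (sub_ne_zero.2 hD9)))
  have n₂ : h ^ 4 * off₁₂ 0 B D ≠ h ^ 4 * off₅₆ 0 B D := by
    rw [← sub_ne_zero, o₂]
    exact mul_ne_zero hh4 (mul_ne_zero h324 (mul_ne_zero hD (sub_ne_zero.2 hB9)))
  have n₃ : h ^ 4 * off₃₄ 0 B D ≠ h ^ 4 * off₅₆ 0 B D := by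
    rw [← sub_ne_zero, o₃]
    exact mul_ne_zero hh4 (mul_ne_zero h324 (mul_ne_zero (pow_ne_zero _ h3) (sub_ne_zero.2 hBD)))
  refine ⟨h ^ 4 * (27 * (81 - 18 * B - 18 * D + (B - D) ^ 2)),
    ![h ^ 4 * off₁₂ 0 B D, h ^ 4 * off₃₄ 0 B D, h ^ 4 * off₅₆ 0 B D],
    ![h ^ 6 * e₁, h ^ 6 * e₂, h ^ 6 * e₃], h2, h3, ?_, ?_, ?_,
    mul_ne_zero hh4 (mul_ne_zero h27 hn), ?_, fun i => ?_, fun i => ?_⟩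
  · exact f₁_eq_zero (by simp [pairCoeffs, scale, i₁]) (by simp [pairCoeffs, scale, i₂])
  · simp only [pairCoeffs, scale, i₃]; ring
  · simp only [pairCoeffs, scale, i₄]; ring
  · intro i j hij
    fin_cases i <;> fin_cases j <;> first | rfl | exfalso
    exacts [n₁ hij, n₂ hij, n₁ hij.symm, n₃ hij, n₂ hij.symm, n₃ hij.symm]
  · obtain ⟨d, hl⟩ := l i
    have hd : d = 0 := (mul_eq_zero.1 (by linear_combination hl.eq₃ : 2 * d = 0)).resolve_left h2
    have := hl.eq₂
    rw [hd] at this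
    linear_combination this
  · obtain ⟨d, hl⟩ := l i
    linear_combination hl.eq₀

end SpecialFibre

/-! ### The stable model over k⟦t⟧ -/

section BaseRing

variable {k : Type*} [Field k]

/-- The coefficients over `k⟦t⟧` of the construction with the parameters `u = r ^ 2` and
`D = m ^ 2`. -/
noncomputable def seriesCoeffs (u D : k) : ShiodaCoeffs (PowerSeries k) :=
  pairCoeffs (PowerSeries.C 6⁻¹) (PowerSeries.C 3⁻¹ * PowerSeries.X) (PowerSeries.C u)
    (PowerSeries.C D)

variable {K : Type*} [Field K] {φ : PowerSeries k →+* K} {u D : k} {s r m : K}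

theorem seriesCoeffs_map (h6 : (6 : k) ≠ 0) (h3 : (3 : k) ≠ 0) :
    (seriesCoeffs u D).map φ = pairCoeffs 6⁻¹ (φ PowerSeries.X / 3) (φ (PowerSeries.C u))
      (φ (PowerSeries.C D)) := by
  have h : ∀ x : k, x ≠ 0 → φ (PowerSeries.C x⁻¹) = (φ (PowerSeries.C x))⁻¹ := fun x hx => by
    refine eq_inv_of_mul_eq_one_left ?_
    rw [← map_mul, ← map_mul, inv_mul_cancel₀ hx, map_one, map_one]
  rw [seriesCoeffs, pairCoeffs_map, map_mul, h 6 h6, h 3 h3, map_ofNat, map_ofNat, map_ofNat,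
    map_ofNat, mul_comm, div_eq_mul_inv]

theorem seriesCoeffs_map_eq_fieldCoeffs (h6 : (6 : k) ≠ 0) (h3 : (3 : k) ≠ 0)
    (hs : s ^ 2 = φ PowerSeries.X) (hr : r ^ 2 = φ (PowerSeries.C u))
    (hm : m ^ 2 = φ (PowerSeries.C D)) : (seriesCoeffs u D).map φ = fieldCoeffs (s / 3) r m := by
  have h3' : (3 : K) ≠ 0 := by
    have := ((isUnit_iff_ne_zero.2 h3).map (φ.comp PowerSeries.C)).ne_zero
    rwa [map_ofNat] at this
  have : φ PowerSeries.X / 3 = 3 * (s / 3) ^ 2 := by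
    rw [← hs]
    field_simp
  rw [seriesCoeffs_map h6 h3, fieldCoeffs, hr, hm, this]

/-- Over a discrete valuation ring flat means torsion-free. The quartic is nonzero modulo the prime
t, so t can be cancelled from a multiple of it. -/
theorem flat_quotient_span_quartic (h2 : (2 : k) ≠ 0) (c : ShiodaCoeffs (PowerSeries k)) :
    Module.Flat (PowerSeries k) (MvPolynomial (Fin 3) (PowerSeries k) ⧸ Ideal.span {c.quartic}) := by
  have hnd : ¬ (C PowerSeries.X : MvPolynomial (Fin 3) (PowerSeries k)) ∣ c.quartic := by
    rintro ⟨f, hf⟩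
    have := congrArg (MvPolynomial.map (PowerSeries.constantCoeff (R := k))) hf
    rw [← map_quartic, map_mul, map_C, PowerSeries.constantCoeff_X, C_0, zero_mul] at this
    exact quartic_ne_zero h2 this
  have hX : Prime (C PowerSeries.X : MvPolynomial (Fin 3) (PowerSeries k)) :=
    (prime_C_iff _).2 PowerSeries.X_prime
  have step : ∀ f, c.quartic ∣ C PowerSeries.X * f → c.quartic ∣ f := by
    rintro f ⟨g, hg⟩
    obtain ⟨g', rfl⟩ := (hX.dvd_or_dvd (Dvd.intro _ hg)).resolve_left hnd
    exact ⟨g', mul_left_cancel₀ hX.ne_zero (by rw [hg]; ring)⟩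
  have step' : ∀ (n : ℕ) (f), c.quartic ∣ C (PowerSeries.X ^ n) * f → c.quartic ∣ f := by
    intro n
    induction n with
    | zero => intro f; simp
    | succ n ih =>
      intro f hf
      rw [pow_succ', C_mul, mul_assoc] at hf
      exact ih f (step _ hf)
  rw [Module.Flat.flat_iff_torsion_eq_bot_of_isBezout, eq_bot_iff]
  intro x hx
  obtain ⟨⟨a, ha⟩, hax⟩ := (Submodule.mem_torsion_iff x).1 hx
  obtain ⟨f, rfl⟩ := Ideal.Quotient.mk_surjective x
  have ha₀ : a ≠ 0 := nonZeroDivisors.ne_zero ha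
  obtain ⟨n, v, rfl⟩ : ∃ (n : ℕ) (v : (PowerSeries k)ˣ), a = PowerSeries.X ^ n * (v : PowerSeries k) := by
    obtain ⟨n, v, h⟩ := IsDiscreteValuationRing.associated_pow_irreducible ha₀
      (PowerSeries.X_prime (R := k)).irreducible
    exact ⟨n, v⁻¹, by rw [← h, mul_assoc, Units.mul_inv, mul_one]⟩
  have hdvd : c.quartic ∣ C (PowerSeries.X ^ n * (v : PowerSeries k)) * f := by
    rw [← Ideal.mem_span_singleton, ← Ideal.Quotient.eq_zero_iff_mem, ← smul_eq_C_mul]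
    exact hax
  rw [C_mul, mul_assoc] at hdvd
  have hv : IsUnit (C (v : PowerSeries k) : MvPolynomial (Fin 3) (PowerSeries k)) := v.isUnit.map C
  rw [Submodule.mem_bot, Ideal.Quotient.eq_zero_iff_mem, Ideal.mem_span_singleton]
  exact hv.dvd_mul_left.1 (step' n _ hdvd)

/-- The stable model over `k⟦t⟧`. -/
theorem isStablePlaneQuarticOver_seriesCoeffs {p : ℕ} [CharP k p] (hp : 11 ≤ p) (hu : ¬ IsSquare u)
    (hD : D = 1 ∨ D = 4 * u) : IsStablePlaneQuarticOver (seriesCoeffs u D).quartic := by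
  have hk : ∀ n : ℤ, 0 < n → n ≤ 10 → (n : k) ≠ 0 := fun n hn hn' h => by
    have := intCast_eq_zero_of_abs_lt (p := p) (by rw [abs_of_pos hn]; omega) h
    omega
  have h2 : (2 : k) ≠ 0 := by simpa using hk 2 (by norm_num) (by norm_num)
  have h3 : (3 : k) ≠ 0 := by simpa using hk 3 (by norm_num) (by norm_num)
  have h6 : (6 : k) ≠ 0 := by simpa using hk 6 (by norm_num) (by norm_num)
  have hsq : ∀ n : k, u ≠ n ^ 2 := fun n h => hu ⟨n, by rw [h, pow_two]⟩
  refine ⟨isHomogeneous_quartic _, flat_quotient_span_quartic h2 _, fun Ω _ _ φ => ?_⟩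
  have hΩ : ∀ x : k, x ≠ 0 → φ (PowerSeries.C x) ≠ 0 := fun x hx =>
    ((isUnit_iff_ne_zero.2 hx).map (φ.comp PowerSeries.C)).ne_zero
  obtain ⟨r, hr⟩ := IsAlgClosed.exists_pow_nat_eq (φ (PowerSeries.C u)) (n := 2) (by norm_num)
  rw [← map_quartic]
  -- Since every nonzero power series is a unit times a power of t, φ either kills t or is
  -- injective: the geometric fibre is special or generic.
  by_cases hφ : φ PowerSeries.X = 0
  · rw [seriesCoeffs_map h6 h3, hφ, zero_div]
    have hu₀ : u ≠ 0 := fun h => hsq 0 (by rw [h]; ring)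
    have hne : ∀ (a : k) (b : ℕ), a ≠ b → φ (PowerSeries.C a) ≠ b := by
      intro a b hab h
      refine hΩ (a - b) (sub_ne_zero.2 hab) ?_
      rw [map_sub, map_sub, map_natCast, map_natCast, h, sub_self]
    have h9 : ∀ a : k, a ≠ 9 → φ (PowerSeries.C a) ≠ 9 := fun a ha => by
      simpa using hne a 9 (by simpa using ha)
    -- The last expression is (u - 4)(u - 16) for D = 1 and 9(u - 1)(u - 9) for D = 4u. Apart from
    -- small integers being nonzero, everything follows from `u` not being a square.
    have hcond : D ≠ 0 ∧ u ≠ D ∧ u ≠ 9 ∧ D ≠ 9 ∧ 81 - 18 * u - 18 * D + (u - D) ^ 2 ≠ 0 := by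
      have hu9 : u ≠ 9 := by rw [show (9 : k) = 3 ^ 2 by norm_num]; exact hsq 3
      rcases hD with rfl | rfl
      · refine ⟨one_ne_zero, ?_, hu9, ?_, ?_⟩
        · simpa using hsq 1
        · intro h
          have : (8 : k) ≠ 0 := by simpa using hk 8 (by norm_num) (by norm_num)
          exact this (by linear_combination -h)
        · rw [show 81 - 18 * u - 18 * 1 + (u - 1) ^ 2 = (u - 2 ^ 2) * (u - 4 ^ 2) by ring]
          exact mul_ne_zero (sub_ne_zero.2 (hsq 2)) (sub_ne_zero.2 (hsq 4))
      · refine ⟨mul_ne_zero ?_ hu₀, ?_, hu9, ?_, ?_⟩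
        · rw [show (4 : k) = 2 ^ 2 by norm_num]; exact pow_ne_zero _ h2
        · intro h
          exact mul_ne_zero h3 hu₀ (by linear_combination -h)
        · intro h
          refine hsq (3 / 2) ?_
          field_simp
          linear_combination h
        · rw [show 81 - 18 * u - 18 * (4 * u) + (u - 4 * u) ^ 2 =
            3 ^ 2 * ((u - 1 ^ 2) * (u - 3 ^ 2)) by ring]
          exact mul_ne_zero (pow_ne_zero _ h3)
            (mul_ne_zero (sub_ne_zero.2 (hsq 1)) (sub_ne_zero.2 (hsq 3)))
    obtain ⟨c₁, c₂, c₃, c₄, c₅⟩ := hcond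
    obtain ⟨x₀, b, e, H⟩ := exists_isNodal_pairCoeffs (h := (6 : Ω)⁻¹) (B := φ (PowerSeries.C u))
      (D := φ (PowerSeries.C D)) (by simpa only [map_ofNat] using hΩ 2 h2) (by simpa only [map_ofNat] using hΩ 3 h3)
      (inv_ne_zero (by simpa only [map_ofNat] using hΩ 6 h6)) (hΩ u hu₀) (hΩ D c₁)
      (fun h => hΩ (u - D) (sub_ne_zero.2 c₂) (by rw [map_sub, map_sub, h, sub_self]))
      (h9 u c₃) (h9 D c₄) (by simpa only [map_ofNat, map_sub, map_add, map_mul, map_pow] using hΩ _ c₅)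
    exact H.isStablePlaneQuartic
  · obtain ⟨s, hs⟩ := IsAlgClosed.exists_pow_nat_eq (φ PowerSeries.X) (n := 2) (by norm_num)
    have hinj : Function.Injective φ := by
      rw [injective_iff_map_eq_zero]
      intro a ha
      by_contra ha₀
      obtain ⟨n, v, h⟩ := IsDiscreteValuationRing.associated_pow_irreducible ha₀
        (PowerSeries.X_prime (R := k)).irreducible
      have := congrArg φ h
      rw [map_mul, ha, zero_mul, map_pow] at this
      exact hφ (eq_zero_of_pow_eq_zero this.symm)
    obtain ⟨m, hm, hm'⟩ : ∃ m : Ω, (m = 1 ∨ m = 2 * r) ∧ m ^ 2 = φ (PowerSeries.C D) := by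
      rcases hD with rfl | rfl
      · exact ⟨1, Or.inl rfl, by simp⟩
      · refine ⟨2 * r, Or.inr rfl, ?_⟩
        rw [mul_pow, hr, map_mul, map_mul, map_ofNat, map_ofNat]
        norm_num
    rw [seriesCoeffs_map_eq_fieldCoeffs h6 h3 hs hr hm']
    exact (genPos hp hu hinj hs hr hm).isNonsingular_quartic.isStablePlaneQuartic
      (isHomogeneous_quartic _)

end BaseRing

end ShiodaCoeffs

/-! ### Products of transpositions in the Pin group -/

section SwapLifts

variable {S : Type*} [DecidableEq S]

/-- The unit vector whose reflection is the transposition of `a` and `b`. -/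
noncomputable def swapVec (a b : S) : S → ℝ := (√2)⁻¹ • (Pi.single a 1 - Pi.single b 1)

theorem inv_sqrt_two_mul_self : (√2 : ℝ)⁻¹ * (√2)⁻¹ = 1 / 2 := by
  rw [← mul_inv, Real.mul_self_sqrt (by norm_num)]; norm_num

theorem sum_swapVec_mul [Fintype S] (a b : S) (v : S → ℝ) :
    ∑ s, swapVec a b s * v s = (√2)⁻¹ * (v a - v b) := by
  simp [swapVec, mul_assoc, ← Finset.mul_sum, sub_mul, Finset.sum_sub_distrib, Pi.single_apply]

theorem polar_swapVec [Fintype S] (a b : S) (v : S → ℝ) :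
    QuadraticMap.polar (stdForm S) (swapVec a b) v = 2 * ((√2)⁻¹ * (v a - v b)) := by
  rw [← sum_swapVec_mul a b v, QuadraticMap.polar]
  simp only [QuadraticMap.weightedSumSquares_apply, one_smul, ← Finset.sum_sub_distrib,
    Finset.mul_sum, Pi.add_apply]
  exact Finset.sum_congr rfl fun i _ => by ring

theorem stdForm_swapVec [Fintype S] {a b : S} (hab : a ≠ b) : stdForm S (swapVec a b) = 1 := by
  rw [QuadraticMap.weightedSumSquares_apply]
  simp only [one_smul]
  rw [sum_swapVec_mul]
  simp only [swapVec, Pi.smul_apply, Pi.sub_apply, Pi.single_eq_same, Pi.single_eq_of_ne hab,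
    Pi.single_eq_of_ne hab.symm, smul_eq_mul]
  linear_combination 2 * inv_sqrt_two_mul_self

theorem swapVec_comp (σ : Equiv.Perm S) (a b : S) :
    swapVec a b ∘ σ.symm = swapVec (σ a) (σ b) := by
  have h : ∀ a, (Pi.single a 1 : S → ℝ) ∘ σ.symm = Pi.single (σ a) 1 := by
    intro a
    funext i
    simp [Pi.single_apply, Equiv.symm_apply_eq]
  funext i
  have ha := congrFun (h a) i
  have hb := congrFun (h b) i
  simp only [Function.comp_apply] at ha hb
  simp [swapVec, ha, hb]

/-- The reflection at `swapVec a b` in the Clifford algebra. -/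
noncomputable def swapLift [Fintype S] (a b : S) : CliffordAlgebra (stdForm S) :=
  CliffordAlgebra.ι _ (swapVec a b)

theorem swapLift_mul_self [Fintype S] {a b : S} (hab : a ≠ b) : swapLift a b * swapLift a b = 1 := by
  rw [swapLift, CliffordAlgebra.ι_sq_scalar, stdForm_swapVec hab, map_one]

/-- Disjoint transpositions have orthogonal vectors, and orthogonal vectors anticommute in the
Clifford algebra. -/
theorem swapLift_mul_swapLift [Fintype S] {a b c d : S} (hac : a ≠ c) (had : a ≠ d) (hbc : b ≠ c)
    (hbd : b ≠ d) : swapLift a b * swapLift c d = -(swapLift c d * swapLift a b) := by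
  rw [eq_neg_iff_add_eq_zero, swapLift, swapLift, CliffordAlgebra.ι_mul_ι_add_swap, polar_swapVec]
  simp [swapVec, hac, had, hbc, hbd]

theorem isPinLift_swapLift [Fintype S] {a b : S} (hab : a ≠ b) :
    IsPinLift (Equiv.swap a b) (swapLift a b) := by
  refine ⟨?_, ?_, fun v => ?_⟩
  · rw [swapLift, CliffordAlgebra.reverse_ι]
    exact swapLift_mul_self hab
  · rw [swapLift, CliffordAlgebra.reverse_ι]
    exact swapLift_mul_self hab
  · have hs : v ∘ (Equiv.swap a b).symm =
        v - (QuadraticMap.polar (stdForm S) (swapVec a b) v) • swapVec a b := by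
      rw [polar_swapVec]
      have h2 := inv_sqrt_two_mul_self
      funext i
      simp only [Function.comp, Equiv.symm_swap, Pi.sub_apply, Pi.smul_apply, swapVec, smul_eq_mul]
      rcases eq_or_ne i a with rfl | hia
      · rw [Equiv.swap_apply_left, Pi.single_eq_same, Pi.single_eq_of_ne hab]
        linear_combination (2 * (v i - v b)) * h2
      · rcases eq_or_ne i b with rfl | hib
        · rw [Equiv.swap_apply_right, Pi.single_eq_same, Pi.single_eq_of_ne hia]
          linear_combination (-2 * (v a - v i)) * h2
        · rw [Equiv.swap_apply_of_ne_of_ne hia hib, Pi.single_eq_of_ne hia,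
            Pi.single_eq_of_ne hib]
          ring
    have hQ := stdForm_swapVec hab
    rw [swapLift]
    generalize swapVec a b = w at hs hQ
    rw [hs, map_sub, map_smul, sub_mul, CliffordAlgebra.involute_ι, smul_mul_assoc,
      CliffordAlgebra.ι_sq_scalar, hQ, map_one, Algebra.smul_def, mul_one,
      ← CliffordAlgebra.ι_mul_ι_add_swap]
    noncomm_ring

variable {I : Type*}

/-- The product of the transpositions of `f p.1` and `f p.2`, for the pairs `p` in a list. -/
def swapProd (f : I → S) (l : List (I × I)) : Equiv.Perm S :=
  (l.map fun p => Equiv.swap (f p.1) (f p.2)).prod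

/-- The corresponding product of reflections. -/
noncomputable def liftProd [Fintype S] (f : I → S) (l : List (I × I)) : CliffordAlgebra (stdForm S) :=
  (l.map fun p => swapLift (f p.1) (f p.2)).prod

theorem swapProd_apply [DecidableEq I] {f : I → S} (hf : Function.Injective f) (l : List (I × I)) (n : I) :
    swapProd f l (f n) = f ((l.map fun p => Equiv.swap p.1 p.2).prod n) := by
  induction l with
  | nil => rfl
  | cons p l ih =>
    simp only [swapProd, List.map_cons, List.prod_cons, Equiv.Perm.mul_apply] at ih ⊢
    rw [ih, ← hf.map_swap]

theorem swapProd_apply_of_notMem {f : I → S} (l : List (I × I)) {x : S} (hx : x ∉ Set.range f) :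
    swapProd f l x = x := by
  induction l with
  | nil => rfl
  | cons p l ih =>
    simp only [swapProd, List.map_cons, List.prod_cons, Equiv.Perm.mul_apply] at ih ⊢
    rw [ih, Equiv.swap_apply_of_ne_of_ne]
    · rintro rfl; exact hx ⟨_, rfl⟩
    · rintro rfl; exact hx ⟨_, rfl⟩

theorem isPinLift_liftProd [Fintype S] {f : I → S} (hf : Function.Injective f) {l : List (I × I)}
    (hl : ∀ p ∈ l, p.1 ≠ p.2) : IsPinLift (swapProd f l) (liftProd f l) := by
  induction l with
  | nil => exact IsPinLift.one
  | cons p l ih =>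
    exact (isPinLift_swapLift (hf.ne (hl p (by simp)))).mul
      (ih fun q hq => hl q (List.mem_cons_of_mem _ hq))

theorem involute_liftProd [Fintype S] (f : I → S) (l : List (I × I)) :
    CliffordAlgebra.involute (liftProd f l) = (-1) ^ l.length * liftProd f l := by
  induction l with
  | nil => simp [liftProd]
  | cons p l ih =>
    simp only [liftProd, List.map_cons, List.prod_cons, List.length_cons, map_mul] at ih ⊢
    have hc := ((Commute.neg_one_left (swapLift (f p.1) (f p.2))).pow_left l.length).eq
    have hi : CliffordAlgebra.involute (swapLift (f p.1) (f p.2)) = -swapLift (f p.1) (f p.2) :=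
      CliffordAlgebra.involute_ι _
    rw [ih, hi, neg_mul, ← mul_assoc, ← hc, pow_succ]
    noncomm_ring

/-- Two pairs without common entries. -/
def PairDisjoint (p q : I × I) : Prop := p.1 ≠ q.1 ∧ p.1 ≠ q.2 ∧ p.2 ≠ q.1 ∧ p.2 ≠ q.2

instance [DecidableEq I] (p q : I × I) : Decidable (PairDisjoint p q) :=
  inferInstanceAs (Decidable (_ ∧ _ ∧ _ ∧ _))

theorem swapLift_mul_liftProd [Fintype S] {f : I → S} (hf : Function.Injective f) {p : I × I}
    {l : List (I × I)} (h : ∀ q ∈ l, PairDisjoint p q) :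
    swapLift (f p.1) (f p.2) * liftProd f l =
      (-1) ^ l.length * (liftProd f l * swapLift (f p.1) (f p.2)) := by
  induction l with
  | nil => simp [liftProd]
  | cons q l ih =>
    have ih' := ih fun q hq => h q (List.mem_cons_of_mem _ hq)
    obtain ⟨h₁, h₂, h₃, h₄⟩ := h q (by simp)
    have hpq := swapLift_mul_swapLift (hf.ne h₁) (hf.ne h₂) (hf.ne h₃) (hf.ne h₄)
    simp only [liftProd, List.map_cons, List.prod_cons, List.length_cons] at ih' ⊢
    rw [← mul_assoc, hpq, neg_mul, mul_assoc, ih', pow_succ]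
    have hc := ((Commute.neg_one_left (swapLift (f q.1) (f q.2))).pow_left l.length).eq
    rw [← mul_assoc, ← hc]
    noncomm_ring

/-- Moving the first reflection past n others costs (-1)ⁿ, and C(n + 1, 2) = n + C(n, 2). -/
theorem liftProd_mul_self [Fintype S] {f : I → S} (hf : Function.Injective f) {l : List (I × I)}
    (hl : ∀ p ∈ l, p.1 ≠ p.2) (h : l.Pairwise PairDisjoint) :
    liftProd f l * liftProd f l = (-1) ^ (l.length.choose 2) := by
  induction l with
  | nil => simp [liftProd]
  | cons p l ih =>
    rw [List.pairwise_cons] at h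
    have h₁ := swapLift_mul_liftProd hf h.1
    have h₂ := ih (fun q hq => hl q (List.mem_cons_of_mem _ hq)) h.2
    have h₃ := swapLift_mul_self (hf.ne (hl p (by simp)))
    have hc : ∀ x : CliffordAlgebra (stdForm S), (-1) ^ l.length * x = x * (-1) ^ l.length :=
      fun x => ((Commute.neg_one_left x).pow_left l.length).eq
    have hcons : liftProd f (p :: l) = swapLift (f p.1) (f p.2) * liftProd f l := rfl
    rw [hcons]
    nth_rw 1 [h₁]
    rw [mul_assoc, mul_assoc, ← mul_assoc (swapLift _ _), h₃, one_mul, h₂, ← pow_add,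
      List.length_cons, Nat.choose_succ_succ' , Nat.choose_one_right]

/-- For an even number of reflections twisted conjugation is ordinary conjugation, so the product
moves past a reflection by permuting its two indices, without a sign. -/
theorem liftProd_mul_liftProd [Fintype S] {f : I → S} {l : List (I × I)} (hf : Function.Injective f)
    (hl : ∀ p ∈ l, p.1 ≠ p.2) (heven : Even l.length) (l' : List (I × I)) :
    liftProd f l * liftProd f l' = liftProd (fun n => swapProd f l (f n)) l' * liftProd f l := by
  have h := (isPinLift_liftProd hf hl).twisted_conj
  rw [involute_liftProd, heven.neg_one_pow, one_mul] at h
  induction l' with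
  | nil => simp [liftProd]
  | cons p l' ih =>
    have hcons : ∀ f : I → S, liftProd f (p :: l') = swapLift (f p.1) (f p.2) * liftProd f l' :=
      fun _ => rfl
    rw [hcons, hcons, ← mul_assoc, swapLift, h, swapVec_comp, mul_assoc, ih, ← mul_assoc]
    rfl

theorem liftProd_mul_liftProd_eq [Fintype S] [DecidableEq I] {f : I → S}
    (hf : Function.Injective f) {l l' : List (I × I)} (hl : ∀ p ∈ l, p.1 ≠ p.2)
    (heven : Even l.length) : liftProd f l * liftProd f l' =
      liftProd f (l'.map (Prod.map (l.map fun p => Equiv.swap p.1 p.2).prod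
        (l.map fun p => Equiv.swap p.1 p.2).prod)) * liftProd f l := by
  rw [liftProd_mul_liftProd hf hl heven]
  simp only [liftProd, List.map_map, swapProd_apply hf]
  rfl

theorem liftProd_cons_cons [Fintype S] {f : I → S} (hf : Function.Injective f) {p q : I × I}
    (h : PairDisjoint p q) (l : List (I × I)) :
    liftProd f (p :: q :: l) = -liftProd f (q :: p :: l) := by
  obtain ⟨h₁, h₂, h₃, h₄⟩ := h
  have hpq := swapLift_mul_swapLift (hf.ne h₁) (hf.ne h₂) (hf.ne h₃) (hf.ne h₄)
  simp only [liftProd, List.map_cons, List.prod_cons]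
  rw [← mul_assoc, hpq, neg_mul, mul_assoc]

end SwapLifts

/-! ### The two involutions on the 27 lines and their lifts -/

section LinePermutations

/-- The transpositions in the action of `√t ↦ -√t` on the 27 lines. -/
def sPairs : List (Fin 27 × Fin 27) := [(0, 1), (6, 7), (13, 17), (14, 18), (15, 19), (16, 20)]

/-- The transpositions in the action of `r ↦ -r` on the 27 lines. -/
def rPairs : List (Fin 27 × Fin 27) := [(13, 14), (17, 18), (2, 3), (8, 9), (22, 24), (23, 25)]

/-- The transpositions in the simultaneous action of `r ↦ -r` and `m ↦ -m` on the 27 lines. -/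
def rmPairs : List (Fin 27 × Fin 27) :=
  [(13, 14), (17, 18), (15, 16), (19, 20), (2, 3), (4, 5), (8, 9), (10, 11), (22, 25), (23, 24)]

/-- The permutation of the 27 lines given by a list of transpositions. -/
def pairsPerm (l : List (Fin 27 × Fin 27)) : Equiv.Perm (Fin 27) :=
  (l.map fun p => Equiv.swap p.1 p.2).prod

/-- The list of transpositions in the action of `√u ↦ -√u`, and the sign of the commutator of the
lifts. -/
inductive IsFlip : List (Fin 27 × Fin 27) → ℤˣ → Prop
  | even : IsFlip rPairs (-1)
  | odd : IsFlip rmPairs 1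

variable {S : Type*} [DecidableEq S] [Fintype S] {f : Fin 27 → S} {l : List (Fin 27 × Fin 27)}
  {ε : ℤˣ}

set_option maxRecDepth 100000 in
theorem isPinLift_sPairs (hf : Function.Injective f) :
    IsPinLift (swapProd f sPairs) (liftProd f sPairs) :=
  isPinLift_liftProd hf (by decide)

set_option maxRecDepth 100000 in
theorem IsFlip.isPinLift (h : IsFlip l ε) (hf : Function.Injective f) :
    IsPinLift (swapProd f l) (liftProd f l) := by
  refine isPinLift_liftProd hf ?_
  cases h <;> decide

set_option maxRecDepth 100000 in
-- There are 6 disjoint transpositions, and C(6, 2) = 15 is odd.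
theorem liftProd_sPairs_mul_self (hf : Function.Injective f) :
    liftProd f sPairs * liftProd f sPairs = -1 := by
  rw [liftProd_mul_self hf (by decide) (by decide)]
  exact Odd.neg_one_pow (by decide)

set_option maxRecDepth 100000 in
-- There are 6 or 10 disjoint transpositions; C(6, 2) = 15 and C(10, 2) = 45 are both odd.
theorem IsFlip.liftProd_mul_self (h : IsFlip l ε) (hf : Function.Injective f) :
    liftProd f l * liftProd f l = -1 := by
  rw [_root_.liftProd_mul_self hf (by cases h <;> decide) (by cases h <;> decide)]
  exact Odd.neg_one_pow (by cases h <;> decide)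

set_option maxRecDepth 100000 in
-- Conjugation by the first lift reorders the factors of the second. For `rPairs` one pair of
-- anticommuting factors is exchanged, which gives -1; for `rmPairs` two pairs are exchanged, which
-- gives 1.
theorem IsFlip.liftProd_comm (h : IsFlip l ε) (hf : Function.Injective f) :
    liftProd f sPairs * liftProd f l =
      ((ε : ℤ) : CliffordAlgebra (stdForm S)) * (liftProd f l * liftProd f sPairs) := by
  rw [liftProd_mul_liftProd_eq hf (by decide) (by decide)]
  cases h with
  | even =>
    have e : rPairs.map (Prod.map (sPairs.map fun p => Equiv.swap p.1 p.2).prod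
        (sPairs.map fun p => Equiv.swap p.1 p.2).prod) =
      (17, 18) :: (13, 14) :: [(2, 3), (8, 9), (22, 24), (23, 25)] := by decide
    rw [e, liftProd_cons_cons hf (by decide)]
    simp [rPairs]
  | odd =>
    have e : rmPairs.map (Prod.map (sPairs.map fun p => Equiv.swap p.1 p.2).prod
        (sPairs.map fun p => Equiv.swap p.1 p.2).prod) =
      (17, 18) :: (13, 14) :: (19, 20) :: (15, 16) ::
        [(2, 3), (4, 5), (8, 9), (10, 11), (22, 25), (23, 24)] := by decide
    rw [e, liftProd_cons_cons hf (by decide)]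
    have h₁ := liftProd_cons_cons hf (p := (19, 20)) (q := (15, 16)) (by decide)
      [(2, 3), (4, 5), (8, 9), (10, 11), (22, 25), (23, 24)]
    have hcons : ∀ p l, liftProd f (p :: l) = swapLift (f p.1) (f p.2) * liftProd f l :=
      fun _ _ => rfl
    rw [hcons (13, 14), hcons (17, 18), h₁, rmPairs, hcons (13, 14), hcons (17, 18)]
    simp

end LinePermutations

/-! ### The Stiefel-Whitney cocycle of two commuting involutions -/

section PinSign

/-- The sign `(-1) ^ (i * j)` for the signs `a = (-1) ^ i` and `b = (-1) ^ j`. -/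
def signBit (a b : ℤˣ) : ℤˣ := if a = -1 ∧ b = -1 then -1 else 1

/-- `x ^ i` for the sign `a = (-1) ^ i` with `i = 0` or `i = 1`. -/
def signPow {M : Type*} [One M] (a : ℤˣ) (x : M) : M := if a = -1 then x else 1

/-- The cocycle on pairs of signs that is attached to two elements which square to `-1` and which
commute up to the sign `ε`. -/
def flipSign (ε a b c d : ℤˣ) : ℤˣ :=
  (if b = -1 ∧ c = -1 then ε else 1) * signBit a c * signBit b d

variable {S : Type*} [Fintype S] {A B : Equiv.Perm S} {x y : CliffordAlgebra (stdForm S)} {ε : ℤˣ}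

/-- Reduction to the normal form xⁱyʲ: moving y past x costs `ε`, and x² = y² = -1 accounts for the
two factors `signBit`. -/
theorem signPow_mul_signPow (hx : x * x = -1) (hy : y * y = -1)
    (hxy : x * y = ((ε : ℤ) : CliffordAlgebra (stdForm S)) * (y * x)) (a b c d : ℤˣ) :
    (signPow a x * signPow b y) * (signPow c x * signPow d y) =
      ((flipSign ε a b c d : ℤ) : CliffordAlgebra (stdForm S)) *
        (signPow (a * c) x * signPow (b * d) y) := by
  have hyx : y * x = ((ε : ℤ) : CliffordAlgebra (stdForm S)) * (x * y) := by
    rw [hxy, ← mul_assoc, ← Int.cast_mul]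
    rcases Int.units_eq_one_or ε with rfl | rfl <;> simp
  have e₁ : ∀ z, x * (x * z) = -z := fun z => by rw [← mul_assoc, hx, neg_one_mul]
  have e₂ : ∀ z, y * (x * z) = ((ε : ℤ) : CliffordAlgebra (stdForm S)) * (x * (y * z)) := fun z => by
    rw [← mul_assoc, hyx, mul_assoc, mul_assoc]
  have e₃ : ∀ z, x * (((ε : ℤ) : CliffordAlgebra (stdForm S)) * z) =
      ((ε : ℤ) : CliffordAlgebra (stdForm S)) * (x * z) := fun z => by
    rw [← mul_assoc, ← (Int.cast_commute (ε : ℤ) x).eq, mul_assoc]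
  rcases Int.units_eq_one_or a with rfl | rfl <;> rcases Int.units_eq_one_or b with rfl | rfl <;>
    rcases Int.units_eq_one_or c with rfl | rfl <;> rcases Int.units_eq_one_or d with rfl | rfl <;>
    simp [signPow, flipSign, signBit, mul_assoc, hx, hy, hyx, e₁, e₂, e₃]

theorem IsPinLift.signPow (hx : IsPinLift A x) (a : ℤˣ) :
    IsPinLift (_root_.signPow a A) (_root_.signPow a x) := by
  rw [_root_.signPow, _root_.signPow]
  split_ifs
  exacts [hx, IsPinLift.one]

/-- The Stiefel-Whitney cocycle of an action through two commuting involutions. -/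
theorem exists_pinSign_eq {G : Type*} [Group G] (ρ : G →* Equiv.Perm S) {χ ψ : G →* ℤˣ}
    (hρ : ∀ g, ρ g = signPow (χ g) A * signPow (ψ g) B) (hA : IsPinLift A x) (hB : IsPinLift B y)
    (hx : x * x = -1) (hy : y * y = -1)
    (hxy : x * y = ((ε : ℤ) : CliffordAlgebra (stdForm S)) * (y * x)) :
    ∃ β : ℤˣ × ℤˣ → ℤˣ, ∀ g h, pinSign (ρ g) (ρ h) =
      flipSign ε (χ g) (ψ g) (χ h) (ψ h) *
        (β (χ g, ψ g) * β (χ h, ψ h) * β (χ (g * h), ψ (g * h))) := by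
  -- The chosen lifts agree with the products of powers of `x` and `y` up to a sign that depends
  -- only on the two characters.
  have key : ∀ p : ℤˣ × ℤˣ, ∃ β : ℤˣ, pinLift (signPow p.1 A * signPow p.2 B) =
      ((β : ℤ) : CliffordAlgebra (stdForm S)) * (signPow p.1 x * signPow p.2 y) := by
    intro p
    rcases (isPinLift_pinLift _).eq_or_eq_neg ((hA.signPow p.1).mul (hB.signPow p.2)) with h | h
    · exact ⟨1, by simpa using h⟩
    · exact ⟨-1, by simpa using h⟩
  choose β hβ using key
  refine ⟨β, fun g h => ?_⟩
  have h₁ := pinLift_mul (ρ g) (ρ h)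
  rw [← map_mul, hρ g, hρ h, hρ (g * h)] at h₁
  have b₁ := hβ (χ g, ψ g)
  have b₂ := hβ (χ h, ψ h)
  have b₃ := hβ (χ (g * h), ψ (g * h))
  simp only at b₁ b₂ b₃
  rw [b₁, b₂, b₃] at h₁
  rw [hρ g, hρ h]
  have hL : IsUnit (signPow (χ (g * h)) x * signPow (ψ (g * h)) y) :=
    ⟨⟨_, _, ((hA.signPow _).mul (hB.signPow _)).mul_reverse,
      ((hA.signPow _).mul (hB.signPow _)).reverse_mul⟩, rfl⟩
  have h₂ := signPow_mul_signPow hx hy hxy (χ g) (ψ g) (χ h) (ψ h)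
  rw [← map_mul, ← map_mul] at h₂
  rw [mul_assoc, ← mul_assoc (_ * _) _ (_ * _), ← (Int.cast_commute (β (χ h, ψ h) : ℤ) _).eq,
    mul_assoc ((β (χ h, ψ h) : ℤ) : CliffordAlgebra (stdForm S)), h₂] at h₁
  simp only [← mul_assoc, ← Int.cast_mul] at h₁
  rw [mul_assoc _ (signPow _ x), mul_assoc _ (signPow _ x)] at h₁
  have h₃ := hL.mul_right_cancel h₁
  have hinj : Function.Injective (fun n : ℤ => (n : CliffordAlgebra (stdForm S))) := by
    intro a b hab
    have : (algebraMap ℝ (CliffordAlgebra (stdForm S))) a = algebraMap ℝ _ b := by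
      simpa using hab
    exact_mod_cast (algebraMap ℝ (CliffordAlgebra (stdForm S))).injective this
  have h₄ : β (χ g, ψ g) * β (χ h, ψ h) * flipSign ε (χ g) (ψ g) (χ h) (ψ h) =
      pinSign (signPow (χ g) A * signPow (ψ g) B) (signPow (χ h) A * signPow (ψ h) B) *
        β (χ (g * h), ψ (g * h)) := by
    apply Units.ext
    push_cast
    exact hinj h₃
  have h₅ : β (χ (g * h), ψ (g * h)) * β (χ (g * h), ψ (g * h)) = 1 := Int.units_mul_self _
  calc _ = pinSign (signPow (χ g) A * signPow (ψ g) B) (signPow (χ h) A * signPow (ψ h) B) *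
      β (χ (g * h), ψ (g * h)) * β (χ (g * h), ψ (g * h)) := by rw [mul_assoc, h₅, mul_one]
    _ = _ := by rw [← h₄]; simp only [mul_comm, mul_assoc]

end PinSign

/-! ### Comparison of cocycles in the Brauer group -/

section Classes

variable {F : Type*} [Field F]

/-- The signs in the units of the separable closure. -/
noncomputable def signUnit (F : Type*) [Field F] : ℤˣ →* (SeparableClosure F)ˣ :=
  Units.map (Int.castRingHom (SeparableClosure F) : ℤ →* SeparableClosure F)

theorem map_signUnit (g : Gal(SeparableClosure F/F)) (z : ℤˣ) :
    Units.map (g : SeparableClosure F →* SeparableClosure F) (signUnit F z) = signUnit F z := by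
  ext
  simp [signUnit]

variable {S S' : Type*} [Fintype S] [Fintype S'] {ρ : Gal(SeparableClosure F/F) →* Equiv.Perm S}
  {ρ' : Gal(SeparableClosure F/F) →* Equiv.Perm S'}

/-- Galois fixes the signs and a sign is its own inverse, so the extra factor is the coboundary of
`b`. -/
theorem galoisSW₂_eq_of_pinSign_eq (hρ : IsLocallyConstant ρ) (hρ' : IsLocallyConstant ρ')
    (b : Gal(SeparableClosure F/F) → ℤˣ) (hb : IsLocallyConstant b)
    (h : ∀ g h, pinSign (ρ' g) (ρ' h) = pinSign (ρ g) (ρ h) * (b g * b h * b (g * h))) :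
    galoisSW₂ ρ hρ = galoisSW₂ ρ' hρ' := by
  refine congrArg Additive.ofMul (QuotientGroup.eq.2 ?_)
  rw [Subgroup.mem_subgroupOf]
  refine ⟨fun g => signUnit F (b g), hb.comp _, fun g h' => ?_⟩
  rw [map_signUnit]
  change (signUnit F (pinSign (ρ g) (ρ h')))⁻¹ * signUnit F (pinSign (ρ' g) (ρ' h')) = _
  rw [← map_inv, ← map_inv, ← map_mul, ← map_mul, ← map_mul, h, inv_mul_cancel_left,
    Int.units_inv_eq_self]
  congr 1
  rw [mul_assoc, mul_comm, mul_assoc, mul_comm]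

theorem exists_of_galoisSW₂_eq_zero (hρ : IsLocallyConstant ρ) (h₀ : galoisSW₂ ρ hρ = 0) :
    ∃ b : Gal(SeparableClosure F/F) → (SeparableClosure F)ˣ, IsLocallyConstant b ∧
      ∀ g h, signUnit F (pinSign (ρ g) (ρ h)) =
        Units.map (g : SeparableClosure F →* SeparableClosure F) (b h) * (b (g * h))⁻¹ * b g := by
  have h₁ := (QuotientGroup.eq_one_iff _).1 (Additive.ofMul.injective h₀)
  rw [Subgroup.mem_subgroupOf] at h₁
  obtain ⟨b, hb, h⟩ := h₁
  exact ⟨b, hb, h⟩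

theorem two_nsmul_galoisSW₂ (hρ : IsLocallyConstant ρ) : 2 • galoisSW₂ ρ hρ = 0 := by
  rw [two_nsmul]
  refine congrArg Additive.ofMul ((QuotientGroup.eq_one_iff _).2 ?_)
  rw [Subgroup.mem_subgroupOf]
  refine ⟨1, IsLocallyConstant.const 1, fun g h => ?_⟩
  change signUnit F (pinSign (ρ g) (ρ h)) * signUnit F (pinSign (ρ g) (ρ h)) = _
  rw [← map_mul, Int.units_mul_self]
  simp

end Classes

/-! ### Quadratic characters and Hilbert 90 -/

section HilbertNinety

variable {F : Type*} [Field F]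

theorem krullTopology_isLocallyConstant_of_open_ker {M : Type*} [Group M]
    (χ : Gal(SeparableClosure F/F) →* M) (h : IsOpen (χ.ker : Set Gal(SeparableClosure F/F))) :
    IsLocallyConstant χ := by
  rw [IsLocallyConstant.iff_exists_open]
  intro σ
  refine ⟨(fun τ => σ⁻¹ * τ) ⁻¹' (χ.ker : Set Gal(SeparableClosure F/F)),
    h.preimage (continuous_const_mul σ⁻¹), by simp, fun τ hτ => ?_⟩
  have h1 : χ (σ⁻¹ * τ) = 1 := hτ
  rw [map_mul, map_inv, inv_mul_eq_one] at h1
  exact h1.symm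

/-- The quadratic character of the square root `s` of an element of the base field. -/
theorem exists_quadraticChar (h2 : (2 : F) ≠ 0) {s : SeparableClosure F} (hs₀ : s ≠ 0) {t : F}
    (hs : s ^ 2 = algebraMap F _ t) : ∃ χ : Gal(SeparableClosure F/F) →* ℤˣ,
      IsLocallyConstant χ ∧ ∀ g : Gal(SeparableClosure F/F), g s = ((χ g : ℤ) : SeparableClosure F) * s := by
  classical
  have h2' : (2 : SeparableClosure F) ≠ 0 := by
    rw [← map_ofNat (algebraMap F (SeparableClosure F)) 2]
    exact (map_ne_zero _).2 h2
  have hg : ∀ g : Gal(SeparableClosure F/F), g s = s ∨ g s = -s := fun g => by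
    refine sq_eq_sq_iff_eq_or_eq_neg.1 ?_
    rw [← map_pow, hs, AlgEquiv.commutes]
  have hne : -s ≠ s := fun h => by
    have : 2 * s = 0 := by linear_combination -h
    exact mul_ne_zero h2' hs₀ this
  let χ : Gal(SeparableClosure F/F) →* ℤˣ :=
    { toFun := fun g => if g s = s then 1 else -1
      map_one' := if_pos rfl
      map_mul' := fun g h => by
        rcases hg g with h₁ | h₁ <;> rcases hg h with h₂ | h₂ <;>
          simp [AlgEquiv.mul_apply, h₁, h₂, hne] }
  have hχ : ∀ g, χ g = if g s = s then 1 else -1 := fun g => rfl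
  refine ⟨χ, krullTopology_isLocallyConstant_of_open_ker χ ?_, fun g => ?_⟩
  · have : FiniteDimensional F (IntermediateField.adjoin F {s}) :=
      IntermediateField.adjoin.finiteDimensional (Algebra.IsIntegral.isIntegral s)
    refine Subgroup.isOpen_mono (H₁ := (IntermediateField.adjoin F {s}).fixingSubgroup) ?_
      (IntermediateField.fixingSubgroup_isOpen _)
    intro g hg'
    rw [MonoidHom.mem_ker, hχ, if_pos]
    exact (IntermediateField.mem_fixingSubgroup_iff _ _).1 hg' s
      (IntermediateField.mem_adjoin_simple_self F s)
  · rw [hχ]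
    rcases hg g with h | h
    · simp [h]
    · simp [h, hne]

/-- Hilbert 90 for a subgroup of the absolute Galois group. -/
theorem exists_eq_div_of_cocycle (H : Subgroup Gal(SeparableClosure F/F))
    (b : Gal(SeparableClosure F/F) → SeparableClosure F) (hb : IsLocallyConstant b)
    (hb₀ : ∀ g, b g ≠ 0) (h : ∀ g ∈ H, ∀ h ∈ H, b (g * h) = b g * g (b h)) :
    ∃ c : SeparableClosure F, c ≠ 0 ∧ ∀ g ∈ H, b g * g c = c := by
  classical
  have h₁ : b 1 = 1 := by
    have := h 1 H.one_mem 1 H.one_mem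
    rw [mul_one, AlgEquiv.one_apply] at this
    exact (mul_left_cancel₀ (hb₀ 1) (by rw [mul_one, ← this])).symm
  have hopen : b ⁻¹' {1} ∈ nhds (1 : Gal(SeparableClosure F/F)) :=
    (hb.isOpen_fiber 1).mem_nhds h₁
  -- By continuity `b` is 1 on the automorphisms fixing a finite extension `E`, so on `H` it depends
  -- only on the restriction to `E`.
  obtain ⟨E, hE, hEb⟩ := (krullTopology_mem_nhds_one_iff F (SeparableClosure F) _).1 hopen
  have hres : ∀ g ∈ H, ∀ g' ∈ H, (∀ x ∈ E, g x = g' x) → b g = b g' := by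
    intro g hg g' hg' hx
    have hmem : g⁻¹ * g' ∈ E.fixingSubgroup := by
      rw [IntermediateField.mem_fixingSubgroup_iff]
      intro x hxE
      rw [AlgEquiv.mul_apply, ← hx x hxE]
      exact g.symm_apply_apply x
    have h₂ := h g hg (g⁻¹ * g') (H.mul_mem (H.inv_mem hg) hg')
    rw [hEb hmem, map_one, mul_one, mul_inv_cancel_left] at h₂
    exact h₂.symm
  let res : Gal(SeparableClosure F/F) → (E →ₐ[F] SeparableClosure F) := fun g =>
    (g : SeparableClosure F →ₐ[F] SeparableClosure F).comp E.val
  -- The value 0 at embeddings that do not come from `H` restricts the sum below to `H`.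
  let a : (E →ₐ[F] SeparableClosure F) → SeparableClosure F := fun ψ =>
    if hψ : ∃ g ∈ H, res g = ψ then b hψ.choose else 0
  have ha : ∀ g ∈ H, a (res g) = b g := by
    intro g hg
    have hψ : ∃ g' ∈ H, res g' = res g := ⟨g, hg, rfl⟩
    simp only [a, dif_pos hψ]
    exact hres _ hψ.choose_spec.1 _ hg fun x hx =>
      DFunLike.congr_fun hψ.choose_spec.2 (⟨x, hx⟩ : E)
  have ha₀ : ∀ ψ, (¬ ∃ g ∈ H, res g = ψ) → a ψ = 0 := fun ψ hψ => by simp only [a, dif_neg hψ]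
  let e : ∀ g : Gal(SeparableClosure F/F),
      (E →ₐ[F] SeparableClosure F) ≃ (E →ₐ[F] SeparableClosure F) := fun g =>
    { toFun := fun ψ => (g : SeparableClosure F →ₐ[F] SeparableClosure F).comp ψ
      invFun := fun ψ => (g.symm : SeparableClosure F →ₐ[F] SeparableClosure F).comp ψ
      left_inv := fun ψ => by ext x; simp
      right_inv := fun ψ => by ext x; simp }
  have he : ∀ g h, e g (res h) = res (g * h) := fun g h => rfl
  have hae : ∀ g ∈ H, ∀ ψ, a (e g ψ) = b g * g (a ψ) := by
    intro g hg ψ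
    by_cases hψ : ∃ h ∈ H, res h = ψ
    · obtain ⟨h', hh', rfl⟩ := hψ
      rw [he, ha _ (H.mul_mem hg hh'), ha _ hh', h g hg h' hh']
    · rw [ha₀ ψ hψ, map_zero, mul_zero, ha₀]
      rintro ⟨h', hh', h''⟩
      refine hψ ⟨g⁻¹ * h', H.mul_mem (H.inv_mem hg) hh', (e g).injective ?_⟩
      rw [he, mul_inv_cancel_left, h'']
  -- Linear independence of distinct embeddings makes the Hilbert 90 sum nonzero for some θ.
  have hlin : ∃ θ : E, ∑ ψ, a ψ * ψ θ ≠ 0 := by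
    by_contra! hz
    have hind := linearIndependent_algHom_toLinearMap F E (SeparableClosure F)
    rw [Fintype.linearIndependent_iff] at hind
    have := hind a (LinearMap.ext fun θ => by
      simpa only [LinearMap.sum_apply, LinearMap.smul_apply, AlgHom.toLinearMap_apply, smul_eq_mul,
        LinearMap.zero_apply] using hz θ) (res 1)
    rw [ha 1 H.one_mem] at this
    exact hb₀ 1 this
  obtain ⟨θ, hθ⟩ := hlin
  refine ⟨_, hθ, fun g hg => ?_⟩
  rw [map_sum, Finset.mul_sum, ← (e g).sum_comp (fun ψ => a ψ * ψ θ)]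
  refine Finset.sum_congr rfl fun ψ _ => ?_
  rw [hae g hg, map_mul, mul_assoc]
  rfl

end HilbertNinety

/-! ### Nonvanishing of the cup product of two quadratic characters -/

section Nonvanishing

variable {F : Type*} [Field F]

/-- If the norm form of `F(√u)` does not represent `1 / t`, then the cup product of the quadratic
characters of `u` and `t` does not vanish in the Brauer group. -/
theorem signBit_ne_coboundary (h2 : (2 : F) ≠ 0) {u t : F}
    (haniso : ∀ a b c : F, a ^ 2 = u * b ^ 2 + t * c ^ 2 → c = 0)
    (hnsq : ∀ a : F, a ^ 2 ≠ u)
    {s r : SeparableClosure F} (hs₀ : s ≠ 0) (hr₀ : r ≠ 0)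
    (hs : s ^ 2 = algebraMap F _ t) (hr : r ^ 2 = algebraMap F _ u)
    {χ ψ : Gal(SeparableClosure F/F) →* ℤˣ}
    (hχ : ∀ g : Gal(SeparableClosure F/F), g s = ((χ g : ℤ) : SeparableClosure F) * s)
    (hψ : ∀ g : Gal(SeparableClosure F/F), g r = ((ψ g : ℤ) : SeparableClosure F) * r)
    {b : Gal(SeparableClosure F/F) → SeparableClosure F} (hb : IsLocallyConstant b)
    (hb₀ : ∀ g, b g ≠ 0)
    (h : ∀ g h, ((signBit (ψ g) (χ h) : ℤ) : SeparableClosure F) * b (g * h) = g (b h) * b g) :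
    False := by
  have h2' : (2 : SeparableClosure F) ≠ 0 := by
    rw [← map_ofNat (algebraMap F (SeparableClosure F)) 2]
    exact (map_ne_zero _).2 h2
  have hfix : ∀ x : SeparableClosure F, (∀ g : Gal(SeparableClosure F/F), g x = x) →
      ∃ a : F, algebraMap F _ a = x := by
    intro x hx
    have : x ∈ (⊥ : IntermediateField F (SeparableClosure F)) :=
      (InfiniteGalois.mem_bot_iff_fixed x).2 hx
    exact IntermediateField.mem_bot.1 this
  have hb₁ : ∀ x : ℤˣ, signBit 1 x = 1 := by decide
  have hb₂ : ∀ x : ℤˣ, signBit (-1) x = x := by decide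
  -- On the kernel of ψ, the Galois group of F(r), the cup product is trivial. There `b` is a
  -- 1-cocycle, and Hilbert 90 splits it.
  obtain ⟨c, hc₀, hc⟩ := exists_eq_div_of_cocycle ψ.ker b hb hb₀ (fun g hg h' _ => by
    have := h g h'
    rw [MonoidHom.mem_ker.1 hg, hb₁] at this
    simpa [mul_comm] using this)
  -- Dividing by the coboundary of `c` makes the cochain equal to 1 on the kernel of ψ and does not
  -- change its coboundary.
  set d : Gal(SeparableClosure F/F) → SeparableClosure F := fun g => b g * g c / c with hd
  have hd₁ : ∀ g ∈ ψ.ker, d g = 1 := fun g hg => by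
    rw [hd]; simp only [hc g hg]; exact div_self hc₀
  have hdh : ∀ g h, ((signBit (ψ g) (χ h) : ℤ) : SeparableClosure F) * d (g * h) = g (d h) * d g := by
    intro g h'
    have hgc : g c ≠ 0 := (map_ne_zero g).2 hc₀
    simp only [hd, map_div₀, map_mul, AlgEquiv.mul_apply]
    field_simp
    linear_combination (g (h' c)) * h g h'
  obtain ⟨τ, hτ⟩ : ∃ τ, ψ τ = -1 := by
    by_contra! hno
    obtain ⟨a, ha⟩ := hfix r fun g => by
      rw [hψ, (Int.units_eq_one_or (ψ g)).resolve_right (hno g)]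
      simp
    refine hnsq a ((algebraMap F (SeparableClosure F)).injective ?_)
    rw [map_pow, ha, hr]
  have hττ : τ * τ ∈ ψ.ker := by rw [MonoidHom.mem_ker, map_mul, hτ]; rfl
  have hχχ : ∀ g : Gal(SeparableClosure F/F),
      ((χ g : ℤ) : SeparableClosure F) * ((χ g : ℤ) : SeparableClosure F) = 1 := fun g => by
    rw [← Int.cast_mul, ← Units.val_mul, Int.units_mul_self]; simp
  -- the value at `τ` is an eigenvector of the kernel of `ψ` for the character `χ`
  have hβ : ∀ g ∈ ψ.ker, g (d τ) = ((χ g : ℤ) : SeparableClosure F) * d τ := by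
    intro g hg
    have hmem : τ⁻¹ * g * τ ∈ ψ.ker := by
      simpa using ψ.normal_ker.conj_mem g hg τ⁻¹
    have e₁ := hdh τ (τ⁻¹ * g * τ)
    have e₂ := hdh g τ
    rw [hd₁ _ hmem, map_one, one_mul, hτ, hb₂] at e₁
    rw [MonoidHom.mem_ker.1 hg, hb₁, hd₁ g hg, mul_one, Units.val_one, Int.cast_one, one_mul] at e₂
    have e₃ : τ * (τ⁻¹ * g * τ) = g * τ := by group
    have e₄ : χ (τ⁻¹ * g * τ) = χ g := by
      rw [map_mul, map_mul, map_inv, mul_comm (χ τ)⁻¹, inv_mul_cancel_right]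
    rw [e₃, e₄, e₂] at e₁
    linear_combination ((χ g : ℤ) : SeparableClosure F) * e₁ - g (d τ) * hχχ g
  -- Dividing by `s` removes the character χ, so γ is fixed by the kernel of ψ and lies in F(r).
  set γ := d τ / s with hγ
  have hγH : ∀ g ∈ ψ.ker, g γ = γ := by
    intro g hg
    rw [hγ, map_div₀, hβ g hg, hχ]
    have := left_ne_zero_of_mul_eq_one (hχχ g)
    field_simp
  -- The cochain identity at (τ, τ) says that t times the norm of γ is 1.
  have hγτ : s ^ 2 * (γ * τ γ) = 1 := by
    have e := hdh τ τ
    rw [hd₁ _ hττ, hτ, hb₂, mul_one] at e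
    rw [hγ, map_div₀, hχ]
    have := left_ne_zero_of_mul_eq_one (hχχ τ)
    field_simp
    rw [mul_comm, ← e]
  have hall : ∀ x, (∀ g ∈ ψ.ker, g x = x) → τ x = x → ∃ a : F, algebraMap F _ a = x := by
    intro x hx hτx
    refine hfix x fun g => ?_
    rcases Int.units_eq_one_or (ψ g) with hg | hg
    · exact hx g hg
    · have : τ⁻¹ * g ∈ ψ.ker := by
        rw [MonoidHom.mem_ker, map_mul, map_inv, hτ, hg]; rfl
      calc g x = τ ((τ⁻¹ * g) x) := by rw [← AlgEquiv.mul_apply, mul_inv_cancel_left]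
        _ = x := by rw [hx _ this, hτx]
  have hγτH : ∀ g ∈ ψ.ker, g (τ γ) = τ γ := by
    intro g hg
    have hmem : τ⁻¹ * g * τ ∈ ψ.ker := by
      simpa using ψ.normal_ker.conj_mem g hg τ⁻¹
    calc g (τ γ) = τ ((τ⁻¹ * g * τ) γ) := by
          rw [← AlgEquiv.mul_apply, ← AlgEquiv.mul_apply]; congr 1; group
      _ = τ γ := by rw [hγH _ hmem]
  have hττγ : τ (τ γ) = γ := hγH _ hττ
  have hτr : τ r = -r := by rw [hψ, hτ]; simp
  have hgr : ∀ g ∈ ψ.ker, g r = r := fun g hg => by rw [hψ, MonoidHom.mem_ker.1 hg]; simp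
  -- The coordinates of γ = α + α'r over `F`; the norm equation becomes t(α² - uα'²) = 1, contrary
  -- to anisotropy.
  obtain ⟨α, hα⟩ := hall ((γ + τ γ) / 2) (fun g hg => by
      rw [map_div₀, map_add, hγH g hg, hγτH g hg, map_ofNat]) (by
      rw [map_div₀, map_add, hττγ, map_ofNat, add_comm])
  obtain ⟨α', hα'⟩ := hall ((γ - τ γ) / (2 * r)) (fun g hg => by
      rw [map_div₀, map_sub, hγH g hg, hγτH g hg, map_mul, map_ofNat, hgr g hg]) (by
      rw [map_div₀, map_sub, hττγ, map_mul, map_ofNat, hτr]; field_simp; ring)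
  have hnorm : t * (α ^ 2 - u * α' ^ 2) = 1 := by
    apply (algebraMap F (SeparableClosure F)).injective
    rw [map_mul, map_sub, map_mul, map_pow, map_pow, ← hs, ← hr, hα, hα', map_one, ← hγτ]
    field_simp
    ring
  exact one_ne_zero (haniso (t * α) (t * α') 1 (by linear_combination t * hnorm))

end Nonvanishing

/-! ### Explicit cochains for the trivial summands -/

section Signs

/-- If z has norm -1 from F(√u), the cochain z^ψ has coboundary ψ ∪ ψ; this is the vanishing of
(u,-1). -/
theorem map_signPow_mul {K : Type*} [Field K] (σ : K →+* K) {z z' : K} (hz : z * z' = -1) {b : ℤˣ}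
    (h : σ z = if b = -1 then z' else z) (d : ℤˣ) :
    σ (signPow d z) * signPow b z = ((signBit b d : ℤ) : K) * signPow (b * d) z := by
  have hz' : z' * z = -1 := by rw [mul_comm, hz]
  rcases Int.units_eq_one_or b with rfl | rfl <;> rcases Int.units_eq_one_or d with rfl | rfl <;>
    simp [signPow, signBit] at h ⊢ <;> simp [h, hz']

/-- For w = √-1 the cochain w^χ has coboundary χ ∪ χ, times ψ ∪ χ if `ε` is 1, since then ψ changes
the sign of w. -/
theorem map_signPow_mul_of_eq_mul {K : Type*} [Field K] (σ : K →+* K) {w : K} (hw : w * w = -1)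
    {b ε : ℤˣ} (h : σ w = ((signPow b (-ε) : ℤˣ) : ℤ) * w) (a c : ℤˣ) :
    σ (signPow c w) * signPow a w =
      ((((if b = -1 ∧ c = -1 then -ε else 1) * signBit a c : ℤˣ) : ℤ) : K) *
        signPow (a * c) w := by
  rcases Int.units_eq_one_or b with rfl | rfl <;> rcases Int.units_eq_one_or a with rfl | rfl <;>
    rcases Int.units_eq_one_or c with rfl | rfl <;>
    simp [signPow, signBit] at h ⊢ <;> simp [h, hw, mul_assoc]

/-- Up to the two coboundaries on the right, the Stiefel-Whitney cocycle is the cup product ψ ∪ χ,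
for either sign `ε`. -/
theorem flipSign_mul_signBit (ε a b c d : ℤˣ) : flipSign ε a b c d * signBit b c =
    signBit b d * ((if b = -1 ∧ c = -1 then -ε else 1) * signBit a c) := by
  rcases Int.units_eq_one_or b with rfl | rfl <;> rcases Int.units_eq_one_or c with rfl | rfl <;>
    simp [flipSign, signBit, mul_comm]

end Signs

/-! ### Actions through two involutions: comparison and nonvanishing -/

section FlipActions

variable {S : Type*} [DecidableEq S]

/-- The group `G` acts on the set `S` through two characters `χ` and `ψ`; it permutes 27 elements `f n`
by the transpositions in the lists `sPairs` and `l`, and it fixes all other elements. -/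
structure IsFlipAction {G : Type*} [Group G] (ρ : G →* Equiv.Perm S) (f : Fin 27 → S)
    (l : List (Fin 27 × Fin 27)) (χ ψ : G →* ℤˣ) : Prop where
  injective : Function.Injective f
  apply : ∀ g n, ρ g (f n) = f ((signPow (χ g) (pairsPerm sPairs) * signPow (ψ g) (pairsPerm l)) n)
  fixed : ∀ g x, x ∉ Set.range f → ρ g x = x

theorem IsFlipAction.eq {G : Type*} [Group G] {ρ : G →* Equiv.Perm S} {f : Fin 27 → S}
    {l : List (Fin 27 × Fin 27)} {χ ψ : G →* ℤˣ} (h : IsFlipAction ρ f l χ ψ) (g : G) :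
    ρ g = signPow (χ g) (swapProd f sPairs) * signPow (ψ g) (swapProd f l) := by
  have key : ∀ (l : List (Fin 27 × Fin 27)) (a : ℤˣ) (n : Fin 27),
      signPow a (swapProd f l) (f n) = f (signPow a (pairsPerm l) n) := by
    intro l a n
    rw [signPow, signPow]
    split_ifs
    · exact swapProd_apply h.injective l n
    · rfl
  have key' : ∀ (l : List (Fin 27 × Fin 27)) (a : ℤˣ) (x : S), x ∉ Set.range f →
      signPow a (swapProd f l) x = x := by
    intro l a x hx
    rw [signPow]
    split_ifs
    · exact swapProd_apply_of_notMem l hx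
    · rfl
  ext x
  by_cases hx : x ∈ Set.range f
  · obtain ⟨n, rfl⟩ := hx
    rw [h.apply, Equiv.Perm.mul_apply, Equiv.Perm.mul_apply, key, key]
  · rw [h.fixed g x hx, Equiv.Perm.mul_apply, key' _ _ _ hx, key' _ _ _ hx]

variable [Fintype S] {F : Type*} [Field F] {ρ : Gal(SeparableClosure F/F) →* Equiv.Perm S}
  {f : Fin 27 → S} {l : List (Fin 27 × Fin 27)} {χ ψ : Gal(SeparableClosure F/F) →* ℤˣ} {ε : ℤˣ}

theorem IsFlipAction.exists_pinSign_eq (h : IsFlipAction ρ f l χ ψ) (hl : IsFlip l ε) :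
    ∃ β : ℤˣ × ℤˣ → ℤˣ, ∀ g h, pinSign (ρ g) (ρ h) =
      flipSign ε (χ g) (ψ g) (χ h) (ψ h) *
        (β (χ g, ψ g) * β (χ h, ψ h) * β (χ (g * h), ψ (g * h))) :=
  _root_.exists_pinSign_eq ρ h.eq (isPinLift_sPairs h.injective) (hl.isPinLift h.injective)
    (liftProd_sPairs_mul_self h.injective) (hl.liftProd_mul_self h.injective)
    (hl.liftProd_comm h.injective)

/-- The Stiefel-Whitney class of an action through two commuting involutions depends only on the two
characters and on the commutator of the lifts of the involutions. -/
theorem IsFlipAction.galoisSW₂_eq {S' : Type*} [DecidableEq S'] [Fintype S']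
    {ρ' : Gal(SeparableClosure F/F) →* Equiv.Perm S'} {f' : Fin 27 → S'}
    (h : IsFlipAction ρ f l χ ψ) (h' : IsFlipAction ρ' f' l χ ψ) (hl : IsFlip l ε)
    (hρ : IsLocallyConstant ρ) (hρ' : IsLocallyConstant ρ')
    (hχ : IsLocallyConstant χ) (hψ : IsLocallyConstant ψ) :
    galoisSW₂ ρ hρ = galoisSW₂ ρ' hρ' := by
  obtain ⟨β, hβ⟩ := h.exists_pinSign_eq hl
  obtain ⟨β', hβ'⟩ := h'.exists_pinSign_eq hl
  refine galoisSW₂_eq_of_pinSign_eq hρ hρ' (fun g => β (χ g, ψ g) * β' (χ g, ψ g))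
    ((hχ.prodMk hψ).comp fun p => β p * β' p) fun g h => ?_
  rw [hβ, hβ']
  have hu : ∀ a : ℤˣ, a * a = 1 := Int.units_mul_self
  generalize β (χ g, ψ g) = a
  generalize β (χ h, ψ h) = b
  generalize β (χ (g * h), ψ (g * h)) = c
  calc _ = flipSign ε (χ g) (ψ g) (χ h) (ψ h) * (a * a) * (b * b) * (c * c) *
        (β' (χ g, ψ g) * β' (χ h, ψ h) * β' (χ (g * h), ψ (g * h))) := by
        rw [hu, hu, hu, mul_one, mul_one, mul_one]
    _ = _ := by
        generalize flipSign ε (χ g) (ψ g) (χ h) (ψ h) = e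
        generalize β' (χ g, ψ g) = a'
        generalize β' (χ h, ψ h) = b'
        generalize β' (χ (g * h), ψ (g * h)) = c'
        ac_rfl

/-- The cochain z^ψ w^χ shows that the class is the cup product of the characters of `u` and `t`.
Both cases of the construction are covered: w is fixed for `ε` = -1, and its sign changes with ψ for
`ε` = 1. -/
theorem IsFlipAction.galoisSW₂_ne_zero (h : IsFlipAction ρ f l χ ψ) (hl : IsFlip l ε)
    (hρ : IsLocallyConstant ρ) (hχc : IsLocallyConstant χ) (hψc : IsLocallyConstant ψ)
    (h2 : (2 : F) ≠ 0) {u t : F} (haniso : ∀ a b c : F, a ^ 2 = u * b ^ 2 + t * c ^ 2 → c = 0)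
    (hnsq : ∀ a : F, a ^ 2 ≠ u)
    {s r : SeparableClosure F} (hs₀ : s ≠ 0) (hr₀ : r ≠ 0)
    (hs : s ^ 2 = algebraMap F _ t) (hr : r ^ 2 = algebraMap F _ u)
    (hχ : ∀ g : Gal(SeparableClosure F/F), g s = ((χ g : ℤ) : SeparableClosure F) * s)
    (hψ : ∀ g : Gal(SeparableClosure F/F), g r = ((ψ g : ℤ) : SeparableClosure F) * r)
    {w : SeparableClosure F} (hw : w ^ 2 = -1)
    (hgw : ∀ g : Gal(SeparableClosure F/F),
      g w = ((signPow (ψ g) (-ε) : ℤˣ) : ℤ) * w)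
    {x y : F} (hxy : x ^ 2 - u * y ^ 2 = -1) : galoisSW₂ ρ hρ ≠ 0 := by
  intro h₀
  obtain ⟨b, hb, hbρ⟩ := exists_of_galoisSW₂_eq_zero hρ h₀
  obtain ⟨β, hβ⟩ := h.exists_pinSign_eq hl
  set z : SeparableClosure F := algebraMap F _ x + algebraMap F _ y * r with hz
  set z' : SeparableClosure F := algebraMap F _ x - algebraMap F _ y * r with hz'
  have hzz : z * z' = -1 := by
    have := congrArg (algebraMap F (SeparableClosure F)) hxy
    rw [map_sub, map_mul, map_pow, map_pow, map_neg, map_one, ← hr] at this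
    linear_combination this
  have hgz : ∀ g : Gal(SeparableClosure F/F), g z = if ψ g = -1 then z' else z := by
    intro g
    rw [hz, map_add, map_mul, AlgEquiv.commutes, AlgEquiv.commutes, hψ]
    rcases Int.units_eq_one_or (ψ g) with h | h <;> rw [h] <;> simp [hz', sub_eq_add_neg]
  have hw₀ : w ≠ 0 := by rintro rfl; norm_num at hw
  have hz₀ : z ≠ 0 := by intro h; rw [h, zero_mul] at hzz; norm_num at hzz
  have hw2 : w * w = -1 := by rw [← hw, pow_two]
  set P : Gal(SeparableClosure F/F) → SeparableClosure F := fun g =>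
    signPow (ψ g) z * signPow (χ g) w with hP
  have hP₀ : ∀ g, P g ≠ 0 := fun g => by
    simp only [hP, signPow]
    refine mul_ne_zero ?_ ?_ <;> split_ifs <;> first | assumption | exact one_ne_zero
  have hPgh : ∀ g h, g (P h) * P g = (((flipSign ε (χ g) (ψ g) (χ h) (ψ h) *
      signBit (ψ g) (χ h) : ℤˣ) : ℤ) : SeparableClosure F) * P (g * h) := by
    intro g h
    have e₁ := map_signPow_mul (g : SeparableClosure F →+* SeparableClosure F) hzz (hgz g) (ψ h)
    have e₂ := map_signPow_mul_of_eq_mul (g : SeparableClosure F →+* SeparableClosure F) hw2 (hgw g)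
      (χ g) (χ h)
    simp only [RingHom.coe_coe] at e₁ e₂
    simp only [hP, map_mul χ, map_mul ψ, map_mul g, flipSign_mul_signBit]
    rw [mul_mul_mul_comm, e₁, e₂, mul_mul_mul_comm, ← Int.cast_mul, ← Units.val_mul]
  have hunit : ∀ a : ℤˣ, ((a : ℤ) : SeparableClosure F) * ((a : ℤ) : SeparableClosure F) = 1 := by
    intro a
    rw [← Int.cast_mul, ← Units.val_mul, Int.units_mul_self, Units.val_one, Int.cast_one]
  -- If the class were trivial, correcting `b` by the signs β and by `P` would give a cochain with
  -- coboundary ψ ∪ χ.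
  refine signBit_ne_coboundary h2 haniso hnsq hs₀ hr₀ hs hr hχ hψ
    (b := fun g => (b g : SeparableClosure F) * ((β (χ g, ψ g) : ℤˣ) : ℤ) / P g) ?_ ?_ ?_
  · have hc := hb.prodMk (hχc.prodMk hψc)
    exact hc.comp fun q => (q.1 : SeparableClosure F) * ((β q.2 : ℤˣ) : ℤ) /
      (signPow q.2.2 z * signPow q.2.1 w)
  · intro g
    refine div_ne_zero (mul_ne_zero (b g).ne_zero ?_) (hP₀ g)
    exact left_ne_zero_of_mul_eq_one (hunit _)
  · intro g h
    have h₁ := congrArg Units.val (hbρ g h)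
    have h₂ : (((pinSign (ρ g) (ρ h) : ℤˣ) : ℤ) : SeparableClosure F) * b (g * h) =
        g (b h) * b g := by
      rw [Units.val_mul, Units.val_mul] at h₁
      refine (congrArg (· * (b (g * h) : SeparableClosure F)) h₁).trans ?_
      change g (b h) * ((b (g * h))⁻¹ : (SeparableClosure F)ˣ) * b g * b (g * h) = _
      rw [mul_right_comm _ _ (b g : SeparableClosure F), mul_assoc, Units.inv_mul, mul_one]
    rw [hβ] at h₂
    have h₃ := hPgh g h
    have hPg := hP₀ g
    have hPh : g (P h) ≠ 0 := (map_ne_zero g).2 (hP₀ h)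
    have hPgh' := hP₀ (g * h)
    have hG := map_intCast g (β (χ h, ψ h) : ℤ)
    simp only [map_div₀, map_mul g, hG]
    have u₁ := hunit (β (χ g, ψ g))
    have u₂ := hunit (β (χ h, ψ h))
    have u₃ := hunit (β (χ (g * h), ψ (g * h)))
    have u₄ := hunit (flipSign ε (χ g) (ψ g) (χ h) (ψ h))
    have u₅ := hunit (signBit (ψ g) (χ h))
    generalize β (χ g, ψ g) = β₁ at *
    generalize β (χ h, ψ h) = β₂ at *
    generalize β (χ (g * h), ψ (g * h)) = β₃ at *
    generalize flipSign ε (χ g) (ψ g) (χ h) (ψ h) = e at *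
    generalize signBit (ψ g) (χ h) = d at *
    clear_value P
    push_cast at h₂ h₃
    rw [div_mul_div_comm, mul_div_assoc', div_eq_div_iff hPgh' (mul_ne_zero hPh hPg)]
    rw [h₃]
    generalize ((e : ℤ) : SeparableClosure F) = e at *
    generalize ((d : ℤ) : SeparableClosure F) = d at *
    generalize ((β₁ : ℤ) : SeparableClosure F) = β₁ at *
    generalize ((β₂ : ℤ) : SeparableClosure F) = β₂ at *
    generalize ((β₃ : ℤ) : SeparableClosure F) = β₃ at *
    generalize (b (g * h) : SeparableClosure F) = B at *
    generalize P (g * h) = Q at *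
    generalize g (b h : SeparableClosure F) = B₂ at *
    generalize (b g : SeparableClosure F) = B₁ at *
    calc d * (B * β₃) * (e * d * Q) = e * B * β₃ * Q * (d * d) := by ring
      _ = e * B * β₃ * Q := by rw [u₅, mul_one]
      _ = e * B * β₃ * Q * (β₁ * β₁) * (β₂ * β₂) := by rw [u₁, u₂, mul_one, mul_one]
      _ = (e * (β₁ * β₂ * β₃) * B) * (β₁ * β₂) * Q := by ring
      _ = B₂ * β₂ * (B₁ * β₁) * Q := by rw [h₂]; ring

end FlipActions

/-! ### Sign changes of the parameters permute the lines -/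

namespace ShiodaCoeffs

section SignChanges

variable {R : Type*} [CommRing R]

set_option maxRecDepth 100000 in
theorem pairsPerm_sPairs (i : Fin 27) : pairsPerm sPairs i =
    (![1, 0, 2, 3, 4, 5, 7, 6, 8, 9, 10, 11, 12, 17, 18, 19, 20, 13, 14, 15, 16, 21, 22, 23, 24, 25,
      26] : Fin 27 → Fin 27) i := by
  revert i; decide

set_option maxRecDepth 100000 in
theorem pairsPerm_rPairs (i : Fin 27) : pairsPerm rPairs i =
    (![0, 1, 3, 2, 4, 5, 6, 7, 9, 8, 10, 11, 12, 14, 13, 15, 16, 18, 17, 19, 20, 21, 24, 25, 22, 23,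
      26] : Fin 27 → Fin 27) i := by
  revert i; decide

set_option maxRecDepth 100000 in
theorem pairsPerm_rmPairs (i : Fin 27) : pairsPerm rmPairs i =
    (![0, 1, 3, 2, 5, 4, 6, 7, 9, 8, 11, 10, 12, 14, 13, 16, 15, 18, 17, 20, 19, 21, 25, 24, 23, 22,
      26] : Fin 27 → Fin 27) i := by
  revert i; decide

theorem lineSlope_neg_left (σ r m : R) (i : Fin 27) :
    lineSlope (-σ) r m i = lineSlope σ r m (pairsPerm sPairs i) := by
  rw [pairsPerm_sPairs]
  fin_cases i <;> simp [lineSlope, slopeOne, slopeθ, slopeS, slopeR, slopeM]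

theorem lineSlope_neg_middle (σ r m : R) (i : Fin 27) :
    lineSlope σ (-r) m i = lineSlope σ r m (pairsPerm rPairs i) := by
  rw [pairsPerm_rPairs]
  fin_cases i <;> simp [lineSlope, slopeOne, slopeθ, slopeS, slopeR, slopeM]

theorem lineSlope_neg_right (σ r m : R) (i : Fin 27) :
    lineSlope σ (-r) (-m) i = lineSlope σ r m (pairsPerm rmPairs i) := by
  rw [pairsPerm_rmPairs]
  fin_cases i <;> simp [lineSlope, slopeOne, slopeθ, slopeS, slopeR, slopeM]

theorem offA₁_neg (σ r m : R) : offA₁ σ (-r) m = offA₁ σ r m ∧ offA₁ σ r (-m) = offA₁ σ r m := by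
  constructor <;> (simp only [offA₁]; ring)

theorem offB₁_neg (σ r m : R) : offB₁ σ (-r) m = offB₁ σ r m ∧ offB₁ σ r (-m) = offB₁ σ r m := by
  constructor <;> (simp only [offB₁]; ring)

theorem offA₃_neg (θ r m : R) : offA₃ θ r (-m) = offA₃ θ r m := by simp only [offA₃]; ring

theorem offB₃_neg (θ r m : R) : offB₃ θ r (-m) = offB₃ θ r m := by simp only [offB₃]; ring

theorem offA₅_neg (θ r m : R) : offA₅ θ (-r) m = offA₅ θ r m := by simp only [offA₅]; ring

theorem offB₅_neg (θ r m : R) : offB₅ θ (-r) m = offB₅ θ r m := by simp only [offB₅]; ring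

theorem off₁₃_neg (σ r m : R) : off₁₃ σ r (-m) = off₁₃ σ r m := by simp only [off₁₃]; ring

theorem off₁₅_neg (σ r m : R) : off₁₅ σ (-r) m = off₁₅ σ r m := by simp only [off₁₅]; ring

/-- Since c₁₂ and c₃₄ share a slope, the action on slopes alone would not determine the permutation
of the lines; the offsets are needed too. -/
theorem lineOffset_neg_left (σ r m : R) (i : Fin 27) :
    lineOffset (-σ) r m i = lineOffset σ r m (pairsPerm sPairs i) := by
  rw [pairsPerm_sPairs]
  fin_cases i <;> simp [lineOffset]

theorem lineOffset_neg_middle (σ r m : R) (i : Fin 27) :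
    lineOffset σ (-r) m i = lineOffset σ r m (pairsPerm rPairs i) := by
  rw [pairsPerm_rPairs]
  fin_cases i <;> simp [lineOffset, (offA₁_neg _ _ _).1, (offB₁_neg _ _ _).1, offA₅_neg, offB₅_neg,
    off₁₅_neg]

theorem lineOffset_neg_right (σ r m : R) (i : Fin 27) :
    lineOffset σ (-r) (-m) i = lineOffset σ r m (pairsPerm rmPairs i) := by
  rw [pairsPerm_rmPairs]
  fin_cases i <;> simp [lineOffset, offA₁_neg, offB₁_neg, offA₃_neg, offB₃_neg, offA₅_neg, offB₅_neg,
    off₁₃_neg, off₁₅_neg]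

theorem map_lineSlope {R' : Type*} [CommRing R'] (φ : R →+* R') (σ r m : R) (i : Fin 27) :
    φ (lineSlope σ r m i) = lineSlope (φ σ) (φ r) (φ m) i := by
  simp [lineSlope, map_ofNat φ]

theorem map_offA₁ {R' : Type*} [CommRing R'] (φ : R →+* R') (σ r m : R) :
    φ (offA₁ σ r m) = offA₁ (φ σ) (φ r) (φ m) := by
  simp only [offA₁, map_add, map_sub, map_mul, map_pow, map_ofNat]

theorem map_offB₁ {R' : Type*} [CommRing R'] (φ : R →+* R') (σ r m : R) :
    φ (offB₁ σ r m) = offB₁ (φ σ) (φ r) (φ m) := by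
  simp only [offB₁, map_add, map_sub, map_mul, map_pow, map_ofNat]

theorem map_off₁₃ {R' : Type*} [CommRing R'] (φ : R →+* R') (σ r m : R) :
    φ (off₁₃ σ r m) = off₁₃ (φ σ) (φ r) (φ m) := by
  simp only [off₁₃, map_add, map_sub, map_mul, map_pow, map_ofNat]

theorem map_off₁₅ {R' : Type*} [CommRing R'] (φ : R →+* R') (σ r m : R) :
    φ (off₁₅ σ r m) = off₁₅ (φ σ) (φ r) (φ m) := by
  simp only [off₁₅, map_add, map_sub, map_mul, map_pow, map_ofNat]

theorem map_offA₃ {R' : Type*} [CommRing R'] (φ : R →+* R') (θ r m : R) :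
    φ (offA₃ θ r m) = offA₃ (φ θ) (φ r) (φ m) := by
  simp only [offA₃, map_add, map_sub, map_mul, map_pow, map_ofNat]

theorem map_offB₃ {R' : Type*} [CommRing R'] (φ : R →+* R') (θ r m : R) :
    φ (offB₃ θ r m) = offB₃ (φ θ) (φ r) (φ m) := by
  simp only [offB₃, map_add, map_sub, map_mul, map_pow, map_ofNat]

theorem map_offA₅ {R' : Type*} [CommRing R'] (φ : R →+* R') (θ r m : R) :
    φ (offA₅ θ r m) = offA₅ (φ θ) (φ r) (φ m) := by
  simp only [offA₅, map_add, map_sub, map_mul, map_pow, map_ofNat]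

theorem map_offB₅ {R' : Type*} [CommRing R'] (φ : R →+* R') (θ r m : R) :
    φ (offB₅ θ r m) = offB₅ (φ θ) (φ r) (φ m) := by
  simp only [offB₅, map_add, map_sub, map_mul, map_pow, map_ofNat]

theorem map_off₃₅ {R' : Type*} [CommRing R'] (φ : R →+* R') (θ r m : R) :
    φ (off₃₅ θ r m) = off₃₅ (φ θ) (φ r) (φ m) := by
  simp only [off₃₅, map_add, map_sub, map_mul, map_pow, map_ofNat]

theorem map_off₁₂ {R' : Type*} [CommRing R'] (φ : R →+* R') (θ B D : R) :
    φ (off₁₂ θ B D) = off₁₂ (φ θ) (φ B) (φ D) := by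
  simp only [off₁₂, map_add, map_sub, map_mul, map_pow, map_ofNat]

theorem map_off₃₄ {R' : Type*} [CommRing R'] (φ : R →+* R') (θ B D : R) :
    φ (off₃₄ θ B D) = off₃₄ (φ θ) (φ B) (φ D) := by
  simp only [off₃₄, map_add, map_sub, map_mul, map_pow, map_ofNat]

theorem map_off₅₆ {R' : Type*} [CommRing R'] (φ : R →+* R') (θ B D : R) :
    φ (off₅₆ θ B D) = off₅₆ (φ θ) (φ B) (φ D) := by
  simp only [off₅₆, map_add, map_sub, map_mul, map_pow, map_ofNat]

theorem map_lineOffset {R' : Type*} [CommRing R'] (φ : R →+* R') (σ r m : R) (i : Fin 27) :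
    φ (lineOffset σ r m i) = lineOffset (φ σ) (φ r) (φ m) i := by
  fin_cases i <;> simp [lineOffset, map_offA₁, map_offB₁, map_off₁₃, map_off₁₅, map_offA₃, map_offB₃, map_offA₅, map_offB₅, map_off₃₅, map_off₁₂, map_off₃₄, map_off₅₆,
    map_ofNat φ]

variable {K : Type*} [Field K]

theorem map_fieldOffset {K' : Type*} [Field K'] (φ : K →+* K') (σ r m : K) (i : Fin 27) :
    φ (fieldOffset σ r m i) = fieldOffset (φ σ) (φ r) (φ m) i := by
  simp only [fieldOffset, map_mul, map_pow, map_inv₀, map_ofNat, map_lineOffset]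

/-- The action of a sign change of `r`, which may change the sign of `m` as well. -/
theorem lineSlope_fieldOffset_neg {l : List (Fin 27 × Fin 27)} {m m' : K}
    (h : (l = rPairs ∧ m' = m) ∨ (l = rmPairs ∧ m' = -m)) (σ r : K) (i : Fin 27) :
    lineSlope σ (-r) m' i = lineSlope σ r m (pairsPerm l i) ∧
      fieldOffset σ (-r) m' i = fieldOffset σ r m (pairsPerm l i) := by
  rcases h with ⟨rfl, rfl⟩ | ⟨rfl, rfl⟩
  · exact ⟨lineSlope_neg_middle _ _ _ _, by rw [fieldOffset, fieldOffset, lineOffset_neg_middle]⟩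
  · exact ⟨lineSlope_neg_right _ _ _ _, by rw [fieldOffset, fieldOffset, lineOffset_neg_right]⟩

/-- A field automorphism that changes the signs of the parameters permutes the lines. -/
theorem map_lineSlope_fieldOffset {l : List (Fin 27 × Fin 27)} {m m' : K}
    (h : (l = rPairs ∧ m' = m) ∨ (l = rmPairs ∧ m' = -m)) {σ r : K} {φ : K →+* K} {χ ψ : ℤˣ}
    (hσ : φ σ = ((χ : ℤ) : K) * σ) (hr : φ r = ((ψ : ℤ) : K) * r)
    (hm : φ m = if ψ = -1 then m' else m) (i : Fin 27) :
    φ (lineSlope σ r m i) =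
        lineSlope σ r m ((signPow χ (pairsPerm sPairs) * signPow ψ (pairsPerm l)) i) ∧
      φ (fieldOffset σ r m i) =
        fieldOffset σ r m ((signPow χ (pairsPerm sPairs) * signPow ψ (pairsPerm l)) i) := by
  have hs : ∀ i, lineSlope (((χ : ℤ) : K) * σ) r m i =
        lineSlope σ r m (signPow χ (pairsPerm sPairs) i) ∧
      fieldOffset (((χ : ℤ) : K) * σ) r m i =
        fieldOffset σ r m (signPow χ (pairsPerm sPairs) i) := by
    intro i
    rcases Int.units_eq_one_or χ with rfl | rfl
    · simp [signPow]
    · simp [signPow, lineSlope_neg_left, fieldOffset, lineOffset_neg_left]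
  rw [Equiv.Perm.mul_apply, ← (hs _).1, ← (hs _).2, map_lineSlope, map_fieldOffset, hσ, hr, hm]
  generalize ((χ : ℤ) : K) * σ = σ'
  rcases Int.units_eq_one_or ψ with rfl | rfl
  · simp [signPow]
  · simpa [signPow] using lineSlope_fieldOffset_neg h σ' r i

end SignChanges

end ShiodaCoeffs

/-! ### Linear algebra of lines and restricted forms -/

section RestrictionToLines

variable {K : Type*} [Field K]

/-- The restriction of a quadratic form to a plane. -/
theorem exists_eval_add_eq {h : MvPolynomial (Fin 3) K} (hh : h.IsHomogeneous 2)
    (h2 : (2 : K) ≠ 0) (v w : Fin 3 → K) : ∃ q : K, ∀ x y : K,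
      eval (x • v + y • w) h = x ^ 2 * eval v h + x * y * q + y ^ 2 * eval w h := by
  have h₁ : ∀ i, ∃ a : Fin 3 → K, ∀ v, eval v (pderiv i h) = ∑ j, a j * v j := fun i =>
    ShiodaCoeffs.exists_eq_sum_of_isHomogeneous_one hh.pderiv
  choose a ha using h₁
  have h₃ : ∀ v, 2 * eval v h = ∑ i, v i * ∑ j, a i j * v j := by
    intro v
    -- Euler's identity expresses 2h through its partial derivatives, which are linear forms.
    have := congrArg (eval v) hh.sum_X_mul_pderiv
    simpa [map_sum, ha] using this.symm
  refine ⟨2⁻¹ * ∑ i, (v i * ∑ j, a i j * w j + w i * ∑ j, a i j * v j), fun x y => ?_⟩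
  refine mul_left_cancel₀ h2 ?_
  have h₄ : ∀ i, ∑ j, a i j * (x • v + y • w) j = x * ∑ j, a i j * v j + y * ∑ j, a i j * w j := by
    intro i
    rw [Finset.mul_sum, Finset.mul_sum, ← Finset.sum_add_distrib]
    exact Finset.sum_congr rfl fun j _ => by simp; ring
  calc 2 * eval (x • v + y • w) h
      = ∑ i, (x • v + y • w) i * (x * ∑ j, a i j * v j + y * ∑ j, a i j * w j) := by
        rw [h₃]; exact Finset.sum_congr rfl fun i _ => by rw [h₄]
    _ = x ^ 2 * ∑ i, v i * ∑ j, a i j * v j +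
        x * y * ∑ i, (v i * ∑ j, a i j * w j + w i * ∑ j, a i j * v j) +
        y ^ 2 * ∑ i, w i * ∑ j, a i j * w j := by
        simp only [Finset.mul_sum (s := Finset.univ) (a := x ^ 2),
          Finset.mul_sum (s := Finset.univ) (a := x * y),
          Finset.mul_sum (s := Finset.univ) (a := y ^ 2), ← Finset.sum_add_distrib]
        refine Finset.sum_congr rfl fun i _ => ?_
        simp only [Pi.add_apply, Pi.smul_apply, smul_eq_mul]
        ring
    _ = _ := by rw [← h₃, ← h₃]; field_simp

/-- A polynomial that vanishes on a punctured line vanishes on the line. -/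
theorem eval_eq_zero_of_forall_ne [Infinite K] {n : ℕ} (h : MvPolynomial (Fin n) K)
    {v w : Fin n → K} (hvw : ∀ y : K, y ≠ 0 → eval (v + y • w) h = 0) : eval v h = 0 := by
  set P : Polynomial K := aeval (fun i => Polynomial.C (v i) + Polynomial.X * Polynomial.C (w i)) h
  have hP : ∀ y, P.eval y = eval (v + y • w) h := by
    intro y
    have := comp_aeval_apply (fun i => Polynomial.C (v i) + Polynomial.X * Polynomial.C (w i))
      (Polynomial.aeval y) h
    rw [Polynomial.coe_aeval_eq_eval] at this
    refine this.trans ?_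
    rw [← coe_aeval_eq_eval]
    change aeval _ h = aeval _ h
    refine congrArg (fun z => aeval z h) (funext fun i => ?_)
    simp only [Polynomial.eval_add, Polynomial.eval_mul, Polynomial.eval_C, Polynomial.eval_X,
      Pi.add_apply, Pi.smul_apply, smul_eq_mul]
  -- Multiplication by X supplies the missing zero at 0, so the product vanishes everywhere on an
  -- infinite field.
  have h₀ : Polynomial.X * P = 0 := by
    refine Polynomial.funext fun y => ?_
    rw [Polynomial.eval_mul, Polynomial.eval_X, Polynomial.eval_zero, hP]
    by_cases hy : y = 0
    · rw [hy, zero_mul]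
    · rw [hvw y hy, mul_zero]
  have h₁ : P = 0 := (mul_eq_zero.1 h₀).resolve_left Polynomial.X_ne_zero
  have h₂ := hP 0
  rw [h₁, Polynomial.eval_zero, zero_smul, add_zero] at h₂
  exact h₂.symm

theorem finrank_ker_dual {n : ℕ} {f : (Fin (n + 1) → K) →ₗ[K] K} (hf : f ≠ 0) :
    Module.finrank K (LinearMap.ker f) = n := by
  have := Module.Dual.finrank_ker_add_one_of_ne_zero hf
  simpa using this

theorem finrank_span_pair_eq_two {n : ℕ} {v w : Fin n → K}
    (h : ∀ x y : K, x • v + y • w = 0 → x = 0 ∧ y = 0) :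
    Module.finrank K (Submodule.span K {v, w}) = 2 := by
  have := finrank_span_eq_card (LinearIndependent.pair_iff.2 h)
  rw [Matrix.range_cons, Matrix.range_cons, Matrix.range_empty, Set.union_empty,
    Fintype.card_fin] at this
  exact this

theorem exists_generator_ker {V : Type*} [AddCommGroup V] [Module K V]
    (hV : Module.finrank K V = 2) {f : V →ₗ[K] K} (hf : f ≠ 0) :
    ∃ v : V, v ≠ 0 ∧ f v = 0 ∧ ∀ w, f w = 0 → ∃ x : K, x • v = w := by
  have : FiniteDimensional K V := .of_finrank_eq_succ hV
  have h₁ : Module.finrank K (LinearMap.ker f) = 1 := by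
    have := Module.Dual.finrank_ker_add_one_of_ne_zero (f := f) hf
    omega
  obtain ⟨⟨v, hfv⟩, hv₀, hspan⟩ := finrank_eq_one_iff'.1 h₁
  refine ⟨v, fun h => hv₀ (Subtype.ext h), hfv, fun w hw => ?_⟩
  obtain ⟨x, hx⟩ := hspan ⟨w, hw⟩
  exact ⟨x, congrArg Subtype.val hx⟩

/-- A plane on which a linear form does not vanish identically. -/
theorem exists_basis_of_ne_zero {n : ℕ} {U : Submodule K (Fin n → K)} (hU : Module.finrank K U = 2)
    (f : (Fin n → K) →ₗ[K] K) (hf : ∃ u ∈ U, f u ≠ 0) :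
    ∃ v ∈ U, ∃ w ∈ U, v ≠ 0 ∧ f v = 0 ∧ f w = 1 ∧ ∀ u ∈ U, ∃ x : K, u = x • v + f u • w := by
  obtain ⟨u, hu, hfu⟩ := hf
  have hne : f.domRestrict U ≠ 0 := fun h => hfu (LinearMap.congr_fun h ⟨u, hu⟩)
  obtain ⟨⟨v, hv⟩, hv₀, hfv, hspan⟩ := exists_generator_ker hU hne
  refine ⟨v, hv, (f u)⁻¹ • u, U.smul_mem _ hu, ?_, hfv, ?_, fun u' hu' => ?_⟩
  · rintro rfl
    exact hv₀ rfl
  · rw [map_smul, smul_eq_mul, inv_mul_cancel₀ hfu]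
  · have hw : f (u' - f u' • (f u)⁻¹ • u) = 0 := by
      rw [map_sub, map_smul, map_smul, smul_eq_mul, smul_eq_mul, inv_mul_cancel₀ hfu, mul_one,
        sub_self]
    obtain ⟨x, hx⟩ := hspan ⟨_, U.sub_mem hu' (U.smul_mem (f u') (U.smul_mem (f u)⁻¹ hu))⟩ hw
    refine ⟨x, ?_⟩
    have : x • v = u' - f u' • (f u)⁻¹ • u := congrArg Subtype.val hx
    rw [this, sub_add_cancel]

theorem exists_ne_zero_of_finrank_eq_two {n : ℕ} {U : Submodule K (Fin n → K)}
    (hU : Module.finrank K U = 2) (f : (Fin n → K) →ₗ[K] K) : ∃ v ∈ U, v ≠ 0 ∧ f v = 0 := by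
  by_cases hf : ∃ u ∈ U, f u ≠ 0
  · obtain ⟨v, hv, -, -, hv₀, hfv, -⟩ := exists_basis_of_ne_zero hU f hf
    exact ⟨v, hv, hv₀, hfv⟩
  · push Not at hf
    have : U ≠ ⊥ := by rintro rfl; simp at hU
    obtain ⟨v, hv, hv₀⟩ := U.ne_bot_iff.1 this
    exact ⟨v, hv, hv₀, hf v hv⟩

end RestrictionToLines

/-! ### All lines on the surface have the form x = a z + b w, y = d z + e w -/

namespace ShiodaCoeffs

section Lines

variable {K : Type*} [Field K]

/-- The linear subspace `x = a z + b w`, `y = d z + e w`. -/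
def lineSpace (a b d e : K) : Submodule K (Fin 4 → K) where
  carrier := {v | v 0 = a * v 2 + b * v 3 ∧ v 1 = d * v 2 + e * v 3}
  add_mem' := by
    rintro v w ⟨h₁, h₂⟩ ⟨h₃, h₄⟩
    constructor <;> simp only [Pi.add_apply]
    · rw [h₁, h₃]; ring
    · rw [h₂, h₄]; ring
  zero_mem' := by simp
  smul_mem' := by
    rintro x v ⟨h₁, h₂⟩
    constructor <;> simp only [Pi.smul_apply, smul_eq_mul]
    · rw [h₁]; ring
    · rw [h₂]; ring

theorem mem_lineSpace {a b d e : K} {v : Fin 4 → K} :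
    v ∈ lineSpace a b d e ↔ v 0 = a * v 2 + b * v 3 ∧ v 1 = d * v 2 + e * v 3 := Iff.rfl

theorem lineSpace_eq_span (a b d e : K) :
    lineSpace a b d e = Submodule.span K {![a, d, 1, 0], ![b, e, 0, 1]} := by
  ext v
  rw [Submodule.mem_span_pair, mem_lineSpace]
  constructor
  · rintro ⟨h₁, h₂⟩
    refine ⟨v 2, v 3, funext fun i => ?_⟩
    fin_cases i <;> simp [h₁, h₂, mul_comm]
  · rintro ⟨x, y, rfl⟩
    simp [mul_comm]

theorem finrank_lineSpace (a b d e : K) : Module.finrank K (lineSpace a b d e) = 2 := by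
  rw [lineSpace_eq_span]
  refine finrank_span_pair_eq_two fun x y h => ⟨?_, ?_⟩
  · simpa using congrFun h 2
  · simpa using congrFun h 3

/-- The value of the cubic form on a parametrized line. -/
theorem eval_cubic_line (c : ShiodaCoeffs K) (a b d e z w : K) :
    eval ![a * z + b * w, d * z + e * w, z, w] c.cubic =
      (a ^ 3 + c.p₂ * a - 2 * d) * z ^ 3 +
      (3 * a ^ 2 * b + c.p₂ * b + c.p₁ * a + c.q₂ - (2 * e + d ^ 2)) * z ^ 2 * w +
      (3 * a * b ^ 2 + c.p₀ * a + c.p₁ * b + c.q₁ - 2 * d * e) * z * w ^ 2 +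
      (b ^ 3 + c.p₀ * b + c.q₀ - e ^ 2) * w ^ 3 := by
  simp [eval_cubic, eval_f₀, eval_f₁, eval_f₂]
  ring

theorem IsLine.eval_cubic_eq_zero {c : ShiodaCoeffs K} {a b d e : K} (h : c.IsLine a b d e)
    {v : Fin 4 → K} (hv : v ∈ lineSpace a b d e) : eval v c.cubic = 0 := by
  have hv' : v = ![a * v 2 + b * v 3, d * v 2 + e * v 3, v 2, v 3] := by
    funext i
    fin_cases i
    exacts [hv.1, hv.2, rfl, rfl]
  rw [hv', eval_cubic_line]
  linear_combination -(v 2) ^ 3 * h.eq₃ - (v 2) ^ 2 * v 3 * h.eq₂ - v 2 * (v 3) ^ 2 * h.eq₁ -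
    (v 3) ^ 3 * h.eq₀

/-- The lines on the cubic surface. -/
theorem exists_isLine_of_forall_eval_eq_zero {c : ShiodaCoeffs K} (h2 : (2 : K) ≠ 0)
    {U : Submodule K (Fin 4 → K)} (hU : Module.finrank K U = 2)
    (h : ∀ v ∈ U, eval v c.cubic = 0) :
    ∃ a b d e, c.IsLine a b d e ∧ U = lineSpace a b d e := by
  have hcub : ∀ v ∈ U, (c.p₂ * v 0 - 2 * v 1 + c.q₂ * v 3) * v 2 ^ 2 +
      (c.p₁ * v 0 * v 3 + c.q₁ * v 3 ^ 2) * v 2 +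
      (v 0 ^ 3 + c.p₀ * v 0 * v 3 ^ 2 + c.q₀ * v 3 ^ 3 - v 1 ^ 2 * v 3) = 0 := by
    intro v hv
    have := h v hv
    rw [eval_cubic, eval_f₀, eval_f₁, eval_f₂] at this
    simpa using this
  have hx : ∀ v ∈ U, v 2 = 0 → v 3 = 0 → v 0 = 0 := by
    intro v hv hz hw
    have := hcub v hv
    rw [hz, hw] at this
    exact pow_eq_zero_iff (n := 3) (by norm_num) |>.1 (by linear_combination this)
  -- No line on the surface passes through [0:1:0:0]: comparing the form at u and u ± v isolates
  -- v₁²u₃ and then v₁u₂², so U would be spanned by v.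
  have hy : ∀ v ∈ U, v 2 = 0 → v 3 = 0 → v 1 = 0 := by
    intro v hv hz hw
    by_contra hv₁
    have hv₀ := hx v hv hz hw
    have hmem : ∀ u ∈ U, ∀ y : K, u + y • v ∈ U := fun u hu y => U.add_mem hu (U.smul_mem _ hv)
    have key : ∀ u ∈ U, u 2 = 0 ∧ u 3 = 0 := by
      intro u hu
      have e₀ := hcub u hu
      have e₁ := hcub _ (hmem u hu 1)
      have e₂ := hcub _ (hmem u hu (-1))
      simp only [Pi.add_apply, Pi.smul_apply, smul_eq_mul, hv₀, hz, hw, mul_zero, add_zero] at e₁ e₂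
      have h₃ : u 3 = 0 := by
        have : 2 * (v 1 ^ 2 * u 3) = 0 := by linear_combination 2 * e₀ - e₁ - e₂
        simpa [h2, hv₁] using this
      rw [h₃] at e₁ e₂
      have : 2 * (2 * (v 1 * u 2 ^ 2)) = 0 := by linear_combination e₂ - e₁
      exact ⟨by simpa [h2, hv₁] using this, h₃⟩
    have hle : U ≤ Submodule.span K {v} := by
      intro u hu
      rw [Submodule.mem_span_singleton]
      refine ⟨u 1 / v 1, funext fun i => ?_⟩
      have hu₀ := hx u hu (key u hu).1 (key u hu).2
      fin_cases i <;> simp [hv₀, hz, hw, hu₀, (key u hu).1, (key u hu).2, hv₁]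
    have := Submodule.finrank_mono hle
    have h1 := finrank_span_le_card (R := K) ({v} : Set (Fin 4 → K))
    rw [hU] at this
    simp at h1
    omega
  let π : U →ₗ[K] (Fin 2 → K) :=
    { toFun := fun v => ![(v : Fin 4 → K) 2, (v : Fin 4 → K) 3]
      map_add' := fun v w => by funext i; fin_cases i <;> rfl
      map_smul' := fun x v => by funext i; fin_cases i <;> rfl }
  have hinj : Function.Injective π := by
    rw [← LinearMap.ker_eq_bot, LinearMap.ker_eq_bot']
    rintro ⟨v, hv⟩ h₀
    have hz : v 2 = 0 := congrFun h₀ 0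
    have hw : v 3 = 0 := congrFun h₀ 1
    refine Subtype.ext (funext fun i => ?_)
    fin_cases i
    exacts [hx v hv hz hw, hy v hv hz hw, hz, hw]
  have hsurj : Function.Surjective π :=
    (LinearMap.injective_iff_surjective_of_finrank_eq_finrank (by rw [hU]; simp)).1 hinj
  obtain ⟨⟨u, hu⟩, hπu⟩ := hsurj ![1, 0]
  obtain ⟨⟨v, hv⟩, hπv⟩ := hsurj ![0, 1]
  have hu₂ : u 2 = 1 := congrFun hπu 0
  have hu₃ : u 3 = 0 := congrFun hπu 1
  have hv₂ : v 2 = 0 := congrFun hπv 0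
  have hv₃ : v 3 = 1 := congrFun hπv 1
  have hsub : ∀ z w : K, ![u 0 * z + v 0 * w, u 1 * z + v 1 * w, z, w] ∈ U := by
    intro z w
    have : ![u 0 * z + v 0 * w, u 1 * z + v 1 * w, z, w] = z • u + w • v := by
      funext i
      fin_cases i <;> simp [hu₂, hu₃, hv₂, hv₃, mul_comm]
    rw [this]
    exact U.add_mem (U.smul_mem _ hu) (U.smul_mem _ hv)
  have heval := fun z w => (eval_cubic_line c (u 0) (v 0) (u 1) (v 1) z w).symm.trans
    (h _ (hsub z w))
  -- Four values of the restricted binary cubic determine its coefficients, up to division by 2.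
  have e₁ := heval 1 0
  have e₂ := heval 0 1
  have e₃ := heval 1 1
  have e₄ := heval 1 (-1)
  refine ⟨u 0, v 0, u 1, v 1, ⟨?_, ?_, ?_, ?_⟩, ?_⟩
  · linear_combination -e₁
  · refine mul_left_cancel₀ h2 ?_
    linear_combination 2 * e₂ + e₄ - e₃
  · refine mul_left_cancel₀ h2 ?_
    linear_combination 2 * e₁ - e₄ - e₃
  · linear_combination -e₂
  · refine le_antisymm (fun x hx' => ?_) fun x hx' => ?_
    · have h₀ := U.sub_mem hx' (hsub (x 2) (x 3))
      have h₁ := hx _ h₀ (by simp) (by simp)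
      have h₂ := hy _ h₀ (by simp) (by simp)
      simp only [Pi.sub_apply] at h₁ h₂
      exact ⟨sub_eq_zero.1 h₁, sub_eq_zero.1 h₂⟩
    · have : x = ![u 0 * x 2 + v 0 * x 3, u 1 * x 2 + v 1 * x 3, x 2, x 3] := by
        funext i
        fin_cases i
        exacts [hx'.1, hx'.2, rfl, rfl]
      rw [this]
      exact hsub _ _

theorem lineSpace_injective {a b d e a' b' d' e' : K}
    (h : lineSpace a b d e = lineSpace a' b' d' e') : a = a' ∧ b = b' := by
  have h₁ : ![a, d, 1, 0] ∈ lineSpace a b d e := by simp [mem_lineSpace]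
  have h₂ : ![b, e, 0, 1] ∈ lineSpace a b d e := by simp [mem_lineSpace]
  rw [h, mem_lineSpace] at h₁ h₂
  exact ⟨by simpa using h₁.1, by simpa using h₂.1⟩

end Lines

end ShiodaCoeffs

/-! ### Bitangents as projections of lines -/

namespace ShiodaCoeffs

section Bitangents

variable {K : Type*} [Field K]

/-- The linear form whose kernel is the projection of a line. -/
def tangentForm (a b d e : K) : (Fin 3 → K) →ₗ[K] K where
  toFun v := a * (v 1 - e * v 2) - d * (v 0 - b * v 2)
  map_add' v w := by simp only [Pi.add_apply]; ring
  map_smul' x v := by simp only [Pi.smul_apply, smul_eq_mul, RingHom.id_apply]; ring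

/-- The projection of the line `x = a z + b w`, `y = d z + e w` from the point `[0 : 0 : 1 : 0]`. -/
def tangentSpace (a b d e : K) : Submodule K (Fin 3 → K) := LinearMap.ker (tangentForm a b d e)

theorem mem_tangentSpace {a b d e : K} {v : Fin 3 → K} :
    v ∈ tangentSpace a b d e ↔ a * (v 1 - e * v 2) - d * (v 0 - b * v 2) = 0 := Iff.rfl

theorem finrank_tangentSpace {a : K} (ha : a ≠ 0) (b d e : K) :
    Module.finrank K (tangentSpace a b d e) = 2 := by
  refine finrank_ker_dual fun h => ha ?_
  simpa [tangentForm] using LinearMap.congr_fun h ![0, 1, 0]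

/-- The linear form `f₀`. -/
def flexForm (c : ShiodaCoeffs K) : (Fin 3 → K) →ₗ[K] K where
  toFun v := c.p₂ * v 0 - 2 * v 1 + c.q₂ * v 2
  map_add' v w := by simp only [Pi.add_apply]; ring
  map_smul' x v := by simp only [Pi.smul_apply, smul_eq_mul, RingHom.id_apply]; ring

theorem flexForm_apply (c : ShiodaCoeffs K) (v : Fin 3 → K) : c.flexForm v = eval v c.f₀ :=
  (c.eval_f₀ v).symm

/-- The kernel of `f₀`. -/
def flexSpace (c : ShiodaCoeffs K) : Submodule K (Fin 3 → K) := LinearMap.ker c.flexForm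

theorem mem_flexSpace {c : ShiodaCoeffs K} {v : Fin 3 → K} : v ∈ c.flexSpace ↔ eval v c.f₀ = 0 := by
  rw [← flexForm_apply]; rfl

theorem finrank_flexSpace (c : ShiodaCoeffs K) (h2 : (2 : K) ≠ 0) :
    Module.finrank K c.flexSpace = 2 := by
  refine finrank_ker_dual fun h => h2 ?_
  simpa [flexForm] using LinearMap.congr_fun h ![0, 1, 0]

/-- For a ≠ 0 the point of the line above `v` has third coordinate (v₀ - b v₂)/a. -/
theorem exists_tangent_coord {a : K} (ha : a ≠ 0) {b d e : K} {v : Fin 3 → K}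
    (hv : v ∈ tangentSpace a b d e) :
    v 0 = a * (a⁻¹ * (v 0 - b * v 2)) + b * v 2 ∧ v 1 = d * (a⁻¹ * (v 0 - b * v 2)) + e * v 2 := by
  rw [mem_tangentSpace] at hv
  refine ⟨by field_simp; ring, ?_⟩
  field_simp
  linear_combination hv

/-- The equation of a line on the surface, in terms of its projection. -/
theorem IsLine.eval_tangent {c : ShiodaCoeffs K} {a b d e : K} (h : c.IsLine a b d e) (ha : a ≠ 0)
    {v : Fin 3 → K} (hv : v ∈ tangentSpace a b d e) :
    eval v c.f₀ * (a⁻¹ * (v 0 - b * v 2)) ^ 2 + eval v c.f₁ * (a⁻¹ * (v 0 - b * v 2)) +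
      eval v c.f₂ = 0 := by
  have h₁ := h.eval_cubic_eq_zero (v := ![v 0, v 1, a⁻¹ * (v 0 - b * v 2), v 2])
    (exists_tangent_coord ha hv)
  rw [eval_cubic] at h₁
  have hv' : ![v 0, v 1, v 2] = v := by
    funext i
    fin_cases i <;> rfl
  simpa [hv'] using h₁

theorem flexSpace_bitangent (c : ShiodaCoeffs K) {v : Fin 3 → K} (hv : v ∈ c.flexSpace) :
    eval v c.quartic = eval v c.f₁ ^ 2 := by
  rw [eval_quartic, mem_flexSpace.1 hv]
  ring

/-- Along the projection the quadratic in Z has the linear form z as a root, so its discriminant is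
the square of 2f₀z + f₁. -/
theorem IsLine.exists_sqrt_quartic {c : ShiodaCoeffs K} {a b d e : K} (h : c.IsLine a b d e)
    (ha : a ≠ 0) : ∃ g : MvPolynomial (Fin 3) K, g.IsHomogeneous 2 ∧
      ∀ v ∈ tangentSpace a b d e, eval v c.quartic = eval v g ^ 2 := by
  refine ⟨c.f₀ * (C (2 * a⁻¹) * X 0 - C (2 * a⁻¹ * b) * X 2) + c.f₁,
    (c.isHomogeneous_f₀.mul ((isHomogeneous_C_mul_X _ _).sub (isHomogeneous_C_mul_X _ _))).add
      c.isHomogeneous_f₁, fun v hv => ?_⟩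
  have h₁ := h.eval_tangent ha hv
  rw [eval_quartic]
  simp only [map_add, map_mul, map_sub, eval_C, eval_X]
  linear_combination -4 * eval v c.f₀ * h₁

/-- The bitangents of the quartic. -/
theorem eq_flexSpace_or_exists_isLine [Infinite K] {c : ShiodaCoeffs K} (h2 : (2 : K) ≠ 0)
    (hc : ∀ a b d e, c.IsLine a b d e → a ≠ 0)
    {U : Submodule K (Fin 3 → K)} (hU : Module.finrank K U = 2) {g : MvPolynomial (Fin 3) K}
    (hg : g.IsHomogeneous 2) (h : ∀ v ∈ U, eval v c.quartic = eval v g ^ 2) :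
    U = c.flexSpace ∨ ∃ a b d e, c.IsLine a b d e ∧ U = tangentSpace a b d e := by
  by_cases hf : ∃ u ∈ U, c.flexForm u ≠ 0
  swap
  · left
    push Not at hf
    exact Submodule.eq_of_le_of_finrank_eq hf (by rw [hU, c.finrank_flexSpace h2])
  right
  obtain ⟨v, hv, w, hw, hv₀, hfv, hfw, hbasis⟩ := exists_basis_of_ne_zero hU _ hf
  -- At the zero of f₀ on U the quartic is f₁², so g = ±f₁ there. With the right sign f₁ - g
  -- vanishes at that point, hence is divisible by f₀ along U.
  obtain ⟨g', hg', h', hv'⟩ : ∃ g' : MvPolynomial (Fin 3) K, g'.IsHomogeneous 2 ∧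
      (∀ v ∈ U, eval v c.quartic = eval v g' ^ 2) ∧ eval v (c.f₁ - g') = 0 := by
    have h₁ : (eval v c.f₁ - eval v g) * (eval v c.f₁ + eval v g) = 0 := by
      have := h v hv
      rw [eval_quartic, ← flexForm_apply, hfv] at this
      linear_combination this
    rcases mul_eq_zero.1 h₁ with h₁ | h₁
    · exact ⟨g, hg, h, by rw [map_sub, h₁]⟩
    · refine ⟨-g, hg.neg, fun u hu => ?_, ?_⟩
      · rw [h u hu, map_neg, neg_sq]
      · rw [map_sub, map_neg, sub_neg_eq_add, h₁]
  obtain ⟨q, hq⟩ := exists_eval_add_eq (c.isHomogeneous_f₁.sub hg') h2 v w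
  set n : K := eval w (c.f₁ - g')
  -- This linear form is the root -(f₁ - g)/(2f₀) of the quadratic; it lifts U to a line on the
  -- surface.
  set ζ : K → K → K := fun x y => -(q * x + n * y) / 2 with hζ
  set V : Submodule K (Fin 4 → K) := Submodule.span K
    {![v 0, v 1, ζ 1 0, v 2], ![w 0, w 1, ζ 0 1, w 2]} with hV
  have hpoint : ∀ x y : K, x • ![v 0, v 1, ζ 1 0, v 2] + y • ![w 0, w 1, ζ 0 1, w 2] =
      ![(x • v + y • w) 0, (x • v + y • w) 1, ζ x y, (x • v + y • w) 2] := by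
    intro x y
    funext i
    fin_cases i <;> simp [hζ]
    ring
  have hfx : ∀ x y : K, c.flexForm (x • v + y • w) = y := by
    intro x y
    rw [map_add, map_smul, map_smul, hfv, hfw, smul_zero, zero_add, smul_eq_mul, mul_one]
  have hcub : ∀ x y : K, y ≠ 0 → eval (![(x • v + y • w) 0, (x • v + y • w) 1, ζ x y,
      (x • v + y • w) 2]) c.cubic = 0 := by
    intro x y hy
    have h₁ := h' _ (U.add_mem (U.smul_mem x hv) (U.smul_mem y hw))
    have h₂ := hq x y
    rw [hv', map_sub] at h₂
    have h₃ := hfx x y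
    rw [flexForm_apply] at h₃
    rw [eval_quartic, h₃] at h₁
    rw [eval_cubic]
    have he : ![(x • v + y • w) 0, (x • v + y • w) 1, (x • v + y • w) 2] = x • v + y • w := by
      funext i
      fin_cases i <;> rfl
    have hz : 2 * ζ x y = -(q * x + n * y) := by simp only [hζ]; field_simp
    simp only [Matrix.cons_val_zero, Matrix.cons_val_one, Matrix.cons_val]
    rw [he, h₃]
    have h4 : (4 : K) ≠ 0 := by
      have : (4 : K) = 2 * 2 := by norm_num
      rw [this]
      exact mul_ne_zero h2 h2
    refine mul_left_cancel₀ (mul_ne_zero h4 hy) ?_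
    generalize ζ x y = Z at *
    generalize eval (x • v + y • w) c.f₁ = F at *
    generalize eval (x • v + y • w) g' = G at *
    have hG : G = F + 2 * y * Z := by linear_combination -h₂ - y * hz
    rw [hG] at h₁
    linear_combination -h₁
  have hVcub : ∀ u ∈ V, eval u c.cubic = 0 := by
    intro u hu
    obtain ⟨x, y, rfl⟩ := Submodule.mem_span_pair.1 hu
    by_cases hy : y = 0
    -- At the zero of f₀ the division is not available; the cubic form vanishes there because it
    -- vanishes on the rest of the line.
    · subst hy
      refine eval_eq_zero_of_forall_ne _ (w := ![w 0, w 1, ζ 0 1, w 2]) fun t ht => ?_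
      rw [zero_smul, add_zero, hpoint]
      exact hcub _ _ ht
    · rw [hpoint]
      exact hcub _ _ hy
  have hVdim : Module.finrank K V = 2 := by
    refine finrank_span_pair_eq_two fun x y hxy => ?_
    rw [hpoint] at hxy
    have h₀ : x • v + y • w = 0 := by
      funext i
      fin_cases i
      exacts [congrFun hxy 0, congrFun hxy 1, congrFun hxy 3]
    have hy : y = 0 := by rw [← hfx x y, h₀, map_zero]
    rw [hy, zero_smul, add_zero] at h₀
    exact ⟨(smul_eq_zero.1 h₀).resolve_right hv₀, hy⟩
  obtain ⟨a, b, d, e, hl, hVl⟩ := exists_isLine_of_forall_eval_eq_zero h2 hVdim hVcub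
  refine ⟨a, b, d, e, hl, Submodule.eq_of_le_of_finrank_eq (fun u hu => ?_)
    (by rw [hU, finrank_tangentSpace (hc _ _ _ _ hl)])⟩
  obtain ⟨x, hx⟩ := hbasis u hu
  have hmem : x • ![v 0, v 1, ζ 1 0, v 2] + c.flexForm u • ![w 0, w 1, ζ 0 1, w 2] ∈ V :=
    Submodule.mem_span_pair.2 ⟨_, _, rfl⟩
  rw [hVl, hpoint, ← hx] at hmem
  obtain ⟨e₁, e₂⟩ := hmem
  simp only [Matrix.cons_val_zero, Matrix.cons_val_one, Matrix.cons_val] at e₁ e₂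
  rw [mem_tangentSpace, e₁, e₂]
  ring

/-- Different lines have different projections. -/
theorem IsLine.eq_of_tangentSpace_eq [Infinite K] {c : ShiodaCoeffs K}
    (hflex : ∀ v : Fin 3 → K, eval v c.f₀ = 0 → eval v c.f₁ = 0 → eval v c.f₂ = 0 → v = 0)
    {a b d e a' b' d' e' : K}
    (h : c.IsLine a b d e) (ha : a ≠ 0) (h' : c.IsLine a' b' d' e') (ha' : a' ≠ 0)
    (heq : tangentSpace a b d e = tangentSpace a' b' d' e') : a = a' ∧ b = b' := by
  have hval := fun v hv => h.eval_tangent (v := v) ha hv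
  have hval' := fun v (hv : v ∈ tangentSpace a b d e) => h'.eval_tangent (v := v) ha' (heq ▸ hv)
  set z : (Fin 3 → K) → K := fun v => a⁻¹ * (v 0 - b * v 2) with hz
  set z' : (Fin 3 → K) → K := fun v => a'⁻¹ * (v 0 - b' * v 2) with hz'
  -- At a zero `u` of f₀ the quadratic becomes linear, with f₁ ≠ 0 because the flex point lies on no
  -- line. So the two lifts agree at `u`.
  obtain ⟨u, hu, hu₀, hfu⟩ := exists_ne_zero_of_finrank_eq_two (finrank_tangentSpace ha b d e)
    c.flexForm
  rw [flexForm_apply] at hfu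
  have e₁ : eval u c.f₀ * z u ^ 2 + eval u c.f₁ * z u + eval u c.f₂ = 0 := hval u hu
  have e₂ : eval u c.f₀ * z' u ^ 2 + eval u c.f₁ * z' u + eval u c.f₂ = 0 := hval' u hu
  rw [hfu, zero_mul, zero_add] at e₁ e₂
  have hf₁ : eval u c.f₁ ≠ 0 := by
    intro hf
    rw [hf, zero_mul, zero_add] at e₁
    exact hu₀ (hflex u hfu hf e₁)
  have hzu : z u = z' u := by
    by_contra hne
    exact (mul_ne_zero hf₁ (sub_ne_zero.2 hne)) (by linear_combination e₁ - e₂)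
  -- Where the lifts differ they are both roots, so f₀(z + z') + f₁ = 0. If they differed at `w`,
  -- this would hold at u + y w for y ≠ 0, hence at `u`, and f₁(u) would vanish.
  have hzz : ∀ v ∈ tangentSpace a b d e, z v = z' v := by
    intro w hw
    by_contra hne
    refine hf₁ ?_
    have hpoly := eval_eq_zero_of_forall_ne (v := u) (w := w)
      (c.f₀ * (C a⁻¹ * (X 0 - C b * X 2) + C a'⁻¹ * (X 0 - C b' * X 2)) + c.f₁) ?_
    · rw [map_add, map_mul, hfu, zero_mul, zero_add] at hpoly
      exact hpoly
    · intro y hy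
      have hmem := (tangentSpace a b d e).add_mem hu ((tangentSpace a b d e).smul_mem y hw)
      have e₃ : _ * z (u + y • w) ^ 2 + _ * z (u + y • w) + _ = 0 := hval _ hmem
      have e₄ : _ * z' (u + y • w) ^ 2 + _ * z' (u + y • w) + _ = 0 := hval' _ hmem
      have hdiff : z (u + y • w) - z' (u + y • w) = y * (z w - z' w) := by
        have h₁ : z (u + y • w) = z u + y * z w := by
          simp only [hz, Pi.add_apply, Pi.smul_apply, smul_eq_mul]; ring
        have h₂ : z' (u + y • w) = z' u + y * z' w := by
          simp only [hz', Pi.add_apply, Pi.smul_apply, smul_eq_mul]; ring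
        rw [h₁, h₂, hzu]
        ring
      have hne' : z (u + y • w) - z' (u + y • w) ≠ 0 := by
        rw [hdiff]
        exact mul_ne_zero hy (sub_ne_zero.2 hne)
      refine mul_left_cancel₀ hne' ?_
      simp only [map_add, map_mul, map_sub, eval_C, eval_X]
      change _ * (_ * (z (u + y • w) + z' (u + y • w)) + _) = _
      linear_combination e₃ - e₄
  have h₁ := hzz ![a, d, 0] (by rw [mem_tangentSpace]; simp; ring)
  have h₂ := hzz ![b, e, 1] (by rw [mem_tangentSpace]; simp)
  simp only [hz, hz', Matrix.cons_val_zero, Matrix.cons_val] at h₁ h₂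
  have haa : a = a' := by
    rw [mul_zero, sub_zero, mul_zero, sub_zero, inv_mul_cancel₀ ha] at h₁
    exact (eq_of_inv_mul_eq_one h₁.symm).symm
  refine ⟨haa, ?_⟩
  subst haa
  have := mul_left_cancel₀ (inv_ne_zero ha) h₂
  linear_combination -this

end Bitangents

end ShiodaCoeffs

/-! ### Galois actions on finite sets of subspaces -/

section GaloisActionOnSubspaces

variable {F : Type*} [Field F] {n : ℕ}
  {T : Set (Submodule (SeparableClosure F) (Fin n → SeparableClosure F))}
  {hT : ∀ σ : Gal(SeparableClosure F/F), ∀ U ∈ T, galSubspace σ U ∈ T}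
  {P : Fin 27 → Submodule (SeparableClosure F) (Fin n → SeparableClosure F)}
  {l : List (Fin 27 × Fin 27)} {χ ψ : Gal(SeparableClosure F/F) →* ℤˣ}

theorem isFlipAction_galPerm (hP : Function.Injective P) (hPT : ∀ i, P i ∈ T)
    (hact : ∀ g i, galSubspace g (P i) =
      P ((signPow (χ g) (pairsPerm sPairs) * signPow (ψ g) (pairsPerm l)) i))
    (hfix : ∀ U ∈ T, U ∉ Set.range P → ∀ g, galSubspace g U = U) :
    IsFlipAction (galPerm T hT) (fun i => (⟨P i, hPT i⟩ : T)) l χ ψ where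
  injective i j h := hP (congrArg Subtype.val h)
  apply g i := Subtype.ext (hact g i)
  fixed := by
    rintro g ⟨U, hU⟩ hx
    refine Subtype.ext (hfix U hU ?_ g)
    rintro ⟨i, rfl⟩
    exact hx ⟨i, rfl⟩

theorem subspacesSW₂_of_finite [Fintype T] (hfin : T.Finite) :
    subspacesSW₂ T hT = galoisSW₂ (galPerm T hT) (galPerm_locallyConstant T hT hfin) := by
  rw [subspacesSW₂, dif_pos hfin]
  congr 1
  exact Subsingleton.elim _ _

end GaloisActionOnSubspaces

/-! ### Lines and bitangents in terms of slope and offset -/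

namespace ShiodaCoeffs

section Coordinates

variable {K : Type*} [Field K]

/-- The coefficient `d` of a line with slope `a`. -/
def lineD (c : ShiodaCoeffs K) (a : K) : K := (a ^ 3 + c.p₂ * a) / 2

/-- The coefficient `e` of a line with slope `a` and offset `b`. -/
def lineE (c : ShiodaCoeffs K) (a b : K) : K :=
  (3 * a ^ 2 * b + c.p₂ * b + c.p₁ * a + c.q₂ - c.lineD a ^ 2) / 2

theorem IsLine.eq_lineD {c : ShiodaCoeffs K} (h2 : (2 : K) ≠ 0) {a b d e : K}
    (h : c.IsLine a b d e) : d = c.lineD a := by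
  rw [lineD, eq_div_iff h2]
  linear_combination h.eq₃

theorem IsLine.eq_lineE {c : ShiodaCoeffs K} (h2 : (2 : K) ≠ 0) {a b d e : K}
    (h : c.IsLine a b d e) : e = c.lineE a b := by
  rw [lineE, eq_div_iff h2, ← h.eq_lineD h2]
  linear_combination h.eq₂

theorem map_lineD {K' : Type*} [Field K'] (φ : K →+* K') (c : ShiodaCoeffs K) (a : K) :
    φ (c.lineD a) = (c.map φ).lineD (φ a) := by
  simp [lineD, map, map_ofNat φ]

theorem map_lineE {K' : Type*} [Field K'] (φ : K →+* K') (c : ShiodaCoeffs K) (a b : K) :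
    φ (c.lineE a b) = (c.map φ).lineE (φ a) (φ b) := by
  rw [lineE, lineE, map_div₀, map_sub, map_pow, map_lineD]
  simp [map, map_ofNat φ]

/-- The linear subspace of the line with slope `a` and offset `b`. -/
def surfaceLine (c : ShiodaCoeffs K) (a b : K) : Submodule K (Fin 4 → K) :=
  lineSpace a b (c.lineD a) (c.lineE a b)

/-- The projection of the line with slope `a` and offset `b`. -/
def surfaceTangent (c : ShiodaCoeffs K) (a b : K) : Submodule K (Fin 3 → K) :=
  tangentSpace a b (c.lineD a) (c.lineE a b)

variable {σ r m : K}

theorem GenPos.isLine (H : GenPos σ r m) (i : Fin 27) :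
    (fieldCoeffs σ r m).IsLine (lineSlope σ r m i) (fieldOffset σ r m i)
      ((fieldCoeffs σ r m).lineD (lineSlope σ r m i))
      ((fieldCoeffs σ r m).lineE (lineSlope σ r m i) (fieldOffset σ r m i)) := by
  obtain ⟨d, e, h⟩ := H.exists_isLine i
  rwa [← h.eq_lineD H.two_ne, ← h.eq_lineE H.two_ne]

theorem GenPos.ne_zero_of_isLine (H : GenPos σ r m) (a b d e : K)
    (h : (fieldCoeffs σ r m).IsLine a b d e) : a ≠ 0 := by
  obtain ⟨i, rfl⟩ := H.exists_slope_eq h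
  exact H.slope_ne i

theorem GenPos.eq_of_slope_offset_eq (H : GenPos σ r m) {i j : Fin 27}
    (h₁ : lineSlope σ r m i = lineSlope σ r m j) (h₂ : fieldOffset σ r m i = fieldOffset σ r m j) :
    i = j := by
  rcases H.slope_inj i j h₁ with h | ⟨rfl, rfl⟩ | ⟨rfl, rfl⟩
  exacts [h, (H.offset_ne h₂).elim, (H.offset_ne h₂.symm).elim]

theorem GenPos.surfaceLine_injective (H : GenPos σ r m) : Function.Injective fun i =>
    (fieldCoeffs σ r m).surfaceLine (lineSlope σ r m i) (fieldOffset σ r m i) := fun _ _ h =>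
  H.eq_of_slope_offset_eq (lineSpace_injective h).1 (lineSpace_injective h).2

theorem GenPos.surfaceTangent_injective [Infinite K] (H : GenPos σ r m) : Function.Injective fun i =>
    (fieldCoeffs σ r m).surfaceTangent (lineSlope σ r m i) (fieldOffset σ r m i) := fun i j h => by
  obtain ⟨h₁, h₂⟩ := (H.isLine i).eq_of_tangentSpace_eq (fun v => H.flex_not_mem) (H.slope_ne i)
    (H.isLine j) (H.slope_ne j) h
  exact H.eq_of_slope_offset_eq h₁ h₂

end Coordinates

/-! ### Galois action on the lines and on the bitangents -/

section GaloisAction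

variable {F : Type*} [Field F]

theorem galSubspace_lineSpace (g : Gal(SeparableClosure F/F)) (a b d e : SeparableClosure F) :
    galSubspace g (lineSpace a b d e) = lineSpace (g a) (g b) (g d) (g e) := by
  ext v
  rw [mem_galSubspace, mem_lineSpace, mem_lineSpace, ← g.injective.eq_iff,
    ← g.injective.eq_iff (a := g.symm (v 1))]
  simp

theorem galSubspace_tangentSpace (g : Gal(SeparableClosure F/F)) (a b d e : SeparableClosure F) :
    galSubspace g (tangentSpace a b d e) = tangentSpace (g a) (g b) (g d) (g e) := by
  ext v
  rw [mem_galSubspace, mem_tangentSpace, mem_tangentSpace, ← g.injective.eq_iff]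
  simp

theorem map_algebraMap_map (c : ShiodaCoeffs F) (g : Gal(SeparableClosure F/F)) :
    (c.map (algebraMap F (SeparableClosure F))).map (g : SeparableClosure F →+* SeparableClosure F) =
      c.map (algebraMap F (SeparableClosure F)) := by
  simp [map]

theorem galSubspace_surfaceLine (c : ShiodaCoeffs F) (g : Gal(SeparableClosure F/F))
    (a b : SeparableClosure F) :
    galSubspace g ((c.map (algebraMap F _)).surfaceLine a b) =
      (c.map (algebraMap F _)).surfaceLine (g a) (g b) := by
  rw [surfaceLine, galSubspace_lineSpace]
  have h₁ := map_lineD (g : SeparableClosure F →+* SeparableClosure F) (c.map (algebraMap F _)) a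
  have h₂ := map_lineE (g : SeparableClosure F →+* SeparableClosure F) (c.map (algebraMap F _)) a b
  rw [map_algebraMap_map] at h₁ h₂
  exact congrArg₂ _ h₁ h₂

theorem galSubspace_surfaceTangent (c : ShiodaCoeffs F) (g : Gal(SeparableClosure F/F))
    (a b : SeparableClosure F) :
    galSubspace g ((c.map (algebraMap F _)).surfaceTangent a b) =
      (c.map (algebraMap F _)).surfaceTangent (g a) (g b) := by
  rw [surfaceTangent, galSubspace_tangentSpace]
  have h₁ := map_lineD (g : SeparableClosure F →+* SeparableClosure F) (c.map (algebraMap F _)) a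
  have h₂ := map_lineE (g : SeparableClosure F →+* SeparableClosure F) (c.map (algebraMap F _)) a b
  rw [map_algebraMap_map] at h₁ h₂
  exact congrArg₂ _ h₁ h₂

theorem galSubspace_flexSpace (c : ShiodaCoeffs F) (g : Gal(SeparableClosure F/F)) :
    galSubspace g (c.map (algebraMap F _)).flexSpace = (c.map (algebraMap F _)).flexSpace := by
  ext v
  rw [mem_galSubspace, mem_flexSpace, mem_flexSpace, ← g.injective.eq_iff, eval_f₀, eval_f₀]
  simp [map, map_ofNat g]

theorem aeval_eq_eval_map {n : ℕ} (f : MvPolynomial (Fin n) F) (v : Fin n → SeparableClosure F) :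
    aeval v f = eval v (MvPolynomial.map (algebraMap F (SeparableClosure F)) f) := by
  rw [eval_map, aeval_def]

variable {c : ShiodaCoeffs F} {σ r m : SeparableClosure F}

theorem linesOn_eq_range (H : GenPos σ r m) (hc : c.map (algebraMap F _) = fieldCoeffs σ r m) :
    linesOn c.cubic = Set.range fun i =>
      (fieldCoeffs σ r m).surfaceLine (lineSlope σ r m i) (fieldOffset σ r m i) := by
  ext U
  constructor
  · rintro ⟨hU, h⟩
    simp only [aeval_eq_eval_map, ← map_cubic, hc] at h
    obtain ⟨a, b, d, e, hl, rfl⟩ := exists_isLine_of_forall_eval_eq_zero H.two_ne hU h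
    obtain ⟨i, rfl, rfl⟩ := H.exists_eq hl
    exact ⟨i, by beta_reduce; rw [surfaceLine, ← hl.eq_lineD H.two_ne, ← hl.eq_lineE H.two_ne]⟩
  · rintro ⟨i, rfl⟩
    refine ⟨finrank_lineSpace _ _ _ _, fun v hv => ?_⟩
    rw [aeval_eq_eval_map, ← map_cubic, hc]
    exact (H.isLine i).eval_cubic_eq_zero hv

/-- The 28 bitangents of the branch curve: the 27 projected lines and the trace f₀ = 0 of the
tangent plane at the centre of projection. -/
theorem bitangents_eq [Infinite F] (H : GenPos σ r m)
    (hc : c.map (algebraMap F _) = fieldCoeffs σ r m) :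
    bitangents c.quartic = insert (fieldCoeffs σ r m).flexSpace (Set.range fun i =>
      (fieldCoeffs σ r m).surfaceTangent (lineSlope σ r m i) (fieldOffset σ r m i)) := by
  have : Infinite (SeparableClosure F) :=
    Infinite.of_injective _ (algebraMap F (SeparableClosure F)).injective
  ext U
  constructor
  · rintro ⟨hU, g, hg, h⟩
    simp only [aeval_eq_eval_map, ← map_quartic, hc] at h
    rcases eq_flexSpace_or_exists_isLine H.two_ne H.ne_zero_of_isLine hU hg h with
      rfl | ⟨a, b, d, e, hl, rfl⟩
    · exact Or.inl rfl
    · obtain ⟨i, rfl, rfl⟩ := H.exists_eq hl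
      exact Or.inr ⟨i, by beta_reduce; rw [surfaceTangent, ← hl.eq_lineD H.two_ne, ← hl.eq_lineE H.two_ne]⟩
  · rintro (rfl | ⟨i, rfl⟩)
    · refine ⟨finrank_flexSpace _ H.two_ne, _, (fieldCoeffs σ r m).isHomogeneous_f₁, fun v hv => ?_⟩
      rw [aeval_eq_eval_map, ← map_quartic, hc]
      exact flexSpace_bitangent _ hv
    · obtain ⟨g, hg, h⟩ := (H.isLine i).exists_sqrt_quartic (H.slope_ne i)
      refine ⟨finrank_tangentSpace (H.slope_ne i) _ _ _, g, hg, fun v hv => ?_⟩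
      rw [aeval_eq_eval_map, ← map_quartic, hc]
      exact h v hv

theorem flex_notMem_of_mem_linesOn (H : GenPos σ r m)
    (hc : c.map (algebraMap F _) = fieldCoeffs σ r m) : ∀ U ∈ linesOn c.cubic, ![0, 0, 1, 0] ∉ U := by
  rw [linesOn_eq_range H hc]
  rintro _ ⟨i, rfl⟩ h
  beta_reduce at h
  rw [surfaceLine, mem_lineSpace] at h
  exact H.slope_ne i (by simpa using h.1.symm)

/-- The automorphism `g` acts through the sign changes `χ g` and `ψ g`. -/
structure IsSignAction (σ r m : SeparableClosure F) (l : List (Fin 27 × Fin 27))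
    (χ ψ : Gal(SeparableClosure F/F) →* ℤˣ) : Prop where
  map_σ : ∀ g, g σ = ((χ g : ℤ) : SeparableClosure F) * σ
  map_r : ∀ g, g r = ((ψ g : ℤ) : SeparableClosure F) * r
  map_m : (l = rPairs ∧ ∀ g : Gal(SeparableClosure F/F), g m = m) ∨
    (l = rmPairs ∧ ∀ g, g m = ((ψ g : ℤ) : SeparableClosure F) * m)

variable {l : List (Fin 27 × Fin 27)} {χ ψ : Gal(SeparableClosure F/F) →* ℤˣ}

theorem IsSignAction.map_line (h : IsSignAction σ r m l χ ψ) (g : Gal(SeparableClosure F/F))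
    (i : Fin 27) :
    g (lineSlope σ r m i) =
        lineSlope σ r m ((signPow (χ g) (pairsPerm sPairs) * signPow (ψ g) (pairsPerm l)) i) ∧
      g (fieldOffset σ r m i) =
        fieldOffset σ r m ((signPow (χ g) (pairsPerm sPairs) * signPow (ψ g) (pairsPerm l)) i) := by
  rcases h.map_m with ⟨rfl, hm⟩ | ⟨rfl, hm⟩
  · exact map_lineSlope_fieldOffset (φ := (g : SeparableClosure F →+* SeparableClosure F))
      (Or.inl ⟨rfl, rfl⟩) (h.map_σ g) (h.map_r g) ((hm g).trans (ite_self m).symm) i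
  · refine map_lineSlope_fieldOffset (φ := (g : SeparableClosure F →+* SeparableClosure F))
      (Or.inr ⟨rfl, rfl⟩) (h.map_σ g) (h.map_r g) ((hm g).trans ?_) i
    rcases Int.units_eq_one_or (ψ g) with h | h <;> simp [h]

theorem IsSignAction.isFlipAction_linesOn (h : IsSignAction σ r m l χ ψ) (H : GenPos σ r m)
    (hc : c.map (algebraMap F _) = fieldCoeffs σ r m) :
    ∃ f, IsFlipAction (galPerm (linesOn c.cubic) fun g => galSubspace_mem_linesOn c.cubic g)
      f l χ ψ := by
  have hr := linesOn_eq_range H hc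
  refine ⟨_, isFlipAction_galPerm H.surfaceLine_injective
    (fun i => hr.ge ⟨i, rfl⟩) (fun g i => ?_) (fun U hU hx => (hx (hr.le hU)).elim)⟩
  rw [← hc, galSubspace_surfaceLine, (h.map_line g i).1, (h.map_line g i).2]

/-- The bitangent f₀ = 0 is defined over `F`, so the action is the one on the 27 lines with one
fixed element added. -/
theorem IsSignAction.isFlipAction_bitangents [Infinite F] (h : IsSignAction σ r m l χ ψ)
    (H : GenPos σ r m) (hc : c.map (algebraMap F _) = fieldCoeffs σ r m) :
    ∃ f, IsFlipAction (galPerm (bitangents c.quartic)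
      fun g => galSubspace_mem_bitangents c.quartic g) f l χ ψ := by
  have : Infinite (SeparableClosure F) :=
    Infinite.of_injective _ (algebraMap F (SeparableClosure F)).injective
  have hr := bitangents_eq H hc
  refine ⟨_, isFlipAction_galPerm H.surfaceTangent_injective
    (fun i => hr.ge (Or.inr ⟨i, rfl⟩)) (fun g i => ?_) (fun U hU hx g => ?_)⟩
  · rw [← hc, galSubspace_surfaceTangent, (h.map_line g i).1, (h.map_line g i).2]
  · rcases hr.le hU with rfl | hU
    · rw [← hc, galSubspace_flexSpace]
    · exact (hx hU).elim

end GaloisAction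

end ShiodaCoeffs

/-! ### The classes of the quartic and of the cubic surface -/

namespace ShiodaCoeffs

section Classes

variable {F : Type*} [Field F] {c : ShiodaCoeffs F} {σ r m : SeparableClosure F}
  {l : List (Fin 27 × Fin 27)} {χ ψ : Gal(SeparableClosure F/F) →* ℤˣ} {ε : ℤˣ}

theorem finite_linesOn (H : GenPos σ r m) (hc : c.map (algebraMap F _) = fieldCoeffs σ r m) :
    (linesOn c.cubic).Finite := by
  rw [linesOn_eq_range H hc]
  exact Set.finite_range _

theorem finite_bitangents [Infinite F] (H : GenPos σ r m)
    (hc : c.map (algebraMap F _) = fieldCoeffs σ r m) : (bitangents c.quartic).Finite := by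
  rw [bitangents_eq H hc]
  exact (Set.finite_range _).insert _

/-- Fixed elements do not affect the squares and commutators of the lifts, so 27 lines and 28
bitangents give cohomologous cocycles. -/
theorem IsSignAction.gammaClass_eq_linesSW₂ [Infinite F] (h : IsSignAction σ r m l χ ψ)
    (H : GenPos σ r m) (hc : c.map (algebraMap F _) = fieldCoeffs σ r m) (hl : IsFlip l ε)
    (hχ : IsLocallyConstant χ) (hψ : IsLocallyConstant ψ) :
    gammaClass c.quartic = linesSW₂ c.cubic := by
  classical
  obtain ⟨f, hf⟩ := h.isFlipAction_bitangents H hc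
  obtain ⟨f', hf'⟩ := h.isFlipAction_linesOn H hc
  let := (finite_bitangents H hc).fintype
  let := (finite_linesOn H hc).fintype
  rw [gammaClass, linesSW₂, subspacesSW₂_of_finite (finite_bitangents H hc),
    subspacesSW₂_of_finite (finite_linesOn H hc)]
  exact hf.galoisSW₂_eq hf' hl _ _ hχ hψ

theorem IsSignAction.gammaClass_ne_zero [Infinite F] (h : IsSignAction σ r m l χ ψ)
    (H : GenPos σ r m) (hc : c.map (algebraMap F _) = fieldCoeffs σ r m) (hl : IsFlip l ε)
    (hχ : IsLocallyConstant χ) (hψ : IsLocallyConstant ψ) {u t : F}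
    (haniso : ∀ a b c : F, a ^ 2 = u * b ^ 2 + t * c ^ 2 → c = 0) (hnsq : ∀ a : F, a ^ 2 ≠ u)
    (h2 : (2 : F) ≠ 0) (hσ₀ : 3 * σ ≠ 0) (hr₀ : r ≠ 0) (hσ : (3 * σ) ^ 2 = algebraMap F _ t)
    (hr : r ^ 2 = algebraMap F _ u) {w : SeparableClosure F} (hw : w ^ 2 = -1)
    (hgw : ∀ g : Gal(SeparableClosure F/F), g w = ((signPow (ψ g) (-ε) : ℤˣ) : ℤ) * w)
    {x y : F} (hxy : x ^ 2 - u * y ^ 2 = -1) : gammaClass c.quartic ≠ 0 := by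
  classical
  obtain ⟨f, hf⟩ := h.isFlipAction_bitangents H hc
  let := (finite_bitangents H hc).fintype
  rw [gammaClass, subspacesSW₂_of_finite (finite_bitangents H hc)]
  refine hf.galoisSW₂_ne_zero hl _ hχ hψ h2 haniso hnsq hσ₀ hr₀ hσ hr (fun g => ?_) h.map_r hw hgw hxy
  rw [map_mul, h.map_σ, map_ofNat]
  ring

end Classes

end ShiodaCoeffs

theorem two_nsmul_gammaClass {F : Type*} [Field F] (f : MvPolynomial (Fin 3) F) :
    2 • gammaClass f = 0 := by
  rw [gammaClass, subspacesSW₂]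
  split_ifs with hfin
  · let := hfin.fintype
    exact two_nsmul_galoisSW₂ _
  · exact nsmul_zero 2

/-! ### Arithmetic of Laurent series and of finite fields -/

section Arithmetic

/-- Clearing denominators reduces this to power series. -/
theorem LaurentSeries.eq_zero_of_sq_eq {k : Type*} [Field k] {u : k} (hu : ¬ IsSquare u)
    {a b c : LaurentSeries k}
    (h : a ^ 2 = algebraMap (PowerSeries k) _ (PowerSeries.C u) * b ^ 2 +
      algebraMap (PowerSeries k) _ PowerSeries.X * c ^ 2) : a = 0 ∧ b = 0 ∧ c = 0 := by
  obtain ⟨a, a', ha', rfl⟩ := IsFractionRing.div_surjective (A := PowerSeries k) a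
  obtain ⟨b, b', hb', rfl⟩ := IsFractionRing.div_surjective (A := PowerSeries k) b
  obtain ⟨c, c', hc', rfl⟩ := IsFractionRing.div_surjective (A := PowerSeries k) c
  rw [mem_nonZeroDivisors_iff_ne_zero] at ha' hb' hc'
  have hinj := IsFractionRing.injective (PowerSeries k) (LaurentSeries k)
  have ha := (map_ne_zero_iff _ hinj).2 ha'
  have hb := (map_ne_zero_iff _ hinj).2 hb'
  have hc := (map_ne_zero_iff _ hinj).2 hc'
  have h₁ : (a * b' * c') ^ 2 =
      PowerSeries.C u * (b * a' * c') ^ 2 + PowerSeries.X * (c * a' * b') ^ 2 := by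
    apply hinj
    simp only [map_add, map_mul, map_pow]
    field_simp at h
    linear_combination h
  obtain ⟨h₂, h₃, h₄⟩ := PowerSeries.eq_zero_of_sq_eq hu h₁
  simp only [mul_eq_zero, ha', hb', hc', or_false] at h₂ h₃ h₄
  simp [h₂, h₃, h₄]

theorem FiniteField.isSquare_neg_of_not_isSquare {k : Type*} [Field k] [Finite k] {u : k}
    (hu : ¬ IsSquare u) (h : ¬ IsSquare (-1 : k)) : IsSquare (-u) := by
  classical
  have := Fintype.ofFinite k
  have h₁ := quadraticChar_neg_one_iff_not_isSquare.2 hu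
  have h₂ := quadraticChar_neg_one_iff_not_isSquare.2 h
  have h₀ : -u ≠ 0 := by
    intro h₀
    rw [neg_eq_zero] at h₀
    exact hu (h₀ ▸ IsSquare.zero)
  rw [← quadraticChar_one_iff_isSquare h₀, ← neg_one_mul, map_mul, h₁, h₂]
  norm_num

theorem FiniteField.card_mod_two_of_two_ne_zero {k : Type*} [Field k] [Fintype k]
    (h2 : (2 : k) ≠ 0) : Fintype.card k % 2 = 1 := by
  refine FiniteField.odd_card_of_char_ne_two fun h => h2 ?_
  have := CharP.cast_eq_zero k (ringChar k)
  rwa [h] at this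

/-- This provides an element of norm -1 in k(√u), which makes (u,-1) vanish. -/
theorem FiniteField.exists_sq_sub_mul_sq_eq_neg_one {k : Type*} [Field k] [Finite k]
    (h2 : (2 : k) ≠ 0) {u : k} (hu : u ≠ 0) : ∃ x y : k, x ^ 2 - u * y ^ 2 = -1 := by
  have := Fintype.ofFinite k
  obtain ⟨x, y, h⟩ := FiniteField.exists_root_sum_quadratic
    (f := Polynomial.X ^ 2 + Polynomial.C 1) (g := Polynomial.C (-u) * Polynomial.X ^ 2)
    (by compute_degree!) (by compute_degree!) (FiniteField.card_mod_two_of_two_ne_zero h2)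
  refine ⟨x, y, ?_⟩
  simp at h
  linear_combination h

theorem FiniteField.isSquare_neg_one_iff_even {k : Type*} [Field k] [Finite k] (h2 : (2 : k) ≠ 0) :
    IsSquare (-1 : k) ↔ Even ((Nat.card k - 1) / 2) := by
  have := Fintype.ofFinite k
  rw [FiniteField.isSquare_neg_one_iff, Nat.card_eq_fintype_card, Nat.even_iff]
  have := FiniteField.card_mod_two_of_two_ne_zero h2
  omega

end Arithmetic

/-! ### The construction over k((t)) -/

namespace ShiodaCoeffs

section LaurentSeries

variable {k : Type*} [Field k]

theorem natCast_ne_zero_of_lt {p : ℕ} {K : Type*} [Field K] [CharP K p] {n : ℕ}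
    (hn : 0 < n) (h : n < p) : (n : K) ≠ 0 := by
  rw [Ne, CharP.cast_eq_zero_iff K p]
  exact Nat.not_dvd_of_pos_of_lt hn h

theorem toSep_injective (k : Type*) [Field k] : Function.Injective (toSep k) :=
  (algebraMap (LaurentSeries k) (SeparableClosure (LaurentSeries k))).injective.comp
    (IsFractionRing.injective (PowerSeries k) (LaurentSeries k))

theorem exists_sq_eq_of_ne_zero {F : Type*} [Field F] (h2 : (2 : F) ≠ 0) (a : F) :
    ∃ s : SeparableClosure F, s ^ 2 = algebraMap F _ a := by
  by_cases ha : a = 0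
  · exact ⟨0, by simp [ha]⟩
  have h2' : (2 : SeparableClosure F) ≠ 0 := by
    rw [← map_ofNat (algebraMap F (SeparableClosure F)) 2]
    exact (map_ne_zero _).2 h2
  have : NeZero ((2 : ℕ) : SeparableClosure F) := ⟨by simpa using h2'⟩
  obtain ⟨s, hs⟩ := IsSepClosed.exists_pow_nat_eq (algebraMap F (SeparableClosure F) a) 2
  exact ⟨s, hs⟩

/-- The smoothness of the cubic surface and of the quartic curve over the field of Laurent series. -/
theorem isSmoothForm_seriesCoeffs {p : ℕ} [CharP k p] (hp11 : 11 ≤ p) {u D : k}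
    (hu : ¬ IsSquare u) (hD : D = 1 ∨ D = 4 * u) :
    IsSmoothForm 3 ((seriesCoeffs u D).map (algebraMap (PowerSeries k) (LaurentSeries k))).cubic ∧
      IsSmoothForm 4
        ((seriesCoeffs u D).map (algebraMap (PowerSeries k) (LaurentSeries k))).quartic := by
  set φ : PowerSeries k →+* AlgebraicClosure (LaurentSeries k) :=
    (algebraMap (LaurentSeries k) (AlgebraicClosure (LaurentSeries k))).comp
      (algebraMap (PowerSeries k) (LaurentSeries k)) with hφ
  have hinj : Function.Injective φ :=
    (algebraMap (LaurentSeries k) (AlgebraicClosure (LaurentSeries k))).injective.comp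
      (IsFractionRing.injective (PowerSeries k) (LaurentSeries k))
  have hk : ∀ n : ℕ, 0 < n → n < 11 → (n : k) ≠ 0 := fun n h h' =>
    natCast_ne_zero_of_lt h (h'.trans_le hp11)
  obtain ⟨s, hs⟩ := IsAlgClosed.exists_pow_nat_eq (φ PowerSeries.X) (n := 2) (by norm_num)
  obtain ⟨r, hr⟩ := IsAlgClosed.exists_pow_nat_eq (φ (PowerSeries.C u)) (n := 2) (by norm_num)
  obtain ⟨m, hm, hm'⟩ : ∃ m, (m = 1 ∨ m = 2 * r) ∧ m ^ 2 = φ (PowerSeries.C D) := by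
    rcases hD with rfl | rfl
    · exact ⟨1, Or.inl rfl, by simp⟩
    · refine ⟨2 * r, Or.inr rfl, ?_⟩
      rw [mul_pow, hr, map_mul, map_mul, map_ofNat, map_ofNat]
      norm_num
  have H := genPos hp11 hu hinj hs hr hm
  have hc : ((seriesCoeffs u D).map (algebraMap (PowerSeries k) (LaurentSeries k))).map
      (algebraMap (LaurentSeries k) (AlgebraicClosure (LaurentSeries k))) =
      fieldCoeffs (s / 3) r m := by
    rw [← seriesCoeffs_map_eq_fieldCoeffs (φ := φ) (by simpa using hk 6 (by norm_num) (by norm_num))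
      (by simpa using hk 3 (by norm_num) (by norm_num)) hs hr hm']
    rfl
  constructor
  · refine isSmoothForm_of_isNonsingular (isHomogeneous_cubic _) ?_
    rw [← map_cubic, hc]
    exact H.isNonsingular_cubic
  · refine isSmoothForm_of_isNonsingular (isHomogeneous_quartic _) ?_
    rw [← map_quartic, hc]
    exact H.isNonsingular_quartic

/-- The classes of the quartic curve and of the cubic surface over the field of Laurent series. -/
theorem gammaClass_seriesCoeffs [Finite k] {p : ℕ} [CharP k p] (hp11 : 11 ≤ p)
    {u D : k} (hu : ¬ IsSquare u) {s r m : SeparableClosure (LaurentSeries k)}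
    (hs : s ^ 2 = toSep k PowerSeries.X) (hr : r ^ 2 = toSep k (PowerSeries.C u))
    (hm : (IsSquare (-1 : k) ∧ m = 1 ∧ D = 1) ∨ (¬ IsSquare (-1 : k) ∧ m = 2 * r ∧ D = 4 * u))
    {cF : ShiodaCoeffs (LaurentSeries k)}
    (hcF : cF = (seriesCoeffs u D).map (algebraMap (PowerSeries k) (LaurentSeries k))) :
    GenPos (s / 3) r m ∧ (seriesCoeffs u D).map (toSep k) = fieldCoeffs (s / 3) r m ∧
      (∀ U ∈ linesOn cF.cubic, ![0, 0, 1, 0] ∉ U) ∧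
      gammaClass cF.quartic = linesSW₂ cF.cubic ∧ gammaClass cF.quartic ≠ 0 := by
  subst hcF
  have hk : ∀ n : ℕ, 0 < n → n < 11 → (n : k) ≠ 0 := fun n h h' =>
    natCast_ne_zero_of_lt h (h'.trans_le hp11)
  have hk2 : (2 : k) ≠ 0 := by simpa using hk 2 (by norm_num) (by norm_num)
  have hu₀ : u ≠ 0 := by
    rintro rfl
    exact hu IsSquare.zero
  have H : GenPos (s / 3) r m := genPos hp11 hu (toSep_injective k) hs hr
    (hm.imp (fun h => h.2.1) fun h => h.2.1)
  have hm' : m ^ 2 = toSep k (PowerSeries.C D) := by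
    rcases hm with ⟨-, rfl, rfl⟩ | ⟨-, rfl, rfl⟩
    · simp
    · rw [mul_pow, hr, map_mul, map_mul, map_ofNat, map_ofNat]
      norm_num
  have hc := seriesCoeffs_map_eq_fieldCoeffs (φ := toSep k)
    (by simpa using hk 6 (by norm_num) (by norm_num))
    (by simpa using hk 3 (by norm_num) (by norm_num)) hs hr hm'
  have hc' : ((seriesCoeffs u D).map (algebraMap (PowerSeries k) (LaurentSeries k))).map
      (algebraMap (LaurentSeries k) (SeparableClosure (LaurentSeries k))) =
      fieldCoeffs (s / 3) r m := hc
  have hinj := IsFractionRing.injective (PowerSeries k) (LaurentSeries k)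
  have : Infinite (PowerSeries k) := Infinite.of_injective _
    (pow_injective_of_not_isUnit PowerSeries.X_prime.not_isUnit PowerSeries.X_ne_zero)
  have : Infinite (LaurentSeries k) := Infinite.of_injective _ hinj
  set ι : k →+* LaurentSeries k :=
    (algebraMap (PowerSeries k) (LaurentSeries k)).comp PowerSeries.C with hι
  have hF2 : (2 : LaurentSeries k) ≠ 0 := by
    rw [← map_ofNat ι 2]
    exact (map_ne_zero ι).2 hk2
  have hs₀ : s ≠ 0 := by
    rintro rfl
    rw [zero_pow two_ne_zero, eq_comm, map_eq_zero_iff _ (toSep_injective k)] at hs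
    exact PowerSeries.X_ne_zero hs
  have hr₀ : r ≠ 0 := by
    rintro rfl
    rw [zero_pow two_ne_zero, eq_comm, map_eq_zero_iff _ (toSep_injective k),
      map_eq_zero_iff _ PowerSeries.C_injective] at hr
    exact hu₀ hr
  have hs3 : 3 * (s / 3) = s := mul_div_cancel₀ s H.three_ne
  obtain ⟨χ, hχ, hχs⟩ := exists_quadraticChar hF2 hs₀ hs
  obtain ⟨ψ, hψ, hψr⟩ := exists_quadraticChar hF2 hr₀ hr
  have hχσ : ∀ g, g (s / 3) = ((χ g : ℤ) : SeparableClosure (LaurentSeries k)) * (s / 3) := by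
    intro g
    rw [map_div₀, hχs, map_ofNat, mul_div_assoc]
  obtain ⟨x, y, hxy⟩ := FiniteField.exists_sq_sub_mul_sq_eq_neg_one hk2 hu₀
  have hxy' : ι x ^ 2 - ι u * ι y ^ 2 = -1 := by
    rw [← map_pow, ← map_pow, ← map_mul, ← map_sub, hxy, map_neg, map_one]
  -- The square root w of -1 is a constant of `k` if -1 is a square. Otherwise -u = v² in `k` and w
  -- = v/r, so w changes sign together with r.
  obtain ⟨l, ε, w, hl, hmap, hw, hgw⟩ : ∃ (l : List (Fin 27 × Fin 27)) (ε : ℤˣ)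
      (w : SeparableClosure (LaurentSeries k)), IsFlip l ε ∧
      ((l = rPairs ∧ ∀ g : Gal(SeparableClosure (LaurentSeries k)/LaurentSeries k), g m = m) ∨
        (l = rmPairs ∧ ∀ g : Gal(SeparableClosure (LaurentSeries k)/LaurentSeries k),
          g m = ((ψ g : ℤ) : SeparableClosure (LaurentSeries k)) * m)) ∧
      w ^ 2 = -1 ∧ ∀ g : Gal(SeparableClosure (LaurentSeries k)/LaurentSeries k),
        g w = ((signPow (ψ g) (-ε) : ℤˣ) : ℤ) * w := by
    rcases hm with ⟨⟨v, hv⟩, rfl, -⟩ | ⟨h, rfl, -⟩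
    · refine ⟨rPairs, -1, algebraMap _ _ (ι v), IsFlip.even, Or.inl ⟨rfl, fun g => map_one g⟩, ?_,
        fun g => ?_⟩
      · rw [← map_pow, ← map_pow, pow_two, ← hv, map_neg, map_neg, map_one, map_one]
      · rw [AlgEquiv.commutes]
        simp [signPow]
    · obtain ⟨v, hv⟩ := FiniteField.isSquare_neg_of_not_isSquare hu h
      refine ⟨rmPairs, 1, algebraMap _ _ (ι v) / r, IsFlip.odd, Or.inr ⟨rfl, fun g => ?_⟩, ?_,
        fun g => ?_⟩
      · rw [map_mul, map_ofNat, hψr]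
        ring
      · have hr' : r ^ 2 = algebraMap _ _ (ι u) := hr
        rw [div_pow, hr', ← map_pow, ← map_pow, pow_two, ← hv, map_neg, map_neg, neg_div, div_self]
        rw [← hr']
        exact pow_ne_zero 2 hr₀
      · rw [map_div₀, AlgEquiv.commutes, hψr]
        rcases Int.units_eq_one_or (ψ g) with h | h <;> simp [h, signPow, div_neg]
  have hact : IsSignAction (s / 3) r m l χ ψ := ⟨hχσ, hψr, hmap⟩
  refine ⟨H, hc, flex_notMem_of_mem_linesOn H hc', hact.gammaClass_eq_linesSW₂ H hc' hl hχ hψ,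
    hact.gammaClass_ne_zero H hc' hl hχ hψ (u := ι u)
      (t := algebraMap (PowerSeries k) (LaurentSeries k) PowerSeries.X)
      (fun a b c h => (LaurentSeries.eq_zero_of_sq_eq hu h).2.2) (fun a h => ?_) hF2
      (by rwa [hs3]) hr₀ (by rw [hs3]; exact hs) hr hw hgw hxy'⟩
  have := (LaurentSeries.eq_zero_of_sq_eq hu (a := a) (b := 1) (c := 0) (by
    rw [one_pow, mul_one, zero_pow two_ne_zero, mul_zero, add_zero]
    exact h)).2.1
  exact one_ne_zero this

end LaurentSeries

end ShiodaCoeffs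

theorem lemma3p6 (p : ℕ) (hp : p.Prime) (hp11 : 11 ≤ p) (k : Type*) [Field k] [Finite k]
    [CharP k p] :
    (∃ f : MvPolynomial (Fin 3) (LaurentSeries k),
      IsSmoothForm 4 f ∧ 2 • gammaClass f = 0 ∧ gammaClass f ≠ 0 ∧ HasStableReduction f) ∧
    ∀ u : k, ¬ IsSquare u → ∀ s r : SeparableClosure (LaurentSeries k),
      s ^ 2 = toSep k PowerSeries.X → r ^ 2 = toSep k (PowerSeries.C u) →
      ∃ c : ShiodaCoeffs (PowerSeries k),
        c.map (toSep k) =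
          ShiodaCoeffs.ofPoints (sixParameters (Nat.card k) (toSep k PowerSeries.X) s r) ∧
        ∃ cF : ShiodaCoeffs (LaurentSeries k),
          cF = c.map (algebraMap (PowerSeries k) (LaurentSeries k)) ∧
          IsSmoothForm 3 cF.cubic ∧
          eval ![0, 0, 1, 0] cF.cubic = 0 ∧
          (∀ U ∈ linesOn cF.cubic, ![0, 0, 1, 0] ∉ U) ∧
          IsSmoothForm 4 cF.quartic ∧
          IsStablePlaneQuarticOver c.quartic ∧
          gammaClass cF.quartic = linesSW₂ cF.cubic ∧
          gammaClass cF.quartic ≠ 0 := by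
  have hk : ∀ n : ℕ, 0 < n → n < 11 → (n : k) ≠ 0 := fun n h h' =>
    ShiodaCoeffs.natCast_ne_zero_of_lt h (h'.trans_le hp11)
  have hk2 : (2 : k) ≠ 0 := by simpa using hk 2 (by norm_num) (by norm_num)
  have hL : ∀ n : ℕ, 0 < n → n < 11 → (n : SeparableClosure (LaurentSeries k)) ≠ 0 := by
    intro n h h'
    rw [← map_natCast ((toSep k).comp PowerSeries.C) n]
    exact (map_ne_zero _).2 (hk n h h')
  have main : ∀ u : k, ¬ IsSquare u → ∀ s r : SeparableClosure (LaurentSeries k),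
      s ^ 2 = toSep k PowerSeries.X → r ^ 2 = toSep k (PowerSeries.C u) →
      ∃ c : ShiodaCoeffs (PowerSeries k),
        c.map (toSep k) =
          ShiodaCoeffs.ofPoints (sixParameters (Nat.card k) (toSep k PowerSeries.X) s r) ∧
        ∃ cF : ShiodaCoeffs (LaurentSeries k),
          cF = c.map (algebraMap (PowerSeries k) (LaurentSeries k)) ∧
          IsSmoothForm 3 cF.cubic ∧
          eval ![0, 0, 1, 0] cF.cubic = 0 ∧
          (∀ U ∈ linesOn cF.cubic, ![0, 0, 1, 0] ∉ U) ∧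
          IsSmoothForm 4 cF.quartic ∧
          IsStablePlaneQuarticOver c.quartic ∧
          gammaClass cF.quartic = linesSW₂ cF.cubic ∧
          gammaClass cF.quartic ≠ 0 := by
    intro u hu s r hs hr
    -- Both cases take the form 1 + t ± m with m = 1 or m = 2r; the parity of (q - 1)/2 decides
    -- whether -1 is a square.
    obtain ⟨m, D, hmD, hsix⟩ : ∃ (m : SeparableClosure (LaurentSeries k)) (D : k),
        ((IsSquare (-1 : k) ∧ m = 1 ∧ D = 1) ∨ (¬ IsSquare (-1 : k) ∧ m = 2 * r ∧ D = 4 * u)) ∧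
        sixParameters (Nat.card k) (toSep k PowerSeries.X) s r =
          ![1 + s, 1 - s, 1 + r, 1 - r, 1 + toSep k PowerSeries.X + m,
            1 + toSep k PowerSeries.X - m] := by
      by_cases h : IsSquare (-1 : k)
      · refine ⟨1, 1, Or.inl ⟨h, rfl, rfl⟩, ?_⟩
        have e₁ : 1 + toSep k PowerSeries.X + 1 = 2 + toSep k PowerSeries.X := by ring
        have e₂ : 1 + toSep k PowerSeries.X - 1 = toSep k PowerSeries.X := by ring
        rw [sixParameters, if_pos ((FiniteField.isSquare_neg_one_iff_even hk2).1 h), e₁, e₂]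
      · refine ⟨2 * r, 4 * u, Or.inr ⟨h, rfl, rfl⟩, ?_⟩
        rw [sixParameters, if_neg fun h' => h ((FiniteField.isSquare_neg_one_iff_even hk2).2 h')]
    have hD : D = 1 ∨ D = 4 * u := hmD.imp (fun h => h.2.2) fun h => h.2.2
    obtain ⟨H, hc, hflex, heq, hne⟩ :=
      ShiodaCoeffs.gammaClass_seriesCoeffs hp11 hu hs hr hmD rfl
    obtain ⟨hcubic, hquartic⟩ := ShiodaCoeffs.isSmoothForm_seriesCoeffs hp11 hu hD
    refine ⟨ShiodaCoeffs.seriesCoeffs u D, ?_, _, rfl, hcubic, ?_, hflex, hquartic,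
      ShiodaCoeffs.isStablePlaneQuarticOver_seriesCoeffs hp11 hu hD, heq, hne⟩
    · rw [hc, hsix]
      refine (ShiodaCoeffs.ofPoints_eq H (by simpa using hL 5 (by norm_num) (by norm_num))
        (by simpa using hL 7 (by norm_num) (by norm_num))
        (ShiodaCoeffs.roots_eq (by simpa using hL 3 (by norm_num) (by norm_num)) hs)).symm
    · simp [ShiodaCoeffs.eval_cubic, ShiodaCoeffs.eval_f₀, ShiodaCoeffs.eval_f₁,
        ShiodaCoeffs.eval_f₂]
  refine ⟨?_, main⟩
  -- The existence statement follows from the explicit one: a non-square exists in odd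
  -- characteristic, and `t` and `u` have square roots in the separable closure.
  obtain ⟨u, hu⟩ := FiniteField.exists_nonsquare (F := k) fun h => by
    have := ringChar.eq k p
    omega
  have hF2 : (2 : LaurentSeries k) ≠ 0 := by
    rw [← map_ofNat ((algebraMap (PowerSeries k) (LaurentSeries k)).comp PowerSeries.C) 2]
    exact (map_ne_zero _).2 hk2
  obtain ⟨s, hs⟩ := ShiodaCoeffs.exists_sq_eq_of_ne_zero hF2
    (algebraMap (PowerSeries k) (LaurentSeries k) PowerSeries.X)
  obtain ⟨r, hr⟩ := ShiodaCoeffs.exists_sq_eq_of_ne_zero hF2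
    (algebraMap (PowerSeries k) (LaurentSeries k) (PowerSeries.C u))
  obtain ⟨c, -, cF, rfl, -, -, -, hquartic, hstable, -, hne⟩ := main u hu s r hs hr
  exact ⟨_, hquartic, two_nsmul_gammaClass _, hne, c.quartic, hstable,
    (ShiodaCoeffs.map_quartic c _).symm⟩
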